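/- Let $(\Sigma^1,g_1)$ and $(\Sigma^2,g_2)$ be compact oriented smooth surfaces without boundary, with Riemannian metrics of the same constant Gauss curvature $c\in\mathbb R$ and with volume forms $\omega_1,\omega_2$. Let $M=\Sigma^1\times\Sigma^2$ carry the product metric, and let $\omega''=\omega_1+\omega_2$ (pulled back to $M$ by the projections). Let $f:\Sigma^1\to\Sigma^2$ be a smooth map with $f^*\omega_2=\omega_1$. Let $0<T\le\infty$ and let $F:\Sigma^1\times[0,T)\to M$ be a smooth mean curvature flow of the graph of $f$: $F$ is smooth, each $F_t=F(\cdot,t)$ is an immersion, $F_0(x)=(x,f(x))$, and $\partial F/\partial t=H$, where $H$ is the mean curvature vector of $F_t$ in $M$. Let $\Sigma_t$ denote $\Sigma^1$ with the metric $F_t^*g_M$, the area measure $d\mu_t$ of this metric and the orientation of $\Sigma^1$, and let $\eta=*_{\Sigma_t}F_t^*\omega''$, that is, $\eta=\omega''(e_1,e_2)$ for an oriented orthonormal basis $e_1,e_2$ of the tangent plane of $\Sigma_t$. Then for every $t\in[0,T)$ the function $\eta$ is positive on $\Sigma_t$, the function $|H|^2/\eta$ is integrable on $\Sigma_t$, the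 function $s\mapsto\int_{\Sigma_s}\frac{|H|^2}{\eta}\,d\mu_s$ is differentiable at $t$ (from the right if $t=0$), and $$\frac{d}{dt}\int_{\Sigma_t}\frac{|H|^2}{\eta}\,d\mu_t\;\le\; c\int_{\Sigma_t}\frac{|H|^2}{\eta}\,d\mu_t .$$ -/

import Mathlib

open scoped Manifold ContDiff
open MeasureTheory

noncomputable section

namespace SurfaceFlow

/-- A (not necessarily continuous) family of functions of two tangent vectors. It is used for
Riemannian metrics and for differential 2-forms. -/
abbrev TwoTensor {E H : Type*} [NormedAddCommGroup E] [NormedSpace ℝ E] [TopologicalSpace H]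
    (I : ModelWithCorners ℝ E H) (M : Type*) [TopologicalSpace M] [ChartedSpace H M] : Type _ :=
  (p : M) → TangentSpace I p → TangentSpace I p → ℝ

section LinearAlgebra

variable {ι E : Type*} [NormedAddCommGroup E] [NormedSpace ℝ E]

/-- The matrix `B (b i) (b j)` of a bilinear form in a basis. -/
def gram (b : Module.Basis ι ℝ E) (B : E → E → ℝ) : Matrix ι ι ℝ :=
  Matrix.of fun i j => B (b i) (b j)

/-- The vector `B^{kl} φ(b_l) b_k`, that is, the vector `v` with `B v w = φ w` for all `w`, when
`B` is an inner product and `φ` is linear. It does not depend on the basis. -/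
def sharp [Fintype ι] [DecidableEq ι] (b : Module.Basis ι ℝ E) (B : E → E → ℝ) (φ : E → ℝ) : E :=
  ∑ k, ∑ l, ((gram b B)⁻¹ k l * φ (b l)) • b k

end LinearAlgebra

/-! Riemannian geometry in charts, on manifolds without boundary. The tangent space `T_p M` is, in
Mathlib, the model vector space `E`: a tangent vector at `p` is given by its coordinates in the
preferred chart `extChartAt I p` at `p`. -/

section Riemannian

variable {ι E H M : Type*} [Fintype ι] [DecidableEq ι]
  [NormedAddCommGroup E] [NormedSpace ℝ E] [TopologicalSpace H] {I : ModelWithCorners ℝ E H}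
  [TopologicalSpace M] [ChartedSpace H M]

/-- The coordinate expression of a 2-tensor in the chart at `p`, at the point with coordinates
`y`, evaluated on the coordinate vectors `u` and `v`. -/
def inChart (g : TwoTensor I M) (p : M) (y : E) (u v : E) : ℝ :=
  g ((extChartAt I p).symm y)
    (mfderiv 𝓘(ℝ, E) I (extChartAt I p).symm y u)
    (mfderiv 𝓘(ℝ, E) I (extChartAt I p).symm y v)

/-- The Christoffel symbols `Γ^k_{ij}` of the Levi-Civita connection of `g` in the chart at `p`, as
a bilinear map: `Γ(u, v) = u^i v^j Γ^k_{ij} ∂_k`, at the point with coordinates `y`. -/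
def christoffel (b : Module.Basis ι ℝ E) (g : TwoTensor I M) (p : M) (y : E) (u v : E) : E :=
  sharp b (inChart g p y) fun w =>
    (1 / 2 : ℝ) * (fderiv ℝ (fun z => inChart g p z v w) y u
      + fderiv ℝ (fun z => inChart g p z u w) y v
      - fderiv ℝ (fun z => inChart g p z u v) y w)

/-- The Riemann curvature tensor, with the sign
`R(X, Y)Z = -∇_X ∇_Y Z + ∇_Y ∇_X Z + ∇_{[X, Y]} Z`,
at the point `p`, computed in the chart at `p` with coordinate vector fields. -/
def riemann (b : Module.Basis ι ℝ E) (g : TwoTensor I M) (p : M) (u v w : TangentSpace I p) :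
    TangentSpace I p :=
  let y₀ : E := extChartAt I p p
  let C : E → E → E → E := christoffel b g p
  (fderiv ℝ (fun y => C y u w) y₀ v + C y₀ v (C y₀ u w))
    - (fderiv ℝ (fun y => C y v w) y₀ u + C y₀ u (C y₀ v w))

/-- All sectional curvatures of `g` are equal to `c`. -/
def HasConstantCurvature (b : Module.Basis ι ℝ E) (g : TwoTensor I M) (c : ℝ) : Prop :=
  ∀ (p : M) (u v : TangentSpace I p),
    g p (riemann b g p u v u) v = c * (g p u u * g p v v - g p u v ^ 2)

end Riemannian

/-! Immersions `F : N → M` into a Riemannian manifold `(M, g)`. -/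

section Immersion

variable {ι E H M : Type*} [Fintype ι] [DecidableEq ι]
  [NormedAddCommGroup E] [NormedSpace ℝ E] [TopologicalSpace H] {I : ModelWithCorners ℝ E H}
  [TopologicalSpace M] [ChartedSpace H M]
  {ι' E' H' N : Type*} [Fintype ι'] [DecidableEq ι']
  [NormedAddCommGroup E'] [NormedSpace ℝ E'] [TopologicalSpace H']
  (I' : ModelWithCorners ℝ E' H')
  [TopologicalSpace N] [ChartedSpace H' N]

/-- The pullback `F^* α` of a 2-tensor; for a metric, the induced metric `g_{ij}`. -/
def pullback (α : TwoTensor I M) (F : N → M) : TwoTensor I' N :=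
  fun x u v => α (F x) (mfderiv I' I F x u) (mfderiv I' I F x v)

/-- `∇^M_{F_* u} F_* v` at `x`, for vector fields `u`, `v` with constant coefficients in the chart
at `x`. In coordinates, it is `u^i v^j (∂_i ∂_j F^A + Γ^A_{BC} ∂_i F^B ∂_j F^C) ∂_A`. -/
def covHessian (b : Module.Basis ι ℝ E) (g : TwoTensor I M) (F : N → M) (x : N)
    (u v : TangentSpace I' x) : TangentSpace I (F x) :=
  let φ : E' → E := writtenInExtChartAt I' I x F
  let x₀ : E' := extChartAt I' x x
  fderiv ℝ (fun y => fderiv ℝ φ y v) x₀ u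
    + christoffel b g (F x) (extChartAt I (F x) (F x)) (fderiv ℝ φ x₀ u) (fderiv ℝ φ x₀ v)

/-- The tangential component `V^⊤ = ⟨V, F_* ∂_l⟩ g^{kl} F_* ∂_k` of a vector `V ∈ T_{F(x)} M`. -/
def tangentialPart (b' : Module.Basis ι' ℝ E') (g : TwoTensor I M) (F : N → M) (x : N)
    (V : TangentSpace I (F x)) : TangentSpace I (F x) :=
  mfderiv I' I F x
    (sharp (E := E') b' (pullback I' g F x) fun w => g (F x) V (mfderiv I' I F x w))

/-- The mean curvature vector `H = g^{ij} (∇^M_{F_* ∂_i} F_* ∂_j)^⊥`. -/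
def meanCurvature (b' : Module.Basis ι' ℝ E') (b : Module.Basis ι ℝ E) (g : TwoTensor I M)
    (F : N → M) (x : N) : TangentSpace I (F x) :=
  ∑ i, ∑ j, (gram b' (pullback I' g F x))⁻¹ i j •
    (covHessian I' b g F x (b' i) (b' j)
      - tangentialPart I' b' g F x (covHessian I' b g F x (b' i) (b' j)))

/-- `F : N × J → M` is a smooth mean curvature flow: a smooth family of immersions, defined for the
times in `J`, with `∂F/∂t = H`. -/
structure IsMeanCurvatureFlow (b' : Module.Basis ι' ℝ E') (b : Module.Basis ι ℝ E)
    (g : TwoTensor I M) (J : Set ℝ) (F : ℝ → N → M) : Prop where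
  smooth : ContMDiffOn (𝓘(ℝ, ℝ).prod I') I ∞ (fun q : ℝ × N => F q.1 q.2) (J ×ˢ Set.univ)
  immersion : ∀ t ∈ J, ∀ x, Function.Injective (mfderiv I' I (F t) x)
  flow : ∀ t ∈ J, ∀ x, HasMFDerivWithinAt 𝓘(ℝ, ℝ) I (fun s => F s x) J t
    (ContinuousLinearMap.toSpanSingleton ℝ (meanCurvature I' b' b g (F t) x))

end Immersion

/-! Surfaces. -/

/-- The coordinate plane. -/
abbrev Plane : Type := EuclideanSpace ℝ (Fin 2)

/-- The standard basis of the coordinate plane. -/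
def planeBasis : Module.Basis (Fin 2) ℝ Plane := (EuclideanSpace.basisFun (Fin 2) ℝ).toBasis

section Surface

variable {S : Type*} [TopologicalSpace S] [ChartedSpace Plane S]

/-- A smooth Riemannian metric on a surface. -/
abbrev SurfaceMetric (S : Type*) [TopologicalSpace S] [ChartedSpace Plane S]
    [IsManifold (𝓡 2) ∞ S] : Type _ :=
  Bundle.ContMDiffRiemannianMetric (𝓡 2) ∞ Plane (fun p : S => TangentSpace (𝓡 2) p)

/-- The underlying 2-tensor of a metric. -/
def metricTensor [IsManifold (𝓡 2) ∞ S] (g : SurfaceMetric S) : TwoTensor (𝓡 2) S :=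
  fun p u v => g.inner p u v

/-- The volume form of an oriented Riemannian surface: a smooth 2-form `ω` with
`ω(e₁, e₂) = ±1` for orthonormal `e₁, e₂`. The orientations of `S` correspond to the choices
of `ω`: a basis `(u, v)` is positively oriented when `ω(u, v) > 0`. -/
structure VolumeForm [IsManifold (𝓡 2) ∞ S] (g : SurfaceMetric S) where
  form (p : S) : TangentSpace (𝓡 2) p →L[ℝ] TangentSpace (𝓡 2) p →L[ℝ] ℝ
  alternating (p : S) (v : TangentSpace (𝓡 2) p) : form p v v = 0
  sq_eq (p : S) (u v : TangentSpace (𝓡 2) p) :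
    form p u v ^ 2 = g.inner p u u * g.inner p v v - g.inner p u v ^ 2
  contMDiff : ContMDiff (𝓡 2) ((𝓡 2).prod 𝓘(ℝ, Plane →L[ℝ] Plane →L[ℝ] ℝ)) ∞
    (fun p ↦ Bundle.TotalSpace.mk' (Plane →L[ℝ] Plane →L[ℝ] ℝ)
      (E := fun p : S => TangentSpace (𝓡 2) p →L[ℝ] TangentSpace (𝓡 2) p →L[ℝ] ℝ) p (form p))

/-- The underlying 2-tensor of a volume form. -/
def VolumeForm.tensor [IsManifold (𝓡 2) ∞ S] {g : SurfaceMetric S} (σ : VolumeForm g) :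
    TwoTensor (𝓡 2) S :=
  fun p u v => σ.form p u v

/-- The Hodge star `*α` of a 2-form `α` on a surface with metric `h`, oriented by the 2-form `σ`: the function
with value `α(e₁, e₂)` for every positively oriented `h`-orthonormal basis `e₁, e₂`, written as
`α(∂₁, ∂₂) / √(det h_{ij})`, with the sign of the basis `∂₁, ∂₂`. -/
def hodgeStar (σ h α : TwoTensor (𝓡 2) S) (x : S) : ℝ :=
  Real.sign (σ x (planeBasis 0) (planeBasis 1)) *
    (α x (planeBasis 0) (planeBasis 1) / √(gram planeBasis (h x)).det)

/-- A smooth partition of unity `ρ_p` such that `ρ_p` is supported in the domain of the chart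
at `p`. -/
def chartPartition (S : Type*) [TopologicalSpace S] [ChartedSpace Plane S] [IsManifold (𝓡 2) ∞ S]
    [T2Space S] [CompactSpace S] : SmoothPartitionOfUnity S (𝓡 2) S :=
  Classical.choose (SmoothPartitionOfUnity.exists_isSubordinate_chartAt_source (𝓡 2) S)

/-- The Riemannian area measure `dμ` of a metric `h` on a closed surface, given by
`√(det h_{ij}) dx¹ dx²` in charts, which are glued by a partition of unity. -/
def areaMeasure [IsManifold (𝓡 2) ∞ S] [T2Space S] [CompactSpace S] [MeasurableSpace S]
    (h : TwoTensor (𝓡 2) S) : Measure S :=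
  Measure.sum fun p : S =>
    Measure.map (extChartAt (𝓡 2) p).symm
      (((volume : Measure Plane).restrict (extChartAt (𝓡 2) p).target).withDensity fun y =>
        ENNReal.ofReal (chartPartition S p ((extChartAt (𝓡 2) p).symm y) *
          √(gram planeBasis (inChart h p y)).det))

end Surface

/-! Surfaces in the product of two surfaces. -/

section Product

variable {S₁ S₂ : Type*} [TopologicalSpace S₁] [ChartedSpace Plane S₁]
  [TopologicalSpace S₂] [ChartedSpace Plane S₂]

/-- The standard basis of `ℝ² × ℝ²`. -/
def productBasis : Module.Basis (Fin 2 ⊕ Fin 2) ℝ (Plane × Plane) := planeBasis.prod planeBasis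

/-- The tensor `π₁^* α + π₂^* β` on `S₁ × S₂`: the product metric, if `α` and `β` are metrics, and
the 2-form `ω'' = ω₁ + ω₂`, if `α` and `β` are the volume forms `ω₁` and `ω₂`. -/
def productTensor (α : TwoTensor (𝓡 2) S₁) (β : TwoTensor (𝓡 2) S₂) :
    TwoTensor ((𝓡 2).prod (𝓡 2)) (S₁ × S₂) :=
  fun p (u v : Plane × Plane) => α p.1 u.1 v.1 + β p.2 u.2 v.2

/-- The squared norm `|H|²` of the mean curvature vector of the surface `F : S₁ → M`, with
respect to the metric `g` of `M = S₁ × S₂`. -/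
def normSqMeanCurvature (g : TwoTensor ((𝓡 2).prod (𝓡 2)) (S₁ × S₂)) (F : S₁ → S₁ × S₂)
    (x : S₁) : ℝ :=
  g (F x) (meanCurvature (𝓡 2) planeBasis productBasis g F x)
    (meanCurvature (𝓡 2) planeBasis productBasis g F x)

/-- The time interval `[0, T)`, for `T ≤ ∞`. -/
def timeInterval (T : EReal) : Set ℝ := {t | 0 ≤ t ∧ (t : EReal) < T}

end Product

end SurfaceFlow

end

/-! Write `ω' = ω₁ - ω₂` and `ω'' = ω₁ + ω₂`. Both are parallel 2-forms for the product metric. For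
such a form the function `θ = *F_t^*(ω₁ ± ω₂)` on a mean curvature flow satisfies `(∂_t - Δ)θ = Bθ`
with `-|c| ≤ B ≤ 2|A|² + |c|`. This is `exists_heatOp_angle`. The factor `θ` on the right comes from
linear algebra in `ℝ⁴` (`exists_angle_coefficient`): the complex structure that defines the form is
an isometry, so the form has the same size on the tangent plane and on the normal plane. Since
`f^*ω₂ = ω₁`, the graph of `f` has `*ω' = 0` and `*ω'' > 0`. The maximum principle
`nonpos_of_evolution` preserves both (`flowAngle_eq_zero`, `flowAngle_pos`). Thus every `Σ_t` is
Lagrangian for `ω'` and `η` stays positive.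

On a Lagrangian surface the second fundamental form is a totally symmetric cubic form. The evolution
equations then become explicit (`heatOp_angle_lagrangian`): `(∂_t - Δ)η = (2|A|² - |H|² + c(1 - η²))
η`, `(∂_t - Δ)|H|² = -2|∇^⊥H|² + 2 Σ ⟨H, A_ij⟩² + c(2 - η²)|H|²`. In the equation for `w = |H|²/η`
the curvature terms combine to `c w`. Cauchy-Schwarz gives `Σ ⟨H, A_ij⟩² ≤ |H|²|A|²`. The gradient
term is absorbed by the square `|∇^⊥H - (∇η/η) H|² ≥ 0`. What remains is `(∂_t - Δ)w ≤ (c + |H|²) w`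
(`heatOp_quotient_le`). The area density satisfies `∂_t √m = -|H|² √m`, which cancels the term `|H|²
w`. The Laplacian integrates to zero by the divergence theorem `sum_integral_gradDiv`.

Pointwise computations use coordinates that are normal to first order at one point, given by a
quadratic Taylor polynomial (`quadMap`), and the flat operator `heatOp` at that point. `fluxDiv_eq`
and `heatOp_normalMap` translate the result back to an arbitrary fixed chart. The evolution
inequality is proved for positive times. All densities are smooth up to time `0`, so it extends to
`t = 0` by continuity of the derivative of the integral (`flowIntegralDeriv_le`). -/

open scoped Manifold ContDiff Topology
open MeasureTheory

noncomputable section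

namespace SurfaceFlow

/-! ### Covariant differentiation along maps into a coordinate domain. -/

section Calculus

variable {E Z : Type*} [NormedAddCommGroup E] [NormedSpace ℝ E]
  [NormedAddCommGroup Z] [NormedSpace ℝ Z]

/-- The bilinear form `B` is parallel at `y` for the connection with Christoffel symbols `Γ`. -/
def IsParallelAt (Γ : E → E →L[ℝ] E →L[ℝ] E) (B : E → E →L[ℝ] E →L[ℝ] ℝ) (y : E) : Prop :=
  ∀ u v w, fderiv ℝ B y u v w = B y (Γ y u v) w + B y v (Γ y u w)

/-- `Γ` is the Levi-Civita connection of the smooth metric `G` on the open set `V`. -/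
structure IsLeviCivitaOn (G : E → E →L[ℝ] E →L[ℝ] ℝ) (Γ : E → E →L[ℝ] E →L[ℝ] E)
    (V : Set E) : Prop where
  isOpen : IsOpen V
  contDiffOn : ContDiffOn ℝ ∞ G V
  contDiffOn_conn : ContDiffOn ℝ ∞ Γ V
  symm : ∀ y ∈ V, ∀ u v, G y u v = G y v u
  pos : ∀ y ∈ V, ∀ u, u ≠ 0 → 0 < G y u u
  torsion_free : ∀ y ∈ V, ∀ u v, Γ y u v = Γ y v u
  parallel : ∀ y ∈ V, IsParallelAt Γ G y

/-- The curvature operator of a connection, with the sign convention of `riemann`. -/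
def curvOp (Γ : E → E →L[ℝ] E →L[ℝ] E) (y u v w : E) : E :=
  (fderiv ℝ Γ y v u w + Γ y v (Γ y u w)) - (fderiv ℝ Γ y u v w + Γ y u (Γ y v w))

/-- The covariant derivative in direction `ξ` of a vector field `Y` along `φ`. -/
def covDeriv (Γ : E → E →L[ℝ] E →L[ℝ] E) (φ : Z → E) (ξ : Z) (Y : Z → E) (z : Z) : E :=
  fderiv ℝ Y z ξ + Γ (φ z) (fderiv ℝ φ z ξ) (Y z)

/-- The partial derivative `∂_ξ φ`. -/
def partialD (φ : Z → E) (ξ : Z) (z : Z) : E := fderiv ℝ φ z ξ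

lemma two_le_infty : (2 : WithTop ℕ∞) ≤ ∞ := by
  have : ((2 : ℕ∞) : WithTop ℕ∞) ≤ ((⊤ : ℕ∞) : WithTop ℕ∞) := WithTop.coe_le_coe.2 le_top
  exact this

lemma infty_add_one_le : ((∞ : WithTop ℕ∞) + 1) ≤ ∞ := by simp

lemma contDiffOn_partialD {φ : Z → E} {O : Set Z} (hO : IsOpen O) (hφ : ContDiffOn ℝ ∞ φ O)
    (ξ : Z) : ContDiffOn ℝ ∞ (partialD φ ξ) O :=
  (hφ.fderiv_of_isOpen hO infty_add_one_le).clm_apply contDiffOn_const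

lemma differentiableAt_of_contDiffOn {F : Type*} [NormedAddCommGroup F] [NormedSpace ℝ F]
    {f : Z → F} {O : Set Z} (hO : IsOpen O)
    (hf : ContDiffOn ℝ ∞ f O) {z : Z} (hz : z ∈ O) : DifferentiableAt ℝ f z :=
  (hf.contDiffAt (hO.mem_nhds hz)).differentiableAt (by simp)

lemma fderiv_fderiv_apply {F : Type*} [NormedAddCommGroup F] [NormedSpace ℝ F]
    {f : Z → F} {O : Set Z} (hO : IsOpen O) (hf : ContDiffOn ℝ ∞ f O) {z : Z} (hz : z ∈ O)
    (ξ ζ : Z) : fderiv ℝ (fun x => fderiv ℝ f x ζ) z ξ = fderiv ℝ (fderiv ℝ f) z ξ ζ := by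
  have h : DifferentiableAt ℝ (fderiv ℝ f) z :=
    differentiableAt_of_contDiffOn hO (hf.fderiv_of_isOpen hO infty_add_one_le) hz
  have := (h.hasFDerivAt.clm_apply (hasFDerivAt_const ζ z)).fderiv
  rw [this]
  simp

lemma fderiv_fderiv_comm {F : Type*} [NormedAddCommGroup F] [NormedSpace ℝ F]
    {f : Z → F} {O : Set Z} (hO : IsOpen O) (hf : ContDiffOn ℝ ∞ f O) {z : Z} (hz : z ∈ O)
    (ξ ζ : Z) : fderiv ℝ (fderiv ℝ f) z ξ ζ = fderiv ℝ (fderiv ℝ f) z ζ ξ :=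
  ((hf.contDiffAt (hO.mem_nhds hz)).isSymmSndFDerivAt
    (by rw [minSmoothness_of_isRCLikeNormedField]; exact two_le_infty)) ξ ζ

lemma contDiffOn_covDeriv {Γ : E → E →L[ℝ] E →L[ℝ] E} {V : Set E} {φ : Z → E} {O : Set Z}
    {Y : Z → E} (hΓ : ContDiffOn ℝ ∞ Γ V)
    (hO : IsOpen O) (hφ : ContDiffOn ℝ ∞ φ O) (hm : Set.MapsTo φ O V)
    (hY : ContDiffOn ℝ ∞ Y O) (ξ : Z) : ContDiffOn ℝ ∞ (covDeriv Γ φ ξ Y) O :=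
  (contDiffOn_partialD hO hY ξ).add
    (((hΓ.comp hφ hm).clm_apply (contDiffOn_partialD hO hφ ξ)).clm_apply hY)

lemma contDiffOn_bilin {B : E → E →L[ℝ] E →L[ℝ] ℝ} {V : Set E} {φ : Z → E} {O : Set Z}
    {Y W : Z → E} (hB : ContDiffOn ℝ ∞ B V)
    (hφ : ContDiffOn ℝ ∞ φ O) (hm : Set.MapsTo φ O V)
    (hY : ContDiffOn ℝ ∞ Y O) (hW : ContDiffOn ℝ ∞ W O) :
    ContDiffOn ℝ ∞ (fun z => B (φ z) (Y z) (W z)) O :=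
  ((hB.comp hφ hm).clm_apply hY).clm_apply hW

/-- By parallelism the derivative of `B` along `φ` consists of exactly the two Christoffel terms
that complete the derivatives of `Y` and `W` to covariant ones. -/
lemma fderiv_parallel {Γ : E → E →L[ℝ] E →L[ℝ] E} {B : E → E →L[ℝ] E →L[ℝ] ℝ} {φ : Z → E} {z : Z}
    {Y W : Z → E} (hB : DifferentiableAt ℝ B (φ z)) (hp : IsParallelAt Γ B (φ z))
    (hφ : DifferentiableAt ℝ φ z) (hY : DifferentiableAt ℝ Y z) (hW : DifferentiableAt ℝ W z)
    (ξ : Z) :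
    fderiv ℝ (fun x => B (φ x) (Y x) (W x)) z ξ
      = B (φ z) (covDeriv Γ φ ξ Y z) (W z) + B (φ z) (Y z) (covDeriv Γ φ ξ W z) := by
  have h1 : HasFDerivAt (fun x => B (φ x)) ((fderiv ℝ B (φ z)).comp (fderiv ℝ φ z)) z :=
    HasFDerivAt.comp (g := B) (f := φ) z hB.hasFDerivAt hφ.hasFDerivAt
  have h2 := (h1.clm_apply hY.hasFDerivAt).clm_apply hW.hasFDerivAt
  rw [h2.fderiv]
  have := hp (fderiv ℝ φ z ξ) (Y z) (W z)
  simp [covDeriv]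
  linarith

lemma covDeriv_partialD_comm {Γ : E → E →L[ℝ] E →L[ℝ] E} {φ : Z → E} {O : Set Z} {z : Z}
    (hO : IsOpen O) (hφ : ContDiffOn ℝ ∞ φ O) (hz : z ∈ O)
    (hs : ∀ u v, Γ (φ z) u v = Γ (φ z) v u) (ξ ζ : Z) :
    covDeriv Γ φ ξ (partialD φ ζ) z = covDeriv Γ φ ζ (partialD φ ξ) z := by
  unfold covDeriv
  have e1 : fderiv ℝ (partialD φ ζ) z ξ = fderiv ℝ (fderiv ℝ φ) z ξ ζ :=
    fderiv_fderiv_apply hO hφ hz ξ ζ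
  have e2 : fderiv ℝ (partialD φ ξ) z ζ = fderiv ℝ (fderiv ℝ φ) z ζ ξ :=
    fderiv_fderiv_apply hO hφ hz ζ ξ
  rw [e1, e2, fderiv_fderiv_comm hO hφ hz ξ ζ]
  unfold partialD
  rw [hs]

lemma fderiv_covDeriv {Γ : E → E →L[ℝ] E →L[ℝ] E} {V : Set E} {φ : Z → E} {O : Set Z} {z : Z}
    {Y : Z → E} (hV : IsOpen V) (hΓ : ContDiffOn ℝ ∞ Γ V)
    (hO : IsOpen O) (hφ : ContDiffOn ℝ ∞ φ O) (hm : Set.MapsTo φ O V)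
    (hY : ContDiffOn ℝ ∞ Y O) (hz : z ∈ O) (ξ ζ : Z) :
    fderiv ℝ (covDeriv Γ φ ζ Y) z ξ = fderiv ℝ (fderiv ℝ Y) z ξ ζ
      + fderiv ℝ Γ (φ z) (fderiv ℝ φ z ξ) (fderiv ℝ φ z ζ) (Y z)
      + Γ (φ z) (fderiv ℝ (fderiv ℝ φ) z ξ ζ) (Y z)
      + Γ (φ z) (fderiv ℝ φ z ζ) (fderiv ℝ Y z ξ) := by
  have hΓd : HasFDerivAt Γ (fderiv ℝ Γ (φ z)) (φ z) :=
    (differentiableAt_of_contDiffOn hV hΓ (hm hz)).hasFDerivAt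
  have h1 : HasFDerivAt (fun x => Γ (φ x)) ((fderiv ℝ Γ (φ z)).comp (fderiv ℝ φ z)) z :=
    HasFDerivAt.comp (g := Γ) (f := φ) z hΓd
      (differentiableAt_of_contDiffOn hO hφ hz).hasFDerivAt
  have dφ := (differentiableAt_of_contDiffOn hO
    (hφ.fderiv_of_isOpen hO infty_add_one_le) hz).hasFDerivAt.clm_apply (hasFDerivAt_const ζ z)
  have dY := (differentiableAt_of_contDiffOn hO
    (hY.fderiv_of_isOpen hO infty_add_one_le) hz).hasFDerivAt.clm_apply (hasFDerivAt_const ζ z)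
  have h2 := dY.add ((h1.clm_apply dφ).clm_apply (differentiableAt_of_contDiffOn hO hY hz).hasFDerivAt)
  have h3 := h2.fderiv
  have h4 : fderiv ℝ (covDeriv Γ φ ζ Y) z = _ := h3
  rw [h4]
  simp
  abel

/-- The second derivatives of `φ` and `Y` are symmetric and cancel. The part that is antisymmetric
in `ξ, ζ` is the derivative of `Γ` and its square, that is, the curvature. The order of the
arguments of `curvOp` reflects the sign convention of `riemann`. -/
lemma covDeriv_commutator {Γ : E → E →L[ℝ] E →L[ℝ] E} {V : Set E} {φ : Z → E} {O : Set Z} {z : Z}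
    {Y : Z → E} (hV : IsOpen V) (hΓ : ContDiffOn ℝ ∞ Γ V)
    (hO : IsOpen O) (hφ : ContDiffOn ℝ ∞ φ O) (hm : Set.MapsTo φ O V)
    (hY : ContDiffOn ℝ ∞ Y O) (hz : z ∈ O) (ξ ζ : Z) :
    covDeriv Γ φ ξ (covDeriv Γ φ ζ Y) z = covDeriv Γ φ ζ (covDeriv Γ φ ξ Y) z
      + curvOp Γ (φ z) (partialD φ ζ z) (partialD φ ξ z) (Y z) := by
  have e1 := fderiv_covDeriv hV hΓ hO hφ hm hY hz ξ ζ
  have e2 := fderiv_covDeriv hV hΓ hO hφ hm hY hz ζ ξ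
  have c1 : covDeriv Γ φ ξ (covDeriv Γ φ ζ Y) z
    = fderiv ℝ (covDeriv Γ φ ζ Y) z ξ + Γ (φ z) (fderiv ℝ φ z ξ) (covDeriv Γ φ ζ Y z) := rfl
  have c2 : covDeriv Γ φ ζ (covDeriv Γ φ ξ Y) z
    = fderiv ℝ (covDeriv Γ φ ξ Y) z ζ + Γ (φ z) (fderiv ℝ φ z ζ) (covDeriv Γ φ ξ Y z) := rfl
  rw [c1, c2, e1, e2, fderiv_fderiv_comm hO hφ hz ξ ζ, fderiv_fderiv_comm hO hY hz ξ ζ]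
  simp only [covDeriv, curvOp, partialD, map_add]
  abel

lemma covDeriv_add {Γ : E → E →L[ℝ] E →L[ℝ] E} {φ : Z → E} {z : Z} {Y W : Z → E}
    (hY : DifferentiableAt ℝ Y z) (hW : DifferentiableAt ℝ W z) (ξ : Z) :
    covDeriv Γ φ ξ (fun x => Y x + W x) z = covDeriv Γ φ ξ Y z + covDeriv Γ φ ξ W z := by
  simp only [covDeriv, fderiv_fun_add hY hW, map_add]
  simp only [add_apply]
  abel

lemma covDeriv_smul {Γ : E → E →L[ℝ] E →L[ℝ] E} {φ : Z → E} {z : Z} {f : Z → ℝ} {Y : Z → E}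
    (hf : DifferentiableAt ℝ f z) (hY : DifferentiableAt ℝ Y z) (ξ : Z) :
    covDeriv Γ φ ξ (fun x => f x • Y x) z
      = fderiv ℝ f z ξ • Y z + f z • covDeriv Γ φ ξ Y z := by
  simp only [covDeriv, fderiv_fun_smul hf hY, map_smul]
  simp
  abel

lemma covDeriv_congr {Γ : E → E →L[ℝ] E →L[ℝ] E} {φ : Z → E} {z : Z} {Y W : Z → E}
    (h : Y =ᶠ[𝓝 z] W) (ξ : Z) : covDeriv Γ φ ξ Y z = covDeriv Γ φ ξ W z := by
  simp only [covDeriv, h.fderiv_eq, h.eq_of_nhds]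

/-- `⟨R(u, v) z, z⟩ = 0`. -/
lemma IsLeviCivitaOn.curvOp_self {G : E → E →L[ℝ] E →L[ℝ] ℝ} {Γ : E → E →L[ℝ] E →L[ℝ] E}
    {V : Set E} (h : IsLeviCivitaOn G Γ V) {y : E} (hy : y ∈ V) (u v w : E) :
    G y (curvOp Γ y u v w) w = 0 := by
  -- The identity serves as the map `φ`, so the calculus along maps gives statements on `V` itself,
  -- with `w` a constant field.
  have hm : Set.MapsTo (fun x : E => x) V V := fun x hx => hx
  have hid : ContDiffOn ℝ ∞ (fun x : E => x) V := contDiffOn_id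
  have hc : ∀ a : E, ContDiffOn ℝ ∞ (fun _ : E => a) V := fun a => contDiffOn_const
  have hGd : ∀ x ∈ V, DifferentiableAt ℝ G x := fun x hx =>
    differentiableAt_of_contDiffOn h.isOpen h.contDiffOn hx
  set D : E → (E → E) → E → E := covDeriv Γ (fun x : E => x) with hD
  have hDc : ∀ a {Y : E → E}, ContDiffOn ℝ ∞ Y V → ContDiffOn ℝ ∞ (D a Y) V := fun a Y hY =>
    contDiffOn_covDeriv h.contDiffOn_conn h.isOpen hid hm hY a
  have key : ∀ a {Y W : E → E}, ContDiffOn ℝ ∞ Y V → ContDiffOn ℝ ∞ W V → ∀ x ∈ V,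
      fderiv ℝ (fun x => G x (Y x) (W x)) x a = G x (D a Y x) (W x) + G x (Y x) (D a W x) :=
    fun a Y W hY hW x hx => fderiv_parallel (φ := fun x : E => x) (hGd x hx) (h.parallel x hx)
      differentiableAt_id (differentiableAt_of_contDiffOn h.isOpen hY hx)
      (differentiableAt_of_contDiffOn h.isOpen hW hx) a
  -- Metric compatibility, used twice, writes `∂_b ∂_a ⟨w, w⟩` as `2⟨D_b D_a w, w⟩` plus a term
  -- symmetric in `a, b`. Symmetry of the second derivative then leaves only the curvature.
  set f : E → ℝ := fun x => G x w w with hf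
  have hfc : ContDiffOn ℝ ∞ f V := contDiffOn_bilin h.contDiffOn hid hm (hc w) (hc w)
  have hf1 : ∀ a, (fun x => fderiv ℝ f x a) =ᶠ[𝓝 y] fun x => 2 * G x (D a (fun _ => w) x) w := by
    intro a
    filter_upwards [h.isOpen.mem_nhds hy] with x hx
    rw [hf, key a (hc w) (hc w) x hx, h.symm x hx w]
    ring
  have hf2 : ∀ a b, fderiv ℝ (fun x => fderiv ℝ f x a) y b
      = 2 * (G y (D b (D a fun _ => w) y) w + G y (D a (fun _ => w) y) (D b (fun _ => w) y)) := by
    intro a b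
    rw [(hf1 a).fderiv_eq, fderiv_const_mul, smul_apply,
      key b (hDc a (hc w)) (hc w) y hy, smul_eq_mul]
    exact differentiableAt_of_contDiffOn h.isOpen
      (contDiffOn_bilin h.contDiffOn hid hm (hDc a (hc w)) (hc w)) hy
  have hcomm := covDeriv_commutator h.isOpen h.contDiffOn_conn h.isOpen hid hm (hc w) hy v u
  have e1 := hf2 u v
  have e2 := hf2 v u
  rw [fderiv_fderiv_apply h.isOpen hfc hy] at e1 e2
  rw [fderiv_fderiv_comm h.isOpen hfc hy] at e1
  have hp : ∀ a, partialD (fun x : E => x) a y = a := by intro a; simp [partialD]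
  rw [hp, hp] at hcomm
  have e3 : G y (D v (D u fun _ => w) y) w
      = G y (D u (D v fun _ => w) y) w + G y (curvOp Γ y u v w) w := by
    rw [hD, hcomm, map_add]; rfl
  have e4 := h.symm y hy (D u (fun _ => w) y) (D v (fun _ => w) y)
  linarith

end Calculus

/-! ### The flat heat operator and its product rules. -/

section Scalar

variable {Z : Type*} [NormedAddCommGroup Z] [NormedSpace ℝ Z]

/-- The second derivative `∂_ξ ∂_ξ f`. -/
def secondD (ξ : Z) (f : Z → ℝ) (z : Z) : ℝ := fderiv ℝ (fun x => fderiv ℝ f x ξ) z ξ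

/-- The heat operator `∂_{ξ₀} - ∂_{ξ₁}² - ∂_{ξ₂}²`. -/
def heatOp (ξ₀ ξ₁ ξ₂ : Z) (f : Z → ℝ) (z : Z) : ℝ :=
  fderiv ℝ f z ξ₀ - secondD ξ₁ f z - secondD ξ₂ f z

lemma fderiv_mul_apply' {f g : Z → ℝ} {z : Z} (hf : DifferentiableAt ℝ f z)
    (hg : DifferentiableAt ℝ g z) (ξ : Z) :
    fderiv ℝ (fun x => f x * g x) z ξ = fderiv ℝ f z ξ * g z + f z * fderiv ℝ g z ξ := by
  rw [fderiv_fun_mul hf hg]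
  simp
  ring

lemma secondD_mul {f g : Z → ℝ} {O : Set Z} {z : Z} (hO : IsOpen O) (hf : ContDiffOn ℝ ∞ f O)
    (hg : ContDiffOn ℝ ∞ g O) (hz : z ∈ O) (ξ : Z) :
    secondD ξ (fun x => f x * g x) z
      = secondD ξ f z * g z + 2 * (fderiv ℝ f z ξ * fderiv ℝ g z ξ) + f z * secondD ξ g z := by
  have d := fun {f : Z → ℝ} (hf : ContDiffOn ℝ ∞ f O) {x} (hx : x ∈ O) =>
    differentiableAt_of_contDiffOn hO hf hx
  have df := contDiffOn_partialD hO hf ξ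
  have dg := contDiffOn_partialD hO hg ξ
  have e : (fun x => fderiv ℝ (fun x => f x * g x) x ξ)
      =ᶠ[𝓝 z] fun x => partialD f ξ x * g x + f x * partialD g ξ x := by
    filter_upwards [hO.mem_nhds hz] with x hx
    exact fderiv_mul_apply' (d hf hx) (d hg hx) ξ
  change fderiv ℝ (fun x => fderiv ℝ (fun x => f x * g x) x ξ) z ξ
    = fderiv ℝ (partialD f ξ) z ξ * g z + 2 * (partialD f ξ z * partialD g ξ z)
      + f z * fderiv ℝ (partialD g ξ) z ξ
  rw [e.fderiv_eq, fderiv_fun_add ((d df hz).fun_mul (d hg hz)) ((d hf hz).fun_mul (d dg hz)), add_apply,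
    fderiv_mul_apply' (d df hz) (d hg hz), fderiv_mul_apply' (d hf hz) (d dg hz)]
  change _ * g z + partialD f ξ z * partialD g ξ z + (partialD f ξ z * partialD g ξ z + _) = _
  ring

lemma secondD_congr {f g : Z → ℝ} {z : Z} (h : f =ᶠ[𝓝 z] g) (ξ : Z) :
    secondD ξ f z = secondD ξ g z := by
  unfold secondD
  have : (fun x => fderiv ℝ f x ξ) =ᶠ[𝓝 z] fun x => fderiv ℝ g x ξ := by
    filter_upwards [h.eventuallyEq_nhds] with x hx
    rw [hx.fderiv_eq]
  rw [this.fderiv_eq]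

lemma heatOp_congr {f g : Z → ℝ} {z : Z} (h : f =ᶠ[𝓝 z] g) (ξ₀ ξ₁ ξ₂ : Z) :
    heatOp ξ₀ ξ₁ ξ₂ f z = heatOp ξ₀ ξ₁ ξ₂ g z := by
  unfold heatOp
  rw [h.fderiv_eq, secondD_congr h, secondD_congr h]

lemma heatOp_mul {f g : Z → ℝ} {O : Set Z} {z : Z} (hO : IsOpen O) (hf : ContDiffOn ℝ ∞ f O)
    (hg : ContDiffOn ℝ ∞ g O) (hz : z ∈ O) (ξ₀ ξ₁ ξ₂ : Z) :
    heatOp ξ₀ ξ₁ ξ₂ (fun x => f x * g x) z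
      = heatOp ξ₀ ξ₁ ξ₂ f z * g z + f z * heatOp ξ₀ ξ₁ ξ₂ g z
        - 2 * (fderiv ℝ f z ξ₁ * fderiv ℝ g z ξ₁ + fderiv ℝ f z ξ₂ * fderiv ℝ g z ξ₂) := by
  unfold heatOp
  rw [secondD_mul hO hf hg hz, secondD_mul hO hf hg hz,
    fderiv_mul_apply' (differentiableAt_of_contDiffOn hO hf hz)
      (differentiableAt_of_contDiffOn hO hg hz)]
  ring

lemma secondD_linear {f g : Z → ℝ} {O : Set Z} {z : Z} (hO : IsOpen O) (hf : ContDiffOn ℝ ∞ f O)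
    (hg : ContDiffOn ℝ ∞ g O) (hz : z ∈ O) (ξ : Z) :
    secondD ξ (fun x => f x - g x) z = secondD ξ f z - secondD ξ g z := by
  unfold secondD
  have e : (fun x => fderiv ℝ (fun x => f x - g x) x ξ)
      =ᶠ[𝓝 z] fun x => partialD f ξ x - partialD g ξ x := by
    filter_upwards [hO.mem_nhds hz] with x hx
    rw [fderiv_fun_sub (differentiableAt_of_contDiffOn hO hf hx)
      (differentiableAt_of_contDiffOn hO hg hx)]
    rfl
  rw [e.fderiv_eq, fderiv_fun_sub
    (differentiableAt_of_contDiffOn hO (contDiffOn_partialD hO hf ξ) hz)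
    (differentiableAt_of_contDiffOn hO (contDiffOn_partialD hO hg ξ) hz)]
  rfl

end Scalar

/-! ### Mean curvature flow in coordinates, modulo tangential terms. -/

section LocalFlow

variable {E Z : Type*} [NormedAddCommGroup E] [NormedSpace ℝ E]
  [NormedAddCommGroup Z] [NormedSpace ℝ Z]

/-- The components `g_{ξζ}` of the induced metric. -/
def indMetric (G : E → E →L[ℝ] E →L[ℝ] ℝ) (φ : Z → E) (ξ ζ : Z) (z : Z) : ℝ :=
  G (φ z) (partialD φ ξ z) (partialD φ ζ z)

/-- The Gram determinant of the induced metric on the span of `ξ` and `ζ`. -/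
def indDet (G : E → E →L[ℝ] E →L[ℝ] ℝ) (φ : Z → E) (ξ ζ : Z) (z : Z) : ℝ :=
  indMetric G φ ξ ξ z * indMetric G φ ζ ζ z - indMetric G φ ξ ζ z ^ 2

/-- The covariant second derivative `D_ξ ∂_ζ φ`. -/
def covX (Γ : E → E →L[ℝ] E →L[ℝ] E) (φ : Z → E) (ξ ζ : Z) : Z → E :=
  covDeriv Γ φ ξ (partialD φ ζ)

/-- The trace of the covariant Hessian, multiplied by the Gram determinant. -/
def traceHess (G : E → E →L[ℝ] E →L[ℝ] ℝ) (Γ : E → E →L[ℝ] E →L[ℝ] E) (φ : Z → E) (ξ ζ : Z)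
    (z : Z) : E :=
  indMetric G φ ζ ζ z • covX Γ φ ξ ξ z + (-2 * indMetric G φ ξ ζ z) • covX Γ φ ξ ζ z
    + indMetric G φ ξ ξ z • covX Γ φ ζ ζ z

/-- A family of surfaces, parametrized by `φ` with time direction `ξ₀` and space directions
`ξ₁, ξ₂`, which moves by mean curvature. -/
structure IsLocalFlow (G : E → E →L[ℝ] E →L[ℝ] ℝ) (Γ : E → E →L[ℝ] E →L[ℝ] E) (V : Set E)
    (φ : Z → E) (O : Set Z) (ξ₀ ξ₁ ξ₂ : Z) : Prop where
  lc : IsLeviCivitaOn G Γ V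
  isOpen : IsOpen O
  smooth : ContDiffOn ℝ ∞ φ O
  mapsTo : Set.MapsTo φ O V
  normal₁ : ∀ z ∈ O, indMetric G φ ξ₀ ξ₁ z = 0
  normal₂ : ∀ z ∈ O, indMetric G φ ξ₀ ξ₂ z = 0
  flow : ∀ z ∈ O, ∃ a b : ℝ, indDet G φ ξ₁ ξ₂ z • partialD φ ξ₀ z
    = traceHess G Γ φ ξ₁ ξ₂ z + a • partialD φ ξ₁ z + b • partialD φ ξ₂ z

/-- The coordinates are normal at `z`, for the induced metric. -/
structure IsNormalAt (G : E → E →L[ℝ] E →L[ℝ] ℝ) (Γ : E → E →L[ℝ] E →L[ℝ] E)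
    (φ : Z → E) (ξ₁ ξ₂ : Z) (z : Z) : Prop where
  g11 : indMetric G φ ξ₁ ξ₁ z = 1
  g22 : indMetric G φ ξ₂ ξ₂ z = 1
  g12 : indMetric G φ ξ₁ ξ₂ z = 0
  n111 : G (φ z) (covX Γ φ ξ₁ ξ₁ z) (partialD φ ξ₁ z) = 0
  n112 : G (φ z) (covX Γ φ ξ₁ ξ₁ z) (partialD φ ξ₂ z) = 0
  n121 : G (φ z) (covX Γ φ ξ₁ ξ₂ z) (partialD φ ξ₁ z) = 0
  n122 : G (φ z) (covX Γ φ ξ₁ ξ₂ z) (partialD φ ξ₂ z) = 0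
  n221 : G (φ z) (covX Γ φ ξ₂ ξ₂ z) (partialD φ ξ₁ z) = 0
  n222 : G (φ z) (covX Γ φ ξ₂ ξ₂ z) (partialD φ ξ₂ z) = 0

variable {G : E → E →L[ℝ] E →L[ℝ] ℝ} {Γ : E → E →L[ℝ] E →L[ℝ] E} {V : Set E}
    {φ : Z → E} {O : Set Z} {ξ₀ ξ₁ ξ₂ : Z} {z : Z}

namespace IsLocalFlow

lemma contDiffOn_X (h : IsLocalFlow G Γ V φ O ξ₀ ξ₁ ξ₂) (ξ : Z) :
    ContDiffOn ℝ ∞ (partialD φ ξ) O := contDiffOn_partialD h.isOpen h.smooth ξ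

lemma contDiffOn_D (h : IsLocalFlow G Γ V φ O ξ₀ ξ₁ ξ₂) {Y : Z → E} (hY : ContDiffOn ℝ ∞ Y O)
    (ξ : Z) : ContDiffOn ℝ ∞ (covDeriv Γ φ ξ Y) O :=
  contDiffOn_covDeriv h.lc.contDiffOn_conn h.isOpen h.smooth h.mapsTo hY ξ

lemma contDiffOn_covX (h : IsLocalFlow G Γ V φ O ξ₀ ξ₁ ξ₂) (ξ ζ : Z) :
    ContDiffOn ℝ ∞ (covX Γ φ ξ ζ) O := h.contDiffOn_D (h.contDiffOn_X ζ) ξ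

lemma contDiffOn_G (h : IsLocalFlow G Γ V φ O ξ₀ ξ₁ ξ₂) {Y W : Z → E}
    (hY : ContDiffOn ℝ ∞ Y O) (hW : ContDiffOn ℝ ∞ W O) :
    ContDiffOn ℝ ∞ (fun z => G (φ z) (Y z) (W z)) O :=
  contDiffOn_bilin h.lc.contDiffOn h.smooth h.mapsTo hY hW

lemma contDiffOn_indMetric (h : IsLocalFlow G Γ V φ O ξ₀ ξ₁ ξ₂) (ξ ζ : Z) :
    ContDiffOn ℝ ∞ (indMetric G φ ξ ζ) O := h.contDiffOn_G (h.contDiffOn_X ξ) (h.contDiffOn_X ζ)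

lemma contDiffOn_indDet (h : IsLocalFlow G Γ V φ O ξ₀ ξ₁ ξ₂) (ξ ζ : Z) :
    ContDiffOn ℝ ∞ (indDet G φ ξ ζ) O :=
  ((h.contDiffOn_indMetric ξ ξ).mul (h.contDiffOn_indMetric ζ ζ)).sub
    ((h.contDiffOn_indMetric ξ ζ).pow 2)

lemma contDiffOn_traceHess (h : IsLocalFlow G Γ V φ O ξ₀ ξ₁ ξ₂) (ξ ζ : Z) :
    ContDiffOn ℝ ∞ (traceHess G Γ φ ξ ζ) O :=
  (((h.contDiffOn_indMetric ζ ζ).smul (h.contDiffOn_covX ξ ξ)).add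
    ((contDiffOn_const.mul (h.contDiffOn_indMetric ξ ζ)).smul (h.contDiffOn_covX ξ ζ))).add
    ((h.contDiffOn_indMetric ξ ξ).smul (h.contDiffOn_covX ζ ζ))

lemma diff (h : IsLocalFlow G Γ V φ O ξ₀ ξ₁ ξ₂) {F : Type*} [NormedAddCommGroup F]
    [NormedSpace ℝ F] {f : Z → F} (hf : ContDiffOn ℝ ∞ f O) (hz : z ∈ O) :
    DifferentiableAt ℝ f z := differentiableAt_of_contDiffOn h.isOpen hf hz

lemma G_symm (h : IsLocalFlow G Γ V φ O ξ₀ ξ₁ ξ₂) (hz : z ∈ O) (u v : E) :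
    G (φ z) u v = G (φ z) v u := h.lc.symm _ (h.mapsTo hz) u v

lemma fderiv_bilin (h : IsLocalFlow G Γ V φ O ξ₀ ξ₁ ξ₂) {B : E → E →L[ℝ] E →L[ℝ] ℝ}
    (hB : ContDiffOn ℝ ∞ B V) (hp : ∀ y ∈ V, IsParallelAt Γ B y) {Y W : Z → E}
    (hY : ContDiffOn ℝ ∞ Y O) (hW : ContDiffOn ℝ ∞ W O) (hz : z ∈ O) (ξ : Z) :
    fderiv ℝ (fun x => B (φ x) (Y x) (W x)) z ξ
      = B (φ z) (covDeriv Γ φ ξ Y z) (W z) + B (φ z) (Y z) (covDeriv Γ φ ξ W z) :=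
  fderiv_parallel (differentiableAt_of_contDiffOn h.lc.isOpen hB (h.mapsTo hz))
    (hp _ (h.mapsTo hz)) (h.diff h.smooth hz) (h.diff hY hz) (h.diff hW hz) ξ

lemma secondD_bilin (h : IsLocalFlow G Γ V φ O ξ₀ ξ₁ ξ₂) {B : E → E →L[ℝ] E →L[ℝ] ℝ}
    (hB : ContDiffOn ℝ ∞ B V) (hp : ∀ y ∈ V, IsParallelAt Γ B y) {Y W : Z → E}
    (hY : ContDiffOn ℝ ∞ Y O) (hW : ContDiffOn ℝ ∞ W O) (hz : z ∈ O) (ξ : Z) :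
    secondD ξ (fun x => B (φ x) (Y x) (W x)) z
      = B (φ z) (covDeriv Γ φ ξ (covDeriv Γ φ ξ Y) z) (W z)
        + 2 * B (φ z) (covDeriv Γ φ ξ Y z) (covDeriv Γ φ ξ W z)
        + B (φ z) (Y z) (covDeriv Γ φ ξ (covDeriv Γ φ ξ W) z) := by
  have e : (fun x => fderiv ℝ (fun x => B (φ x) (Y x) (W x)) x ξ)
      =ᶠ[𝓝 z] fun x => B (φ x) (covDeriv Γ φ ξ Y x) (W x)
        + B (φ x) (Y x) (covDeriv Γ φ ξ W x) := by
    filter_upwards [h.isOpen.mem_nhds hz] with x hx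
    exact h.fderiv_bilin hB hp hY hW hx ξ
  have hDY := h.contDiffOn_D hY ξ
  have hDW := h.contDiffOn_D hW ξ
  unfold secondD
  rw [e.fderiv_eq, fderiv_fun_add
    (h.diff (contDiffOn_bilin hB h.smooth h.mapsTo hDY hW) hz)
    (h.diff (contDiffOn_bilin hB h.smooth h.mapsTo hY hDW) hz), add_apply,
    h.fderiv_bilin hB hp hDY hW hz, h.fderiv_bilin hB hp hY hDW hz]
  ring

lemma covX_comm (h : IsLocalFlow G Γ V φ O ξ₀ ξ₁ ξ₂) (hz : z ∈ O) (ξ ζ : Z) :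
    covX Γ φ ξ ζ z = covX Γ φ ζ ξ z :=
  covDeriv_partialD_comm h.isOpen h.smooth hz (h.lc.torsion_free _ (h.mapsTo hz)) ξ ζ

lemma commutator (h : IsLocalFlow G Γ V φ O ξ₀ ξ₁ ξ₂) (hz : z ∈ O) (ξ ζ κ : Z) :
    covDeriv Γ φ ξ (covX Γ φ ζ κ) z = covDeriv Γ φ ζ (covX Γ φ ξ κ) z
      + curvOp Γ (φ z) (partialD φ ζ z) (partialD φ ξ z) (partialD φ κ z) :=
  covDeriv_commutator h.lc.isOpen h.lc.contDiffOn_conn h.isOpen h.smooth h.mapsTo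
    (h.contDiffOn_X κ) hz ξ ζ

lemma covDeriv_covX_comm (h : IsLocalFlow G Γ V φ O ξ₀ ξ₁ ξ₂) (hz : z ∈ O) (ξ ζ κ : Z) :
    covDeriv Γ φ ξ (covX Γ φ ζ κ) z = covDeriv Γ φ ξ (covX Γ φ κ ζ) z := by
  apply covDeriv_congr
  filter_upwards [h.isOpen.mem_nhds hz] with x hx
  exact h.covX_comm hx ζ κ

/-- The velocity, without undetermined coefficients. -/
lemma sq_smul_velocity (h : IsLocalFlow G Γ V φ O ξ₀ ξ₁ ξ₂) (hz : z ∈ O) :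
    indDet G φ ξ₁ ξ₂ z ^ 2 • partialD φ ξ₀ z
      = indDet G φ ξ₁ ξ₂ z • traceHess G Γ φ ξ₁ ξ₂ z
        + (-(indMetric G φ ξ₂ ξ₂ z * G (φ z) (traceHess G Γ φ ξ₁ ξ₂ z) (partialD φ ξ₁ z)
            - indMetric G φ ξ₁ ξ₂ z * G (φ z) (traceHess G Γ φ ξ₁ ξ₂ z) (partialD φ ξ₂ z)))
            • partialD φ ξ₁ z
        + (-(indMetric G φ ξ₁ ξ₁ z * G (φ z) (traceHess G Γ φ ξ₁ ξ₂ z) (partialD φ ξ₂ z)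
            - indMetric G φ ξ₁ ξ₂ z * G (φ z) (traceHess G Γ φ ξ₁ ξ₂ z) (partialD φ ξ₁ z)))
            • partialD φ ξ₂ z := by
  obtain ⟨a, b, hab⟩ := h.flow z hz
  have n1 := h.normal₁ z hz
  have n2 := h.normal₂ z hz
  have e1 := congrArg (fun v => G (φ z) v (partialD φ ξ₁ z)) hab
  have e2 := congrArg (fun v => G (φ z) v (partialD φ ξ₂ z)) hab
  have s := h.G_symm hz (partialD φ ξ₂ z) (partialD φ ξ₁ z)
  simp only [map_add, map_smul, add_apply, smul_apply, smul_eq_mul] at e1 e2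
  change indDet G φ ξ₁ ξ₂ z * indMetric G φ ξ₀ ξ₁ z = _ + a * indMetric G φ ξ₁ ξ₁ z + _ at e1
  change indDet G φ ξ₁ ξ₂ z * indMetric G φ ξ₀ ξ₂ z = _ + a * indMetric G φ ξ₁ ξ₂ z
    + b * indMetric G φ ξ₂ ξ₂ z at e2
  rw [s] at e1
  change _ = _ + _ + b * indMetric G φ ξ₁ ξ₂ z at e1
  rw [n1] at e1
  rw [n2] at e2
  -- Cramer's rule. The velocity is normal, so the left sides of `e1` and `e2` vanish, and `a`, `b`
  -- times the determinant become explicit smooth functions. This costs the second power of the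
  -- determinant.
  have ha : -(indMetric G φ ξ₂ ξ₂ z * G (φ z) (traceHess G Γ φ ξ₁ ξ₂ z) (partialD φ ξ₁ z)
      - indMetric G φ ξ₁ ξ₂ z * G (φ z) (traceHess G Γ φ ξ₁ ξ₂ z) (partialD φ ξ₂ z))
      = indDet G φ ξ₁ ξ₂ z * a := by
    unfold indDet
    linear_combination indMetric G φ ξ₂ ξ₂ z * e1 - indMetric G φ ξ₁ ξ₂ z * e2
  have hb : -(indMetric G φ ξ₁ ξ₁ z * G (φ z) (traceHess G Γ φ ξ₁ ξ₂ z) (partialD φ ξ₂ z)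
      - indMetric G φ ξ₁ ξ₂ z * G (φ z) (traceHess G Γ φ ξ₁ ξ₂ z) (partialD φ ξ₁ z))
      = indDet G φ ξ₁ ξ₂ z * b := by
    unfold indDet
    linear_combination indMetric G φ ξ₁ ξ₁ z * e2 - indMetric G φ ξ₁ ξ₂ z * e1
  rw [ha, hb, pow_two, mul_smul, hab, smul_add, smul_add, mul_smul, mul_smul]

lemma fderiv_indMetric (h : IsLocalFlow G Γ V φ O ξ₀ ξ₁ ξ₂) (hz : z ∈ O) (ξ ζ κ : Z) :
    fderiv ℝ (indMetric G φ ζ κ) z ξ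
      = G (φ z) (covX Γ φ ξ ζ z) (partialD φ κ z) + G (φ z) (partialD φ ζ z) (covX Γ φ ξ κ z) :=
  h.fderiv_bilin h.lc.contDiffOn h.lc.parallel (h.contDiffOn_X ζ) (h.contDiffOn_X κ) hz ξ

/-- At the centre of normal coordinates the Gram matrix is the identity and the covariant second
derivatives are normal, so the tangential correction disappears. -/
lemma velocity_eq (h : IsLocalFlow G Γ V φ O ξ₀ ξ₁ ξ₂) (hz : z ∈ O)
    (hn : IsNormalAt G Γ φ ξ₁ ξ₂ z) :
    partialD φ ξ₀ z = covX Γ φ ξ₁ ξ₁ z + covX Γ φ ξ₂ ξ₂ z := by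
  have e := h.sq_smul_velocity hz
  have hd : indDet G φ ξ₁ ξ₂ z = 1 := by simp [indDet, hn.g11, hn.g22, hn.g12]
  have hT : traceHess G Γ φ ξ₁ ξ₂ z = covX Γ φ ξ₁ ξ₁ z + covX Γ φ ξ₂ ξ₂ z := by
    simp [traceHess, hn.g11, hn.g22, hn.g12]
  rw [hd, hT] at e
  simpa [hn.n111, hn.n112, hn.n221, hn.n222] using e

/-- The covariant derivative of the velocity, at the centre of normal coordinates. -/
lemma covDeriv_velocity (h : IsLocalFlow G Γ V φ O ξ₀ ξ₁ ξ₂) (hz : z ∈ O)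
    (hn : IsNormalAt G Γ φ ξ₁ ξ₂ z) (ξ : Z) :
    ∃ p q : ℝ, covX Γ φ ξ ξ₀ z
      = covDeriv Γ φ ξ (covX Γ φ ξ₁ ξ₁) z + covDeriv Γ φ ξ (covX Γ φ ξ₂ ξ₂) z
        + fderiv ℝ (indMetric G φ ξ₂ ξ₂) z ξ • covX Γ φ ξ₁ ξ₁ z
        - (2 * fderiv ℝ (indMetric G φ ξ₁ ξ₂) z ξ) • covX Γ φ ξ₁ ξ₂ z
        + fderiv ℝ (indMetric G φ ξ₁ ξ₁) z ξ • covX Γ φ ξ₂ ξ₂ z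
        - (fderiv ℝ (indMetric G φ ξ₁ ξ₁) z ξ + fderiv ℝ (indMetric G φ ξ₂ ξ₂) z ξ)
          • partialD φ ξ₀ z
        + p • partialD φ ξ₁ z + q • partialD φ ξ₂ z := by
  set T := traceHess G Γ φ ξ₁ ξ₂ with hTd
  set m := indDet G φ ξ₁ ξ₂ with hmd
  set b₁ : Z → ℝ := fun z => -(indMetric G φ ξ₂ ξ₂ z * G (φ z) (T z) (partialD φ ξ₁ z)
            - indMetric G φ ξ₁ ξ₂ z * G (φ z) (T z) (partialD φ ξ₂ z)) with hb₁
  set b₂ : Z → ℝ := fun z => -(indMetric G φ ξ₁ ξ₁ z * G (φ z) (T z) (partialD φ ξ₂ z)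
            - indMetric G φ ξ₁ ξ₂ z * G (φ z) (T z) (partialD φ ξ₁ z)) with hb₂
  have cT : ContDiffOn ℝ ∞ T O := h.contDiffOn_traceHess ξ₁ ξ₂
  have cm : ContDiffOn ℝ ∞ m O := h.contDiffOn_indDet ξ₁ ξ₂
  have cg := h.contDiffOn_indMetric
  have cX := h.contDiffOn_X
  have cA := h.contDiffOn_covX
  have cb₁ : ContDiffOn ℝ ∞ b₁ O := (((cg ξ₂ ξ₂).mul (h.contDiffOn_G cT (cX ξ₁))).sub
    ((cg ξ₁ ξ₂).mul (h.contDiffOn_G cT (cX ξ₂)))).neg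
  have cb₂ : ContDiffOn ℝ ∞ b₂ O := (((cg ξ₁ ξ₁).mul (h.contDiffOn_G cT (cX ξ₂))).sub
    ((cg ξ₁ ξ₂).mul (h.contDiffOn_G cT (cX ξ₁)))).neg
  -- This identity holds near `z` and has no undetermined coefficients, so it may be differentiated.
  -- Since `b₁` and `b₂` vanish at `z`, they contribute only their derivatives, as the tangential
  -- terms `p` and `q`.
  have e : (fun x => (m x * m x) • partialD φ ξ₀ x)
      =ᶠ[𝓝 z] fun x => (m x • T x + b₁ x • partialD φ ξ₁ x) + b₂ x • partialD φ ξ₂ x := by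
    filter_upwards [h.isOpen.mem_nhds hz] with x hx
    rw [← pow_two]
    exact h.sq_smul_velocity hx
  have hd : m z = 1 := by simp [hmd, indDet, hn.g11, hn.g22, hn.g12]
  have hT : T z = covX Γ φ ξ₁ ξ₁ z + covX Γ φ ξ₂ ξ₂ z := by
    simp [hTd, traceHess, hn.g11, hn.g22, hn.g12]
  have hbz₁ : b₁ z = 0 := by simp [hb₁, hT, hn.n111, hn.n112, hn.n221, hn.n222]
  have hbz₂ : b₂ z = 0 := by simp [hb₂, hT, hn.n111, hn.n112, hn.n221, hn.n222]
  have e' := covDeriv_congr (Γ := Γ) (φ := φ) e ξ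
  have d := fun {F : Type _} [NormedAddCommGroup F] [NormedSpace ℝ F] {f : Z → F}
    (hf : ContDiffOn ℝ ∞ f O) => h.diff hf hz
  have dr := fun {f : Z → ℝ} (hf : ContDiffOn ℝ ∞ f O) => h.diff hf hz
  rw [covDeriv_smul ((dr cm).fun_mul (dr cm)) (d (cX ξ₀)),
    covDeriv_add (((dr cm).fun_smul (d cT)).fun_add ((dr cb₁).fun_smul (d (cX ξ₁))))
      ((dr cb₂).fun_smul (d (cX ξ₂))), covDeriv_add ((dr cm).fun_smul (d cT)) ((dr cb₁).fun_smul (d (cX ξ₁))),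
    covDeriv_smul (dr cm) (d cT), covDeriv_smul (dr cb₁) (d (cX ξ₁)),
    covDeriv_smul (dr cb₂) (d (cX ξ₂)), fderiv_mul_apply' (dr cm) (dr cm), hd, hbz₁, hbz₂] at e'
  have eT : covDeriv Γ φ ξ T z = fderiv ℝ (indMetric G φ ξ₂ ξ₂) z ξ • covX Γ φ ξ₁ ξ₁ z
      + covDeriv Γ φ ξ (covX Γ φ ξ₁ ξ₁) z
      - (2 * fderiv ℝ (indMetric G φ ξ₁ ξ₂) z ξ) • covX Γ φ ξ₁ ξ₂ z
      + fderiv ℝ (indMetric G φ ξ₁ ξ₁) z ξ • covX Γ φ ξ₂ ξ₂ z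
      + covDeriv Γ φ ξ (covX Γ φ ξ₂ ξ₂) z := by
    have : T = fun x => (indMetric G φ ξ₂ ξ₂ x • covX Γ φ ξ₁ ξ₁ x
        + (-2 * indMetric G φ ξ₁ ξ₂ x) • covX Γ φ ξ₁ ξ₂ x)
        + indMetric G φ ξ₁ ξ₁ x • covX Γ φ ξ₂ ξ₂ x := rfl
    have dc : DifferentiableAt ℝ (fun x => -2 * indMetric G φ ξ₁ ξ₂ x) z :=
      (dr (cg ξ₁ ξ₂)).const_mul _
    rw [this, covDeriv_add (((dr (cg ξ₂ ξ₂)).fun_smul (d (cA ξ₁ ξ₁))).fun_add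
        (dc.fun_smul (d (cA ξ₁ ξ₂)))) ((dr (cg ξ₁ ξ₁)).fun_smul (d (cA ξ₂ ξ₂))),
      covDeriv_add ((dr (cg ξ₂ ξ₂)).fun_smul (d (cA ξ₁ ξ₁))) (dc.fun_smul (d (cA ξ₁ ξ₂))),
      covDeriv_smul (dr (cg ξ₂ ξ₂)) (d (cA ξ₁ ξ₁)), covDeriv_smul dc (d (cA ξ₁ ξ₂)),
      covDeriv_smul (dr (cg ξ₁ ξ₁)) (d (cA ξ₂ ξ₂)), fderiv_const_mul (dr (cg ξ₁ ξ₂)), hn.g11,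
      hn.g12, hn.g22, smul_apply, smul_eq_mul]
    module
  have em : fderiv ℝ m z ξ = fderiv ℝ (indMetric G φ ξ₁ ξ₁) z ξ
      + fderiv ℝ (indMetric G φ ξ₂ ξ₂) z ξ := by
    have : m = fun x => indMetric G φ ξ₁ ξ₁ x * indMetric G φ ξ₂ ξ₂ x
      - indMetric G φ ξ₁ ξ₂ x * indMetric G φ ξ₁ ξ₂ x := by
      ext x; simp [hmd, indDet, pow_two]
    rw [this, fderiv_fun_sub ((dr (cg ξ₁ ξ₁)).fun_mul (dr (cg ξ₂ ξ₂)))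
      ((dr (cg ξ₁ ξ₂)).fun_mul (dr (cg ξ₁ ξ₂))), sub_apply,
      fderiv_mul_apply' (dr (cg ξ₁ ξ₁)) (dr (cg ξ₂ ξ₂)),
      fderiv_mul_apply' (dr (cg ξ₁ ξ₂)) (dr (cg ξ₁ ξ₂)), hn.g11, hn.g12, hn.g22]
    ring
  refine ⟨fderiv ℝ b₁ z ξ, fderiv ℝ b₂ z ξ, ?_⟩
  rw [eT, em, hT, h.velocity_eq hz hn,
    show covDeriv Γ φ ξ (partialD φ ξ₀) z = covX Γ φ ξ ξ₀ z from rfl] at e'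
  rw [h.velocity_eq hz hn]
  linear_combination (norm := module) e'

end IsLocalFlow

end LocalFlow

/-! ### Evolution of parallel 2-forms and of the squared speed. -/

section LocalFlowEvolution

variable {E Z : Type*} [NormedAddCommGroup E] [NormedSpace ℝ E]
  [NormedAddCommGroup Z] [NormedSpace ℝ Z]
variable {G : E → E →L[ℝ] E →L[ℝ] ℝ} {Γ : E → E →L[ℝ] E →L[ℝ] E} {V : Set E}
    {φ : Z → E} {O : Set Z} {ξ₀ ξ₁ ξ₂ : Z} {z : Z}

lemma covX_eq (ξ ζ : Z) : covX Γ φ ξ ζ = covDeriv Γ φ ξ (partialD φ ζ) := rfl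

namespace IsLocalFlow

lemma heatOp_bilin (h : IsLocalFlow G Γ V φ O ξ₀ ξ₁ ξ₂) {B : E → E →L[ℝ] E →L[ℝ] ℝ}
    (hB : ContDiffOn ℝ ∞ B V) (hp : ∀ y ∈ V, IsParallelAt Γ B y) {Y W : Z → E}
    (hY : ContDiffOn ℝ ∞ Y O) (hW : ContDiffOn ℝ ∞ W O) (hz : z ∈ O) :
    heatOp ξ₀ ξ₁ ξ₂ (fun x => B (φ x) (Y x) (W x)) z
      = B (φ z) (covDeriv Γ φ ξ₀ Y z) (W z) + B (φ z) (Y z) (covDeriv Γ φ ξ₀ W z)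
        - B (φ z) (covDeriv Γ φ ξ₁ (covDeriv Γ φ ξ₁ Y) z
            + covDeriv Γ φ ξ₂ (covDeriv Γ φ ξ₂ Y) z) (W z)
        - B (φ z) (Y z) (covDeriv Γ φ ξ₁ (covDeriv Γ φ ξ₁ W) z
            + covDeriv Γ φ ξ₂ (covDeriv Γ φ ξ₂ W) z)
        - 2 * (B (φ z) (covDeriv Γ φ ξ₁ Y z) (covDeriv Γ φ ξ₁ W z)
            + B (φ z) (covDeriv Γ φ ξ₂ Y z) (covDeriv Γ φ ξ₂ W z)) := by
  unfold heatOp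
  rw [h.fderiv_bilin hB hp hY hW hz, h.secondD_bilin hB hp hY hW hz,
    h.secondD_bilin hB hp hY hW hz]
  simp only [map_add, add_apply]
  ring

lemma fderiv_indMetric_eq_zero (h : IsLocalFlow G Γ V φ O ξ₀ ξ₁ ξ₂) (hz : z ∈ O)
    (hn : IsNormalAt G Γ φ ξ₁ ξ₂ z) :
    (fderiv ℝ (indMetric G φ ξ₁ ξ₁) z ξ₁ = 0 ∧ fderiv ℝ (indMetric G φ ξ₁ ξ₂) z ξ₁ = 0 ∧
      fderiv ℝ (indMetric G φ ξ₂ ξ₂) z ξ₁ = 0) ∧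
    (fderiv ℝ (indMetric G φ ξ₁ ξ₁) z ξ₂ = 0 ∧ fderiv ℝ (indMetric G φ ξ₁ ξ₂) z ξ₂ = 0 ∧
      fderiv ℝ (indMetric G φ ξ₂ ξ₂) z ξ₂ = 0) := by
  have s := h.G_symm hz
  have c := h.covX_comm hz ξ₂ ξ₁
  simp only [h.fderiv_indMetric hz, c, s (partialD φ _ z), hn.n111, hn.n112, hn.n121, hn.n122,
    hn.n221, hn.n222, add_zero, and_self]

/-- In the space directions the first derivatives of the induced metric vanish at the centre, so
only traces of third derivatives survive. The tangential coefficients are left unknown because they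
cancel in `heatOp_angle`. -/
lemma covX_velocity (h : IsLocalFlow G Γ V φ O ξ₀ ξ₁ ξ₂) (hz : z ∈ O)
    (hn : IsNormalAt G Γ φ ξ₁ ξ₂ z) :
    (∃ p q : ℝ, covX Γ φ ξ₁ ξ₀ z
      = covDeriv Γ φ ξ₁ (covX Γ φ ξ₁ ξ₁) z + covDeriv Γ φ ξ₁ (covX Γ φ ξ₂ ξ₂) z
        + p • partialD φ ξ₁ z + q • partialD φ ξ₂ z) ∧
    (∃ p q : ℝ, covX Γ φ ξ₂ ξ₀ z
      = covDeriv Γ φ ξ₂ (covX Γ φ ξ₁ ξ₁) z + covDeriv Γ φ ξ₂ (covX Γ φ ξ₂ ξ₂) z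
        + p • partialD φ ξ₁ z + q • partialD φ ξ₂ z) := by
  obtain ⟨⟨a1, a2, a3⟩, b1, b2, b3⟩ := h.fderiv_indMetric_eq_zero hz hn
  constructor
  · obtain ⟨p, q, e⟩ := h.covDeriv_velocity hz hn ξ₁
    refine ⟨p, q, ?_⟩
    rw [e, a1, a2, a3]
    module
  · obtain ⟨p, q, e⟩ := h.covDeriv_velocity hz hn ξ₂
    refine ⟨p, q, ?_⟩
    rw [e, b1, b2, b3]
    module

/-- The Codazzi equation: `D_k D_k X_i = D_k D_i X_k = D_i D_k X_k + R`, and the sum of `D_i D_k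
X_k` over `k` is the derivative of the mean curvature vector up to tangential terms. Curvature
arises only for `k ≠ i`. -/
lemma rough_laplacian_X (h : IsLocalFlow G Γ V φ O ξ₀ ξ₁ ξ₂) (hz : z ∈ O)
    (hn : IsNormalAt G Γ φ ξ₁ ξ₂ z) :
    (∃ p q : ℝ, covDeriv Γ φ ξ₁ (covX Γ φ ξ₁ ξ₁) z + covDeriv Γ φ ξ₂ (covX Γ φ ξ₂ ξ₁) z
      = covX Γ φ ξ₁ ξ₀ z + curvOp Γ (φ z) (partialD φ ξ₁ z) (partialD φ ξ₂ z) (partialD φ ξ₂ z)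
        + p • partialD φ ξ₁ z + q • partialD φ ξ₂ z) ∧
    (∃ p q : ℝ, covDeriv Γ φ ξ₁ (covX Γ φ ξ₁ ξ₂) z + covDeriv Γ φ ξ₂ (covX Γ φ ξ₂ ξ₂) z
      = covX Γ φ ξ₂ ξ₀ z + curvOp Γ (φ z) (partialD φ ξ₂ z) (partialD φ ξ₁ z) (partialD φ ξ₁ z)
        + p • partialD φ ξ₁ z + q • partialD φ ξ₂ z) := by
  obtain ⟨⟨p, q, e⟩, p', q', e'⟩ := h.covX_velocity hz hn
  constructor
  · refine ⟨-p, -q, ?_⟩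
    rw [h.covDeriv_covX_comm hz ξ₂ ξ₂ ξ₁, h.commutator hz ξ₂ ξ₁ ξ₂, e]
    module
  · refine ⟨-p', -q', ?_⟩
    rw [h.covDeriv_covX_comm hz ξ₁ ξ₁ ξ₂, h.commutator hz ξ₁ ξ₂ ξ₁, e']
    module

/-- The orthogonality of the velocity to the tangent vectors is differentiated. This expresses the
tangential part of `D_ξ H` by the second fundamental form. -/
lemma G_covX_velocity (h : IsLocalFlow G Γ V φ O ξ₀ ξ₁ ξ₂) (hz : z ∈ O) (ξ : Z) :
    G (φ z) (covX Γ φ ξ ξ₀ z) (partialD φ ξ₁ z)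
      = -G (φ z) (partialD φ ξ₀ z) (covX Γ φ ξ ξ₁ z) ∧
    G (φ z) (covX Γ φ ξ ξ₀ z) (partialD φ ξ₂ z)
      = -G (φ z) (partialD φ ξ₀ z) (covX Γ φ ξ ξ₂ z) := by
  have e : ∀ f : Z → ℝ, (∀ z ∈ O, f z = 0) → fderiv ℝ f z ξ = 0 := by
    intro f hf
    have : f =ᶠ[𝓝 z] fun _ => 0 := by
      filter_upwards [h.isOpen.mem_nhds hz] with x hx using hf x hx
    rw [this.fderiv_eq]
    simp
  have e1 := e _ h.normal₁
  have e2 := e _ h.normal₂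
  rw [h.fderiv_indMetric hz] at e1 e2
  constructor <;> linarith

/-- The evolution of a parallel 2-form evaluated on the tangent planes of the surfaces. -/
lemma heatOp_angle (h : IsLocalFlow G Γ V φ O ξ₀ ξ₁ ξ₂) (hz : z ∈ O)
    (hn : IsNormalAt G Γ φ ξ₁ ξ₂ z) (hm : ∀ z ∈ O, 0 < indDet G φ ξ₁ ξ₂ z)
    {B : E → E →L[ℝ] E →L[ℝ] ℝ}
    (hB : ContDiffOn ℝ ∞ B V) (hp : ∀ y ∈ V, IsParallelAt Γ B y)
    (halt : ∀ v, B (φ z) v v = 0) :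
    heatOp ξ₀ ξ₁ ξ₂ (fun x => B (φ x) (partialD φ ξ₁ x) (partialD φ ξ₂ x)
        / √(indDet G φ ξ₁ ξ₂ x)) z
      = -(B (φ z) (curvOp Γ (φ z) (partialD φ ξ₁ z) (partialD φ ξ₂ z) (partialD φ ξ₂ z))
            (partialD φ ξ₂ z)
          + B (φ z) (partialD φ ξ₁ z)
            (curvOp Γ (φ z) (partialD φ ξ₂ z) (partialD φ ξ₁ z) (partialD φ ξ₁ z)))
        + B (φ z) (partialD φ ξ₁ z) (partialD φ ξ₂ z)
          * (G (φ z) (curvOp Γ (φ z) (partialD φ ξ₁ z) (partialD φ ξ₂ z) (partialD φ ξ₂ z))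
              (partialD φ ξ₁ z)
            + G (φ z) (curvOp Γ (φ z) (partialD φ ξ₂ z) (partialD φ ξ₁ z) (partialD φ ξ₁ z))
              (partialD φ ξ₂ z)
            + G (φ z) (covX Γ φ ξ₁ ξ₁ z) (covX Γ φ ξ₁ ξ₁ z)
            + 2 * G (φ z) (covX Γ φ ξ₁ ξ₂ z) (covX Γ φ ξ₁ ξ₂ z)
            + G (φ z) (covX Γ φ ξ₂ ξ₂ z) (covX Γ φ ξ₂ ξ₂ z))
        - 2 * (B (φ z) (covX Γ φ ξ₁ ξ₁ z) (covX Γ φ ξ₁ ξ₂ z)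
          + B (φ z) (covX Γ φ ξ₁ ξ₂ z) (covX Γ φ ξ₂ ξ₂ z)) := by
  set m := indDet G φ ξ₁ ξ₂ with hmd
  set Om : Z → ℝ := fun x => B (φ x) (partialD φ ξ₁ x) (partialD φ ξ₂ x) with hOm
  set s : Z → ℝ := fun x => √(m x) with hs
  have cm : ContDiffOn ℝ ∞ m O := h.contDiffOn_indDet ξ₁ ξ₂
  have cO : ContDiffOn ℝ ∞ Om O := contDiffOn_bilin hB h.smooth h.mapsTo (h.contDiffOn_X ξ₁)
    (h.contDiffOn_X ξ₂)
  have cs : ContDiffOn ℝ ∞ s O := cm.sqrt fun x hx => (hm x hx).ne'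
  have cθ : ContDiffOn ℝ ∞ (fun x => Om x / s x) O :=
    cO.div cs fun x hx => (Real.sqrt_pos.2 (hm x hx)).ne'
  have mz : m z = 1 := by simp [hmd, indDet, hn.g11, hn.g22, hn.g12]
  have sz : s z = 1 := by simp [hs, mz]
  have cg := h.contDiffOn_indMetric
  obtain ⟨⟨a1, a2, a3⟩, b1, b2, b3⟩ := h.fderiv_indMetric_eq_zero hz hn
  have hmf : m = fun x => indMetric G φ ξ₁ ξ₁ x * indMetric G φ ξ₂ ξ₂ x
      - indMetric G φ ξ₁ ξ₂ x * indMetric G φ ξ₁ ξ₂ x := by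
    ext x; simp [hmd, indDet, pow_two]
  have dr := fun {f : Z → ℝ} (hf : ContDiffOn ℝ ∞ f O) => h.diff hf hz
  have m' : ∀ ξ, fderiv ℝ m z ξ = fderiv ℝ (indMetric G φ ξ₁ ξ₁) z ξ
      + fderiv ℝ (indMetric G φ ξ₂ ξ₂) z ξ := by
    intro ξ
    rw [hmf, fderiv_fun_sub ((dr (cg ξ₁ ξ₁)).fun_mul (dr (cg ξ₂ ξ₂)))
      ((dr (cg ξ₁ ξ₂)).fun_mul (dr (cg ξ₁ ξ₂))), sub_apply,
      fderiv_mul_apply' (dr (cg ξ₁ ξ₁)) (dr (cg ξ₂ ξ₂)),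
      fderiv_mul_apply' (dr (cg ξ₁ ξ₂)) (dr (cg ξ₁ ξ₂)), hn.g11, hn.g12, hn.g22]
    ring
  have heatm : heatOp ξ₀ ξ₁ ξ₂ m z = heatOp ξ₀ ξ₁ ξ₂ (indMetric G φ ξ₁ ξ₁) z
      + heatOp ξ₀ ξ₁ ξ₂ (indMetric G φ ξ₂ ξ₂) z := by
    have c1 := (cg ξ₁ ξ₁).mul (cg ξ₂ ξ₂)
    have c2 := (cg ξ₁ ξ₂).mul (cg ξ₁ ξ₂)
    unfold heatOp
    rw [m', hmf, secondD_linear h.isOpen c1 c2 hz, secondD_linear h.isOpen c1 c2 hz,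
      secondD_mul h.isOpen (cg ξ₁ ξ₁) (cg ξ₂ ξ₂) hz, secondD_mul h.isOpen (cg ξ₁ ξ₁) (cg ξ₂ ξ₂) hz,
      secondD_mul h.isOpen (cg ξ₁ ξ₂) (cg ξ₁ ξ₂) hz, secondD_mul h.isOpen (cg ξ₁ ξ₂) (cg ξ₁ ξ₂) hz,
      hn.g11, hn.g12, hn.g22, a1, a2, b1, b2]
    ring
  -- The square root and the quotient are treated through the products `s * s = m` and `(Om / s) * s
  -- = Om`. The space derivatives of `s` vanish at `z`, so `heatOp_mul` produces no gradient term.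
  have hss : (fun x => s x * s x) =ᶠ[𝓝 z] m := by
    filter_upwards [h.isOpen.mem_nhds hz] with x hx
    exact Real.mul_self_sqrt (hm x hx).le
  have s' : ∀ ξ, 2 * fderiv ℝ s z ξ = fderiv ℝ m z ξ := by
    intro ξ
    rw [← hss.fderiv_eq, fderiv_mul_apply' (dr cs) (dr cs), sz]
    ring
  have s1 : fderiv ℝ s z ξ₁ = 0 := by
    have := s' ξ₁
    rw [m', a1, a3] at this
    linarith
  have s2 : fderiv ℝ s z ξ₂ = 0 := by
    have := s' ξ₂
    rw [m', b1, b3] at this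
    linarith
  have heats : heatOp ξ₀ ξ₁ ξ₂ m z = 2 * heatOp ξ₀ ξ₁ ξ₂ s z := by
    rw [← heatOp_congr hss, heatOp_mul h.isOpen cs cs hz, sz, s1, s2]
    ring
  have hθ : (fun x => Om x / s x * s x) =ᶠ[𝓝 z] Om := by
    filter_upwards [h.isOpen.mem_nhds hz] with x hx
    exact div_mul_cancel₀ _ (Real.sqrt_pos.2 (hm x hx)).ne'
  have heatO : heatOp ξ₀ ξ₁ ξ₂ Om z = heatOp ξ₀ ξ₁ ξ₂ (fun x => Om x / s x) z
      + Om z * heatOp ξ₀ ξ₁ ξ₂ s z := by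
    rw [← heatOp_congr hθ, heatOp_mul h.isOpen cθ cs hz, sz, s1, s2]
    ring
  have hO := h.heatOp_bilin hB hp (h.contDiffOn_X ξ₁) (h.contDiffOn_X ξ₂) hz
  have h11 := h.heatOp_bilin h.lc.contDiffOn h.lc.parallel (h.contDiffOn_X ξ₁)
    (h.contDiffOn_X ξ₁) hz
  have h22 := h.heatOp_bilin h.lc.contDiffOn h.lc.parallel (h.contDiffOn_X ξ₂)
    (h.contDiffOn_X ξ₂) hz
  change heatOp ξ₀ ξ₁ ξ₂ (indMetric G φ ξ₁ ξ₁) z = _ at h11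
  change heatOp ξ₀ ξ₁ ξ₂ (indMetric G φ ξ₂ ξ₂) z = _ at h22
  change heatOp ξ₀ ξ₁ ξ₂ Om z = _ at hO
  simp only [← covX_eq] at hO h11 h22
  obtain ⟨⟨p, q, e⟩, p', q', e'⟩ := h.rough_laplacian_X hz hn
  have hsym := h.G_symm hz
  have halt' : ∀ u v, B (φ z) u v = -B (φ z) v u := by
    intro u v
    have := halt (u + v)
    simp only [map_add, add_apply, halt] at this
    linarith
  rw [e, e', h.covX_comm hz ξ₀ ξ₁, h.covX_comm hz ξ₀ ξ₂, h.covX_comm hz ξ₂ ξ₁] at hO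
  rw [e, h.covX_comm hz ξ₀ ξ₁, h.covX_comm hz ξ₂ ξ₁] at h11
  rw [e', h.covX_comm hz ξ₀ ξ₂] at h22
  simp only [map_add, map_smul, add_apply, smul_apply, smul_eq_mul, halt] at hO h11 h22
  have g11 : G (φ z) (partialD φ ξ₁ z) (partialD φ ξ₁ z) = 1 := hn.g11
  have g22 : G (φ z) (partialD φ ξ₂ z) (partialD φ ξ₂ z) = 1 := hn.g22
  have g12 : G (φ z) (partialD φ ξ₁ z) (partialD φ ξ₂ z) = 0 := hn.g12
  have g21 : G (φ z) (partialD φ ξ₂ z) (partialD φ ξ₁ z) = 0 := by rw [hsym, g12]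
  rw [hsym (partialD φ ξ₁ z) (curvOp _ _ _ _ _), hsym (partialD φ ξ₁ z) (covX _ _ _ _ _), g11, g12,
    g21] at h11
  rw [hsym (partialD φ ξ₂ z) (curvOp _ _ _ _ _), hsym (partialD φ ξ₂ z) (covX _ _ _ _ _), g22, g12,
    g21] at h22
  have hB21 := halt' (partialD φ ξ₂ z) (partialD φ ξ₁ z)
  have hOmz : Om z = B (φ z) (partialD φ ξ₁ z) (partialD φ ξ₂ z) := rfl
  rw [← hOmz] at hO ⊢
  obtain ⟨g1, -⟩ := h.G_covX_velocity hz ξ₁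
  obtain ⟨-, g2⟩ := h.G_covX_velocity hz ξ₂
  -- The derivatives of the velocity cancel between the time derivative and the rough Laplacian. The
  -- unknown tangential coefficients cancel between the form and the area density.
  linear_combination -heatO + hO - Om z * (heatm + h11 + h22) / 2 + Om z / 2 * heats

/-- The evolution of the squared norm of the velocity. -/
lemma heatOp_speed (h : IsLocalFlow G Γ V φ O ξ₀ ξ₁ ξ₂) (hz : z ∈ O)
    (hn : IsNormalAt G Γ φ ξ₁ ξ₂ z) :
    heatOp ξ₀ ξ₁ ξ₂ (indMetric G φ ξ₀ ξ₀) z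
      = -2 * (G (φ z) (covX Γ φ ξ₁ ξ₀ z) (covX Γ φ ξ₁ ξ₀ z)
          + G (φ z) (covX Γ φ ξ₂ ξ₀ z) (covX Γ φ ξ₂ ξ₀ z))
        + 4 * (G (φ z) (partialD φ ξ₀ z) (covX Γ φ ξ₁ ξ₁ z) ^ 2
          + 2 * G (φ z) (partialD φ ξ₀ z) (covX Γ φ ξ₁ ξ₂ z) ^ 2
          + G (φ z) (partialD φ ξ₀ z) (covX Γ φ ξ₂ ξ₂ z) ^ 2)
        - 2 * (G (φ z) (curvOp Γ (φ z) (partialD φ ξ₀ z) (partialD φ ξ₁ z) (partialD φ ξ₁ z))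
            (partialD φ ξ₀ z)
          + G (φ z) (curvOp Γ (φ z) (partialD φ ξ₀ z) (partialD φ ξ₂ z) (partialD φ ξ₂ z))
            (partialD φ ξ₀ z)) := by
  have hO := h.heatOp_bilin h.lc.contDiffOn h.lc.parallel (h.contDiffOn_X ξ₀)
    (h.contDiffOn_X ξ₀) hz
  change heatOp ξ₀ ξ₁ ξ₂ (indMetric G φ ξ₀ ξ₀) z = _ at hO
  simp only [← covX_eq] at hO
  -- `D_i D_i X₀ = D_i D_0 X_i = D_0 D_i X_i + R`. The sum of `D_0 D_i X_i` is the acceleration of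
  -- the flow, up to the time derivative of the metric, and cancels against the first terms of `hO`.
  rw [h.covDeriv_covX_comm hz ξ₁ ξ₁ ξ₀, h.covDeriv_covX_comm hz ξ₂ ξ₂ ξ₀,
    h.commutator hz ξ₁ ξ₀ ξ₁, h.commutator hz ξ₂ ξ₀ ξ₂] at hO
  obtain ⟨p, q, e⟩ := h.covDeriv_velocity hz hn ξ₀
  have hsym := h.G_symm hz
  have hv := h.velocity_eq hz hn
  obtain ⟨g11, g12⟩ := h.G_covX_velocity hz ξ₁
  obtain ⟨g21, g22⟩ := h.G_covX_velocity hz ξ₂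
  rw [h.covX_comm hz ξ₂ ξ₁] at g21
  -- The evolution of the induced metric, `∂_t g_ij = -2⟨H, A_ij⟩`; it is responsible for the
  -- quadratic terms in `⟨H, A_ij⟩`.
  have k1 := h.fderiv_indMetric hz ξ₀ ξ₁ ξ₁
  have k2 := h.fderiv_indMetric hz ξ₀ ξ₁ ξ₂
  have k3 := h.fderiv_indMetric hz ξ₀ ξ₂ ξ₂
  rw [h.covX_comm hz ξ₀ ξ₁] at k1 k2
  rw [h.covX_comm hz ξ₀ ξ₂] at k2 k3
  rw [hsym (partialD φ ξ₁ z), g11] at k1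
  rw [hsym (partialD φ ξ₁ z), g12, g21] at k2
  rw [hsym (partialD φ ξ₂ z), g22] at k3
  have n1 : G (φ z) (partialD φ ξ₀ z) (partialD φ ξ₁ z) = 0 := h.normal₁ z hz
  have n2 : G (φ z) (partialD φ ξ₀ z) (partialD φ ξ₂ z) = 0 := h.normal₂ z hz
  have e' := congrArg (fun v => G (φ z) (partialD φ ξ₀ z) v) e
  have hv' := congrArg (fun v => G (φ z) (partialD φ ξ₀ z) v) hv
  simp only [map_add, map_sub, map_smul, smul_eq_mul, n1, n2, k1, k2, k3] at e' hv'
  simp only [map_add, add_apply, hsym _ (partialD φ ξ₀ z)] at hO ⊢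
  set a := G (φ z) (partialD φ ξ₀ z) (covX Γ φ ξ₁ ξ₁ z)
  set b := G (φ z) (partialD φ ξ₀ z) (covX Γ φ ξ₂ ξ₂ z)
  rw [hv'] at e'
  linear_combination hO + 2 * e'

end IsLocalFlow
end LocalFlowEvolution

/-! ### Linear algebra of a tangent plane in the sum of two oriented planes. -/

section FourSpace

/-- Euclidean four-space, the sum of two oriented planes. -/
abbrev FourSpace : Type := EuclideanSpace ℝ (Fin 4)

namespace FourSpace

/-- The inner product. -/
def ip (x y : FourSpace) : ℝ := x 0 * y 0 + x 1 * y 1 + x 2 * y 2 + x 3 * y 3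
/-- The area form of the first plane. -/
def a₁ (x y : FourSpace) : ℝ := x 0 * y 1 - x 1 * y 0
/-- The area form of the second plane. -/
def a₂ (x y : FourSpace) : ℝ := x 2 * y 3 - x 3 * y 2
/-- The complex structure of the sum of the two planes. -/
def rot (x : FourSpace) : FourSpace := !₂[-x 1, x 0, -x 3, x 2]
/-- The complex structure with the second plane reversed. -/
def rot' (x : FourSpace) : FourSpace := !₂[-x 1, x 0, x 3, -x 2]

lemma inner_eq (x y : FourSpace) : inner ℝ x y = ip x y := by
  simp [ip, PiLp.inner_apply, Fin.sum_univ_four]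
  ring

lemma ip_self_nonneg (x : FourSpace) : 0 ≤ ip x x := by
  simp only [ip]
  nlinarith [mul_self_nonneg (x 0), mul_self_nonneg (x 1), mul_self_nonneg (x 2),
    mul_self_nonneg (x 3)]

lemma ip_comm (x y : FourSpace) : ip x y = ip y x := by simp [ip]; ring

lemma ip_rot (x y : FourSpace) : ip (rot x) y = a₁ x y + a₂ x y := by
  simp [ip, rot, a₁, a₂]; ring

lemma ip_rot' (x y : FourSpace) : ip (rot' x) y = a₁ x y - a₂ x y := by
  simp [ip, rot', a₁, a₂]; ring

/-- An orthonormal system of four vectors is complete. -/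
lemma parseval {e₁ e₂ e₃ e₄ : FourSpace} (h11 : ip e₁ e₁ = 1) (h22 : ip e₂ e₂ = 1)
    (h33 : ip e₃ e₃ = 1) (h44 : ip e₄ e₄ = 1) (h12 : ip e₁ e₂ = 0) (h13 : ip e₁ e₃ = 0)
    (h14 : ip e₁ e₄ = 0) (h23 : ip e₂ e₃ = 0) (h24 : ip e₂ e₄ = 0) (h34 : ip e₃ e₄ = 0)
    (x y : FourSpace) :
    ip x y = ip x e₁ * ip y e₁ + ip x e₂ * ip y e₂ + ip x e₃ * ip y e₃ + ip x e₄ * ip y e₄ := by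
  have hv : Orthonormal ℝ ((Set.univ : Set (Fin 4)).domRestrict ![e₁, e₂, e₃, e₄]) := by
    rw [orthonormal_iff_ite]
    rintro ⟨i, -⟩ ⟨j, -⟩
    have := ip_comm
    simp only [Set.domRestrict_apply, inner_eq, Subtype.mk.injEq]
    fin_cases i <;> fin_cases j <;>
      simp [h11, h22, h33, h44, h12, h13, h14, h23, h24, h34, this e₂ e₁, this e₃ e₁, this e₃ e₂,
        this e₄ e₁, this e₄ e₂, this e₄ e₃]
  obtain ⟨b, hb⟩ := hv.exists_orthonormalBasis_extension_of_card_eq (by simp)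
  have := b.sum_inner_mul_inner x y
  simp only [inner_eq, Fin.sum_univ_four, hb _ (Set.mem_univ _)] at this
  rw [← this, ip_comm y e₁, ip_comm y e₂, ip_comm y e₃, ip_comm y e₄]
  simp

/-- An orthonormal pair can be completed to an orthonormal basis. -/
lemma exists_completion {e₁ e₂ : FourSpace} (h11 : ip e₁ e₁ = 1) (h22 : ip e₂ e₂ = 1)
    (h12 : ip e₁ e₂ = 0) : ∃ e₃ e₄ : FourSpace, ip e₃ e₃ = 1 ∧ ip e₄ e₄ = 1 ∧
      ip e₁ e₃ = 0 ∧ ip e₁ e₄ = 0 ∧ ip e₂ e₃ = 0 ∧ ip e₂ e₄ = 0 ∧ ip e₃ e₄ = 0 := by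
  have hv : Orthonormal ℝ (({0, 1} : Set (Fin 4)).domRestrict ![e₁, e₂, 0, 0]) := by
    rw [orthonormal_iff_ite]
    rintro ⟨i, hi⟩ ⟨j, hj⟩
    simp only [Set.mem_insert_iff, Set.mem_singleton_iff] at hi hj
    simp only [Set.domRestrict_apply, inner_eq, Subtype.mk.injEq]
    rcases hi with rfl | rfl <;> rcases hj with rfl | rfl <;>
      simp [h11, h22, h12, ip_comm e₂ e₁]
  obtain ⟨b, hb⟩ := hv.exists_orthonormalBasis_extension_of_card_eq (by simp)
  have h0 : b 0 = e₁ := hb 0 (by simp)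
  have h1 : b 1 = e₂ := hb 1 (by simp)
  have ho := orthonormal_iff_ite.1 b.orthonormal
  simp only [inner_eq] at ho
  refine ⟨b 2, b 3, ?_, ?_, ?_, ?_, ?_, ?_, ?_⟩
  · simpa using ho 2 2
  · simpa using ho 3 3
  · simpa [h0] using ho 0 2
  · simpa [h0] using ho 0 3
  · simpa [h1] using ho 1 2
  · simpa [h1] using ho 1 3
  · simpa using ho 2 3

/-- The 2-form `⟨rot ·, ·⟩` restricted to the plane of `e₃, e₄` is a multiple of its area form, and
the factor is its value on the basis. -/
lemma rot_normal {e₁ e₂ e₃ e₄ : FourSpace} (h11 : ip e₁ e₁ = 1) (h22 : ip e₂ e₂ = 1)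
    (h33 : ip e₃ e₃ = 1) (h44 : ip e₄ e₄ = 1) (h12 : ip e₁ e₂ = 0) (h13 : ip e₁ e₃ = 0)
    (h14 : ip e₁ e₄ = 0) (h23 : ip e₂ e₃ = 0) (h24 : ip e₂ e₄ = 0) (h34 : ip e₃ e₄ = 0)
    {x y : FourSpace} (hx1 : ip x e₁ = 0) (hx2 : ip x e₂ = 0) (hy1 : ip y e₁ = 0)
    (hy2 : ip y e₂ = 0) :
    ip (rot x) y = ip (rot e₃) e₄ * (ip x e₃ * ip y e₄ - ip x e₄ * ip y e₃) := by
  have P := parseval h11 h22 h33 h44 h12 h13 h14 h23 h24 h34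
  have sk : ∀ u v, ip (rot u) v = -ip u (rot v) := by
    intro u v; simp [ip, rot]; ring
  have z3 : ip e₃ (rot e₃) = 0 := by simp [ip, rot]; ring
  have z4 : ip e₄ (rot e₄) = 0 := by simp [ip, rot]; ring
  have q : ip e₃ (rot e₄) = -ip (rot e₃) e₄ := by rw [sk]; ring
  have q' : ip e₄ (rot e₃) = ip (rot e₃) e₄ := ip_comm _ _
  rw [P (rot x) y, hy1, hy2, sk x e₃, sk x e₄, P x (rot e₃), P x (rot e₄), hx1, hx2,
    ip_comm (rot e₃) e₃, ip_comm (rot e₄) e₃, ip_comm (rot e₄) e₄, z3, z4, q]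
  ring

/-- In an orthonormal basis `rot` has a skew orthogonal matrix, and the unit length of its rows
forces the entries `12` and `34` to agree in absolute value. Hence the form is as large on the
normal plane as on the tangent plane. -/
lemma rot_sq_le {e₁ e₂ : FourSpace} (h11 : ip e₁ e₁ = 1) (h22 : ip e₂ e₂ = 1)
    (h12 : ip e₁ e₂ = 0) {x y : FourSpace} (hx1 : ip x e₁ = 0) (hx2 : ip x e₂ = 0)
    (hy1 : ip y e₁ = 0) (hy2 : ip y e₂ = 0) :
    ip (rot e₁) e₂ ^ 2 ≤ 1 ∧ ip (rot x) y ^ 2 ≤ ip (rot e₁) e₂ ^ 2 * (ip x x * ip y y) := by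
  obtain ⟨e₃, e₄, h33, h44, h13, h14, h23, h24, h34⟩ := exists_completion h11 h22 h12
  have P := parseval h11 h22 h33 h44 h12 h13 h14 h23 h24 h34
  have sk : ∀ u v, ip (rot u) v = -ip u (rot v) := by
    intro u v; simp [ip, rot]; ring
  have ze : ∀ u, ip (rot u) u = 0 := by intro u; simp [ip, rot]; ring
  have iso : ∀ u, ip (rot u) (rot u) = ip u u := by intro u; simp [ip, rot]; ring
  have anti : ∀ u v, ip (rot u) v = -ip (rot v) u := by intro u v; simp [ip, rot]; ring
  have r1 := P (rot e₁) (rot e₁)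
  have r2 := P (rot e₂) (rot e₂)
  have r3 := P (rot e₃) (rot e₃)
  have r4 := P (rot e₄) (rot e₄)
  rw [iso, h11, ze] at r1
  rw [iso, h22, ze, anti e₂ e₁] at r2
  rw [iso, h33, ze, anti e₃ e₁, anti e₃ e₂] at r3
  rw [iso, h44, ze, anti e₄ e₁, anti e₄ e₂, anti e₄ e₃] at r4
  -- The sum of the first two row norms minus the sum of the last two: all mixed entries cancel.
  have hq : ip (rot e₃) e₄ ^ 2 = ip (rot e₁) e₂ ^ 2 := by linarith
  refine ⟨by nlinarith [sq_nonneg (ip (rot e₁) e₃), sq_nonneg (ip (rot e₁) e₄)], ?_⟩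
  rw [rot_normal h11 h22 h33 h44 h12 h13 h14 h23 h24 h34 hx1 hx2 hy1 hy2, P x x, P y y, hx1, hx2,
    hy1, hy2, mul_pow, hq]
  apply mul_le_mul_of_nonneg_left _ (sq_nonneg _)
  nlinarith [sq_nonneg (ip x e₃ * ip y e₃ + ip x e₄ * ip y e₄)]

/-- The first plane's components of an orthonormal pair. -/
lemma trace_projection {e₁ e₂ : FourSpace} (h11 : ip e₁ e₁ = 1) (h22 : ip e₂ e₂ = 1)
    (h12 : ip e₁ e₂ = 0) :
    e₁ 0 ^ 2 + e₁ 1 ^ 2 + (e₂ 0 ^ 2 + e₂ 1 ^ 2) = 1 + a₁ e₁ e₂ ^ 2 - a₂ e₁ e₂ ^ 2 := by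
  simp only [ip, a₁, a₂] at *
  have k11 : e₁ 2 ^ 2 + e₁ 3 ^ 2 = 1 - (e₁ 0 ^ 2 + e₁ 1 ^ 2) := by linarith
  have k22 : e₂ 2 ^ 2 + e₂ 3 ^ 2 = 1 - (e₂ 0 ^ 2 + e₂ 1 ^ 2) := by linarith
  have k12 : e₁ 2 * e₂ 2 + e₁ 3 * e₂ 3 = -(e₁ 0 * e₂ 0 + e₁ 1 * e₂ 1) := by linarith
  have m1 : (e₁ 2 * e₂ 3 - e₁ 3 * e₂ 2) ^ 2 = (e₁ 2 ^ 2 + e₁ 3 ^ 2) * (e₂ 2 ^ 2 + e₂ 3 ^ 2)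
    - (e₁ 2 * e₂ 2 + e₁ 3 * e₂ 3) ^ 2 := by ring
  rw [m1, k11, k22, k12]
  ring

/-- The curvature of each factor sees only its own area form, so everything reduces to `a₁ e₁ e₂`,
`a₂ e₁ e₂` and the trace of the projection to the first plane. The trace is eliminated by
`trace_projection`. -/
lemma curvature_term {e₁ e₂ v v' : FourSpace} (h11 : ip e₁ e₁ = 1) (h22 : ip e₂ e₂ = 1)
    (h12 : ip e₁ e₂ = 0) {c : ℝ}
    (hv : ∀ w, ip v w = c * (a₁ e₁ e₂ * a₁ e₂ w + a₂ e₁ e₂ * a₂ e₂ w))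
    (hv' : ∀ w, ip v' w = c * (a₁ e₂ e₁ * a₁ e₁ w + a₂ e₂ e₁ * a₂ e₁ w)) :
    -(ip (rot v) e₂ + ip (rot e₁) v') + ip (rot e₁) e₂ * (ip v e₁ + ip v' e₂)
      = c * (1 - ip (rot e₁) e₂ ^ 2) * ip (rot e₁) e₂ := by
  have t := trace_projection h11 h22 h12
  have sk : ∀ u v, ip (rot u) v = -ip u (rot v) := by
    intro u v; simp [ip, rot]; ring
  rw [sk v e₂, ip_comm (rot e₁) v', hv, hv', hv, hv', ip_rot]
  have s1 : a₁ e₂ e₁ = -a₁ e₁ e₂ := by simp [a₁]; ring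
  have s2 : a₂ e₂ e₁ = -a₂ e₁ e₂ := by simp [a₂]; ring
  have u1 : a₁ e₂ (rot e₂) = e₂ 0 ^ 2 + e₂ 1 ^ 2 := by simp [a₁, rot]; ring
  have u2 : a₂ e₂ (rot e₂) = 1 - (e₂ 0 ^ 2 + e₂ 1 ^ 2) := by
    rw [← h22]; simp [a₂, rot, ip]; ring
  have w1 : a₁ e₁ (rot e₁) = e₁ 0 ^ 2 + e₁ 1 ^ 2 := by simp [a₁, rot]; ring
  have w2 : a₂ e₁ (rot e₁) = 1 - (e₁ 0 ^ 2 + e₁ 1 ^ 2) := by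
    rw [← h11]; simp [a₂, rot, ip]; ring
  rw [s1, s2, u1, u2, w1, w2]
  linear_combination c * (a₁ e₁ e₂ - a₂ e₁ e₂) * t

/-- The quadratic normal term is bounded by a multiple of the angle itself, by `rot_sq_le` and the
inequality of arithmetic and geometric means. So the whole reaction term is divisible by the angle,
even where the angle vanishes. -/
lemma abs_two_forms_le {e₁ e₂ x y z : FourSpace} (h11 : ip e₁ e₁ = 1) (h22 : ip e₂ e₂ = 1)
    (h12 : ip e₁ e₂ = 0) (hx1 : ip x e₁ = 0) (hx2 : ip x e₂ = 0) (hy1 : ip y e₁ = 0)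
    (hy2 : ip y e₂ = 0) (hz1 : ip z e₁ = 0) (hz2 : ip z e₂ = 0) :
    |2 * (ip (rot x) y + ip (rot y) z)| ≤ |ip (rot e₁) e₂| * (ip x x + 2 * ip y y + ip z z) := by
  have nn := ip_self_nonneg
  have key : ∀ u v, ip u e₁ = 0 → ip u e₂ = 0 → ip v e₁ = 0 → ip v e₂ = 0 →
      |2 * ip (rot u) v| ≤ |ip (rot e₁) e₂| * (ip u u + ip v v) := by
    intro u v hu1 hu2 hv1 hv2
    have := (rot_sq_le h11 h22 h12 hu1 hu2 hv1 hv2).2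
    apply abs_le_of_sq_le_sq _ (mul_nonneg (abs_nonneg _) (add_nonneg (nn u) (nn v)))
    rw [mul_pow, mul_pow, sq_abs]
    have h4 : 4 * (ip u u * ip v v) ≤ (ip u u + ip v v) ^ 2 := by
      nlinarith [sq_nonneg (ip u u - ip v v)]
    nlinarith [sq_nonneg (ip (rot e₁) e₂)]
  have k1 := key x y hx1 hx2 hy1 hy2
  have k2 := key y z hy1 hy2 hz1 hz2
  have := abs_add_le (2 * ip (rot x) y) (2 * ip (rot y) z)
  rw [mul_add]
  linarith

/-- The reaction term in the evolution of the Kähler angle. -/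
lemma exists_angle_coefficient {e₁ e₂ x y z v v' : FourSpace} (h11 : ip e₁ e₁ = 1)
    (h22 : ip e₂ e₂ = 1)
    (h12 : ip e₁ e₂ = 0) (hx1 : ip x e₁ = 0) (hx2 : ip x e₂ = 0) (hy1 : ip y e₁ = 0)
    (hy2 : ip y e₂ = 0) (hz1 : ip z e₁ = 0) (hz2 : ip z e₂ = 0) {c : ℝ}
    (hv : ∀ w, ip v w = c * (a₁ e₁ e₂ * a₁ e₂ w + a₂ e₁ e₂ * a₂ e₂ w))
    (hv' : ∀ w, ip v' w = c * (a₁ e₂ e₁ * a₁ e₁ w + a₂ e₂ e₁ * a₂ e₁ w)) :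
    ∃ B : ℝ, -|c| ≤ B ∧ B ≤ 2 * (ip x x + 2 * ip y y + ip z z) + |c| ∧
      -(ip (rot v) e₂ + ip (rot e₁) v') + ip (rot e₁) e₂ * (ip v e₁ + ip v' e₂
        + ip x x + 2 * ip y y + ip z z) - 2 * (ip (rot x) y + ip (rot y) z)
      = B * ip (rot e₁) e₂ := by
  have ht := curvature_term h11 h22 h12 hv hv'
  have hb := abs_two_forms_le h11 h22 h12 hx1 hx2 hy1 hy2 hz1 hz2
  have hs := (rot_sq_le h11 h22 h12 hx1 hx2 hy1 hy2).1
  set q := ip (rot e₁) e₂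
  set A := ip x x + 2 * ip y y + ip z z
  set N := 2 * (ip (rot x) y + ip (rot y) z)
  have hc : |c * (1 - q ^ 2)| ≤ |c| := by
    rw [abs_mul]
    have : |1 - q ^ 2| ≤ 1 := by rw [abs_le]; constructor <;> nlinarith [sq_nonneg q]
    nlinarith [abs_nonneg c]
  have hc' := abs_le.1 hc
  -- The natural coefficient contains `N / q`. For `q = 0` the bound `hb` forces `N = 0`, and this
  -- term is left out.
  by_cases hq : q = 0
  · have hN : N = 0 := by
      rw [hq] at hb
      simpa using hb
    refine ⟨A + c * (1 - q ^ 2), ?_, ?_, ?_⟩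
    · have : 0 ≤ A := by
        have := ip_self_nonneg
        simp only [A]
        linarith [this x, this y, this z]
      linarith
    · have : 0 ≤ A := by
        have := ip_self_nonneg
        simp only [A]
        linarith [this x, this y, this z]
      linarith
    · linear_combination ht - hN
  · refine ⟨A - N / q + c * (1 - q ^ 2), ?_, ?_, ?_⟩
    · have : |N / q| ≤ A := by
        rw [abs_div, div_le_iff₀ (abs_pos.2 hq)]
        linarith
      have := abs_le.1 this
      linarith
    · have : |N / q| ≤ A := by
        rw [abs_div, div_le_iff₀ (abs_pos.2 hq)]
        linarith
      have := abs_le.1 this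
      linarith
    · have : N / q * q = N := div_mul_cancel₀ _ hq
      linear_combination ht + this

/-- The orthonormal basis `e₁, e₂, J'e₁, J'e₂` adapted to a Lagrangian plane. -/
lemma lagrangian_parseval {e₁ e₂ : FourSpace} (h11 : ip e₁ e₁ = 1) (h22 : ip e₂ e₂ = 1)
    (h12 : ip e₁ e₂ = 0) (hL : ip (rot' e₁) e₂ = 0) {x y : FourSpace}
    (hx1 : ip x e₁ = 0) (hx2 : ip x e₂ = 0) (hy1 : ip y e₁ = 0) (hy2 : ip y e₂ = 0) :
    ip x y = ip x (rot' e₁) * ip y (rot' e₁) + ip x (rot' e₂) * ip y (rot' e₂) ∧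
    ip (rot x) y = ip (rot e₁) e₂ *
      (ip x (rot' e₁) * ip y (rot' e₂) - ip x (rot' e₂) * ip y (rot' e₁)) ∧
    (∀ w, ip x w = ip x (rot' e₁) * ip (rot' e₁) w + ip x (rot' e₂) * ip (rot' e₂) w) := by
  have iso : ∀ u v, ip (rot' u) (rot' v) = ip u v := by intro u v; simp [ip, rot']; ring
  have ze : ∀ u, ip u (rot' u) = 0 := by intro u; simp [ip, rot']; ring
  have h14 : ip e₁ (rot' e₂) = 0 := by
    rw [← neg_eq_zero, ← hL]; simp [ip, rot']; ring
  have h23 : ip e₂ (rot' e₁) = 0 := by rw [ip_comm, hL]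
  have h33 : ip (rot' e₁) (rot' e₁) = 1 := by rw [iso, h11]
  have h44 : ip (rot' e₂) (rot' e₂) = 1 := by rw [iso, h22]
  have h34 : ip (rot' e₁) (rot' e₂) = 0 := by rw [iso, h12]
  have P := parseval h11 h22 h33 h44 h12 (ze e₁) h14 h23 (ze e₂) h34
  -- The two complex structures commute, and `rot'` is an isometry.
  have hr : ip (rot (rot' e₁)) (rot' e₂) = ip (rot e₁) e₂ := by simp [ip, rot, rot']; ring
  refine ⟨?_, ?_, ?_⟩
  · rw [P x y, hx1, hx2]; ring
  · rw [rot_normal h11 h22 h33 h44 h12 (ze e₁) h14 h23 (ze e₂) h34 hx1 hx2 hy1 hy2, hr]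
  · intro w
    rw [P x w, hx1, hx2, ip_comm w (rot' e₁), ip_comm w (rot' e₂)]; ring

/-- `x, y, z` stand for `A_11, A_12, A_22`. The hypotheses `hxy` and `hyz` are the differentiated
Lagrangian condition and say that the cubic form `⟨A_ij, J'e_k⟩` is totally symmetric. In the basis
`J'e₁, J'e₂` both sides become the same polynomial in its four components. -/
lemma lagrangian_second_form {e₁ e₂ x y z : FourSpace} (h11 : ip e₁ e₁ = 1) (h22 : ip e₂ e₂ = 1)
    (h12 : ip e₁ e₂ = 0) (hL : ip (rot' e₁) e₂ = 0)
    (hx1 : ip x e₁ = 0) (hx2 : ip x e₂ = 0) (hy1 : ip y e₁ = 0)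
    (hy2 : ip y e₂ = 0) (hz1 : ip z e₁ = 0) (hz2 : ip z e₂ = 0)
    (hxy : ip (rot' x) e₂ + ip (rot' e₁) y = 0) (hyz : ip (rot' y) e₂ + ip (rot' e₁) z = 0) :
    2 * (ip (rot x) y + ip (rot y) z) = ip (rot e₁) e₂ *
      (ip (x + z) (x + z) - (ip x x + 2 * ip y y + ip z z)) := by
  obtain ⟨nxz, -, -⟩ := lagrangian_parseval h11 h22 h12 hL hx1 hx2 hz1 hz2
  obtain ⟨nxx, -, -⟩ := lagrangian_parseval h11 h22 h12 hL hx1 hx2 hx1 hx2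
  obtain ⟨-, rxy, -⟩ := lagrangian_parseval h11 h22 h12 hL hx1 hx2 hy1 hy2
  obtain ⟨nyy, -, -⟩ := lagrangian_parseval h11 h22 h12 hL hy1 hy2 hy1 hy2
  obtain ⟨-, ryz, -⟩ := lagrangian_parseval h11 h22 h12 hL hy1 hy2 hz1 hz2
  obtain ⟨nzz, -, -⟩ := lagrangian_parseval h11 h22 h12 hL hz1 hz2 hz1 hz2
  have sk : ∀ u v, ip (rot' u) v = -ip u (rot' v) := by
    intro u v; simp [ip, rot']; ring
  have s1 : ip x (rot' e₂) = ip y (rot' e₁) := by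
    rw [sk, ip_comm (rot' e₁)] at hxy; linarith
  have s2 : ip y (rot' e₂) = ip z (rot' e₁) := by
    rw [sk, ip_comm (rot' e₁)] at hyz; linarith
  have ex : ip (x + z) (x + z) = ip x x + 2 * ip x z + ip z z := by simp [ip]; ring
  rw [ex, rxy, ryz, nxx, nyy, nzz, nxz, s1, s2]
  ring

/-- This evaluates the ambient curvature term in the evolution of `|H|²`, with `x = H`. The vector
`x` is expanded in `J'e₁, J'e₂`, and the forms become Gram entries `A, C, D` of the first-plane
components of `e₁, e₂`. The Lagrangian condition makes the projection have trace one, so `D = 1 -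
A`. -/
lemma lagrangian_ricci {e₁ e₂ x : FourSpace} (h11 : ip e₁ e₁ = 1) (h22 : ip e₂ e₂ = 1)
    (h12 : ip e₁ e₂ = 0) (hL : ip (rot' e₁) e₂ = 0)
    (hx1 : ip x e₁ = 0) (hx2 : ip x e₂ = 0) :
    2 * (a₁ x e₁ ^ 2 + a₂ x e₁ ^ 2 + (a₁ x e₂ ^ 2 + a₂ x e₂ ^ 2))
      = (2 - ip (rot e₁) e₂ ^ 2) * ip x x := by
  obtain ⟨nxx, -, ex⟩ := lagrangian_parseval h11 h22 h12 hL hx1 hx2 hx1 hx2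
  have t := trace_projection h11 h22 h12
  have hpr : a₁ e₁ e₂ = a₂ e₁ e₂ := by rw [ip_rot'] at hL; linarith
  set h₁ := ip x (rot' e₁)
  set h₂ := ip x (rot' e₂)
  set A := e₁ 0 ^ 2 + e₁ 1 ^ 2 with hA
  set D := e₂ 0 ^ 2 + e₂ 1 ^ 2 with hD
  set C := e₁ 0 * e₂ 0 + e₁ 1 * e₂ 1 with hC
  have k1 : ∀ w, a₁ x w = -ip x !₂[-w 1, w 0, 0, 0] := by
    intro w; simp [a₁, ip]; ring
  have k2 : ∀ w, a₂ x w = -ip x !₂[0, 0, -w 3, w 2] := by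
    intro w; simp [a₂, ip]; ring
  have b1 : a₁ x e₁ = -(h₁ * A + h₂ * C) := by
    rw [k1, ex]; simp [ip, rot', hA, hC]; ring
  have b2 : a₁ x e₂ = -(h₁ * C + h₂ * D) := by
    rw [k1, ex]; simp [ip, rot', hD, hC]; ring
  have b3 : a₂ x e₁ = h₁ * (1 - A) - h₂ * C := by
    have q1 : 1 - A = e₁ 2 ^ 2 + e₁ 3 ^ 2 := by simp only [ip] at h11; rw [hA]; linarith
    have q2 : -C = e₁ 2 * e₂ 2 + e₁ 3 * e₂ 3 := by simp only [ip] at h12; rw [hC]; linarith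
    rw [k2, ex, q1, sub_eq_add_neg, ← mul_neg, q2]; simp [ip, rot']; ring
  have b4 : a₂ x e₂ = -h₁ * C + h₂ * (1 - D) := by
    have q1 : 1 - D = e₂ 2 ^ 2 + e₂ 3 ^ 2 := by simp only [ip] at h22; rw [hD]; linarith
    have q2 : -C = e₁ 2 * e₂ 2 + e₁ 3 * e₂ 3 := by simp only [ip] at h12; rw [hC]; linarith
    rw [k2, ex, q1, neg_mul, ← mul_neg, q2]; simp [ip, rot']; ring
  have det : a₁ e₁ e₂ ^ 2 = A * D - C ^ 2 := by simp only [a₁, hA, hC, hD]; ring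
  have hT : D = 1 - A := by rw [hpr] at t; linarith
  have hq : ip (rot e₁) e₂ ^ 2 = 4 * (A * D - C ^ 2) := by
    rw [ip_rot, ← hpr, ← det]; ring
  rw [hq, nxx, b1, b2, b3, b4, hT]
  ring

end FourSpace
end FourSpace

/-! ### The reaction terms at a point, and the inequality for the quotient. -/

section Reaction

variable {E Z : Type*} [NormedAddCommGroup E] [NormedSpace ℝ E]
  [NormedAddCommGroup Z] [NormedSpace ℝ Z]

/-- `L` is an isometry to Euclidean four-space which takes `W₁` and `W₂` to the two area forms, and
`R` is the curvature operator of a product of two surfaces with Gauss curvature `c`. -/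
structure IsProductPoint (G W₁ W₂ : E →L[ℝ] E →L[ℝ] ℝ) (R : E → E → E → E) (c : ℝ)
    (L : E ≃ₗ[ℝ] FourSpace) : Prop where
  metric : ∀ u v, G u v = FourSpace.ip (L u) (L v)
  form₁ : ∀ u v, W₁ u v = FourSpace.a₁ (L u) (L v)
  form₂ : ∀ u v, W₂ u v = FourSpace.a₂ (L u) (L v)
  curv : ∀ u v w x, G (R u v w) x = c * (W₁ u v * W₁ w x + W₂ u v * W₂ w x)

variable {G : E → E →L[ℝ] E →L[ℝ] ℝ} {Γ : E → E →L[ℝ] E →L[ℝ] E} {V : Set E}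
    {φ : Z → E} {O : Set Z} {ξ₀ ξ₁ ξ₂ : Z} {z : Z} {W₁ W₂ : E → E →L[ℝ] E →L[ℝ] ℝ} {c : ℝ}
    {L : E ≃ₗ[ℝ] FourSpace}

lemma IsProductPoint.curv_ip {G W₁ W₂ : E →L[ℝ] E →L[ℝ] ℝ} {R : E → E → E → E}
    (h : IsProductPoint G W₁ W₂ R c L) (u v w : E) (x : FourSpace) :
    FourSpace.ip (L (R u v w)) x = c * (FourSpace.a₁ (L u) (L v) * FourSpace.a₁ (L w) x
      + FourSpace.a₂ (L u) (L v) * FourSpace.a₂ (L w) x) := by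
  obtain ⟨x, rfl⟩ := L.surjective x
  rw [← h.metric, h.curv, h.form₁, h.form₁, h.form₂, h.form₂]

namespace IsLocalFlow

/-- The squared norm of the second fundamental form, at the centre of normal coordinates. -/
def sqNormA (G : E → E →L[ℝ] E →L[ℝ] ℝ) (Γ : E → E →L[ℝ] E →L[ℝ] E) (φ : Z → E) (ξ₁ ξ₂ z : Z) :
    ℝ :=
  G (φ z) (covX Γ φ ξ₁ ξ₁ z) (covX Γ φ ξ₁ ξ₁ z)
    + 2 * G (φ z) (covX Γ φ ξ₁ ξ₂ z) (covX Γ φ ξ₁ ξ₂ z)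
    + G (φ z) (covX Γ φ ξ₂ ξ₂ z) (covX Γ φ ξ₂ ξ₂ z)

/-- The Kähler angle of the surfaces. -/
def angle (G W₁ W₂ : E → E →L[ℝ] E →L[ℝ] ℝ) (φ : Z → E) (ξ₁ ξ₂ z : Z) : ℝ :=
  (W₁ + W₂) (φ z) (partialD φ ξ₁ z) (partialD φ ξ₂ z) / √(indDet G φ ξ₁ ξ₂ z)

lemma angle_eq (hn : IsNormalAt G Γ φ ξ₁ ξ₂ z) :
    angle G W₁ W₂ φ ξ₁ ξ₂ z = W₁ (φ z) (partialD φ ξ₁ z) (partialD φ ξ₂ z)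
      + W₂ (φ z) (partialD φ ξ₁ z) (partialD φ ξ₂ z) := by
  simp [angle, indDet, hn.g11, hn.g22, hn.g12]

variable (h : IsLocalFlow G Γ V φ O ξ₀ ξ₁ ξ₂) (hz : z ∈ O)
    (hn : IsNormalAt G Γ φ ξ₁ ξ₂ z) (hm : ∀ z ∈ O, 0 < indDet G φ ξ₁ ξ₂ z)
    (hW₁ : ContDiffOn ℝ ∞ W₁ V) (hW₂ : ContDiffOn ℝ ∞ W₂ V)
    (hp₁ : ∀ y ∈ V, IsParallelAt Γ W₁ y) (hp₂ : ∀ y ∈ V, IsParallelAt Γ W₂ y)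
    (hL : IsProductPoint (G (φ z)) (W₁ (φ z)) (W₂ (φ z)) (curvOp Γ (φ z)) c L)

include h hW₁ hW₂ hp₁ hp₂ in
lemma parallel_add (y : E) (hy : y ∈ V) : IsParallelAt Γ (W₁ + W₂) y := by
  intro u v w
  have d1 := differentiableAt_of_contDiffOn h.lc.isOpen hW₁ hy
  have d2 := differentiableAt_of_contDiffOn h.lc.isOpen hW₂ hy
  rw [fderiv_add d1 d2]
  simp only [add_apply, Pi.add_apply, hp₁ y hy u v w, hp₂ y hy u v w]
  ring

include h hz hn hm hW₁ hW₂ hp₁ hp₂ hL in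
-- No Lagrangian condition is assumed here. This form of the equation is what the maximum principle
-- needs, both to preserve the Lagrangian condition and to preserve positivity.
lemma exists_heatOp_angle :
    ∃ B : ℝ, -|c| ≤ B ∧ B ≤ 2 * sqNormA G Γ φ ξ₁ ξ₂ z + |c| ∧
      heatOp ξ₀ ξ₁ ξ₂ (angle G W₁ W₂ φ ξ₁ ξ₂) z = B * angle G W₁ W₂ φ ξ₁ ξ₂ z := by
  have halt : ∀ v, (W₁ + W₂) (φ z) v v = 0 := by
    intro v
    simp only [Pi.add_apply, add_apply, hL.form₁, hL.form₂, FourSpace.a₁, FourSpace.a₂]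
    ring
  have e := h.heatOp_angle (B := W₁ + W₂) hz hn hm (hW₁.add hW₂)
    (parallel_add h hW₁ hW₂ hp₁ hp₂) halt
  have hip : ∀ u v, (W₁ + W₂) (φ z) u v = FourSpace.ip (FourSpace.rot (L u)) (L v) := by
    intro u v
    simp only [Pi.add_apply, add_apply, hL.form₁, hL.form₂, FourSpace.ip_rot]
  have g11 : G (φ z) (partialD φ ξ₁ z) (partialD φ ξ₁ z) = 1 := hn.g11
  have g22 : G (φ z) (partialD φ ξ₂ z) (partialD φ ξ₂ z) = 1 := hn.g22
  have g12 : G (φ z) (partialD φ ξ₁ z) (partialD φ ξ₂ z) = 0 := hn.g12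
  have n111 := hn.n111
  have n112 := hn.n112
  have n121 := hn.n121
  have n122 := hn.n122
  have n221 := hn.n221
  have n222 := hn.n222
  rw [hL.metric] at g11 g22 g12 n111 n112 n121 n122 n221 n222
  obtain ⟨B, hB1, hB2, hB⟩ := FourSpace.exists_angle_coefficient g11 g22 g12 n111 n112 n121 n122
    n221 n222 (hL.curv_ip (partialD φ ξ₁ z) (partialD φ ξ₂ z) (partialD φ ξ₂ z))
    (hL.curv_ip (partialD φ ξ₂ z) (partialD φ ξ₁ z) (partialD φ ξ₁ z))
  refine ⟨B, hB1, ?_, ?_⟩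
  · simpa only [sqNormA, hL.metric] using hB2
  · change heatOp ξ₀ ξ₁ ξ₂ (fun x => (W₁ + W₂) (φ x) (partialD φ ξ₁ x) (partialD φ ξ₂ x)
        / √(indDet G φ ξ₁ ξ₂ x)) z = _
    rw [e, angle_eq hn, hL.form₁, hL.form₂, ← FourSpace.ip_rot, ← hB]
    simp only [hip, hL.metric]

/-- On a Lagrangian surface the reaction term is `2|A|² - |H|² + c (1 - η²)`. -/
lemma heatOp_angle_lagrangian (h : IsLocalFlow G Γ V φ O ξ₀ ξ₁ ξ₂) (hz : z ∈ O)
    (hn : IsNormalAt G Γ φ ξ₁ ξ₂ z) (hm : ∀ z ∈ O, 0 < indDet G φ ξ₁ ξ₂ z)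
    (hW₁ : ContDiffOn ℝ ∞ W₁ V) (hW₂ : ContDiffOn ℝ ∞ W₂ V)
    (hp₁ : ∀ y ∈ V, IsParallelAt Γ W₁ y) (hp₂ : ∀ y ∈ V, IsParallelAt Γ W₂ y)
    (hL : IsProductPoint (G (φ z)) (W₁ (φ z)) (W₂ (φ z)) (curvOp Γ (φ z)) c L)
    (hlag : ∀ x ∈ O, W₁ (φ x) (partialD φ ξ₁ x) (partialD φ ξ₂ x)
      = W₂ (φ x) (partialD φ ξ₁ x) (partialD φ ξ₂ x)) :
    heatOp ξ₀ ξ₁ ξ₂ (angle G W₁ W₂ φ ξ₁ ξ₂) z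
        = (2 * sqNormA G Γ φ ξ₁ ξ₂ z - indMetric G φ ξ₀ ξ₀ z
          + c * (1 - angle G W₁ W₂ φ ξ₁ ξ₂ z ^ 2)) * angle G W₁ W₂ φ ξ₁ ξ₂ z ∧
      heatOp ξ₀ ξ₁ ξ₂ (indMetric G φ ξ₀ ξ₀) z
        = -2 * (G (φ z) (covX Γ φ ξ₁ ξ₀ z) (covX Γ φ ξ₁ ξ₀ z)
          + G (φ z) (covX Γ φ ξ₂ ξ₀ z) (covX Γ φ ξ₂ ξ₀ z))
        + 4 * (G (φ z) (partialD φ ξ₀ z) (covX Γ φ ξ₁ ξ₁ z) ^ 2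
          + 2 * G (φ z) (partialD φ ξ₀ z) (covX Γ φ ξ₁ ξ₂ z) ^ 2
          + G (φ z) (partialD φ ξ₀ z) (covX Γ φ ξ₂ ξ₂ z) ^ 2)
        + c * (2 - angle G W₁ W₂ φ ξ₁ ξ₂ z ^ 2) * indMetric G φ ξ₀ ξ₀ z := by
  have halt : ∀ v, (W₁ + W₂) (φ z) v v = 0 := by
    intro v
    simp only [Pi.add_apply, add_apply, hL.form₁, hL.form₂, FourSpace.a₁, FourSpace.a₂]
    ring
  have e := h.heatOp_angle (B := W₁ + W₂) hz hn hm (hW₁.add hW₂)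
    (parallel_add h hW₁ hW₂ hp₁ hp₂) halt
  have e' := h.heatOp_speed hz hn
  have hip : ∀ u v, (W₁ + W₂) (φ z) u v = FourSpace.ip (FourSpace.rot (L u)) (L v) := by
    intro u v
    simp only [Pi.add_apply, add_apply, hL.form₁, hL.form₂, FourSpace.ip_rot]
  have g11 : G (φ z) (partialD φ ξ₁ z) (partialD φ ξ₁ z) = 1 := hn.g11
  have g22 : G (φ z) (partialD φ ξ₂ z) (partialD φ ξ₂ z) = 1 := hn.g22
  have g12 : G (φ z) (partialD φ ξ₁ z) (partialD φ ξ₂ z) = 0 := hn.g12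
  have n01 : G (φ z) (partialD φ ξ₀ z) (partialD φ ξ₁ z) = 0 := h.normal₁ z hz
  have n02 : G (φ z) (partialD φ ξ₀ z) (partialD φ ξ₂ z) = 0 := h.normal₂ z hz
  have n111 := hn.n111
  have n112 := hn.n112
  have n121 := hn.n121
  have n122 := hn.n122
  have n221 := hn.n221
  have n222 := hn.n222
  have hv := h.velocity_eq hz hn
  have l12 : FourSpace.ip (FourSpace.rot' (L (partialD φ ξ₁ z))) (L (partialD φ ξ₂ z)) = 0 := by
    rw [FourSpace.ip_rot', ← hL.form₁, ← hL.form₂, hlag z hz, sub_self]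
  -- The derivative of the Lagrangian condition in the direction `ξ`. It gives the symmetry of the
  -- cubic form required by `lagrangian_second_form`.
  have hl : ∀ ξ, FourSpace.ip (FourSpace.rot' (L (covX Γ φ ξ ξ₁ z))) (L (partialD φ ξ₂ z))
      + FourSpace.ip (FourSpace.rot' (L (partialD φ ξ₁ z))) (L (covX Γ φ ξ ξ₂ z)) = 0 := by
    intro ξ
    have he : (fun x => W₁ (φ x) (partialD φ ξ₁ x) (partialD φ ξ₂ x)) =ᶠ[𝓝 z]
        fun x => W₂ (φ x) (partialD φ ξ₁ x) (partialD φ ξ₂ x) := by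
      filter_upwards [h.isOpen.mem_nhds hz] with x hx using hlag x hx
    have k1 := h.fderiv_bilin hW₁ hp₁ (h.contDiffOn_X ξ₁) (h.contDiffOn_X ξ₂) hz ξ
    have k2 := h.fderiv_bilin hW₂ hp₂ (h.contDiffOn_X ξ₁) (h.contDiffOn_X ξ₂) hz ξ
    rw [he.fderiv_eq, k2] at k1
    simp only [← covX_eq, hL.form₁, hL.form₂] at k1
    rw [FourSpace.ip_rot', FourSpace.ip_rot']
    linarith
  have hl1 := hl ξ₁
  have hl2 := hl ξ₂
  rw [h.covX_comm hz ξ₂ ξ₁] at hl2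
  rw [hL.metric] at g11 g22 g12 n111 n112 n121 n122 n221 n222 n01 n02
  have hct := FourSpace.curvature_term g11 g22 g12
    (hL.curv_ip (partialD φ ξ₁ z) (partialD φ ξ₂ z) (partialD φ ξ₂ z))
    (hL.curv_ip (partialD φ ξ₂ z) (partialD φ ξ₁ z) (partialD φ ξ₁ z))
  have hsf := FourSpace.lagrangian_second_form g11 g22 g12 l12 n111 n112 n121 n122 n221 n222 hl1 hl2
  have hr := FourSpace.lagrangian_ricci g11 g22 g12 l12 n01 n02
  have hH : indMetric G φ ξ₀ ξ₀ z = FourSpace.ip (L (partialD φ ξ₀ z)) (L (partialD φ ξ₀ z)) :=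
    hL.metric _ _
  have hang : angle G W₁ W₂ φ ξ₁ ξ₂ z
      = FourSpace.ip (FourSpace.rot (L (partialD φ ξ₁ z))) (L (partialD φ ξ₂ z)) := by
    rw [angle_eq hn, hL.form₁, hL.form₂, ← FourSpace.ip_rot]
  constructor
  · change heatOp ξ₀ ξ₁ ξ₂ (fun x => (W₁ + W₂) (φ x) (partialD φ ξ₁ x) (partialD φ ξ₂ x)
        / √(indDet G φ ξ₁ ξ₂ x)) z = _
    rw [hv] at hH
    rw [e, hang, hH, sqNormA]
    simp only [hip, hL.metric, map_add] at hsf ⊢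
    linear_combination hct - hsf
  · rw [e', hang, hL.curv, hL.curv, hH]
    have sk₁ : ∀ u v, W₁ (φ z) u v = -W₁ (φ z) v u := by
      intro u v; simp only [hL.form₁, FourSpace.a₁]; ring
    have sk₂ : ∀ u v, W₂ (φ z) u v = -W₂ (φ z) v u := by
      intro u v; simp only [hL.form₂, FourSpace.a₂]; ring
    rw [sk₁ (partialD φ ξ₁ z), sk₁ (partialD φ ξ₂ z), sk₂ (partialD φ ξ₁ z),
      sk₂ (partialD φ ξ₂ z)]
    rw [← hL.form₁, ← hL.form₁, ← hL.form₂, ← hL.form₂] at hr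
    linear_combination c * hr

set_option maxHeartbeats 1000000 in
/-- The evolution inequality for `|H|² / η`. -/
lemma heatOp_quotient_le (h : IsLocalFlow G Γ V φ O ξ₀ ξ₁ ξ₂) (hz : z ∈ O)
    (hn : IsNormalAt G Γ φ ξ₁ ξ₂ z) (hm : ∀ z ∈ O, 0 < indDet G φ ξ₁ ξ₂ z)
    (hW₁ : ContDiffOn ℝ ∞ W₁ V) (hW₂ : ContDiffOn ℝ ∞ W₂ V)
    (hp₁ : ∀ y ∈ V, IsParallelAt Γ W₁ y) (hp₂ : ∀ y ∈ V, IsParallelAt Γ W₂ y)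
    (hL : IsProductPoint (G (φ z)) (W₁ (φ z)) (W₂ (φ z)) (curvOp Γ (φ z)) c L)
    (hlag : ∀ x ∈ O, W₁ (φ x) (partialD φ ξ₁ x) (partialD φ ξ₂ x)
      = W₂ (φ x) (partialD φ ξ₁ x) (partialD φ ξ₂ x))
    (hpos : ∀ x ∈ O, 0 < angle G W₁ W₂ φ ξ₁ ξ₂ x) :
    heatOp ξ₀ ξ₁ ξ₂ (fun x => indMetric G φ ξ₀ ξ₀ x / angle G W₁ W₂ φ ξ₁ ξ₂ x) z
      ≤ (c + indMetric G φ ξ₀ ξ₀ z)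
        * (indMetric G φ ξ₀ ξ₀ z / angle G W₁ W₂ φ ξ₁ ξ₂ z) := by
  obtain ⟨k1, k2⟩ := h.heatOp_angle_lagrangian hz hn hm hW₁ hW₂ hp₁ hp₂ hL hlag
  set u := indMetric G φ ξ₀ ξ₀ with hu
  set η := angle G W₁ W₂ φ ξ₁ ξ₂ with hη
  have cu : ContDiffOn ℝ ∞ u O := h.contDiffOn_indMetric ξ₀ ξ₀
  have cη : ContDiffOn ℝ ∞ η O :=
    (contDiffOn_bilin (hW₁.add hW₂) h.smooth h.mapsTo (h.contDiffOn_X ξ₁) (h.contDiffOn_X ξ₂)).div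
      ((h.contDiffOn_indDet ξ₁ ξ₂).sqrt fun x hx => (hm x hx).ne')
      fun x hx => (Real.sqrt_pos.2 (hm x hx)).ne'
  have cw : ContDiffOn ℝ ∞ (fun x => u x / η x) O := cu.div cη fun x hx => (hpos x hx).ne'
  have hwe : (fun x => u x / η x * η x) =ᶠ[𝓝 z] u := by
    filter_upwards [h.isOpen.mem_nhds hz] with x hx
    exact div_mul_cancel₀ _ (hpos x hx).ne'
  -- The product rule for `u = (u/η) η` replaces the quotient rule; the gradient term that has to be
  -- absorbed is `∇(u/η) · ∇η`.
  have hheat := heatOp_mul h.isOpen cw cη hz ξ₀ ξ₁ ξ₂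
  rw [heatOp_congr hwe] at hheat
  have hgrad : ∀ ξ, fderiv ℝ u z ξ = fderiv ℝ (fun x => u x / η x) z ξ * η z
      + u z / η z * fderiv ℝ η z ξ := by
    intro ξ
    rw [← hwe.fderiv_eq, fderiv_mul_apply' (h.diff cw hz) (h.diff cη hz)]
  have hu' : ∀ ξ, fderiv ℝ u z ξ = 2 * G (φ z) (partialD φ ξ₀ z) (covX Γ φ ξ ξ₀ z) := by
    intro ξ
    rw [hu, h.fderiv_indMetric hz, h.G_symm hz (covX Γ φ ξ ξ₀ z)]
    ring
  have hηz : 0 < η z := hpos z hz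
  set w := u z / η z with hw
  have huw : u z = w * η z := by rw [hw, div_mul_cancel₀ _ hηz.ne']
  have hsym := h.G_symm hz
  have nn : ∀ v, 0 ≤ G (φ z) v v := fun v => by
    rcases eq_or_ne v 0 with rfl | hv
    · simp
    · exact (h.lc.pos _ (h.mapsTo hz) v hv).le
  -- Cauchy-Schwarz
  have cs : ∀ v, G (φ z) (partialD φ ξ₀ z) v ^ 2 ≤ u z * G (φ z) v v := by
    intro v
    have q := nn (u z • v - G (φ z) (partialD φ ξ₀ z) v • partialD φ ξ₀ z)
    simp only [map_sub, sub_apply, map_smul, smul_apply, smul_eq_mul, hsym v (partialD φ ξ₀ z)] at q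
    change 0 ≤ u z * (u z * _ - _ * _) - _ * (u z * _ - _ * u z) at q
    have hu0 : 0 ≤ u z := nn _
    rcases hu0.eq_or_lt with h0 | h0
    · have : partialD φ ξ₀ z = 0 := by
        by_contra hne
        exact absurd (h.lc.pos _ (h.mapsTo hz) _ hne) (by
          change ¬ (0 < u z)
          rw [← h0]; exact lt_irrefl _)
      simp [this, ← h0]
    · by_contra hlt
      push Not at hlt
      nlinarith
  -- the completed square, for the normal part of `D_ξ H`
  have g11 : G (φ z) (partialD φ ξ₁ z) (partialD φ ξ₁ z) = 1 := hn.g11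
  have g22 : G (φ z) (partialD φ ξ₂ z) (partialD φ ξ₂ z) = 1 := hn.g22
  have g12 : G (φ z) (partialD φ ξ₁ z) (partialD φ ξ₂ z) = 0 := hn.g12
  have n01 : G (φ z) (partialD φ ξ₀ z) (partialD φ ξ₁ z) = 0 := h.normal₁ z hz
  have n02 : G (φ z) (partialD φ ξ₀ z) (partialD φ ξ₂ z) = 0 := h.normal₂ z hz
  have sq : ∀ ξ, fderiv ℝ (fun x => u x / η x) z ξ * fderiv ℝ η z ξ
      ≤ G (φ z) (covX Γ φ ξ ξ₀ z) (covX Γ φ ξ ξ₀ z)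
        - G (φ z) (partialD φ ξ₀ z) (covX Γ φ ξ ξ₁ z) ^ 2
        - G (φ z) (partialD φ ξ₀ z) (covX Γ φ ξ ξ₂ z) ^ 2 := by
    intro ξ
    obtain ⟨t1, t2⟩ := h.G_covX_velocity hz ξ
    set d := fderiv ℝ η z ξ
    -- The vector is the normal part of `D_ξ H` minus `(∂_ξ η / η) H`. With `2⟨H, D_ξ H⟩ = ∂_ξ (w
    -- η)` its squared length is `|∇^⊥_ξ H|² - ∂_ξ w ∂_ξ η`.
    have q := nn (covX Γ φ ξ ξ₀ z
      + G (φ z) (partialD φ ξ₀ z) (covX Γ φ ξ ξ₁ z) • partialD φ ξ₁ z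
      + G (φ z) (partialD φ ξ₀ z) (covX Γ φ ξ ξ₂ z) • partialD φ ξ₂ z
      - (d / η z) • partialD φ ξ₀ z)
    have t1' := (hsym (partialD φ ξ₁ z) (covX Γ φ ξ ξ₀ z)).trans t1
    have t2' := (hsym (partialD φ ξ₂ z) (covX Γ φ ξ ξ₀ z)).trans t2
    have n10 := (hsym (partialD φ ξ₁ z) (partialD φ ξ₀ z)).trans n01
    have n20 := (hsym (partialD φ ξ₂ z) (partialD φ ξ₀ z)).trans n02
    have g21 := (hsym (partialD φ ξ₂ z) (partialD φ ξ₁ z)).trans g12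
    simp only [map_sub, sub_apply, map_add, add_apply, map_smul, smul_apply, smul_eq_mul,
      t1', t2', n10, n20, g21, hsym (covX Γ φ ξ ξ₀ z) (partialD φ ξ₀ z), t1, t2, n01, n02, g11, g12,
      g22] at q
    have hg := hgrad ξ
    rw [hu'] at hg
    have hdu : G (φ z) (partialD φ ξ₀ z) (partialD φ ξ₀ z) = w * η z := huw
    rw [hdu] at q
    set x := fderiv ℝ (fun x => u x / η x) z ξ
    have hx : G (φ z) (partialD φ ξ₀ z) (covX Γ φ ξ ξ₀ z) = (x * η z + w * d) / 2 := by
      linarith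
    rw [hx] at q
    have e1 : d / η z * η z = d := div_mul_cancel₀ _ hηz.ne'
    have e2 : d / η z * ((x * η z + w * d) / 2) = (x * d + w * d * (d / η z)) / 2 := by
      linear_combination (x / 2) * e1
    have e3 : d / η z * (d / η z * (w * η z)) = w * d * (d / η z) := by
      linear_combination (w * (d / η z)) * e1
    linarith
  have s1 := sq ξ₁
  have s2 := sq ξ₂
  rw [h.covX_comm hz ξ₂ ξ₁] at s2
  have c1 := cs (covX Γ φ ξ₁ ξ₁ z)
  have c2 := cs (covX Γ φ ξ₁ ξ₂ z)
  have c3 := cs (covX Γ φ ξ₂ ξ₂ z)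
  have hA : sqNormA G Γ φ ξ₁ ξ₂ z = G (φ z) (covX Γ φ ξ₁ ξ₁ z) (covX Γ φ ξ₁ ξ₁ z)
    + 2 * G (φ z) (covX Γ φ ξ₁ ξ₂ z) (covX Γ φ ξ₁ ξ₂ z)
    + G (φ z) (covX Γ φ ξ₂ ξ₂ z) (covX Γ φ ξ₂ ξ₂ z) := rfl
  rw [k1, k2, hA] at hheat
  set D := heatOp ξ₀ ξ₁ ξ₂ (fun x => u x / η x) z
  -- After multiplication by `η`, the three Cauchy-Schwarz inequalities cancel the `|A|²` terms. The
  -- curvature terms leave `c u`, and the `-|H|²` in the equation of `η` leaves `u²`.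
  refine le_of_mul_le_mul_right ?_ hηz
  rw [huw] at hheat c1 c2 c3 ⊢
  linarith

end IsLocalFlow
end Reaction

/-! ### Existence and uniqueness of the Levi-Civita connection in coordinates. -/

section LeviCivita

set_option maxSynthPendingDepth 6
set_option synthInstance.maxHeartbeats 200000

variable {E : Type*} [NormedAddCommGroup E] [NormedSpace ℝ E]

/-- The Christoffel symbols of the first kind. -/
def koszul (D : E →L[ℝ] E →L[ℝ] E →L[ℝ] ℝ) : E →L[ℝ] E →L[ℝ] E →L[ℝ] ℝ :=
  (1 / 2 : ℝ) • (D + D.flip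
    - ((ContinuousLinearMap.flipₗᵢ ℝ E E ℝ).toContinuousLinearEquiv :
        (E →L[ℝ] E →L[ℝ] ℝ) →L[ℝ] (E →L[ℝ] E →L[ℝ] ℝ)) ∘L D.flip)

lemma koszul_apply (D : E →L[ℝ] E →L[ℝ] E →L[ℝ] ℝ) (u v w : E) :
    koszul D u v w = (1 / 2 : ℝ) * (D u v w + D v u w - D w u v) := by
  simp [koszul, add_apply, sub_apply, smul_apply]

lemma contDiff_koszul : ContDiff ℝ ∞ (koszul (E := E)) := by
  have h1 : ContDiff ℝ ∞ fun D : E →L[ℝ] E →L[ℝ] E →L[ℝ] ℝ => D.flip :=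
    (ContinuousLinearMap.flipₗᵢ ℝ E E (E →L[ℝ] ℝ)).contDiff
  unfold koszul
  exact ((contDiff_id.add h1).sub (contDiff_const.clm_comp h1)).const_smul (1 / 2 : ℝ)

variable [FiniteDimensional ℝ E]

lemma isInvertible_of_pos {B : E →L[ℝ] E →L[ℝ] ℝ} (hB : ∀ u, u ≠ 0 → 0 < B u u) :
    B.IsInvertible := by
  have hinj : Function.Injective (B : E →ₗ[ℝ] E →L[ℝ] ℝ) := by
    rw [injective_iff_map_eq_zero]
    intro u hu
    by_contra h
    have := hB u h
    have e : B u = 0 := hu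
    rw [e] at this
    simp at this
  have hr : Module.finrank ℝ E = Module.finrank ℝ (E →L[ℝ] ℝ) := by
    rw [← (LinearMap.toContinuousLinearMap : (E →ₗ[ℝ] ℝ) ≃ₗ[ℝ] (E →L[ℝ] ℝ)).finrank_eq]
    exact (Subspace.dual_finrank_eq (K := ℝ) (V := E)).symm
  refine ⟨(LinearEquiv.ofInjectiveOfFinrankEq (B : E →ₗ[ℝ] E →L[ℝ] ℝ) hinj hr).toContinuousLinearEquiv, ?_⟩
  ext u v
  rfl

/-- The Levi-Civita connection of a metric on an open subset of a vector space. -/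
def leviCivita (G : E → E →L[ℝ] E →L[ℝ] ℝ) (y : E) : E →L[ℝ] E →L[ℝ] E :=
  ContinuousLinearMap.compL ℝ E (E →L[ℝ] ℝ) E (ContinuousLinearMap.inverse (G y)) ∘L
    koszul (fderiv ℝ G y)

lemma leviCivita_spec {G : E → E →L[ℝ] E →L[ℝ] ℝ} {y : E} (hp : ∀ u, u ≠ 0 → 0 < G y u u)
    (u v w : E) : G y (leviCivita G y u v) w = koszul (fderiv ℝ G y) u v w := by
  obtain ⟨e, he⟩ := isInvertible_of_pos hp
  have : leviCivita G y u v = e.symm (koszul (fderiv ℝ G y) u v) := by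
    simp only [leviCivita, ← he, ContinuousLinearMap.inverse_equiv]
    rfl
  rw [this, ← he]
  simp

/-- Smoothness comes from that of operator inversion at invertible points. The other properties
follow from the Koszul formula and from the symmetry of `fderiv ℝ G` in its last two arguments. -/
lemma isLeviCivitaOn_leviCivita {G : E → E →L[ℝ] E →L[ℝ] ℝ} {V : Set E} (hV : IsOpen V)
    (hG : ContDiffOn ℝ ∞ G V) (hs : ∀ y ∈ V, ∀ u v, G y u v = G y v u)
    (hp : ∀ y ∈ V, ∀ u, u ≠ 0 → 0 < G y u u) : IsLeviCivitaOn G (leviCivita G) V := by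
  have hsD : ∀ y ∈ V, ∀ u v w, fderiv ℝ G y u v w = fderiv ℝ G y u w v := by
    intro y hy u v w
    have hd := (differentiableAt_of_contDiffOn hV hG hy).hasFDerivAt
    have e1 := ((hd.clm_apply (hasFDerivAt_const v y)).clm_apply (hasFDerivAt_const w y)).fderiv
    have e2 := ((hd.clm_apply (hasFDerivAt_const w y)).clm_apply (hasFDerivAt_const v y)).fderiv
    have e3 : (fun y => G y v w) =ᶠ[𝓝 y] fun y => G y w v :=
      Filter.eventually_of_mem (hV.mem_nhds hy) fun x hx => hs x hx v w
    have e4 := e3.fderiv_eq (𝕜 := ℝ)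
    rw [e1, e2] at e4
    simpa using DFunLike.congr_fun e4 u
  have hdet : ∀ y ∈ V, ∀ a b, (∀ w, G y a w = G y b w) → a = b := by
    intro y hy a b hab
    by_contra hne
    have := hp y hy (a - b) (sub_ne_zero.2 hne)
    simp [hab] at this
  refine ⟨hV, hG, ?_, hs, hp, ?_, ?_⟩
  · have h1 : ContDiffOn ℝ ∞ (fun y => ContinuousLinearMap.inverse (G y)) V := by
      intro y hy
      obtain ⟨e, he⟩ := isInvertible_of_pos (hp y hy)
      have h2 : ContDiffAt ℝ ∞ ContinuousLinearMap.inverse (G y) := he ▸ contDiffAt_map_inverse e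
      exact h2.comp_contDiffWithinAt y (hG y hy)
    have h2 : ContDiffOn ℝ ∞ (fun y => koszul (fderiv ℝ G y)) V :=
      contDiff_koszul.comp_contDiffOn (hG.fderiv_of_isOpen hV infty_add_one_le)
    exact (((ContinuousLinearMap.compL ℝ E (E →L[ℝ] ℝ) E).contDiff).comp_contDiffOn h1).clm_comp h2
  · intro y hy u v
    refine hdet y hy _ _ fun w => ?_
    rw [leviCivita_spec (hp y hy), leviCivita_spec (hp y hy), koszul_apply, koszul_apply,
      hsD y hy w u v]
    ring
  · intro y hy u v w
    rw [leviCivita_spec (hp y hy), hs y hy v, leviCivita_spec (hp y hy), koszul_apply,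
      koszul_apply, hsD y hy v u w, hsD y hy w u v, hsD y hy u w v]
    ring

omit [FiniteDimensional ℝ E] in
/-- The Christoffel symbols of two metrics that are related by a change of coordinates `τ`. -/
lemma IsLeviCivitaOn.conn_comp {E' : Type*} [NormedAddCommGroup E'] [NormedSpace ℝ E']
    {G : E → E →L[ℝ] E →L[ℝ] ℝ} {Γ : E → E →L[ℝ] E →L[ℝ] E} {V : Set E}
    {G' : E' → E' →L[ℝ] E' →L[ℝ] ℝ} {Γ' : E' → E' →L[ℝ] E' →L[ℝ] E'} {V' : Set E'}
    (h : IsLeviCivitaOn G Γ V) (h' : IsLeviCivitaOn G' Γ' V') {τ : E → E'} {y : E} (hy : y ∈ V)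
    (hy' : τ y ∈ V') (hτ : ContDiffAt ℝ ∞ τ y)
    (hiso : ∀ᶠ z in 𝓝 y, ∀ u v, G z u v = G' (τ z) (fderiv ℝ τ z u) (fderiv ℝ τ z v))
    (hsurj : Function.Surjective (fderiv ℝ τ y)) (u v : E) :
    fderiv ℝ τ y (Γ y u v) = Γ' (τ y) (fderiv ℝ τ y u) (fderiv ℝ τ y v)
      + fderiv ℝ (fderiv ℝ τ) y u v := by
  set A := fderiv ℝ τ y with hA
  have hd1 : HasFDerivAt τ A y := (hτ.differentiableAt (by simp)).hasFDerivAt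
  have hc2 : ContDiffAt ℝ ∞ (fderiv ℝ τ) y := hτ.fderiv_right infty_add_one_le
  have hd2 : HasFDerivAt (fderiv ℝ τ) (fderiv ℝ (fderiv ℝ τ) y) y :=
    (hc2.differentiableAt (by simp)).hasFDerivAt
  set D2 := fderiv ℝ (fderiv ℝ τ) y with hD2
  have hsymm : ∀ u v, D2 u v = D2 v u := fun u v =>
    (hτ.isSymmSndFDerivAt (by simpa using two_le_infty)).eq u v
  have hG := (differentiableAt_of_contDiffOn h.isOpen h.contDiffOn hy).hasFDerivAt
  have hG' := (differentiableAt_of_contDiffOn h'.isOpen h'.contDiffOn hy').hasFDerivAt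
  have key : ∀ w u v, G' (τ y) (A (Γ y w u) - Γ' (τ y) (A w) (A u) - D2 w u) (A v)
      + G' (τ y) (A u) (A (Γ y w v) - Γ' (τ y) (A w) (A v) - D2 w v) = 0 := by
    intro w u v
    have e1 := ((hG.clm_apply (hasFDerivAt_const u y)).clm_apply (hasFDerivAt_const v y)).fderiv
    have e2 := (((hG'.comp y hd1).clm_apply (hd2.clm_apply (hasFDerivAt_const u y))).clm_apply
      (hd2.clm_apply (hasFDerivAt_const v y))).fderiv
    have e3 : (fun z => G z u v) =ᶠ[𝓝 y]
        fun z => (G' ∘ τ) z (fderiv ℝ τ z u) (fderiv ℝ τ z v) := by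
      filter_upwards [hiso] with z hz using hz u v
    have e4 := e3.fderiv_eq (𝕜 := ℝ)
    rw [e1, e2] at e4
    have e5 := DFunLike.congr_fun e4 w
    simp only [add_apply, ContinuousLinearMap.comp_apply, ContinuousLinearMap.flip_apply,
      zero_apply, map_zero, zero_add, Function.comp,
      ← hA] at e5
    have hi := hiso.self_of_nhds
    rw [h.parallel y hy, h'.parallel _ hy', hi, hi, ← hA] at e5
    simp only [map_sub, sub_apply]
    linarith
  -- `T` is the defect in the transformation law. It is symmetric in its first two arguments and
  -- antisymmetric in its last two, hence zero, as in the uniqueness proof for the Levi-Civita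
  -- connection.
  set T : E → E → E → ℝ := fun w u v =>
    G' (τ y) (A (Γ y w u) - Γ' (τ y) (A w) (A u) - D2 w u) (A v) with hT
  have t1 : ∀ w u v, T w u v = T u w v := by
    intro w u v
    simp only [hT, h.torsion_free y hy w u, h'.torsion_free _ hy' (A w), hsymm w u]
  have t2 : ∀ w u v, T w u v + T w v u = 0 := by
    intro w u v
    have := key w u v
    rw [h'.symm _ hy' (A u)] at this
    exact this
  have t3 : ∀ w u v, T w u v = 0 := by
    intro w u v
    have := t2 w u v; have := t2 u v w; have := t2 v w u
    have := t1 w u v; have := t1 w v u; have := t1 u v w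
    linarith
  obtain ⟨d, hd⟩ := hsurj (A (Γ y u v) - Γ' (τ y) (A u) (A v) - D2 u v)
  have h0 : A (Γ y u v) - Γ' (τ y) (A u) (A v) - D2 u v = 0 := by
    by_contra hne
    have := h'.pos _ hy' _ hne
    have t := t3 u v d
    simp only [hT] at t
    rw [hd] at t
    linarith
  rw [sub_sub, sub_eq_zero] at h0
  exact h0

end LeviCivita

/-! ### Smooth fields of bilinear forms in charts. -/

section ChartForms

open Bundle

variable {E H S : Type*} [NormedAddCommGroup E] [NormedSpace ℝ E] [TopologicalSpace H]
  {I : ModelWithCorners ℝ E H} [TopologicalSpace S] [ChartedSpace H S] [IsManifold I ∞ S]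

/-- The tangent map of `κ` sends a constant vector to a smooth section along `κ`. Evaluating the
smooth section `α` on two of them in the bundle gives a smooth function. -/
lemma contDiffOn_pullback_form
    {α : (p : S) → TangentSpace I p →L[ℝ] TangentSpace I p →L[ℝ] ℝ}
    (hα : ContMDiff I (I.prod 𝓘(ℝ, E →L[ℝ] E →L[ℝ] ℝ)) ∞
      (fun p ↦ TotalSpace.mk' (E →L[ℝ] E →L[ℝ] ℝ)
        (E := fun p : S => TangentSpace I p →L[ℝ] TangentSpace I p →L[ℝ] ℝ) p (α p)))
    {Z : Type*} [NormedAddCommGroup Z] [NormedSpace ℝ Z] {κ : Z → S} {U : Set Z} (hU : IsOpen U)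
    (hκ : ContMDiffOn 𝓘(ℝ, Z) I ∞ κ U) (u v : Z) :
    ContDiffOn ℝ ∞ (fun z => α (κ z) (mfderiv 𝓘(ℝ, Z) I κ z u) (mfderiv 𝓘(ℝ, Z) I κ z v)) U := by
  have hI1 : IsManifold I 1 S := IsManifold.of_le (n := ∞) (by simp)
  have hsec : ∀ u : Z, ContMDiffOn 𝓘(ℝ, Z) (I.prod 𝓘(ℝ, E)) ∞
      (fun z => TotalSpace.mk' E (E := TangentSpace I) (κ z) (mfderiv 𝓘(ℝ, Z) I κ z u)) U := by
    intro u
    have h1 := hκ.contMDiffOn_tangentMapWithin (m := ∞) infty_add_one_le hU.uniqueMDiffOn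
    have h2 : ContMDiffOn 𝓘(ℝ, Z) (𝓘(ℝ, Z).prod 𝓘(ℝ, Z)) ∞
        (fun z => (TotalSpace.mk' Z (E := TangentSpace 𝓘(ℝ, Z)) z u : TangentBundle 𝓘(ℝ, Z) Z)) U := by
      exact fun z _ => (contMDiffWithinAt_vectorSpace_iff_contDiffWithinAt
        (V := fun _ => u)).2 contDiffWithinAt_const
    have h3 := h1.comp h2 (fun z hz => hz)
    refine h3.congr fun z hz => ?_
    simp only [Function.comp, tangentMapWithin, mfderivWithin_of_isOpen hU hz]
  rw [← contMDiffOn_iff_contDiffOn]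
  intro z hz
  have : ContMDiffWithinAt 𝓘(ℝ, Z) (I.prod 𝓘(ℝ)) ∞
      (fun m ↦ TotalSpace.mk' ℝ (E := Bundle.Trivial S ℝ) (κ m)
        (α (κ m) (mfderiv 𝓘(ℝ, Z) I κ m u) (mfderiv 𝓘(ℝ, Z) I κ m v))) U z := by
    apply ContMDiffWithinAt.clm_bundle_apply₂ (F₁ := E) (F₂ := E)
      (E₁ := TangentSpace I) (E₂ := TangentSpace I) (b := κ)
    · exact ContMDiffAt.comp_contMDiffWithinAt z hα.contMDiffAt (hκ z hz)
    · exact hsec u z hz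
    · exact hsec v z hz
  simp only [contMDiffWithinAt_totalSpace] at this
  exact this.2

/-- The coordinate expression of a field of bilinear forms in the chart at `p`. -/
def chartForm (α : (p : S) → TangentSpace I p →L[ℝ] TangentSpace I p →L[ℝ] ℝ) (p : S) (y : E) :
    E →L[ℝ] E →L[ℝ] ℝ :=
  ContinuousLinearMap.bilinearComp (E := E) (F := E) (G := ℝ) (E' := E) (F' := E)
    (α ((extChartAt I p).symm y))
    (mfderiv 𝓘(ℝ, E) I (extChartAt I p).symm y)
    (mfderiv 𝓘(ℝ, E) I (extChartAt I p).symm y)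

omit [IsManifold I ∞ S] in
lemma chartForm_apply (α : (p : S) → TangentSpace I p →L[ℝ] TangentSpace I p →L[ℝ] ℝ) (p : S)
    (y u v : E) : chartForm α p y u v = inChart (I := I) (fun p u v => α p u v) p y u v := rfl

lemma contDiffOn_chartForm [FiniteDimensional ℝ E] [I.Boundaryless]
    {α : (p : S) → TangentSpace I p →L[ℝ] TangentSpace I p →L[ℝ] ℝ}
    (hα : ContMDiff I (I.prod 𝓘(ℝ, E →L[ℝ] E →L[ℝ] ℝ)) ∞
      (fun p ↦ TotalSpace.mk' (E →L[ℝ] E →L[ℝ] ℝ)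
        (E := fun p : S => TangentSpace I p →L[ℝ] TangentSpace I p →L[ℝ] ℝ) p (α p))) (p : S) :
    ContDiffOn ℝ ∞ (chartForm α p) (extChartAt I p).target := by
  rw [contDiffOn_clm_apply]
  intro u
  rw [contDiffOn_clm_apply]
  intro v
  exact contDiffOn_pullback_form hα (isOpen_extChartAt_target p) (contMDiffOn_extChartAt_symm p) u v

lemma injective_mfderiv_extChartAt_symm [I.Boundaryless] (p : S) {y : E}
    (hy : y ∈ (extChartAt I p).target) :
    Function.Injective (mfderiv 𝓘(ℝ, E) I (extChartAt I p).symm y) := by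
  have hI1 : IsManifold I 1 S := IsManifold.of_le (n := ∞) (by simp)
  have h := isInvertible_mfderivWithin_extChartAt_symm hy
  rw [I.range_eq_univ, mfderivWithin_univ] at h
  obtain ⟨e, he⟩ := h
  rw [← he]
  exact e.injective

lemma mfderiv_extChartAt_symm_self [I.Boundaryless] (p : S) :
    mfderiv 𝓘(ℝ, E) I (extChartAt I p).symm (extChartAt I p p) = ContinuousLinearMap.id ℝ E := by
  have hI1 : IsManifold I 1 S := IsManifold.of_le (n := ∞) (by simp)
  have h := mfderivWithin_range_extChartAt_symm (I := I) (x := p)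
  rw [I.range_eq_univ, mfderivWithin_univ] at h
  exact h

/-- The tangent space at `p` is read in the preferred chart at `p`, whose inverse therefore has the
identity as differential at the centre. -/
lemma inChart_self [I.Boundaryless] (α : TwoTensor I S) (p : S) (u v : E) :
    inChart α p (extChartAt I p p) u v = α p u v := by
  simp only [inChart, mfderiv_extChartAt_symm_self]
  rw [extChartAt_to_inv]
  rfl

end ChartForms

/-! ### Determinants and Gram determinants in the plane. -/

section PlaneAlgebra

lemma plane_eq (u : Plane) : u = u 0 • planeBasis 0 + u 1 • planeBasis 1 := by
  ext i
  fin_cases i <;> simp [planeBasis]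

lemma planeBasis_linearIndependent {a b : ℝ} (h : a • planeBasis 0 + b • planeBasis 1 = 0) :
    a = 0 ∧ b = 0 := by
  have h0 := congrArg (fun v : Plane => v 0) h
  have h1 := congrArg (fun v : Plane => v 1) h
  simpa [planeBasis] using And.intro h0 h1

/-- The determinant of two vectors of the plane. -/
def planeDet (u v : Plane) : ℝ := u 0 * v 1 - u 1 * v 0

lemma alternating_plane (B : Plane →ₗ[ℝ] Plane →ₗ[ℝ] ℝ) (hB : ∀ v, B v v = 0) (u v : Plane) :
    B u v = planeDet u v * B (planeBasis 0) (planeBasis 1) := by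
  have h10 : B (planeBasis 1) (planeBasis 0) = - B (planeBasis 0) (planeBasis 1) := by
    have := hB (planeBasis 0 + planeBasis 1)
    simp only [map_add, LinearMap.add_apply, hB] at this
    linarith
  conv_lhs => rw [plane_eq u, plane_eq v]
  simp only [map_add, LinearMap.add_apply, map_smul, LinearMap.smul_apply, hB, h10, smul_eq_mul,
    planeDet]
  ring

lemma alternating_plane' (B : Plane →L[ℝ] Plane →L[ℝ] ℝ) (hB : ∀ v, B v v = 0) (u v : Plane) :
    B u v = planeDet u v * B (planeBasis 0) (planeBasis 1) :=
  alternating_plane (LinearMap.mk₂ ℝ (fun u v => B u v) (by simp) (by simp) (by simp) (by simp))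
    hB u v

lemma gram_det_pos {E : Type*} [NormedAddCommGroup E] [NormedSpace ℝ E]
    {B : E →L[ℝ] E →L[ℝ] ℝ} (hs : ∀ u v, B u v = B v u) (hp : ∀ u, u ≠ 0 → 0 < B u u) {u v : E}
    (h : ∀ a b : ℝ, a • u + b • v = 0 → a = 0 ∧ b = 0) : 0 < B u u * B v v - B u v ^ 2 := by
  have hu : u ≠ 0 := by
    rintro rfl
    simpa using h 1 0 (by simp)
  have h1 := hp u hu
  -- This vector is `B`-orthogonal to `u`, and its squared length is `B u u` times the Gram
  -- determinant.
  have h2 : (-(B u v)) • u + (B u u) • v ≠ 0 := by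
    intro e
    exact h1.ne' (h _ _ e).2
  have h3 := hp _ h2
  have e : B ((-(B u v)) • u + (B u u) • v) ((-(B u v)) • u + (B u u) • v)
      = B u u * (B u u * B v v - B u v ^ 2) := by
    simp only [map_add, map_smul, add_apply, smul_apply, smul_eq_mul]
    rw [hs v u]
    ring
  rw [e] at h3
  exact pos_of_mul_pos_right h3 h1.le |> fun h => by simpa using h

end PlaneAlgebra

/-! ### A surface metric with its area form: parallelism, curvature, orthonormal coframe. -/

section SurfaceChart

variable {E : Type*} [NormedAddCommGroup E] [NormedSpace ℝ E]

lemma fderiv_apply_apply {F : Type*} [NormedAddCommGroup F] [NormedSpace ℝ F]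
    {B : E → E →L[ℝ] E →L[ℝ] F} {y : E} (hB : DifferentiableAt ℝ B y) (u v w : E) :
    fderiv ℝ (fun z => B z v w) y u = fderiv ℝ B y u v w := by
  have e1 := ((hB.hasFDerivAt.clm_apply (hasFDerivAt_const v y)).clm_apply
    (hasFDerivAt_const w y)).fderiv
  rw [e1]
  simp

/-- A metric with constant curvature `c` at the point `y₀`, and its area form, in a chart. -/
structure IsSurfaceChart (G W : Plane → Plane →L[ℝ] Plane →L[ℝ] ℝ)
    (Γ : Plane → Plane →L[ℝ] Plane →L[ℝ] Plane) (V : Set Plane) (c : ℝ) (y₀ : Plane) : Prop where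
  lc : IsLeviCivitaOn G Γ V
  contDiffOn_form : ContDiffOn ℝ ∞ W V
  alternating : ∀ y ∈ V, ∀ v, W y v v = 0
  sq_eq : ∀ y ∈ V, ∀ u v, W y u v ^ 2 = G y u u * G y v v - G y u v ^ 2
  mem : y₀ ∈ V
  curv_diag : ∀ u v, G y₀ (curvOp Γ y₀ u v u) v = c * (G y₀ u u * G y₀ v v - G y₀ u v ^ 2)

namespace IsSurfaceChart

variable {G W : Plane → Plane →L[ℝ] Plane →L[ℝ] ℝ} {Γ : Plane → Plane →L[ℝ] Plane →L[ℝ] Plane}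
  {V : Set Plane} {c : ℝ} {y₀ y : Plane} (h : IsSurfaceChart G W Γ V c y₀)

include h

lemma neg : IsSurfaceChart G (-W) Γ V c y₀ := by
  refine ⟨h.lc, h.contDiffOn_form.neg, ?_, ?_, h.mem, h.curv_diag⟩
  · intro y hy v
    simp [h.alternating y hy v]
  · intro y hy u v
    simpa using h.sq_eq y hy u v

/-- Polarization of `sq_eq` in the first argument. -/
lemma form_mul (hy : y ∈ V) (a b v : Plane) :
    W y a v * W y b v = G y a b * G y v v - G y a v * G y b v := by
  have e1 := h.sq_eq y hy (a + b) v
  have e2 := h.sq_eq y hy a v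
  have e3 := h.sq_eq y hy b v
  have e4 := h.lc.symm y hy b a
  simp only [map_add, add_apply] at e1
  rw [e4] at e1
  linear_combination (e1 - e2 - e3) / 2

lemma form_swap (hy : y ∈ V) (u v : Plane) : W y u v = -W y v u := by
  have := h.alternating y hy (u + v)
  simp only [map_add, add_apply, h.alternating y hy] at this
  linarith

lemma form_basis_ne (hy : y ∈ V) : W y (planeBasis 0) (planeBasis 1) ≠ 0 := by
  intro e
  have h1 := h.sq_eq y hy (planeBasis 0) (planeBasis 1)
  have h2 := gram_det_pos (h.lc.symm y hy) (h.lc.pos y hy)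
    (u := planeBasis 0) (v := planeBasis 1) fun a b => planeBasis_linearIndependent
  rw [e] at h1
  linarith

/-- The square of the area form is a Gram determinant of a parallel metric. Differentiating `W² =
det G` gives `W ∇W = 0`, and `W` does not vanish on a basis. -/
lemma parallel_form (hy : y ∈ V) : IsParallelAt Γ W y := by
  intro x u v
  have dW := differentiableAt_of_contDiffOn h.lc.isOpen h.contDiffOn_form hy
  have dG := differentiableAt_of_contDiffOn h.lc.isOpen h.lc.contDiffOn hy
  have dWc : ∀ u v, DifferentiableAt ℝ (fun z => W z u v) y := fun u v =>
    (dW.clm_apply (differentiableAt_const u)).clm_apply (differentiableAt_const v)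
  have dGc : ∀ u v, DifferentiableAt ℝ (fun z => G z u v) y := fun u v =>
    (dG.clm_apply (differentiableAt_const u)).clm_apply (differentiableAt_const v)
  have halt : ∀ v, fderiv ℝ W y x v v = 0 := by
    intro v
    rw [← fderiv_apply_apply dW]
    have : (fun z => W z v v) =ᶠ[𝓝 y] fun _ => 0 :=
      Filter.eventually_of_mem (h.lc.isOpen.mem_nhds hy) fun z hz => h.alternating z hz v
    rw [this.fderiv_eq]
    simp
  have key : ∀ u v, W y u v * (fderiv ℝ W y x u v - W y (Γ y x u) v - W y u (Γ y x v)) = 0 := by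
    intro u v
    have e : (fun z => W z u v * W z u v) =ᶠ[𝓝 y]
        fun z => G z u u * G z v v - G z u v * G z u v := by
      refine Filter.eventually_of_mem (h.lc.isOpen.mem_nhds hy) fun z hz => ?_
      have := h.sq_eq z hz u v
      simp only []
      linear_combination this
    have e2 := DFunLike.congr_fun (e.fderiv_eq (𝕜 := ℝ)) x
    rw [fderiv_fun_mul (dWc u v) (dWc u v),
      fderiv_fun_sub ((dGc u u).fun_mul (dGc v v)) ((dGc u v).fun_mul (dGc u v)),
      fderiv_fun_mul (dGc u u) (dGc v v), fderiv_fun_mul (dGc u v) (dGc u v)] at e2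
    simp only [add_apply, sub_apply, smul_apply, smul_eq_mul, fderiv_apply_apply dW,
      fderiv_apply_apply dG] at e2
    rw [h.lc.parallel y hy, h.lc.parallel y hy, h.lc.parallel y hy] at e2
    have m1 := h.form_mul hy (Γ y x u) u v
    have m2 := h.form_mul hy (Γ y x v) v u
    have s1 := h.form_swap hy u v
    have s2 := h.form_swap hy u (Γ y x v)
    have t1 := h.lc.symm y hy u (Γ y x u)
    have t2 := h.lc.symm y hy v (Γ y x v)
    have t3 := h.lc.symm y hy (Γ y x v) u
    have t4 := h.lc.symm y hy v u
    rw [t1, t2] at e2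
    rw [t3, t4] at m2
    have m2' : W y u (Γ y x v) * W y u v = G y (Γ y x v) v * G y u u - G y u (Γ y x v) * G y u v := by
      rw [s1, s2]
      linear_combination m2
    linear_combination e2 / 2 - m1 - m2'
  have k := key (planeBasis 0) (planeBasis 1)
  have k' := (mul_eq_zero.1 k).resolve_left (h.form_basis_ne hy)
  -- `N` is the covariant derivative of `W` in the direction `x`. It is alternating, so its value on
  -- the standard basis determines it.
  let N : Plane →L[ℝ] Plane →L[ℝ] ℝ := fderiv ℝ W y x - (W y) ∘L (Γ y x)
    - ContinuousLinearMap.bilinearComp (W y) (ContinuousLinearMap.id ℝ Plane) (Γ y x)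
  have hN : ∀ u v, N u v = fderiv ℝ W y x u v - W y (Γ y x u) v - W y u (Γ y x v) := fun u v => by
    simp [N, ContinuousLinearMap.bilinearComp_apply]
  have := alternating_plane' N (fun v => by
    rw [hN, halt, h.form_swap hy v (Γ y x v)]; ring) u v
  rw [hN, hN, k', mul_zero] at this
  linarith

/-- In dimension two the curvature is skew in each pair of arguments, so a single number determines
it. Skewness in the second pair is `curvOp_self`; the number is the diagonal value `curv_diag` on
the standard basis. -/
lemma curv (u v w x : Plane) :
    G y₀ (curvOp Γ y₀ u v w) x = c * (W y₀ u v * W y₀ w x) := by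
  let K : Plane → Plane → Plane →L[ℝ] Plane := fun u v =>
    (fderiv ℝ Γ y₀ v u + Γ y₀ v ∘L Γ y₀ u) - (fderiv ℝ Γ y₀ u v + Γ y₀ u ∘L Γ y₀ v)
  have hK : ∀ u v w, curvOp Γ y₀ u v w = K u v w := fun u v w => rfl
  have e1 : ∀ u v w x, G y₀ (K u v w) x
      = planeDet w x * G y₀ (K u v (planeBasis 0)) (planeBasis 1) := by
    intro u v w x
    exact alternating_plane' (G y₀ ∘L K u v)
      (fun w => h.lc.curvOp_self h.mem u v w) w x
  have e2 : ∀ u v w x, G y₀ (K u v w) x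
      = planeDet u v * G y₀ (K (planeBasis 0) (planeBasis 1) w) x := by
    intro u v w x
    refine alternating_plane (LinearMap.mk₂ ℝ (fun u v => G y₀ (K u v w) x)
      ?_ ?_ ?_ ?_) ?_ u v
    · intro a b d
      simp only [K, map_add, map_sub, sub_apply, add_apply, ContinuousLinearMap.comp_apply]
      ring
    · intro r a b
      simp only [K, map_add, map_sub, sub_apply, add_apply, ContinuousLinearMap.comp_apply,
        map_smul, smul_apply, smul_eq_mul]
      ring
    · intro a b d
      simp only [K, map_add, map_sub, sub_apply, add_apply, ContinuousLinearMap.comp_apply]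
      ring
    · intro r a b
      simp only [K, map_add, map_sub, sub_apply, add_apply, ContinuousLinearMap.comp_apply,
        map_smul, smul_apply, smul_eq_mul]
      ring
    · intro a
      simp [K]
  have a1 := alternating_plane' (W y₀) (h.alternating y₀ h.mem)
  have d := h.curv_diag (planeBasis 0) (planeBasis 1)
  rw [hK, ← h.sq_eq y₀ h.mem] at d
  rw [hK, e1, e2, d, a1 u v, a1 w x]
  ring

lemma exists_frame : ∃ l₁ l₂ : Plane →ₗ[ℝ] ℝ,
    (∀ u v, G y₀ u v = l₁ u * l₁ v + l₂ u * l₂ v) ∧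
    ∀ u v, W y₀ u v = l₁ u * l₂ v - l₂ u * l₁ v := by
  set e := planeBasis 0 with he
  have hA : 0 < G y₀ e e := h.lc.pos y₀ h.mem e (planeBasis.ne_zero 0)
  set A := G y₀ e e with hAdef
  have hs : √A * √A = A := Real.mul_self_sqrt hA.le
  have hs0 : √A ≠ 0 := (Real.sqrt_pos.2 hA).ne'
  -- The coframe dual to the positively oriented orthonormal frame that starts with `e / |e|`.
  refine ⟨(√A)⁻¹ • (G y₀ e : Plane →ₗ[ℝ] ℝ), (√A)⁻¹ • (W y₀ e : Plane →ₗ[ℝ] ℝ), ?_, ?_⟩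
  · intro u v
    have m := h.form_mul h.mem u v e
    rw [h.form_swap h.mem u e, h.form_swap h.mem v e, h.lc.symm y₀ h.mem u e,
      h.lc.symm y₀ h.mem v e] at m
    simp only [LinearMap.smul_apply, ContinuousLinearMap.coe_coe, smul_eq_mul]
    field_simp
    rw [pow_two, hs]
    linear_combination -m
  · intro u v
    have a1 := alternating_plane' (W y₀) (h.alternating y₀ h.mem)
    have hv := alternating_plane (LinearMap.mk₂ ℝ (fun u v => G y₀ e u * W y₀ e v - W y₀ e u * G y₀ e v)
      (by intro a b d; simp only [map_add]; ring) (by intro r a b; simp only [map_smul, smul_eq_mul]; ring)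
      (by intro a b d; simp only [map_add]; ring) (by intro r a b; simp only [map_smul, smul_eq_mul]; ring))
      (by intro v; simp only [LinearMap.mk₂_apply]; ring) u v
    simp only [LinearMap.mk₂_apply, ← he, h.alternating y₀ h.mem, zero_mul, sub_zero,
      ← hAdef] at hv
    simp only [LinearMap.smul_apply, ContinuousLinearMap.coe_coe, smul_eq_mul]
    field_simp
    rw [pow_two, hs, hv, a1 u v]
    ring

end IsSurfaceChart
end SurfaceChart

/-! ### Products of metrics, connections and area forms. -/

section ProductChart

variable {E : Type*} [NormedAddCommGroup E] [NormedSpace ℝ E]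

/-- The sum of two fields of bilinear forms, on the product. -/
def prodForm (A₁ A₂ : E → E →L[ℝ] E →L[ℝ] ℝ) (y : E × E) : E × E →L[ℝ] E × E →L[ℝ] ℝ :=
  (A₁ y.1).bilinearComp (ContinuousLinearMap.fst ℝ E E) (ContinuousLinearMap.fst ℝ E E)
    + (A₂ y.2).bilinearComp (ContinuousLinearMap.snd ℝ E E) (ContinuousLinearMap.snd ℝ E E)

lemma prodForm_apply (A₁ A₂ : E → E →L[ℝ] E →L[ℝ] ℝ) (y u v : E × E) :
    prodForm A₁ A₂ y u v = A₁ y.1 u.1 v.1 + A₂ y.2 u.2 v.2 := rfl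

/-- The product of two connections. -/
def prodConn (Γ₁ Γ₂ : E → E →L[ℝ] E →L[ℝ] E) (y : E × E) : E × E →L[ℝ] E × E →L[ℝ] E × E :=
  ContinuousLinearMap.compL ℝ (E × E) E (E × E) (ContinuousLinearMap.inl ℝ E E) ∘L
      (Γ₁ y.1).bilinearComp (ContinuousLinearMap.fst ℝ E E) (ContinuousLinearMap.fst ℝ E E)
    + ContinuousLinearMap.compL ℝ (E × E) E (E × E) (ContinuousLinearMap.inr ℝ E E) ∘L
      (Γ₂ y.2).bilinearComp (ContinuousLinearMap.snd ℝ E E) (ContinuousLinearMap.snd ℝ E E)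

lemma prodConn_apply (Γ₁ Γ₂ : E → E →L[ℝ] E →L[ℝ] E) (y u v : E × E) :
    prodConn Γ₁ Γ₂ y u v = (Γ₁ y.1 u.1 v.1, Γ₂ y.2 u.2 v.2) := by
  simp [prodConn, add_apply, ContinuousLinearMap.bilinearComp_apply]

lemma contDiffOn_fst_snd {F : Type*} [NormedAddCommGroup F] [NormedSpace ℝ F] {V₁ V₂ : Set E}
    {A₁ A₂ : E → E →L[ℝ] E →L[ℝ] F} (h₁ : ContDiffOn ℝ ∞ A₁ V₁) (h₂ : ContDiffOn ℝ ∞ A₂ V₂)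
    (u v : E × E) : ContDiffOn ℝ ∞ (fun y : E × E => A₁ y.1 u.1 v.1) (V₁ ×ˢ V₂) ∧
      ContDiffOn ℝ ∞ (fun y : E × E => A₂ y.2 u.2 v.2) (V₁ ×ˢ V₂) := by
  constructor
  · exact ((h₁.comp contDiffOn_fst fun y hy => hy.1).clm_apply contDiffOn_const).clm_apply
      contDiffOn_const
  · exact ((h₂.comp contDiffOn_snd fun y hy => hy.2).clm_apply contDiffOn_const).clm_apply
      contDiffOn_const

lemma fderiv_fst_snd {F : Type*} [NormedAddCommGroup F] [NormedSpace ℝ F]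
    {A₁ A₂ : E → E →L[ℝ] E →L[ℝ] F} {y : E × E} (h₁ : DifferentiableAt ℝ A₁ y.1)
    (h₂ : DifferentiableAt ℝ A₂ y.2) (u v : E × E) :
    HasFDerivAt (fun y : E × E => A₁ y.1 u.1 v.1)
      (((fderiv ℝ A₁ y.1).flip u.1).flip v.1 ∘L ContinuousLinearMap.fst ℝ E E) y ∧
    HasFDerivAt (fun y : E × E => A₂ y.2 u.2 v.2)
      (((fderiv ℝ A₂ y.2).flip u.2).flip v.2 ∘L ContinuousLinearMap.snd ℝ E E) y := by
  constructor
  · have := ((h₁.hasFDerivAt.clm_apply (hasFDerivAt_const u.1 y.1)).clm_apply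
      (hasFDerivAt_const v.1 y.1)).comp y (hasFDerivAt_fst (p := y))
    refine this.congr_fderiv ?_
    ext <;> simp
  · have := ((h₂.hasFDerivAt.clm_apply (hasFDerivAt_const u.2 y.2)).clm_apply
      (hasFDerivAt_const v.2 y.2)).comp y (hasFDerivAt_snd (p := y))
    refine this.congr_fderiv ?_
    ext <;> simp

variable [FiniteDimensional ℝ E]

lemma contDiffOn_prodForm {V₁ V₂ : Set E}
    {A₁ A₂ : E → E →L[ℝ] E →L[ℝ] ℝ} (h₁ : ContDiffOn ℝ ∞ A₁ V₁) (h₂ : ContDiffOn ℝ ∞ A₂ V₂) :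
    ContDiffOn ℝ ∞ (prodForm A₁ A₂) (V₁ ×ˢ V₂) := by
  rw [contDiffOn_clm_apply]
  intro u
  rw [contDiffOn_clm_apply]
  intro v
  obtain ⟨a, b⟩ := contDiffOn_fst_snd h₁ h₂ u v
  exact a.add b

lemma contDiffOn_prodConn {V₁ V₂ : Set E}
    {A₁ A₂ : E → E →L[ℝ] E →L[ℝ] E} (h₁ : ContDiffOn ℝ ∞ A₁ V₁) (h₂ : ContDiffOn ℝ ∞ A₂ V₂) :
    ContDiffOn ℝ ∞ (prodConn A₁ A₂) (V₁ ×ˢ V₂) := by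
  rw [contDiffOn_clm_apply]
  intro u
  rw [contDiffOn_clm_apply]
  intro v
  obtain ⟨a, b⟩ := contDiffOn_fst_snd h₁ h₂ u v
  simp only [prodConn_apply]
  exact a.prodMk b

lemma fderiv_prodForm {V₁ V₂ : Set E} (hV₁ : IsOpen V₁) (hV₂ : IsOpen V₂)
    {A₁ A₂ : E → E →L[ℝ] E →L[ℝ] ℝ} (h₁ : ContDiffOn ℝ ∞ A₁ V₁) (h₂ : ContDiffOn ℝ ∞ A₂ V₂)
    {y : E × E} (hy : y ∈ V₁ ×ˢ V₂) (x u v : E × E) :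
    fderiv ℝ (prodForm A₁ A₂) y x u v
      = fderiv ℝ A₁ y.1 x.1 u.1 v.1 + fderiv ℝ A₂ y.2 x.2 u.2 v.2 := by
  have hd := differentiableAt_of_contDiffOn (hV₁.prod hV₂) (contDiffOn_prodForm h₁ h₂) hy
  obtain ⟨a, b⟩ := fderiv_fst_snd (differentiableAt_of_contDiffOn hV₁ h₁ hy.1)
    (differentiableAt_of_contDiffOn hV₂ h₂ hy.2) u v
  rw [← fderiv_apply_apply hd]
  simp only [prodForm_apply]
  rw [(a.fun_add b).fderiv]
  simp

lemma fderiv_prodConn {V₁ V₂ : Set E} (hV₁ : IsOpen V₁) (hV₂ : IsOpen V₂)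
    {A₁ A₂ : E → E →L[ℝ] E →L[ℝ] E} (h₁ : ContDiffOn ℝ ∞ A₁ V₁) (h₂ : ContDiffOn ℝ ∞ A₂ V₂)
    {y : E × E} (hy : y ∈ V₁ ×ˢ V₂) (x u v : E × E) :
    fderiv ℝ (prodConn A₁ A₂) y x u v
      = (fderiv ℝ A₁ y.1 x.1 u.1 v.1, fderiv ℝ A₂ y.2 x.2 u.2 v.2) := by
  have hd := differentiableAt_of_contDiffOn (hV₁.prod hV₂) (contDiffOn_prodConn h₁ h₂) hy
  obtain ⟨a, b⟩ := fderiv_fst_snd (differentiableAt_of_contDiffOn hV₁ h₁ hy.1)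
    (differentiableAt_of_contDiffOn hV₂ h₂ hy.2) u v
  rw [← fderiv_apply_apply hd]
  simp only [prodConn_apply]
  rw [(a.prodMk b).fderiv]
  simp

lemma isParallelAt_prod {V₁ V₂ : Set E} (hV₁ : IsOpen V₁) (hV₂ : IsOpen V₂)
    {A₁ A₂ : E → E →L[ℝ] E →L[ℝ] ℝ} (h₁ : ContDiffOn ℝ ∞ A₁ V₁) (h₂ : ContDiffOn ℝ ∞ A₂ V₂)
    {Γ₁ Γ₂ : E → E →L[ℝ] E →L[ℝ] E} {y : E × E} (hy : y ∈ V₁ ×ˢ V₂)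
    (p₁ : IsParallelAt Γ₁ A₁ y.1) (p₂ : IsParallelAt Γ₂ A₂ y.2) :
    IsParallelAt (prodConn Γ₁ Γ₂) (prodForm A₁ A₂) y := by
  intro x u v
  rw [fderiv_prodForm hV₁ hV₂ h₁ h₂ hy, p₁, p₂]
  simp only [prodForm_apply, prodConn_apply]
  ring

lemma IsLeviCivitaOn.prod {V₁ V₂ : Set E} {G₁ G₂ : E → E →L[ℝ] E →L[ℝ] ℝ}
    {Γ₁ Γ₂ : E → E →L[ℝ] E →L[ℝ] E} (h₁ : IsLeviCivitaOn G₁ Γ₁ V₁) (h₂ : IsLeviCivitaOn G₂ Γ₂ V₂) :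
    IsLeviCivitaOn (prodForm G₁ G₂) (prodConn Γ₁ Γ₂) (V₁ ×ˢ V₂) := by
  refine ⟨h₁.isOpen.prod h₂.isOpen, contDiffOn_prodForm h₁.contDiffOn h₂.contDiffOn,
    contDiffOn_prodConn h₁.contDiffOn_conn h₂.contDiffOn_conn, ?_, ?_, ?_, ?_⟩
  · intro y hy u v
    simp only [prodForm_apply, h₁.symm _ hy.1 u.1, h₂.symm _ hy.2 u.2]
  · intro y hy u hu
    have a₁ : 0 ≤ G₁ y.1 u.1 u.1 := by
      by_cases h : u.1 = 0
      · simp [h]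
      · exact (h₁.pos _ hy.1 _ h).le
    have a₂ : 0 ≤ G₂ y.2 u.2 u.2 := by
      by_cases h : u.2 = 0
      · simp [h]
      · exact (h₂.pos _ hy.2 _ h).le
    rw [prodForm_apply]
    by_cases h : u.1 = 0
    · have : u.2 ≠ 0 := fun h' => hu (Prod.ext h h')
      linarith [h₂.pos _ hy.2 _ this]
    · linarith [h₁.pos _ hy.1 _ h]
  · intro y hy u v
    simp only [prodConn_apply, h₁.torsion_free _ hy.1 u.1, h₂.torsion_free _ hy.2 u.2]
  · intro y hy
    exact isParallelAt_prod h₁.isOpen h₂.isOpen h₁.contDiffOn h₂.contDiffOn hy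
      (h₁.parallel _ hy.1) (h₂.parallel _ hy.2)

/-- A product of two surfaces of constant curvature `c` in a chart centred at `q₀`, with the
pullbacks of the two area forms. -/
structure IsProductChart (G : E → E →L[ℝ] E →L[ℝ] ℝ) (Γ : E → E →L[ℝ] E →L[ℝ] E) (V : Set E)
    (W₁ W₂ : E → E →L[ℝ] E →L[ℝ] ℝ) (c : ℝ) (q₀ : E) : Prop where
  lc : IsLeviCivitaOn G Γ V
  contDiffOn₁ : ContDiffOn ℝ ∞ W₁ V
  contDiffOn₂ : ContDiffOn ℝ ∞ W₂ V
  parallel₁ : ∀ y ∈ V, IsParallelAt Γ W₁ y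
  parallel₂ : ∀ y ∈ V, IsParallelAt Γ W₂ y
  mem : q₀ ∈ V
  point : ∃ L, IsProductPoint (G q₀) (W₁ q₀) (W₂ q₀) (curvOp Γ q₀) c L

lemma IsSurfaceChart.prod {G₁ W₁ G₂ W₂ : Plane → Plane →L[ℝ] Plane →L[ℝ] ℝ}
    {Γ₁ Γ₂ : Plane → Plane →L[ℝ] Plane →L[ℝ] Plane} {V₁ V₂ : Set Plane} {c : ℝ} {y₁ y₂ : Plane}
    (h₁ : IsSurfaceChart G₁ W₁ Γ₁ V₁ c y₁) (h₂ : IsSurfaceChart G₂ W₂ Γ₂ V₂ c y₂) :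
    IsProductChart (prodForm G₁ G₂) (prodConn Γ₁ Γ₂) (V₁ ×ˢ V₂) (prodForm W₁ 0) (prodForm 0 W₂)
      c (y₁, y₂) := by
  have z₁ : ContDiffOn ℝ ∞ (0 : Plane → Plane →L[ℝ] Plane →L[ℝ] ℝ) V₁ := contDiffOn_const
  have z₂ : ContDiffOn ℝ ∞ (0 : Plane → Plane →L[ℝ] Plane →L[ℝ] ℝ) V₂ := contDiffOn_const
  have pz : ∀ (Γ : Plane → Plane →L[ℝ] Plane →L[ℝ] Plane) (y : Plane),
      IsParallelAt Γ (0 : Plane → Plane →L[ℝ] Plane →L[ℝ] ℝ) y := by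
    intro Γ y u v w
    simp
  refine ⟨h₁.lc.prod h₂.lc, contDiffOn_prodForm h₁.contDiffOn_form z₂,
    contDiffOn_prodForm z₁ h₂.contDiffOn_form, ?_, ?_, ⟨h₁.mem, h₂.mem⟩, ?_⟩
  · exact fun y hy => isParallelAt_prod h₁.lc.isOpen h₂.lc.isOpen h₁.contDiffOn_form z₂ hy
      (h₁.parallel_form hy.1) (pz _ _)
  · exact fun y hy => isParallelAt_prod h₁.lc.isOpen h₂.lc.isOpen z₁ h₂.contDiffOn_form hy
      (pz _ _) (h₂.parallel_form hy.2)
  obtain ⟨l₁, l₂, hl, hl'⟩ := h₁.exists_frame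
  obtain ⟨m₁, m₂, hm, hm'⟩ := h₂.exists_frame
  -- The oriented orthonormal coframes of the two factors, put side by side.
  let L₀ : Plane × Plane →ₗ[ℝ] FourSpace :=
    { toFun := fun u => !₂[l₁ u.1, l₂ u.1, m₁ u.2, m₂ u.2]
      map_add' := by
        intro u v
        ext i
        fin_cases i <;> simp
      map_smul' := by
        intro r u
        ext i
        fin_cases i <;> simp }
  have hG : ∀ u v, prodForm G₁ G₂ (y₁, y₂) u v = FourSpace.ip (L₀ u) (L₀ v) := by
    intro u v
    simp only [prodForm_apply, hl, hm]
    simp [L₀, FourSpace.ip]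
    ring
  have hlc := h₁.lc.prod h₂.lc
  have hinj : Function.Injective L₀ := by
    rw [injective_iff_map_eq_zero]
    intro u hu
    by_contra hne
    have := hlc.pos (y₁, y₂) ⟨h₁.mem, h₂.mem⟩ u hne
    rw [hG, hu] at this
    simp [FourSpace.ip] at this
  let L := LinearEquiv.ofInjectiveOfFinrankEq L₀ hinj (by simp)
  have hL : ∀ u, L u = L₀ u := fun u => rfl
  refine ⟨L, ?_, ?_, ?_, ?_⟩
  · intro u v
    rw [hL, hL, hG]
  · intro u v
    simp only [hL, prodForm_apply, hl']
    simp [L₀, FourSpace.a₁]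
  · intro u v
    simp only [hL, prodForm_apply, hm']
    simp [L₀, FourSpace.a₂]
  · intro u v w x
    -- The product connection and its derivative split into the two factors, so there is no mixed
    -- curvature.
    have e : curvOp (prodConn Γ₁ Γ₂) (y₁, y₂) u v w
        = (curvOp Γ₁ y₁ u.1 v.1 w.1, curvOp Γ₂ y₂ u.2 v.2 w.2) := by
      simp only [curvOp, prodConn_apply, fderiv_prodConn h₁.lc.isOpen h₂.lc.isOpen
        h₁.lc.contDiffOn_conn h₂.lc.contDiffOn_conn (y := (y₁, y₂)) ⟨h₁.mem, h₂.mem⟩]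
      rfl
    rw [e]
    simp only [prodForm_apply, h₁.curv, h₂.curv]
    simp
    ring

end ProductChart

/-! ### The index formulas for `sharp`, Christoffel symbols and curvature. -/

section Charts

variable {ι E : Type*} [Fintype ι] [DecidableEq ι] [NormedAddCommGroup E] [NormedSpace ℝ E]

omit [DecidableEq ι] in
lemma map_eq_sum_repr (b : Module.Basis ι ℝ E) (φ : E →L[ℝ] ℝ) (w : E) :
    φ w = ∑ i, b.repr w i * φ (b i) := by
  conv_lhs => rw [← b.sum_repr w]
  rw [map_sum]
  simp only [map_smul, smul_eq_mul]

omit [DecidableEq ι] in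
lemma gram_mulVec_eq {b : Module.Basis ι ℝ E} {B : E →L[ℝ] E →L[ℝ] ℝ}
    (hs : ∀ u v, B u v = B v u) (v : E) (k : ι) :
    (gram b fun u v => B u v).mulVec (b.repr v) k = B v (b k) := by
  rw [hs, map_eq_sum_repr b (B (b k)) v]
  simp [gram, Matrix.mulVec, dotProduct, mul_comm]

lemma isUnit_det_gram {b : Module.Basis ι ℝ E} {B : E →L[ℝ] E →L[ℝ] ℝ}
    (hs : ∀ u v, B u v = B v u) (hp : ∀ u, u ≠ 0 → 0 < B u u) :
    IsUnit (gram b fun u v => B u v).det := by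
  rw [isUnit_iff_ne_zero]
  intro h
  obtain ⟨x, hx, hx'⟩ := Matrix.exists_mulVec_eq_zero_iff.2 h
  set v : E := ∑ i, x i • b i with hv
  have hr : (b.repr v : ι → ℝ) = x := b.repr_sum_self x
  have hz : ∀ k, B v (b k) = 0 := fun k => by
    rw [← gram_mulVec_eq hs, hr, hx']; rfl
  have h0 : B v v = 0 := by
    rw [map_eq_sum_repr b (B v) v]
    simp [hz]
  have hv0 : v = 0 := by
    by_contra hne
    exact (hp v hne).ne' h0
  rw [hv0] at hr
  simp at hr
  exact hx hr.symm

lemma sharp_eq {b : Module.Basis ι ℝ E} {B : E →L[ℝ] E →L[ℝ] ℝ}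
    (hs : ∀ u v, B u v = B v u) (hp : ∀ u, u ≠ 0 → 0 < B u u) (v : E) :
    sharp b (fun u v => B u v) (fun w => B v w) = v := by
  have hu := isUnit_det_gram (b := b) hs hp
  have e : ∀ k, ∑ l, (gram b fun u v => B u v)⁻¹ k l * B v (b l) = b.repr v k := by
    intro k
    have h1 : (gram b fun u v => B u v)⁻¹.mulVec
        ((gram b fun u v => B u v).mulVec (b.repr v)) k = b.repr v k := by
      rw [Matrix.mulVec_mulVec, Matrix.nonsing_inv_mul _ hu, Matrix.one_mulVec]
    rw [← h1]
    simp only [Matrix.mulVec, dotProduct]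
    refine Finset.sum_congr rfl fun l _ => ?_
    congr 1
    exact (gram_mulVec_eq hs v l).symm
  simp only [sharp, ← Finset.sum_smul, e]
  exact b.sum_repr v

variable {H M : Type*} [TopologicalSpace H] {I : ModelWithCorners ℝ E H} [TopologicalSpace M]
  [ChartedSpace H M]

/-- Substituting metric compatibility for the three derivatives of the metric, torsion-freeness
cancels all terms except `⟨Γ(u, v), w⟩`. Then `sharp` inverts the metric. -/
lemma christoffel_eq {b : Module.Basis ι ℝ E} {g : TwoTensor I M} {p : M}
    {G : E → E →L[ℝ] E →L[ℝ] ℝ} {Γ : E → E →L[ℝ] E →L[ℝ] E} {V : Set E}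
    (h : IsLeviCivitaOn G Γ V) {y : E} (hy : y ∈ V)
    (hg : ∀ y ∈ V, ∀ u v, inChart g p y u v = G y u v) (u v : E) :
    christoffel b g p y u v = Γ y u v := by
  have hd := differentiableAt_of_contDiffOn h.isOpen h.contDiffOn hy
  have e : ∀ u v w, fderiv ℝ (fun z => inChart g p z u v) y w = fderiv ℝ G y w u v := by
    intro u v w
    have : (fun z => inChart g p z u v) =ᶠ[𝓝 y] fun z => G z u v :=
      Filter.eventually_of_mem (h.isOpen.mem_nhds hy) fun z hz => hg z hz u v
    rw [this.fderiv_eq, fderiv_apply_apply hd]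
  have e2 : inChart g p y = fun u v => G y u v := by
    funext u v
    exact hg y hy u v
  have e3 : (fun w => (1 / 2 : ℝ) * (fderiv ℝ (fun z => inChart g p z v w) y u
      + fderiv ℝ (fun z => inChart g p z u w) y v
      - fderiv ℝ (fun z => inChart g p z u v) y w)) = fun w => G y (Γ y u v) w := by
    funext w
    rw [e, e, e, h.parallel y hy, h.parallel y hy, h.parallel y hy,
      h.torsion_free y hy w u, h.torsion_free y hy w v, h.torsion_free y hy v u,
      h.symm y hy u (Γ y v w), h.symm y hy v (Γ y u w)]
    ring
  rw [christoffel, e2, e3]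
  exact sharp_eq (h.symm y hy) (h.pos y hy) _

lemma riemann_eq {b : Module.Basis ι ℝ E} {g : TwoTensor I M} {p : M}
    {G : E → E →L[ℝ] E →L[ℝ] ℝ} {Γ : E → E →L[ℝ] E →L[ℝ] E} {V : Set E}
    (h : IsLeviCivitaOn G Γ V) (hy : extChartAt I p p ∈ V)
    (hg : ∀ y ∈ V, ∀ u v, inChart g p y u v = G y u v) (u v w : E) :
    riemann b g p u v w = curvOp Γ (extChartAt I p p) u v w := by
  have hd := differentiableAt_of_contDiffOn h.isOpen h.contDiffOn_conn hy
  have e : ∀ u v w, fderiv ℝ (fun y => christoffel b g p y u v) (extChartAt I p p) w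
      = fderiv ℝ Γ (extChartAt I p p) w u v := by
    intro u v w
    have : (fun y => christoffel b g p y u v) =ᶠ[𝓝 (extChartAt I p p)] fun z => Γ z u v :=
      Filter.eventually_of_mem (h.isOpen.mem_nhds hy) fun z hz => christoffel_eq h hz hg u v
    rw [this.fderiv_eq, fderiv_apply_apply hd]
  simp only [riemann, e, christoffel_eq h hy hg]
  rfl

end Charts

/-! ### Riemannian surfaces in their charts. -/

section SurfaceCharts

variable {S : Type*} [TopologicalSpace S] [ChartedSpace Plane S] [IsManifold (𝓡 2) ∞ S]
  {c : ℝ} {g : SurfaceMetric S}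

lemma isLeviCivitaOn_chart (g : SurfaceMetric S) (p : S) :
    IsLeviCivitaOn (chartForm g.inner p) (leviCivita (chartForm g.inner p))
      (extChartAt (𝓡 2) p).target := by
  refine isLeviCivitaOn_leviCivita (isOpen_extChartAt_target p)
    (contDiffOn_chartForm g.contMDiff p) ?_ ?_
  · intro y _ u v
    exact g.symm _ _ _
  · intro y hy u hu
    refine g.pos _ _ fun h => hu ?_
    exact injective_mfderiv_extChartAt_symm p hy (h.trans (map_zero _).symm)

set_option maxHeartbeats 800000 in
-- The curvature hypothesis refers to each point in its own preferred chart, so only the centre of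
-- the chart is covered here. Other points are reached in `isSurfaceChart_chart_of_mem`.
lemma isSurfaceChart_chart (hg : HasConstantCurvature planeBasis (metricTensor g) c)
    (σ : VolumeForm g) (p : S) :
    IsSurfaceChart (chartForm g.inner p) (chartForm σ.form p) (leviCivita (chartForm g.inner p))
      (extChartAt (𝓡 2) p).target c (extChartAt (𝓡 2) p p) := by
  have hlc := isLeviCivitaOn_chart g p
  refine ⟨hlc, contDiffOn_chartForm σ.contMDiff p, fun y _ v => σ.alternating _ _,
    fun y _ u v => σ.sq_eq _ _ _, mem_extChartAt_target p, fun u v => ?_⟩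
  have e : ∀ u v, chartForm g.inner p (extChartAt (𝓡 2) p p) u v = metricTensor g p u v := fun u v =>
    inChart_self (metricTensor g) p u v
  have := hg p u v
  rw [riemann_eq hlc (mem_extChartAt_target p) (fun y _ u v => rfl)] at this
  rw [e, e, e, e]
  exact this

lemma hasMFDerivAt_extChartAt_symm (p : S) {y : Plane} (hy : y ∈ (extChartAt (𝓡 2) p).target) :
    HasMFDerivAt 𝓘(ℝ, Plane) (𝓡 2) (extChartAt (𝓡 2) p).symm y
      (mfderiv 𝓘(ℝ, Plane) (𝓡 2) (extChartAt (𝓡 2) p).symm y) :=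
  (((contMDiffOn_extChartAt_symm (n := ∞) p).contMDiffAt
    ((isOpen_extChartAt_target p).mem_nhds hy)).mdifferentiableAt (by simp)).hasMFDerivAt

end SurfaceCharts

/-! ### The product metric in product charts. -/

section ProductCharts

variable {S₁ S₂ : Type*}
    [TopologicalSpace S₁] [ChartedSpace Plane S₁] [IsManifold (𝓡 2) ∞ S₁]
    [TopologicalSpace S₂] [ChartedSpace Plane S₂] [IsManifold (𝓡 2) ∞ S₂]

omit [IsManifold (𝓡 2) ∞ S₁] [IsManifold (𝓡 2) ∞ S₂] in
lemma target_prod (q : S₁ × S₂) : (extChartAt ((𝓡 2).prod (𝓡 2)) q).target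
    = (extChartAt (𝓡 2) q.1).target ×ˢ (extChartAt (𝓡 2) q.2).target := by
  rw [extChartAt_prod]
  rfl

lemma mfderiv_extChartAt_prod_symm (q : S₁ × S₂) {y : Plane × Plane}
    (hy : y ∈ (extChartAt ((𝓡 2).prod (𝓡 2)) q).target) (u : Plane × Plane) :
    mfderiv 𝓘(ℝ, Plane × Plane) ((𝓡 2).prod (𝓡 2)) (extChartAt ((𝓡 2).prod (𝓡 2)) q).symm y u
      = (mfderiv 𝓘(ℝ, Plane) (𝓡 2) (extChartAt (𝓡 2) q.1).symm y.1 u.1,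
        mfderiv 𝓘(ℝ, Plane) (𝓡 2) (extChartAt (𝓡 2) q.2).symm y.2 u.2) := by
  rw [target_prod] at hy
  have f1 : HasMFDerivAt 𝓘(ℝ, Plane × Plane) 𝓘(ℝ, Plane) Prod.fst y
      (ContinuousLinearMap.fst ℝ Plane Plane) :=
    (hasFDerivAt_fst (𝕜 := ℝ) (p := y)).hasMFDerivAt
  have f2 : HasMFDerivAt 𝓘(ℝ, Plane × Plane) 𝓘(ℝ, Plane) Prod.snd y
      (ContinuousLinearMap.snd ℝ Plane Plane) :=
    (hasFDerivAt_snd (𝕜 := ℝ) (p := y)).hasMFDerivAt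
  have := ((hasMFDerivAt_extChartAt_symm q.1 hy.1).comp y f1).prodMk ((hasMFDerivAt_extChartAt_symm q.2 hy.2).comp y f2)
  have e : (extChartAt ((𝓡 2).prod (𝓡 2)) q).symm
      = fun z => (((extChartAt (𝓡 2) q.1).symm ∘ Prod.fst) z,
        ((extChartAt (𝓡 2) q.2).symm ∘ Prod.snd) z) := by
    rw [extChartAt_prod]
    rfl
  rw [e, this.mfderiv]
  rfl

/-- The product metric in the chart at `q`. -/
def chartMetric (g₁ : SurfaceMetric S₁) (g₂ : SurfaceMetric S₂) (q : S₁ × S₂) :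
    Plane × Plane → Plane × Plane →L[ℝ] Plane × Plane →L[ℝ] ℝ :=
  prodForm (chartForm g₁.inner q.1) (chartForm g₂.inner q.2)

/-- The Levi-Civita connection of the product metric in the chart at `q`. -/
def chartConn (g₁ : SurfaceMetric S₁) (g₂ : SurfaceMetric S₂) (q : S₁ × S₂) :
    Plane × Plane → Plane × Plane →L[ℝ] Plane × Plane →L[ℝ] Plane × Plane :=
  prodConn (leviCivita (chartForm g₁.inner q.1)) (leviCivita (chartForm g₂.inner q.2))

lemma isLeviCivitaOn_chartMetric (g₁ : SurfaceMetric S₁) (g₂ : SurfaceMetric S₂) (q : S₁ × S₂) :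
    IsLeviCivitaOn (chartMetric g₁ g₂ q) (chartConn g₁ g₂ q)
      (extChartAt ((𝓡 2).prod (𝓡 2)) q).target := by
  rw [target_prod]
  exact (isLeviCivitaOn_chart g₁ q.1).prod (isLeviCivitaOn_chart g₂ q.2)

lemma inChart_productTensor (α₁ : (p : S₁) → TangentSpace (𝓡 2) p →L[ℝ] TangentSpace (𝓡 2) p →L[ℝ] ℝ)
    (α₂ : (p : S₂) → TangentSpace (𝓡 2) p →L[ℝ] TangentSpace (𝓡 2) p →L[ℝ] ℝ) (q : S₁ × S₂)
    {y : Plane × Plane} (hy : y ∈ (extChartAt ((𝓡 2).prod (𝓡 2)) q).target) (u v : Plane × Plane) :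
    inChart (productTensor (fun p u v => α₁ p u v) fun p u v => α₂ p u v) q y u v
      = prodForm (chartForm α₁ q.1) (chartForm α₂ q.2) y u v := by
  simp only [inChart, productTensor, mfderiv_extChartAt_prod_symm q hy]
  rw [extChartAt_prod]
  rfl

end ProductCharts

/-! ### Behaviour of covariant derivatives and curvature under changes of coordinates. -/

section Covariance

variable {E E' P Z : Type*} [NormedAddCommGroup E] [NormedSpace ℝ E]
  [NormedAddCommGroup E'] [NormedSpace ℝ E'] [NormedAddCommGroup P] [NormedSpace ℝ P]
  [NormedAddCommGroup Z] [NormedSpace ℝ Z]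

/-- The law of transformation of Christoffel symbols under the change of coordinates `τ`. -/
def IsConnMapAt (Γ : E → E →L[ℝ] E →L[ℝ] E) (Γ' : E' → E' →L[ℝ] E' →L[ℝ] E') (τ : E → E')
    (y : E) : Prop :=
  ∀ u v, fderiv ℝ τ y (Γ y u v) = Γ' (τ y) (fderiv ℝ τ y u) (fderiv ℝ τ y v)
    + fderiv ℝ (fderiv ℝ τ) y u v

/-- The second derivative of `τ` produced by the chain rule is the inhomogeneous term in the
transformation law of the Christoffel symbols. -/
lemma covDeriv_comp {Γ : E → E →L[ℝ] E →L[ℝ] E} {Γ' : E' → E' →L[ℝ] E' →L[ℝ] E'} {τ : E → E'}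
    {φ Y : Z → E} {z : Z} (hτ : ContDiffAt ℝ ∞ τ (φ z)) (h : IsConnMapAt Γ Γ' τ (φ z))
    (hφ : DifferentiableAt ℝ φ z) (hY : DifferentiableAt ℝ Y z) (ξ : Z) :
    covDeriv Γ' (fun x => τ (φ x)) ξ (fun x => fderiv ℝ τ (φ x) (Y x)) z
      = fderiv ℝ τ (φ z) (covDeriv Γ φ ξ Y z) := by
  have h1 : HasFDerivAt τ (fderiv ℝ τ (φ z)) (φ z) := (hτ.differentiableAt (by simp)).hasFDerivAt
  have h2 : HasFDerivAt (fderiv ℝ τ) (fderiv ℝ (fderiv ℝ τ) (φ z)) (φ z) :=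
    ((hτ.fderiv_right (m := ∞) infty_add_one_le).differentiableAt (by simp)).hasFDerivAt
  have e1 : fderiv ℝ (fun x => τ (φ x)) z = fderiv ℝ τ (φ z) ∘L fderiv ℝ φ z :=
    (HasFDerivAt.comp (g := τ) (f := φ) z h1 hφ.hasFDerivAt).fderiv
  have e2 := ((HasFDerivAt.comp (g := fderiv ℝ τ) (f := φ) z h2 hφ.hasFDerivAt).clm_apply
    hY.hasFDerivAt).fderiv
  have e3 : fderiv ℝ (fun x => fderiv ℝ τ (φ x) (Y x)) z = _ := e2
  have h3 := h (fderiv ℝ φ z ξ) (Y z)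
  simp only [covDeriv, e1, e3, map_add, h3]
  simp
  abel

lemma curvOp_comp {Γ : E → E →L[ℝ] E →L[ℝ] E} {Γ' : E' → E' →L[ℝ] E' →L[ℝ] E'} {τ : E → E'}
    {U : Set E} {V' : Set E'} (hU : IsOpen U) (hΓ : ContDiffOn ℝ ∞ Γ U) (hV' : IsOpen V')
    (hΓ' : ContDiffOn ℝ ∞ Γ' V') (hτ : ContDiffOn ℝ ∞ τ U) (hm : Set.MapsTo τ U V')
    (h : ∀ y ∈ U, IsConnMapAt Γ Γ' τ y) {y : E} (hy : y ∈ U) (u v w : E) :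
    fderiv ℝ τ y (curvOp Γ y u v w)
      = curvOp Γ' (τ y) (fderiv ℝ τ y u) (fderiv ℝ τ y v) (fderiv ℝ τ y w) := by
  have hid : ContDiffOn ℝ ∞ (fun x : E => x) U := contDiffOn_id
  have hmid : Set.MapsTo (fun x : E => x) U U := fun x hx => hx
  have hw : ContDiffOn ℝ ∞ (fun _ : E => w) U := contDiffOn_const
  have hτw : ContDiffOn ℝ ∞ (fun x => fderiv ℝ τ x w) U := contDiffOn_partialD hU hτ w
  have c1 := covDeriv_commutator hU hΓ hU hid hmid hw hy v u
  -- Here `τ` itself is the map and its derivative in direction `w` the field along it. Comparing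
  -- with the commutator for the identity map in `c1` transports the curvature.
  have c2 := covDeriv_commutator hV' hΓ' hU hτ hm hτw hy v u
  have k1 : ∀ ξ, ∀ x ∈ U, covDeriv Γ' τ ξ (fun x => fderiv ℝ τ x w) x
      = fderiv ℝ τ x (covDeriv Γ (fun x => x) ξ (fun _ => w) x) := fun ξ x hx =>
    covDeriv_comp (φ := fun x => x) (hτ.contDiffAt (hU.mem_nhds hx)) (h x hx)
      differentiableAt_id (differentiableAt_const w) ξ
  have k2 : ∀ ξ ζ, covDeriv Γ' τ ζ (covDeriv Γ' τ ξ (fun x => fderiv ℝ τ x w)) y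
      = fderiv ℝ τ y (covDeriv Γ (fun x => x) ζ (covDeriv Γ (fun x => x) ξ (fun _ => w)) y) := by
    intro ξ ζ
    rw [← covDeriv_comp (φ := fun x : E => x) (hτ.contDiffAt (hU.mem_nhds hy)) (h y hy)
      differentiableAt_id (differentiableAt_of_contDiffOn hU
        (contDiffOn_covDeriv hΓ hU hid hmid hw ξ) hy) ζ]
    exact covDeriv_congr (Filter.eventually_of_mem (hU.mem_nhds hy) (k1 ξ)) ζ
  rw [k2, k2, c1, map_add] at c2
  simpa [partialD] using c2

/-- The covariant Hessian under changes of the coordinates of the source and of the target. -/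
lemma covX_comp {Γ : E → E →L[ℝ] E →L[ℝ] E} {Γ' : E' → E' →L[ℝ] E' →L[ℝ] E'} {τ : E → E'}
    {φ : P → E} {σ : Z → P} {z : Z} (hτ : ContDiffAt ℝ ∞ τ (φ (σ z)))
    (h : IsConnMapAt Γ Γ' τ (φ (σ z))) (hφ : ContDiffAt ℝ ∞ φ (σ z)) (hσ : ContDiffAt ℝ ∞ σ z)
    (ξ ζ : Z) :
    covX Γ' (fun x => τ (φ (σ x))) ξ ζ z
      = fderiv ℝ τ (φ (σ z)) (covX Γ φ (fderiv ℝ σ z ξ) (fderiv ℝ σ z ζ) (σ z)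
          + fderiv ℝ φ (σ z) (fderiv ℝ (fderiv ℝ σ) z ξ ζ)) := by
  have hψ : ContDiffAt ℝ ∞ (fun x => φ (σ x)) z := hφ.comp z hσ
  have e1 : (partialD (fun x => τ (φ (σ x))) ζ) =ᶠ[𝓝 z]
      fun x => fderiv ℝ τ (φ (σ x)) (fderiv ℝ φ (σ x) (fderiv ℝ σ x ζ)) := by
    have b1 : ∀ᶠ x in 𝓝 z, ContDiffAt ℝ 2 σ x := (hσ.of_le two_le_infty).eventually (by simp)
    have b2 : ∀ᶠ x in 𝓝 z, ContDiffAt ℝ 2 φ (σ x) :=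
      hσ.continuousAt.eventually ((hφ.of_le two_le_infty).eventually (by simp))
    have b3 : ∀ᶠ x in 𝓝 z, ContDiffAt ℝ 2 τ (φ (σ x)) :=
      hψ.continuousAt.eventually ((hτ.of_le two_le_infty).eventually (by simp))
    filter_upwards [b1, b2, b3] with x h1 h2 h3
    have := (h3.differentiableAt (by simp)).hasFDerivAt.comp x
      ((h2.differentiableAt (by simp)).hasFDerivAt.comp x
        (h1.differentiableAt (by simp)).hasFDerivAt)
    have e : fderiv ℝ (fun x => τ (φ (σ x))) x = _ := this.fderiv
    simp only [partialD, e]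
    rfl
  have hY1 : DifferentiableAt ℝ (fun x => fderiv ℝ φ (σ x)) z :=
    DifferentiableAt.comp (g := fderiv ℝ φ) (f := σ) z
      ((hφ.fderiv_right (m := ∞) infty_add_one_le).differentiableAt (by simp))
      (hσ.differentiableAt (by simp))
  have hS2 := (hσ.fderiv_right (m := ∞) infty_add_one_le).differentiableAt (by simp)
  have hφ2 := (hφ.fderiv_right (m := ∞) infty_add_one_le).differentiableAt (by simp)
  have hY2 : DifferentiableAt ℝ (fun x => fderiv ℝ σ x ζ) z := hS2.clm_apply (differentiableAt_const ζ)
  have e2 := covDeriv_comp (φ := fun x => φ (σ x)) (ξ := ξ) hτ h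
    (hψ.differentiableAt (by simp)) (hY1.clm_apply hY2)
  unfold covX
  rw [covDeriv_congr e1, e2]
  congr 1
  have e3 : fderiv ℝ (fun x => φ (σ x)) z = fderiv ℝ φ (σ z) ∘L fderiv ℝ σ z :=
    (HasFDerivAt.comp (g := φ) (f := σ) z (hφ.differentiableAt (by simp)).hasFDerivAt
      (hσ.differentiableAt (by simp)).hasFDerivAt).fderiv
  have e4 : fderiv ℝ (fun x => fderiv ℝ φ (σ x)) z = fderiv ℝ (fderiv ℝ φ) (σ z) ∘L fderiv ℝ σ z :=
    (HasFDerivAt.comp (g := fderiv ℝ φ) (f := σ) z hφ2.hasFDerivAt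
      (hσ.differentiableAt (by simp)).hasFDerivAt).fderiv
  have e5 := (hY1.hasFDerivAt.clm_apply hY2.hasFDerivAt).fderiv
  have e6 := (hS2.hasFDerivAt.clm_apply (hasFDerivAt_const ζ z)).fderiv
  have e7 : fderiv ℝ (partialD φ (fderiv ℝ σ z ζ)) (σ z) (fderiv ℝ σ z ξ)
      = fderiv ℝ (fderiv ℝ φ) (σ z) (fderiv ℝ σ z ξ) (fderiv ℝ σ z ζ) := by
    have := (hφ2.hasFDerivAt.clm_apply (hasFDerivAt_const (fderiv ℝ σ z ζ) (σ z))).fderiv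
    have e : fderiv ℝ (partialD φ (fderiv ℝ σ z ζ)) (σ z) = _ := this
    rw [e]
    simp
  simp only [covDeriv, e7, e5, e3, e6, e4]
  simp [partialD]
  abel

lemma isConnMapAt_id (Γ : E → E →L[ℝ] E →L[ℝ] E) (y : E) : IsConnMapAt Γ Γ (fun x => x) y := by
  intro u v
  have e : fderiv ℝ (fun x : E => x) = fun _ => ContinuousLinearMap.id ℝ E := by
    funext x
    exact fderiv_fun_id
  simp [e]

end Covariance

/-! ### Transition maps between charts. -/

section Transition

variable {E H M : Type*} [NormedAddCommGroup E] [NormedSpace ℝ E] [TopologicalSpace H]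
  {I : ModelWithCorners ℝ E H} [TopologicalSpace M] [ChartedSpace H M]

variable (I) in
/-- The domain of the change of coordinates from the chart at `p` to the chart at `p'`. -/
def transDom (p p' : M) : Set E :=
  (extChartAt I p).target ∩ (extChartAt I p).symm ⁻¹' (extChartAt I p').source

variable (I) in
/-- The change of coordinates from the chart at `p` to the chart at `p'`. -/
def transMap (p p' : M) (y : E) : E := extChartAt I p' ((extChartAt I p).symm y)

lemma transMap_mem {p p' : M} {y : E} (hy : y ∈ transDom I p p') :
    transMap I p p' y ∈ (extChartAt I p').target := (extChartAt I p').map_source hy.2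

lemma symm_transMap {p p' : M} {y : E} (hy : y ∈ transDom I p p') :
    (extChartAt I p').symm (transMap I p p' y) = (extChartAt I p).symm y :=
  (extChartAt I p').left_inv hy.2

variable [IsManifold I ∞ M] [I.Boundaryless]

omit [IsManifold I ∞ M] in
lemma isOpen_transDom (p p' : M) : IsOpen (transDom I p p') :=
  (continuousOn_extChartAt_symm p).isOpen_inter_preimage (isOpen_extChartAt_target p)
    (isOpen_extChartAt_source p')

omit [I.Boundaryless] in
lemma contDiffOn_transMap (p p' : M) : ContDiffOn ℝ ∞ (transMap I p p') (transDom I p p') := by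
  rw [← contMDiffOn_iff_contDiffOn]
  exact (contMDiffOn_extChartAt (I := I) (n := ∞) (x := p')).comp
    ((contMDiffOn_extChartAt_symm (n := ∞) p).mono fun y hy => hy.1)
    fun y hy => by simpa using hy.2

lemma mfderiv_symm_transMap {p p' : M} {y : E} (hy : y ∈ transDom I p p') (u : E) :
    mfderiv 𝓘(ℝ, E) I (extChartAt I p).symm y u
      = mfderiv 𝓘(ℝ, E) I (extChartAt I p').symm (transMap I p p' y)
        (fderiv ℝ (transMap I p p') y u) := by
  have h1 : MDifferentiableAt 𝓘(ℝ, E) I (extChartAt I p').symm (transMap I p p' y) :=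
    ((contMDiffOn_extChartAt_symm (n := ∞) p').contMDiffAt
      ((isOpen_extChartAt_target p').mem_nhds (transMap_mem hy))).mdifferentiableAt (by simp)
  have h2 := (differentiableAt_of_contDiffOn (isOpen_transDom p p')
    (contDiffOn_transMap p p') hy).hasFDerivAt.hasMFDerivAt
  have h3 := (HasMFDerivAt.comp y h1.hasMFDerivAt h2).mfderiv
  have h4 : (extChartAt I p).symm =ᶠ[𝓝 y] (extChartAt I p').symm ∘ transMap I p p' :=
    Filter.eventually_of_mem ((isOpen_transDom p p').mem_nhds hy)
      fun z hz => (symm_transMap hz).symm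
  rw [h4.mfderiv_eq]
  exact DFunLike.congr_fun h3 u

lemma fderiv_transMap_injective {p p' : M} {y : E} (hy : y ∈ transDom I p p') :
    Function.Injective (fderiv ℝ (transMap I p p') y) := by
  rw [injective_iff_map_eq_zero]
  intro u hu
  refine injective_mfderiv_extChartAt_symm p hy.1
    ((mfderiv_symm_transMap hy u).trans (Eq.trans ?_ (map_zero _).symm))
  exact (congrArg _ hu).trans (map_zero _)

lemma fderiv_transMap_surjective [FiniteDimensional ℝ E] {p p' : M} {y : E}
    (hy : y ∈ transDom I p p') : Function.Surjective (fderiv ℝ (transMap I p p') y) :=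
  LinearMap.surjective_of_injective (f := (fderiv ℝ (transMap I p p') y : E →ₗ[ℝ] E))
    (fderiv_transMap_injective hy)

lemma inChart_transMap (α : TwoTensor I M) {p p' : M} {y : E} (hy : y ∈ transDom I p p')
    (u v : E) : inChart α p y u v = inChart α p' (transMap I p p' y)
      (fderiv ℝ (transMap I p p') y u) (fderiv ℝ (transMap I p p') y v) := by
  simp only [inChart, mfderiv_symm_transMap hy]
  rw [symm_transMap hy]

lemma isConnMapAt_transMap [FiniteDimensional ℝ E] {α : TwoTensor I M} {p p' : M}
    {G G' : E → E →L[ℝ] E →L[ℝ] ℝ} {Γ Γ' : E → E →L[ℝ] E →L[ℝ] E}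
    (h : IsLeviCivitaOn G Γ (extChartAt I p).target)
    (h' : IsLeviCivitaOn G' Γ' (extChartAt I p').target)
    (hG : ∀ y ∈ (extChartAt I p).target, ∀ u v, inChart α p y u v = G y u v)
    (hG' : ∀ y ∈ (extChartAt I p').target, ∀ u v, inChart α p' y u v = G' y u v)
    {y : E} (hy : y ∈ transDom I p p') : IsConnMapAt Γ Γ' (transMap I p p') y := by
  refine h.conn_comp h' hy.1 (transMap_mem hy)
    ((contDiffOn_transMap p p').contDiffAt ((isOpen_transDom p p').mem_nhds hy)) ?_
    (fderiv_transMap_surjective hy)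
  refine Filter.eventually_of_mem ((isOpen_transDom p p').mem_nhds hy) fun z hz u v => ?_
  rw [← hG z hz.1, ← hG' _ (transMap_mem hz), inChart_transMap α hz]

end Transition

/-! ### Constant curvature away from the centre of a chart. -/

section ConstantCurvature

variable {S : Type*} [TopologicalSpace S] [ChartedSpace Plane S] [IsManifold (𝓡 2) ∞ S]
  {c : ℝ} {g : SurfaceMetric S}

/-- The point with coordinates `y` is the centre of its own preferred chart, where the curvature is
known; the transition map carries curvature and metric over. -/
lemma isSurfaceChart_chart_of_mem (hg : HasConstantCurvature planeBasis (metricTensor g) c)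
    (σ : VolumeForm g) (p : S) {y : Plane} (hy : y ∈ (extChartAt (𝓡 2) p).target) :
    IsSurfaceChart (chartForm g.inner p) (chartForm σ.form p) (leviCivita (chartForm g.inner p))
      (extChartAt (𝓡 2) p).target c y := by
  have h := isSurfaceChart_chart hg σ p
  refine ⟨h.lc, h.contDiffOn_form, h.alternating, h.sq_eq, hy, fun u v => ?_⟩
  set p' := (extChartAt (𝓡 2) p).symm y with hp'
  have h' := isSurfaceChart_chart hg σ p'
  have hyd : y ∈ transDom (𝓡 2) p p' := ⟨hy, mem_extChartAt_source p'⟩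
  have hG : ∀ z ∈ transDom (𝓡 2) p p', ∀ u v, chartForm g.inner p z u v
      = chartForm g.inner p' (transMap (𝓡 2) p p' z) (fderiv ℝ (transMap (𝓡 2) p p') z u)
        (fderiv ℝ (transMap (𝓡 2) p p') z v) := fun z hz u v =>
    inChart_transMap (metricTensor g) hz u v
  have hc := curvOp_comp (isOpen_transDom p p') (h.lc.contDiffOn_conn.mono fun z hz => hz.1)
    h'.lc.isOpen h'.lc.contDiffOn_conn (contDiffOn_transMap p p') (fun z hz => transMap_mem hz)
    (fun z hz => isConnMapAt_transMap (α := metricTensor g) h.lc h'.lc (fun _ _ _ _ => rfl)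
      (fun _ _ _ _ => rfl) hz) hyd
  rw [hG y hyd, hG y hyd, hG y hyd, hG y hyd, hc]
  exact h'.curv_diag _ _

end ConstantCurvature

/-! ### The product chart, for both orientations of the second factor. -/

section ProductCurvature

variable {S₁ S₂ : Type*}
    [TopologicalSpace S₁] [ChartedSpace Plane S₁] [IsManifold (𝓡 2) ∞ S₁]
    [TopologicalSpace S₂] [ChartedSpace Plane S₂] [IsManifold (𝓡 2) ∞ S₂]

lemma isProductChart_chart {c : ℝ} {g₁ : SurfaceMetric S₁} {g₂ : SurfaceMetric S₂}
    (hg₁ : HasConstantCurvature planeBasis (metricTensor g₁) c)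
    (hg₂ : HasConstantCurvature planeBasis (metricTensor g₂) c)
    (ω₁ : VolumeForm g₁) (ω₂ : VolumeForm g₂) (q : S₁ × S₂) {y : Plane × Plane}
    (hy : y ∈ (extChartAt ((𝓡 2).prod (𝓡 2)) q).target) :
    IsProductChart (chartMetric g₁ g₂ q) (chartConn g₁ g₂ q)
        (extChartAt ((𝓡 2).prod (𝓡 2)) q).target (prodForm (chartForm ω₁.form q.1) 0)
        (prodForm 0 (chartForm ω₂.form q.2)) c y ∧
      IsProductChart (chartMetric g₁ g₂ q) (chartConn g₁ g₂ q)
        (extChartAt ((𝓡 2).prod (𝓡 2)) q).target (prodForm (chartForm ω₁.form q.1) 0)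
        (prodForm 0 (-chartForm ω₂.form q.2)) c y := by
  rw [target_prod] at hy ⊢
  have h₁ := isSurfaceChart_chart_of_mem hg₁ ω₁ q.1 hy.1
  have h₂ := isSurfaceChart_chart_of_mem hg₂ ω₂ q.2 hy.2
  exact ⟨h₁.prod h₂, h₁.prod h₂.neg⟩

end ProductCurvature

/-! ### The mean curvature vector as a trace, modulo tangential vectors. -/

section MeanCurvatureAlgebra

variable {E : Type*} [NormedAddCommGroup E] [NormedSpace ℝ E]

lemma sharp_planeBasis_spec {B : Plane →L[ℝ] Plane →L[ℝ] ℝ} (hs : ∀ u v, B u v = B v u)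
    (hp : ∀ u, u ≠ 0 → 0 < B u u) (φ : Plane →L[ℝ] ℝ) (w : Plane) :
    B (sharp planeBasis (fun u v => B u v) fun w => φ w) w = φ w := by
  obtain ⟨e, he⟩ := isInvertible_of_pos hp
  have h1 : (fun w => φ w) = fun w => B (e.symm φ) w := by
    funext w
    rw [← he]
    simp
  rw [h1, sharp_eq hs hp, ← he]
  simp

/-- The mean curvature vector, in terms of the second derivatives `X` and the differential `D`. -/
def meanCurvatureOf (G : E →L[ℝ] E →L[ℝ] ℝ) (D : Plane →L[ℝ] E) (X : Plane → Plane → E) : E :=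
  ∑ i, ∑ j, (gram planeBasis fun u v => G (D u) (D v))⁻¹ i j •
    (X (planeBasis i) (planeBasis j) - D (sharp planeBasis (fun u v => G (D u) (D v))
      fun w => G (X (planeBasis i) (planeBasis j)) (D w)))

variable {G : E →L[ℝ] E →L[ℝ] ℝ} (hs : ∀ u v, G u v = G v u) (hp : ∀ u, u ≠ 0 → 0 < G u u)
  {D : Plane →L[ℝ] E} (hD : Function.Injective D)

include hs hp hD

lemma meanCurvatureOf_normal (X : Plane → Plane → E) (u : Plane) :
    G (meanCurvatureOf G D X) (D u) = 0 := by
  let B : Plane →L[ℝ] Plane →L[ℝ] ℝ := G.bilinearComp D D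
  have hBs : ∀ u v, B u v = B v u := fun u v => hs _ _
  have hBp : ∀ u, u ≠ 0 → 0 < B u u := fun u hu => hp _ fun h => hu (hD (h.trans (map_zero D).symm))
  have key : ∀ V : E, G (V - D (sharp planeBasis (fun u v => G (D u) (D v))
      fun w => G V (D w))) (D u) = 0 := by
    intro V
    have := sharp_planeBasis_spec hBs hBp (G V ∘L D) u
    rw [map_sub, sub_apply, sub_eq_zero]
    exact this.symm
  simp only [meanCurvatureOf, map_sum, map_smul, sum_apply, smul_apply, key, smul_zero,
    Finset.sum_const_zero]

/-- In a pair `u, v` both the Gram determinant and the trace scale by the square of the determinant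
of `u, v`, so the standard basis may be replaced by any pair. Degenerate pairs are harmless because
nothing is divided. -/
lemma meanCurvatureOf_eq (X : Plane →L[ℝ] Plane →L[ℝ] E) (hX : ∀ u v, X u v = X v u)
    (u v : Plane) : ∃ a : Plane,
    (G (D u) (D u) * G (D v) (D v) - G (D u) (D v) ^ 2) • meanCurvatureOf G D (fun u v => X u v)
      = G (D v) (D v) • X u u + (-2 * G (D u) (D v)) • X u v + G (D u) (D u) • X v v + D a := by
  set e := planeBasis 0 with he
  set f := planeBasis 1 with hf
  set A := G (D e) (D e) with hA
  set B := G (D e) (D f) with hB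
  set C := G (D f) (D f) with hC
  have hdet : 0 < A * C - B ^ 2 := by
    refine gram_det_pos hs hp fun a b hab => planeBasis_linearIndependent (hD ?_)
    rw [D.map_zero, ← hab, D.map_add, D.map_smul, D.map_smul]
  set m := A * C - B ^ 2 with hm
  have hgd : (gram planeBasis fun u v => G (D u) (D v)).det = m := by
    rw [Matrix.det_fin_two]
    simp only [gram, Matrix.of_apply, ← he, ← hf, ← hA, ← hC, hs (D f) (D e), ← hB, hm]
    ring
  have hinv : (gram planeBasis fun u v => G (D u) (D v))⁻¹
      = !![m⁻¹ * C, -(m⁻¹ * B); -(m⁻¹ * B), m⁻¹ * A] := by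
    rw [Matrix.inv_def, hgd, Matrix.adjugate_fin_two, Ring.inverse_eq_inv']
    ext i j
    fin_cases i <;> fin_cases j <;>
      simp [gram, ← he, ← hf, ← hA, ← hC, hs (D f) (D e), ← hB]
  set T : Plane → Plane → Plane := fun u v => sharp planeBasis (fun u v => G (D u) (D v))
      fun w => G (X u v) (D w) with hT
  have h1 : m • meanCurvatureOf G D (fun u v => X u v)
      = C • (X e e - D (T e e)) + (-B) • (X e f - D (T e f)) + (-B) • (X e f - D (T f e))
        + A • (X f f - D (T f f)) := by
    simp only [meanCurvatureOf, hinv, Fin.sum_univ_two, ← he, ← hf]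
    simp only [Matrix.of_apply, Matrix.cons_val', Matrix.cons_val_zero, Matrix.cons_val_one,
      Matrix.cons_val_fin_one]
    rw [hX f e]
    simp only [smul_add, smul_smul]
    have e1 : m * (m⁻¹ * C) = C := by field_simp
    have e2 : m * (m⁻¹ * A) = A := by field_simp
    have e3 : m * -(m⁻¹ * B) = -B := by field_simp
    rw [e1, e2, e3]
    simp only [hT, hX f e]
    abel
  have hu := plane_eq u
  have hv := plane_eq v
  rw [← he, ← hf] at hu hv
  set a := u 0
  set b := u 1
  set c := v 0
  set d := v 1
  have g1 : G (D u) (D u) = a ^ 2 * A + 2 * a * b * B + b ^ 2 * C := by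
    rw [hu]
    simp only [map_add, map_smul, add_apply, smul_apply, smul_eq_mul, hs (D f) (D e), ← hA, ← hB,
      ← hC]
    ring
  have g2 : G (D v) (D v) = c ^ 2 * A + 2 * c * d * B + d ^ 2 * C := by
    rw [hv]
    simp only [map_add, map_smul, add_apply, smul_apply, smul_eq_mul, hs (D f) (D e), ← hA, ← hB,
      ← hC]
    ring
  have g3 : G (D u) (D v) = a * c * A + (a * d + b * c) * B + b * d * C := by
    rw [hu, hv]
    simp only [map_add, map_smul, add_apply, smul_apply, smul_eq_mul, hs (D f) (D e), ← hA, ← hB,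
      ← hC]
    ring
  have x1 : X u u = a ^ 2 • X e e + (2 * a * b) • X e f + b ^ 2 • X f f := by
    rw [hu]
    simp only [map_add, map_smul, add_apply, smul_apply, hX f e]
    module
  have x2 : X v v = c ^ 2 • X e e + (2 * c * d) • X e f + d ^ 2 • X f f := by
    rw [hv]
    simp only [map_add, map_smul, add_apply, smul_apply, hX f e]
    module
  have x3 : X u v = (a * c) • X e e + (a * d + b * c) • X e f + (b * d) • X f f := by
    rw [hu, hv]
    simp only [map_add, map_smul, add_apply, smul_apply, hX f e]
    module
  -- The tangential projections subtracted in the mean curvature vector, traced in the standard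
  -- basis and scaled by the squared determinant of `u, v`.
  refine ⟨(-(a * d - b * c) ^ 2) • (C • T e e - B • T e f - B • T f e + A • T f f), ?_⟩
  have e0 : G (D u) (D u) * G (D v) (D v) - G (D u) (D v) ^ 2 = (a * d - b * c) ^ 2 * m := by
    rw [g1, g2, g3, hm]
    ring
  rw [e0, mul_smul, h1, x1, x2, x3, g1, g2, g3]
  simp only [map_smul, map_add, map_sub]
  module

end MeanCurvatureAlgebra

/-! ### Coordinate expressions of maps between manifolds. -/

section MapsInCharts

variable {E H M : Type*}
  [NormedAddCommGroup E] [NormedSpace ℝ E] [TopologicalSpace H] {I : ModelWithCorners ℝ E H}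
  [TopologicalSpace M] [ChartedSpace H M]
  {E' H' N : Type*}
  [NormedAddCommGroup E'] [NormedSpace ℝ E'] [TopologicalSpace H']
  {I' : ModelWithCorners ℝ E' H'}
  [TopologicalSpace N] [ChartedSpace H' N]

variable (I I') in
/-- The coordinate expression of a map. -/
def mapInChart (F : N → M) (p : N) (q : M) (y : E') : E :=
  extChartAt I q (F ((extChartAt I' p).symm y))

variable (I I') in
/-- The domain of the coordinate expression of a map. -/
def mapDom (F : N → M) (p : N) (q : M) : Set E' :=
  (extChartAt I' p).target ∩ (extChartAt I' p).symm ⁻¹' (F ⁻¹' (extChartAt I q).source)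

variable {F : N → M} {p : N} {q : M}

lemma mapInChart_mem {y : E'} (hy : y ∈ mapDom I I' F p q) :
    mapInChart I I' F p q y ∈ (extChartAt I q).target := (extChartAt I q).map_source hy.2

lemma symm_mapInChart {y : E'} (hy : y ∈ mapDom I I' F p q) :
    (extChartAt I q).symm (mapInChart I I' F p q y) = F ((extChartAt I' p).symm y) :=
  (extChartAt I q).left_inv hy.2

lemma isOpen_mapDom [I'.Boundaryless] (hF : Continuous F) :
    IsOpen (mapDom I I' F p q) :=
  (continuousOn_extChartAt_symm p).isOpen_inter_preimage (isOpen_extChartAt_target p)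
    ((isOpen_extChartAt_source q).preimage hF)

variable [IsManifold I ∞ M] [IsManifold I' ∞ N]

lemma contDiffOn_mapInChart (hF : ContMDiff I' I ∞ F) :
    ContDiffOn ℝ ∞ (mapInChart I I' F p q) (mapDom I I' F p q) := by
  rw [← contMDiffOn_iff_contDiffOn]
  exact (contMDiffOn_extChartAt (I := I) (n := ∞) (x := q)).comp
    (hF.comp_contMDiffOn ((contMDiffOn_extChartAt_symm (n := ∞) p).mono fun y hy => hy.1))
    fun y hy => by simpa using hy.2

variable [I.Boundaryless] [I'.Boundaryless]

lemma mfderiv_mapInChart (hF : ContMDiff I' I ∞ F) {y : E'} (hy : y ∈ mapDom I I' F p q) (u : E') :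
    mfderiv 𝓘(ℝ, E) I (extChartAt I q).symm (mapInChart I I' F p q y)
        (fderiv ℝ (mapInChart I I' F p q) y u)
      = mfderiv I' I F ((extChartAt I' p).symm y)
          (mfderiv 𝓘(ℝ, E') I' (extChartAt I' p).symm y u) := by
  have hO := isOpen_mapDom (I := I) (I' := I') (p := p) (q := q) hF.continuous
  have h1 : MDifferentiableAt 𝓘(ℝ, E) I (extChartAt I q).symm (mapInChart I I' F p q y) :=
    ((contMDiffOn_extChartAt_symm (n := ∞) q).contMDiffAt
      ((isOpen_extChartAt_target q).mem_nhds (mapInChart_mem hy))).mdifferentiableAt (by simp)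
  have h2 := (differentiableAt_of_contDiffOn hO
    (contDiffOn_mapInChart (p := p) (q := q) hF) hy).hasFDerivAt.hasMFDerivAt
  have h3 := (HasMFDerivAt.comp y h1.hasMFDerivAt h2).mfderiv
  have h4 : MDifferentiableAt 𝓘(ℝ, E') I' (extChartAt I' p).symm y :=
    ((contMDiffOn_extChartAt_symm (n := ∞) p).contMDiffAt
      ((isOpen_extChartAt_target p).mem_nhds hy.1)).mdifferentiableAt (by simp)
  have h5 := (HasMFDerivAt.comp y ((hF.mdifferentiable (by simp))
    ((extChartAt I' p).symm y)).hasMFDerivAt h4.hasMFDerivAt).mfderiv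
  have h6 : (extChartAt I q).symm ∘ mapInChart I I' F p q =ᶠ[𝓝 y] F ∘ (extChartAt I' p).symm :=
    Filter.eventually_of_mem (hO.mem_nhds hy) fun z hz => symm_mapInChart hz
  have h7 := h6.mfderiv_eq (I := 𝓘(ℝ, E')) (I' := I)
  rw [h3, h5] at h7
  exact DFunLike.congr_fun h7 u

lemma inChart_pullback (α : TwoTensor I M) (hF : ContMDiff I' I ∞ F) {y : E'}
    (hy : y ∈ mapDom I I' F p q) (u v : E') :
    inChart (pullback I' α F) p y u v = inChart α q (mapInChart I I' F p q y)
      (fderiv ℝ (mapInChart I I' F p q) y u) (fderiv ℝ (mapInChart I I' F p q) y v) := by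
  simp only [inChart, mfderiv_mapInChart hF hy, pullback]
  rw [symm_mapInChart hy]

omit [IsManifold I ∞ M] [IsManifold I' ∞ N] [I.Boundaryless] [I'.Boundaryless] in
lemma mem_mapDom_self (F : N → M) (x : N) : extChartAt I' x x ∈ mapDom I I' F x (F x) := by
  refine ⟨mem_extChartAt_target x, ?_⟩
  simp

omit [IsManifold I ∞ M] [IsManifold I' ∞ N] [I.Boundaryless] in
lemma mfderiv_eq_fderiv_mapInChart (hF : ContMDiff I' I ∞ F) (x : N) (u : E') :
    mfderiv I' I F x u = fderiv ℝ (mapInChart I I' F x (F x)) (extChartAt I' x x) u := by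
  have hm : MDifferentiableAt I' I F x := (hF.mdifferentiable (by simp)) x
  have h : mfderiv I' I F x = fderivWithin ℝ (mapInChart I I' F x (F x)) (Set.range I')
      (extChartAt I' x x) := if_pos hm
  rw [I'.range_eq_univ, fderivWithin_univ] at h
  exact DFunLike.congr_fun h u

end MapsInCharts

/-! ### The mean curvature vector in arbitrary charts. -/

section MeanCurvatureInCharts

variable {S₁ S₂ : Type*}
    [TopologicalSpace S₁] [ChartedSpace Plane S₁] [IsManifold (𝓡 2) ∞ S₁]
    [TopologicalSpace S₂] [ChartedSpace Plane S₂] [IsManifold (𝓡 2) ∞ S₂]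
    {g₁ : SurfaceMetric S₁} {g₂ : SurfaceMetric S₂} {F : S₁ → S₁ × S₂}

lemma inChart_metric (g₁ : SurfaceMetric S₁) (g₂ : SurfaceMetric S₂) (q : S₁ × S₂)
    {y : Plane × Plane} (hy : y ∈ (extChartAt ((𝓡 2).prod (𝓡 2)) q).target) (u v : Plane × Plane) :
    inChart (productTensor (metricTensor g₁) (metricTensor g₂)) q y u v
      = chartMetric g₁ g₂ q y u v :=
  inChart_productTensor g₁.inner g₂.inner q hy u v

lemma metric_eq_chartMetric (g₁ : SurfaceMetric S₁) (g₂ : SurfaceMetric S₂) (q : S₁ × S₂)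
    (u v : Plane × Plane) :
    productTensor (metricTensor g₁) (metricTensor g₂) q u v
      = chartMetric g₁ g₂ q (extChartAt ((𝓡 2).prod (𝓡 2)) q q) u v :=
  (inChart_self _ q u v).symm.trans (inChart_metric g₁ g₂ q (mem_extChartAt_target q) u v)

lemma covHessian_eq (F : S₁ → S₁ × S₂) (x : S₁) (u v : Plane) :
    covHessian (𝓡 2) productBasis (productTensor (metricTensor g₁) (metricTensor g₂)) F x u v
      = covX (chartConn g₁ g₂ (F x)) (mapInChart ((𝓡 2).prod (𝓡 2)) (𝓡 2) F x (F x)) u v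
        (extChartAt (𝓡 2) x x) := by
  have h := christoffel_eq (b := productBasis) (isLeviCivitaOn_chartMetric g₁ g₂ (F x))
    (mem_extChartAt_target (F x)) (fun y hy u v => inChart_metric g₁ g₂ (F x) hy u v)
  have e : mapInChart ((𝓡 2).prod (𝓡 2)) (𝓡 2) F x (F x) (extChartAt (𝓡 2) x x)
      = extChartAt ((𝓡 2).prod (𝓡 2)) (F x) (F x) := by
    rw [mapInChart, extChartAt_to_inv]
  simp only [covX, covDeriv, e]
  rw [← h]
  rfl

lemma meanCurvature_eq (hF : ContMDiff (𝓡 2) ((𝓡 2).prod (𝓡 2)) ∞ F) (x : S₁) :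
    meanCurvature (𝓡 2) planeBasis productBasis (productTensor (metricTensor g₁) (metricTensor g₂))
        F x
      = meanCurvatureOf (chartMetric g₁ g₂ (F x) (extChartAt ((𝓡 2).prod (𝓡 2)) (F x) (F x)))
        (fderiv ℝ (mapInChart ((𝓡 2).prod (𝓡 2)) (𝓡 2) F x (F x)) (extChartAt (𝓡 2) x x))
        (fun u v => covX (chartConn g₁ g₂ (F x))
          (mapInChart ((𝓡 2).prod (𝓡 2)) (𝓡 2) F x (F x)) u v (extChartAt (𝓡 2) x x)) := by
  set D := fderiv ℝ (mapInChart ((𝓡 2).prod (𝓡 2)) (𝓡 2) F x (F x)) (extChartAt (𝓡 2) x x) with hD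
  have e1 : ∀ u : Plane, mfderiv (𝓡 2) ((𝓡 2).prod (𝓡 2)) F x u = D u := fun u =>
    mfderiv_eq_fderiv_mapInChart hF x u
  have e2 : pullback (𝓡 2) (productTensor (metricTensor g₁) (metricTensor g₂)) F x
      = fun u v => chartMetric g₁ g₂ (F x) (extChartAt ((𝓡 2).prod (𝓡 2)) (F x) (F x)) (D u) (D v) := by
    funext u v
    exact (congrArg₂ (productTensor (metricTensor g₁) (metricTensor g₂) (F x)) (e1 u) (e1 v)).trans
      (metric_eq_chartMetric g₁ g₂ (F x) (D u) (D v))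
  have e3 : ∀ V : Plane × Plane, (fun w : Plane =>
      productTensor (metricTensor g₁) (metricTensor g₂) (F x) V (mfderiv (𝓡 2) ((𝓡 2).prod (𝓡 2)) F x w))
      = fun w => chartMetric g₁ g₂ (F x) (extChartAt ((𝓡 2).prod (𝓡 2)) (F x) (F x)) V (D w) := by
    intro V
    funext w
    exact (metric_eq_chartMetric g₁ g₂ (F x) V _).trans (congrArg _ (e1 w))
  unfold meanCurvature meanCurvatureOf tangentialPart
  refine Finset.sum_congr rfl fun i _ => Finset.sum_congr rfl fun j _ => ?_
  have e4 := covHessian_eq (g₁ := g₁) (g₂ := g₂) F x (planeBasis i) (planeBasis j)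
  rw [e2, e4]
  refine congrArg₂ _ rfl (congrArg₂ _ rfl ?_)
  refine (e1 _).trans (congrArg D ?_)
  rw [← e3]

/-- The mean curvature vector in arbitrary charts of the source and of the target. -/
lemma exists_meanCurvature_inChart (hF : ContMDiff (𝓡 2) ((𝓡 2).prod (𝓡 2)) ∞ F)
    (himm : ∀ x, Function.Injective (mfderiv (𝓡 2) ((𝓡 2).prod (𝓡 2)) F x))
    {p : S₁} {q : S₁ × S₂} {y : Plane} (hy : y ∈ mapDom ((𝓡 2).prod (𝓡 2)) (𝓡 2) F p q)
    (φ : Plane → Plane × Plane) (hφ : φ = mapInChart ((𝓡 2).prod (𝓡 2)) (𝓡 2) F p q) :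
    ∃ h : Plane × Plane,
      (∀ u, chartMetric g₁ g₂ q (φ y) h (fderiv ℝ φ y u) = 0) ∧
      (∀ u v, ∃ a, indDet (chartMetric g₁ g₂ q) φ u v y • h
        = traceHess (chartMetric g₁ g₂ q) (chartConn g₁ g₂ q) φ u v y + fderiv ℝ φ y a) ∧
      normSqMeanCurvature (productTensor (metricTensor g₁) (metricTensor g₂)) F
        ((extChartAt (𝓡 2) p).symm y) = chartMetric g₁ g₂ q (φ y) h h ∧
      ∀ (γ : ℝ → S₁ × S₂) (J : Set ℝ) (t : ℝ), γ t = F ((extChartAt (𝓡 2) p).symm y) →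
        HasMFDerivWithinAt 𝓘(ℝ, ℝ) ((𝓡 2).prod (𝓡 2)) γ J t
          (ContinuousLinearMap.toSpanSingleton ℝ (show TangentSpace ((𝓡 2).prod (𝓡 2)) (γ t) from
            (meanCurvature (𝓡 2) planeBasis productBasis
            (productTensor (metricTensor g₁) (metricTensor g₂)) F ((extChartAt (𝓡 2) p).symm y)))) →
        HasDerivWithinAt (fun s => extChartAt ((𝓡 2).prod (𝓡 2)) q (γ s)) h J t := by
  set x := (extChartAt (𝓡 2) p).symm y with hx
  set q' := F x with hq'
  set φ₀ := mapInChart ((𝓡 2).prod (𝓡 2)) (𝓡 2) F x q' with hφ₀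
  set σ := transMap (𝓡 2) p x with hσ
  set τ := transMap ((𝓡 2).prod (𝓡 2)) q' q with hτ
  have hyσ : y ∈ transDom (𝓡 2) p x := ⟨hy.1, mem_extChartAt_source x⟩
  have σy : σ y = extChartAt (𝓡 2) x x := rfl
  have hφ₀y : φ₀ (σ y) = extChartAt ((𝓡 2).prod (𝓡 2)) q' q' := by
    simp only [hφ₀, mapInChart, σy, extChartAt_to_inv, ← hq']
  have hyτ : φ₀ (σ y) ∈ transDom ((𝓡 2).prod (𝓡 2)) q' q := by
    rw [hφ₀y]
    refine ⟨mem_extChartAt_target q', ?_⟩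
    rw [Set.mem_preimage, extChartAt_to_inv]
    exact hy.2
  have hO := isOpen_mapDom (I := (𝓡 2).prod (𝓡 2)) (I' := 𝓡 2) (p := p) (q := q) hF.continuous
  have hO' := isOpen_mapDom (I := (𝓡 2).prod (𝓡 2)) (I' := 𝓡 2) (p := p) (q := q') hF.continuous
  have hO₀ := isOpen_mapDom (I := (𝓡 2).prod (𝓡 2)) (I' := 𝓡 2) (p := x) (q := q') hF.continuous
  -- The mean curvature vector is defined in the preferred charts at `x` and `F x`. The expression
  -- in the given charts factors through that one near `y`, and `covX_comp` compares the Hessians.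
  have hev : φ =ᶠ[𝓝 y] fun z => τ (φ₀ (σ z)) := by
    have hyO' : y ∈ mapDom ((𝓡 2).prod (𝓡 2)) (𝓡 2) F p q' := ⟨hy.1, mem_extChartAt_source q'⟩
    filter_upwards [hO'.mem_nhds hyO', (isOpen_transDom p x).mem_nhds hyσ] with z hz hz'
    simp only [hφ, hτ, hφ₀, transMap, mapInChart, hσ]
    have e1 := symm_transMap hz'
    rw [transMap] at e1
    rw [e1, (extChartAt ((𝓡 2).prod (𝓡 2)) q').left_inv hz.2]
  have cτ : ContDiffAt ℝ ∞ τ (φ₀ (σ y)) :=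
    (contDiffOn_transMap q' q).contDiffAt ((isOpen_transDom q' q).mem_nhds hyτ)
  have cσ : ContDiffAt ℝ ∞ σ y :=
    (contDiffOn_transMap p x).contDiffAt ((isOpen_transDom p x).mem_nhds hyσ)
  have cφ₀ : ContDiffAt ℝ ∞ φ₀ (σ y) :=
    (contDiffOn_mapInChart hF).contDiffAt (hO₀.mem_nhds (mem_mapDom_self F x))
  have hlc' := isLeviCivitaOn_chartMetric g₁ g₂ q'
  have hlc := isLeviCivitaOn_chartMetric g₁ g₂ q
  have hconn : IsConnMapAt (chartConn g₁ g₂ q') (chartConn g₁ g₂ q) τ (φ₀ (σ y)) :=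
    isConnMapAt_transMap hlc' hlc (fun y hy => inChart_metric g₁ g₂ q' hy)
      (fun y hy => inChart_metric g₁ g₂ q hy) hyτ
  set D₀ := fderiv ℝ φ₀ (σ y) with hD₀
  set A := fderiv ℝ σ y with hA
  set B := fderiv ℝ τ (φ₀ (σ y)) with hB
  have hval : φ y = τ (φ₀ (σ y)) := hev.self_of_nhds
  have hDφ : ∀ u, fderiv ℝ φ y u = B (D₀ (A u)) := by
    intro u
    have := (cτ.differentiableAt (by simp)).hasFDerivAt.comp y
      ((cφ₀.differentiableAt (by simp)).hasFDerivAt.comp y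
        (cσ.differentiableAt (by simp)).hasFDerivAt)
    rw [hev.fderiv_eq]
    exact DFunLike.congr_fun this.fderiv u
  have hiso : ∀ u v, chartMetric g₁ g₂ q (φ y) (B u) (B v) = chartMetric g₁ g₂ q' (φ₀ (σ y)) u v := by
    intro u v
    rw [← inChart_metric g₁ g₂ q' hyτ.1, inChart_transMap _ hyτ, hval,
      inChart_metric g₁ g₂ q (transMap_mem hyτ)]
  set G₀ := chartMetric g₁ g₂ q' (φ₀ (σ y)) with hG₀
  set X : Plane → Plane → Plane × Plane := fun u v => covX (chartConn g₁ g₂ q') φ₀ u v (σ y) with hX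
  have hcov : ∀ u v, covX (chartConn g₁ g₂ q) φ u v y
      = B (X (A u) (A v) + D₀ (fderiv ℝ (fderiv ℝ σ) y u v)) := by
    intro u v
    have h1 : covX (chartConn g₁ g₂ q) φ u v y
        = covX (chartConn g₁ g₂ q) (fun z => τ (φ₀ (σ z))) u v y := by
      simp only [covX, covDeriv, hval, hev.fderiv_eq]
      congr 2
      · refine Filter.EventuallyEq.fderiv_eq ?_
        filter_upwards [hev.eventuallyEq_nhds] with z hz
        simp only [partialD, hz.fderiv_eq]
      · simp only [partialD, hev.fderiv_eq]
    rw [h1, covX_comp cτ hconn cφ₀ cσ]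
  have hAs : Function.Surjective A := fderiv_transMap_surjective hyσ
  have hs : ∀ u v, G₀ u v = G₀ v u := hlc'.symm _ hyτ.1
  have hp : ∀ u, u ≠ 0 → 0 < G₀ u u := hlc'.pos _ hyτ.1
  have hDi : Function.Injective D₀ := by
    intro u v huv
    refine himm x ?_
    rw [mfderiv_eq_fderiv_mapInChart hF x u, mfderiv_eq_fderiv_mapInChart hF x v]
    exact huv
  let XB : Plane →L[ℝ] Plane →L[ℝ] Plane × Plane := fderiv ℝ (fderiv ℝ φ₀) (σ y)
    + (chartConn g₁ g₂ q' (φ₀ (σ y))).bilinearComp D₀ D₀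
  have hXB : ∀ u v, X u v = XB u v := by
    intro u v
    simp only [hX, covX, covDeriv, XB]
    have : fderiv ℝ (partialD φ₀ v) (σ y) u = _ :=
      fderiv_fderiv_apply hO₀ (contDiffOn_mapInChart hF) (mem_mapDom_self F x) u v
    rw [this]
    rfl
  have hXs : ∀ u v, XB u v = XB v u := by
    intro u v
    rw [← hXB, ← hXB]
    exact covDeriv_partialD_comm hO₀ (contDiffOn_mapInChart hF) (mem_mapDom_self F x)
      (hlc'.torsion_free _ hyτ.1) u v
  have hXfun : X = fun u v => XB u v := by
    funext u v
    exact hXB u v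
  set m : Plane × Plane := meanCurvature (𝓡 2) planeBasis productBasis
    (productTensor (metricTensor g₁) (metricTensor g₂)) F x with hm
  have hmeq : m = meanCurvatureOf G₀ D₀ X := by
    have := meanCurvature_eq (g₁ := g₁) (g₂ := g₂) hF x
    rw [hG₀, hφ₀y]
    exact this
  refine ⟨B m, ?_, ?_, ?_, ?_⟩
  · intro u
    rw [hDφ, hiso, hmeq]
    exact meanCurvatureOf_normal hs hp hDi X _
  · intro u v
    obtain ⟨a, ha⟩ := meanCurvatureOf_eq hs hp hDi XB hXs (A u) (A v)
    have hind : ∀ u v, indMetric (chartMetric g₁ g₂ q) φ u v y = G₀ (D₀ (A u)) (D₀ (A v)) := by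
      intro u v
      rw [indMetric, partialD, partialD, hDφ, hDφ, hiso]
    simp only [indDet, traceHess, hind, hcov]
    rw [hmeq, hXfun, ← map_smul, ha]
    set s := fun u v => fderiv ℝ (fderiv ℝ σ) y u v with hsd
    -- The second derivatives of `σ` change the Hessian by tangential vectors only. They are
    -- collected in the tangential term, after solving for its preimage under the invertible `A`.
    obtain ⟨a', ha'⟩ := hAs (a - G₀ (D₀ (A v)) (D₀ (A v)) • s u u
      - (-2 * G₀ (D₀ (A u)) (D₀ (A v))) • s u v - G₀ (D₀ (A u)) (D₀ (A u)) • s v v)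
    refine ⟨a', ?_⟩
    rw [hDφ, ha']
    simp only [map_add, map_sub, map_smul, hsd]
    module
  · rw [hiso, hG₀, hφ₀y]
    exact metric_eq_chartMetric g₁ g₂ (F x) m m
  · intro γ J t hγ hd
    have h1 : HasFDerivWithinAt (fun s => extChartAt ((𝓡 2).prod (𝓡 2)) (γ t) (γ s))
        (ContinuousLinearMap.toSpanSingleton ℝ m) J t := by
      have := hd.2
      simp only [writtenInExtChartAt, extChartAt_self_eq] at this
      simpa using! this
    rw [hγ] at h1
    have hτ' : HasFDerivAt τ B (extChartAt ((𝓡 2).prod (𝓡 2)) (F x) (γ t)) := by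
      rw [hγ, ← hq', ← hφ₀y]
      exact (cτ.differentiableAt (by simp)).hasFDerivAt
    have h2 := hτ'.comp_hasFDerivWithinAt t h1
    have h3 : HasDerivWithinAt (fun s => τ (extChartAt ((𝓡 2).prod (𝓡 2)) (F x) (γ s))) (B m) J t := by
      have := h2.hasDerivWithinAt
      simpa using! this
    refine h3.congr_of_eventuallyEq ?_ ?_
    · have hc : ContinuousWithinAt γ J t := hd.1
      have : (extChartAt ((𝓡 2).prod (𝓡 2)) q').source ∈ 𝓝 (γ t) := by
        rw [hγ]
        exact extChartAt_source_mem_nhds q'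
      filter_upwards [hc this] with s hs
      simp only [hτ, transMap]
      rw [(extChartAt ((𝓡 2).prod (𝓡 2)) q').left_inv hs]
    · simp only [hτ, transMap, hγ]
      rw [(extChartAt ((𝓡 2).prod (𝓡 2)) q').left_inv (mem_extChartAt_source q')]

end MeanCurvatureInCharts

/-! ### Space derivatives of maps on a time slab with boundary. -/

section Slices

variable {P F : Type*} [NormedAddCommGroup P] [NormedSpace ℝ P] [NormedAddCommGroup F]
  [NormedSpace ℝ F]

/-- The derivative of `φ (t, ·)` in the direction `u`. -/
def sliceD (φ : ℝ × P → F) (u : P) (z : ℝ × P) : F := fderiv ℝ (fun y => φ (z.1, y)) z.2 u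

lemma sliceD_eq_fderivWithin {J : Set ℝ} {W : Set (ℝ × P)} (hW : IsOpen W)
    {φ : ℝ × P → F} {z : ℝ × P} (hz : z ∈ (J ×ˢ Set.univ) ∩ W)
    (hφ : DifferentiableWithinAt ℝ φ ((J ×ˢ Set.univ) ∩ W) z) (u : P) :
    sliceD φ u z = fderivWithin ℝ φ ((J ×ˢ Set.univ) ∩ W) z (0, u) := by
  have h1 : HasFDerivAt (fun y : P => (z.1, y)) (ContinuousLinearMap.inr ℝ ℝ P) z.2 :=
    hasFDerivAt_prodMk_right z.1 z.2
  have hpre : (fun y : P => (z.1, y)) ⁻¹' ((J ×ˢ Set.univ) ∩ W) ∈ 𝓝 z.2 := by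
    have : Continuous (fun y : P => (z.1, y)) := by fun_prop
    filter_upwards [(hW.preimage this).mem_nhds (show z.2 ∈ _ from hz.2)] with y hy
    exact ⟨⟨hz.1.1, trivial⟩, hy⟩
  have h2 : HasFDerivWithinAt φ (fderivWithin ℝ φ ((J ×ˢ Set.univ) ∩ W) z)
      ((J ×ˢ Set.univ) ∩ W) (z.1, z.2) := hφ.hasFDerivWithinAt
  have h3 := (h2.comp z.2 (h1.hasFDerivWithinAt (s := (fun y : P => (z.1, y)) ⁻¹'
    ((J ×ˢ Set.univ) ∩ W))) fun y hy => hy).hasFDerivAt hpre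
  rw [sliceD]
  have h4 : fderiv ℝ (fun y => φ (z.1, y)) z.2 = _ := h3.fderiv
  rw [h4]
  simp

lemma uniqueDiffOn_slab {J : Set ℝ} (hJ : UniqueDiffOn ℝ J) {W : Set (ℝ × P)} (hW : IsOpen W) :
    UniqueDiffOn ℝ ((J ×ˢ Set.univ) ∩ W) := (hJ.prod uniqueDiffOn_univ).inter hW

/-- At a boundary time the two-sided derivative in space-time need not exist. The space derivative
is taken in the slice and agrees with the derivative within the slab, so it is smooth up to the
boundary time. -/
lemma contDiffOn_sliceD {J : Set ℝ} (hJ : UniqueDiffOn ℝ J) {W : Set (ℝ × P)} (hW : IsOpen W)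
    {φ : ℝ × P → F} (hφ : ContDiffOn ℝ ∞ φ ((J ×ˢ Set.univ) ∩ W)) (u : P) :
    ContDiffOn ℝ ∞ (sliceD φ u) ((J ×ˢ Set.univ) ∩ W) := by
  have h1 := hφ.fderivWithin (uniqueDiffOn_slab hJ hW) infty_add_one_le
  refine (h1.clm_apply (contDiffOn_const (c := ((0 : ℝ), u)))).congr fun z hz => ?_
  exact sliceD_eq_fderivWithin hW hz ((hφ z hz).differentiableWithinAt (by simp)) u

lemma sliceD_eq_partialD {φ : ℝ × P → F} {z : ℝ × P} (hφ : DifferentiableAt ℝ φ z) (u : P) :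
    sliceD φ u z = partialD φ (0, u) z := by
  have h1 : HasFDerivAt (fun y : P => (z.1, y)) (ContinuousLinearMap.inr ℝ ℝ P) z.2 :=
    hasFDerivAt_prodMk_right z.1 z.2
  have h2 : HasFDerivAt φ (fderiv ℝ φ z) (z.1, z.2) := hφ.hasFDerivAt
  have h4 : fderiv ℝ (fun y => φ (z.1, y)) z.2 = _ := (h2.comp z.2 h1).fderiv
  rw [sliceD, h4, partialD]
  simp

lemma covX_slice {Γ : F → F →L[ℝ] F →L[ℝ] F} {φ : ℝ × P → F} {z : ℝ × P}
    (hφ : ContDiffAt ℝ ∞ φ z) (u v : P) :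
    covX Γ (fun y => φ (z.1, y)) u v z.2 = covX Γ φ (0, u) (0, v) z := by
  have hσ : ContDiff ℝ ∞ (fun y : P => (z.1, y)) := contDiff_const.prodMk contDiff_id
  have e1 : fderiv ℝ (fun y : P => (z.1, y)) = fun _ => ContinuousLinearMap.inr ℝ ℝ P := by
    funext y
    exact (hasFDerivAt_prodMk_right z.1 y).fderiv
  have := covX_comp (Γ := Γ) (Γ' := Γ) (τ := fun x : F => x) (φ := φ)
    (σ := fun y : P => (z.1, y)) (z := z.2) contDiffAt_id (isConnMapAt_id Γ _) hφ
    hσ.contDiffAt u v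
  rw [this]
  simp [e1, fderiv_fun_id]

end Slices

/-! ### The time interval and its initial point. -/

section TimeInterval

lemma uniqueDiffOn_timeInterval (T : EReal) : UniqueDiffOn ℝ (timeInterval T) := by
  by_cases hT : 0 < T
  · refine uniqueDiffOn_convex ?_ ?_
    · rw [convex_iff_ordConnected]
      refine ⟨fun x hx y hy z hz => ⟨hx.1.trans hz.1, lt_of_le_of_lt ?_ hy.2⟩⟩
      exact EReal.coe_le_coe_iff.2 hz.2
    · obtain ⟨r, hr0, hr⟩ := EReal.lt_iff_exists_real_btwn.1 hT
      have hr0' : (0 : ℝ) < r := by exact_mod_cast hr0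
      refine ⟨r / 2, mem_interior.2 ⟨Set.Ioo 0 r, ?_, isOpen_Ioo, by constructor <;> linarith⟩⟩
      intro s hs
      exact ⟨hs.1.le, lt_trans (EReal.coe_lt_coe_iff.2 hs.2) hr⟩
  · have : timeInterval T = ∅ := by
      ext t
      simp only [timeInterval, Set.mem_ofPred_eq, Set.mem_empty_iff_false, iff_false, not_and]
      intro h0 h
      exact hT (lt_of_le_of_lt (by exact_mod_cast h0) h)
    rw [this]
    exact uniqueDiffOn_empty

lemma isOpen_timeInterval_pos (T : EReal) : IsOpen {t : ℝ | 0 < t ∧ (t : EReal) < T} :=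
  isOpen_Ioi.inter (isOpen_Iio.preimage continuous_coe_real_ereal)

lemma timeInterval_mem_nhds {T : EReal} {t : ℝ} (ht : t ∈ timeInterval T) (h0 : 0 < t) :
    timeInterval T ∈ 𝓝 t :=
  Filter.mem_of_superset ((isOpen_timeInterval_pos T).mem_nhds ⟨h0, ht.2⟩)
    fun _ hs => ⟨hs.1.le, hs.2⟩

end TimeInterval

/-! ### Mean curvature flow in a fixed pair of charts. -/

section FlowInChart

variable {E : Type*} [NormedAddCommGroup E] [NormedSpace ℝ E]

/-- A mean curvature flow in coordinates. -/
structure IsFlowInChart (G : E → E →L[ℝ] E →L[ℝ] ℝ) (Γ : E → E →L[ℝ] E →L[ℝ] E) (V : Set E)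
    (φ : ℝ × Plane → E) (O : Set (ℝ × Plane)) : Prop where
  lc : IsLeviCivitaOn G Γ V
  isOpen : IsOpen O
  smooth : ContDiffOn ℝ ∞ φ O
  mapsTo : Set.MapsTo φ O V
  immersion : ∀ z ∈ O, ∀ u, partialD φ (0, u) z = 0 → u = 0
  normal : ∀ z ∈ O, ∀ u, indMetric G φ (1, 0) (0, u) z = 0
  flow : ∀ z ∈ O, ∀ u v, ∃ a, indDet G φ (0, u) (0, v) z • partialD φ (1, 0) z
    = traceHess G Γ φ (0, u) (0, v) z + partialD φ (0, a) z

lemma IsFlowInChart.isLocalFlow {G : E → E →L[ℝ] E →L[ℝ] ℝ} {Γ : E → E →L[ℝ] E →L[ℝ] E} {V : Set E}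
    {φ : ℝ × Plane → E} {O : Set (ℝ × Plane)} (h : IsFlowInChart G Γ V φ O) :
    IsLocalFlow G Γ V φ O (1, 0) (0, planeBasis 0) (0, planeBasis 1) := by
  refine ⟨h.lc, h.isOpen, h.smooth, h.mapsTo, fun z hz => h.normal z hz _,
    fun z hz => h.normal z hz _, fun z hz => ?_⟩
  obtain ⟨a, ha⟩ := h.flow z hz (planeBasis 0) (planeBasis 1)
  refine ⟨a 0, a 1, ?_⟩
  rw [ha, add_assoc]
  congr 1
  have : ((0 : ℝ), a) = a 0 • ((0 : ℝ), planeBasis 0) + a 1 • ((0 : ℝ), planeBasis 1) := by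
    rw [Prod.smul_mk, Prod.smul_mk, Prod.mk_add_mk, ← plane_eq]
    simp
  rw [partialD, this]
  simp only [map_add, map_smul, partialD]

end FlowInChart

/-! ### The given flow satisfies the coordinate equations. -/

section FlowOfSurfaces

variable {S₁ S₂ : Type*}
    [TopologicalSpace S₁] [ChartedSpace Plane S₁] [IsManifold (𝓡 2) ∞ S₁]
    [TopologicalSpace S₂] [ChartedSpace Plane S₂] [IsManifold (𝓡 2) ∞ S₂]
    {g₁ : SurfaceMetric S₁} {g₂ : SurfaceMetric S₂} {T : EReal} {F : ℝ → S₁ → S₁ × S₂}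

/-- A family of maps in charts. -/
def flowMap (F : ℝ → S₁ → S₁ × S₂) (p : S₁) (q : S₁ × S₂) (z : ℝ × Plane) : Plane × Plane :=
  mapInChart ((𝓡 2).prod (𝓡 2)) (𝓡 2) (F z.1) p q z.2

/-- The domain, in space-time, of the expression of a family of maps in charts. -/
def flowDom (J : Set ℝ) (F : ℝ → S₁ → S₁ × S₂) (p : S₁) (q : S₁ × S₂) : Set (ℝ × Plane) :=
  {z | z.1 ∈ J ∧ z.2 ∈ mapDom ((𝓡 2).prod (𝓡 2)) (𝓡 2) (F z.1) p q}

variable (hF : IsMeanCurvatureFlow (𝓡 2) planeBasis productBasis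
  (productTensor (metricTensor g₁) (metricTensor g₂)) (timeInterval T) F)

include hF

lemma contMDiff_flow {t : ℝ} (ht : t ∈ timeInterval T) :
    ContMDiff (𝓡 2) ((𝓡 2).prod (𝓡 2)) ∞ (F t) := by
  rw [← contMDiffOn_univ]
  have h1 : ContMDiffOn (𝓡 2) (𝓘(ℝ, ℝ).prod (𝓡 2)) ∞ (fun x : S₁ => (t, x)) Set.univ :=
    (contMDiff_const.prodMk contMDiff_id).contMDiffOn
  exact hF.smooth.comp h1 fun x _ => ⟨ht, trivial⟩

lemma continuousOn_flow : ContinuousOn (fun q : ℝ × S₁ => F q.1 q.2) (timeInterval T ×ˢ Set.univ) :=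
  hF.smooth.continuousOn

/-- The flow is only known to be continuous on the slab, so the domain of its coordinate expression
is relatively open there. The form chosen suits the derivatives within slabs. -/
lemma exists_flowDom_eq (p : S₁) (q : S₁ × S₂) : ∃ W : Set (ℝ × Plane), IsOpen W ∧
    flowDom (timeInterval T) F p q = (timeInterval T ×ˢ Set.univ) ∩ W := by
  have h1 : ContinuousOn (fun z : ℝ × Plane => F z.1 ((extChartAt (𝓡 2) p).symm z.2))
      (timeInterval T ×ˢ (extChartAt (𝓡 2) p).target) := by
    have h2 : ContinuousOn (fun z : ℝ × Plane => (z.1, (extChartAt (𝓡 2) p).symm z.2))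
        (timeInterval T ×ˢ (extChartAt (𝓡 2) p).target) :=
      continuousOn_fst.prodMk ((continuousOn_extChartAt_symm p).comp continuousOn_snd
        fun z hz => hz.2)
    exact (continuousOn_flow hF).comp h2 fun z hz => ⟨hz.1, trivial⟩
  obtain ⟨W, hW, hWe⟩ := continuousOn_iff'.1 h1 _ (isOpen_extChartAt_source (I := (𝓡 2).prod (𝓡 2)) q)
  refine ⟨(Set.univ ×ˢ (extChartAt (𝓡 2) p).target) ∩ W,
    (isOpen_univ.prod (isOpen_extChartAt_target p)).inter hW, ?_⟩
  ext z
  have := Set.ext_iff.1 hWe z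
  simp only [Set.mem_inter_iff, Set.mem_preimage, Set.mem_prod, Set.mem_univ, true_and,
    and_true, flowDom, mapDom, Set.mem_ofPred_eq] at this ⊢
  tauto

lemma contDiffOn_flowMap (p : S₁) (q : S₁ × S₂) :
    ContDiffOn ℝ ∞ (flowMap F p q) (flowDom (timeInterval T) F p q) := by
  rw [← contMDiffOn_iff_contDiffOn]
  have h1 : ContMDiffOn 𝓘(ℝ, ℝ × Plane) (𝓘(ℝ, ℝ).prod (𝓡 2)) ∞
      (fun z : ℝ × Plane => (z.1, (extChartAt (𝓡 2) p).symm z.2)) (flowDom (timeInterval T) F p q) := by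
    refine ContMDiffOn.prodMk contDiff_fst.contMDiff.contMDiffOn ?_
    exact (contMDiffOn_extChartAt_symm (n := ∞) p).comp contDiff_snd.contMDiff.contMDiffOn
      fun z hz => hz.2.1
  exact (contMDiffOn_extChartAt (I := (𝓡 2).prod (𝓡 2)) (n := ∞) (x := q)).comp
    (hF.smooth.comp h1 fun z hz => ⟨hz.1, trivial⟩) fun z hz => by simpa using hz.2.2

lemma isOpen_flowDom_pos (p : S₁) (q : S₁ × S₂) :
    IsOpen (flowDom {t : ℝ | 0 < t ∧ (t : EReal) < T} F p q) := by
  obtain ⟨W, hW, h⟩ := exists_flowDom_eq hF p q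
  have : flowDom {t : ℝ | 0 < t ∧ (t : EReal) < T} F p q
      = ({t : ℝ | 0 < t ∧ (t : EReal) < T} ×ˢ Set.univ) ∩ W := by
    ext z
    have := Set.ext_iff.1 h z
    simp only [flowDom, timeInterval, Set.mem_inter_iff, Set.mem_prod, Set.mem_ofPred_eq,
      Set.mem_univ, and_true] at this ⊢
    constructor
    · rintro ⟨⟨a, b⟩, d⟩
      exact ⟨⟨a, b⟩, (this.1 ⟨⟨a.le, b⟩, d⟩).2⟩
    · rintro ⟨⟨a, b⟩, d⟩
      exact ⟨⟨a, b⟩, (this.2 ⟨⟨a.le, b⟩, d⟩).2⟩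
  rw [this]
  exact ((isOpen_timeInterval_pos T).prod isOpen_univ).inter hW

omit [IsManifold (𝓡 2) ∞ S₁] [IsManifold (𝓡 2) ∞ S₂] hF in
lemma flowDom_pos_subset (p : S₁) (q : S₁ × S₂) :
    flowDom {t : ℝ | 0 < t ∧ (t : EReal) < T} F p q ⊆ flowDom (timeInterval T) F p q :=
  fun _ hz => ⟨⟨hz.1.1.le, hz.1.2⟩, hz.2⟩

/-- The velocity of the flow in charts, at all times. -/
lemma exists_velocity {p : S₁} {q : S₁ × S₂} {z : ℝ × Plane}
    (hz : z ∈ flowDom (timeInterval T) F p q) : ∃ h : Plane × Plane,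
    HasDerivWithinAt (fun s => flowMap F p q (s, z.2)) h (timeInterval T) z.1 ∧
      (∀ u, chartMetric g₁ g₂ q (flowMap F p q z) h (sliceD (flowMap F p q) u z) = 0) ∧
      (∀ u v, ∃ a, indDet (chartMetric g₁ g₂ q) (fun y => flowMap F p q (z.1, y)) u v z.2 • h
        = traceHess (chartMetric g₁ g₂ q) (chartConn g₁ g₂ q) (fun y => flowMap F p q (z.1, y)) u v z.2
          + sliceD (flowMap F p q) a z) ∧
      normSqMeanCurvature (productTensor (metricTensor g₁) (metricTensor g₂)) (F z.1)
        ((extChartAt (𝓡 2) p).symm z.2) = chartMetric g₁ g₂ q (flowMap F p q z) h h := by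
  obtain ⟨h, h1, h2, h3, h4⟩ := exists_meanCurvature_inChart (g₁ := g₁) (g₂ := g₂)
    (contMDiff_flow hF hz.1) (hF.immersion z.1 hz.1) hz.2 _ rfl
  exact ⟨h, h4 (fun s => F s ((extChartAt (𝓡 2) p).symm z.2)) (timeInterval T) z.1 rfl
    (hF.flow z.1 hz.1 _), h1, h2, h3⟩

/-- Positive times give an open domain, where derivatives within the time interval are ordinary
derivatives. -/
lemma isFlowInChart (p : S₁) (q : S₁ × S₂) :
    IsFlowInChart (chartMetric g₁ g₂ q) (chartConn g₁ g₂ q)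
      (extChartAt ((𝓡 2).prod (𝓡 2)) q).target (flowMap F p q)
      (flowDom {t : ℝ | 0 < t ∧ (t : EReal) < T} F p q) := by
  have hO := isOpen_flowDom_pos hF p q
  have hc := (contDiffOn_flowMap hF p q).mono (flowDom_pos_subset p q)
  have hd : ∀ z ∈ flowDom {t : ℝ | 0 < t ∧ (t : EReal) < T} F p q,
      ∀ u, sliceD (flowMap F p q) u z = partialD (flowMap F p q) (0, u) z := fun z hz u =>
    sliceD_eq_partialD (differentiableAt_of_contDiffOn hO hc hz) u
  have hcov : ∀ z ∈ flowDom {t : ℝ | 0 < t ∧ (t : EReal) < T} F p q,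
      ∀ u v, covX (chartConn g₁ g₂ q) (fun y => flowMap F p q (z.1, y)) u v z.2
        = covX (chartConn g₁ g₂ q) (flowMap F p q) (0, u) (0, v) z := fun z hz u v =>
    covX_slice (hc.contDiffAt (hO.mem_nhds hz)) u v
  have hg : ∀ z ∈ flowDom {t : ℝ | 0 < t ∧ (t : EReal) < T} F p q,
      ∀ u v, indMetric (chartMetric g₁ g₂ q) (fun y => flowMap F p q (z.1, y)) u v z.2
        = indMetric (chartMetric g₁ g₂ q) (flowMap F p q) (0, u) (0, v) z := by
    intro z hz u v
    rw [indMetric, indMetric, ← hd z hz u, ← hd z hz v]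
    rfl
  -- The velocity supplied by `exists_velocity` is a derivative within the time interval; uniqueness
  -- of the derivative identifies it with the partial derivative in time.
  have hvel : ∀ z ∈ flowDom {t : ℝ | 0 < t ∧ (t : EReal) < T} F p q, ∀ h,
      HasDerivWithinAt (fun s => flowMap F p q (s, z.2)) h (timeInterval T) z.1 →
      partialD (flowMap F p q) (1, 0) z = h := by
    intro z hz h hh
    have h1 := hh.hasDerivAt (timeInterval_mem_nhds ⟨hz.1.1.le, hz.1.2⟩ hz.1.1)
    have h2 : HasFDerivAt (flowMap F p q) (fderiv ℝ (flowMap F p q) z) (z.1, z.2) :=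
      (differentiableAt_of_contDiffOn hO hc hz).hasFDerivAt
    have h3 := (h2.comp z.1 (hasFDerivAt_prodMk_left z.1 z.2)).hasDerivAt
    have h4 := h1.unique h3
    rw [h4, partialD]
    simp
  refine ⟨isLeviCivitaOn_chartMetric g₁ g₂ q, hO, hc, fun z hz => mapInChart_mem hz.2, ?_, ?_, ?_⟩
  · intro z hz u hu
    have hzJ := (flowDom_pos_subset p q hz).1
    have h1 := mfderiv_mapInChart (contMDiff_flow hF hzJ) hz.2 u
    rw [← hd z hz u] at hu
    have h3 := h1.symm.trans ((congrArg _ hu).trans (map_zero _))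
    have h4 := hF.immersion z.1 hzJ _ (h3.trans (map_zero _).symm)
    exact injective_mfderiv_extChartAt_symm p hz.2.1 (h4.trans (map_zero _).symm)
  · intro z hz u
    obtain ⟨h, h1, h2, -, -⟩ := exists_velocity hF (flowDom_pos_subset p q hz)
    rw [indMetric, hvel z hz h h1, ← hd z hz u]
    exact h2 u
  · intro z hz u v
    obtain ⟨h, h1, -, h2, -⟩ := exists_velocity hF (flowDom_pos_subset p q hz)
    obtain ⟨a, ha⟩ := h2 u v
    refine ⟨a, ?_⟩
    rw [hvel z hz h h1, ← hd z hz a]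
    simp only [indDet, traceHess, hg z hz, hcov z hz] at ha ⊢
    exact ha

lemma normSqMeanCurvature_eq {p : S₁} {q : S₁ × S₂} {z : ℝ × Plane}
    (hz : z ∈ flowDom {t : ℝ | 0 < t ∧ (t : EReal) < T} F p q) :
    normSqMeanCurvature (productTensor (metricTensor g₁) (metricTensor g₂)) (F z.1)
        ((extChartAt (𝓡 2) p).symm z.2)
      = indMetric (chartMetric g₁ g₂ q) (flowMap F p q) (1, 0) (1, 0) z := by
  obtain ⟨h, h1, -, -, h2⟩ := exists_velocity hF (flowDom_pos_subset p q hz)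
  have h1' := h1.hasDerivAt (timeInterval_mem_nhds ⟨hz.1.1.le, hz.1.2⟩ hz.1.1)
  have h3 : HasFDerivAt (flowMap F p q) (fderiv ℝ (flowMap F p q) z) (z.1, z.2) :=
    ((isFlowInChart hF p q).isLocalFlow.diff (isFlowInChart hF p q).smooth hz).hasFDerivAt
  have h3' := (h3.comp z.1 (hasFDerivAt_prodMk_left z.1 z.2)).hasDerivAt
  have h4 := h1'.unique h3'
  rw [h2, h4, indMetric, partialD]
  simp

end FlowOfSurfaces

/-! ### Contractions and orthonormal bases in the plane. -/

section PlaneForms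

lemma planeDet_basis : planeDet (planeBasis 0) (planeBasis 1) = 1 := by
  simp [planeDet, planeBasis]

lemma eq_zero_of_planeDet {A : Plane →L[ℝ] Plane}
    (h : planeDet (A (planeBasis 0)) (A (planeBasis 1)) ≠ 0)
    {u : Plane} (hu : A u = 0) : u = 0 := by
  rw [plane_eq u, map_add, map_smul, map_smul] at hu
  have h0 := congrArg (fun v : Plane => v 0) hu
  have h1 := congrArg (fun v : Plane => v 1) hu
  simp only [PiLp.add_apply, PiLp.smul_apply, smul_eq_mul, PiLp.zero_apply] at h0 h1
  unfold planeDet at h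
  set a := A (planeBasis 0)
  set b := A (planeBasis 1)
  have e0 : u 0 * (a 0 * b 1 - a 1 * b 0) = 0 := by linear_combination b 1 * h0 - b 0 * h1
  have e1 : u 1 * (a 0 * b 1 - a 1 * b 0) = 0 := by linear_combination a 0 * h1 - a 1 * h0
  have e0' := (mul_eq_zero.1 e0).resolve_right h
  have e1' := (mul_eq_zero.1 e1).resolve_right h
  rw [plane_eq u, e0', e1']
  simp

/-- The contraction of the bilinear form `B` with the inverse of `g`, multiplied by the
determinant of `g`, in the basis `u, v`. -/
def contr (g B : Plane → Plane → ℝ) (u v : Plane) : ℝ :=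
  g v v * B u u - 2 * g u v * B u v + g u u * B v v

lemma gram_planeDet (g : Plane →L[ℝ] Plane →L[ℝ] ℝ) (hg : ∀ u v, g u v = g v u) (u v : Plane) :
    g u u * g v v - g u v ^ 2 = planeDet u v ^ 2 *
      (g (planeBasis 0) (planeBasis 0) * g (planeBasis 1) (planeBasis 1)
        - g (planeBasis 0) (planeBasis 1) ^ 2) := by
  conv_lhs => rw [plane_eq u, plane_eq v]
  simp only [map_add, map_smul, add_apply, smul_apply, smul_eq_mul, planeDet,
    hg (planeBasis 1) (planeBasis 0)]
  ring

lemma contr_planeDet (g B : Plane →L[ℝ] Plane →L[ℝ] ℝ) (hg : ∀ u v, g u v = g v u)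
    (hB : ∀ u v, B u v = B v u) (u v : Plane) :
    contr (fun u v => g u v) (fun u v => B u v) u v = planeDet u v ^ 2 *
      contr (fun u v => g u v) (fun u v => B u v) (planeBasis 0) (planeBasis 1) := by
  unfold contr
  conv_lhs => rw [plane_eq u, plane_eq v]
  simp only [map_add, map_smul, add_apply, smul_apply, smul_eq_mul, planeDet,
    hg (planeBasis 1) (planeBasis 0), hB (planeBasis 1) (planeBasis 0)]
  ring

/-- The trace of `B` with respect to `g`, computed in a `g`-orthonormal basis and in the standard
one. It serves to pass from normal coordinates back to the chart. -/
lemma contr_orthonormal (g B : Plane →L[ℝ] Plane →L[ℝ] ℝ) (hg : ∀ u v, g u v = g v u)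
    (hB : ∀ u v, B u v = B v u) {u v : Plane} (huu : g u u = 1) (hvv : g v v = 1)
    (huv : g u v = 0) :
    (g (planeBasis 0) (planeBasis 0) * g (planeBasis 1) (planeBasis 1)
        - g (planeBasis 0) (planeBasis 1) ^ 2) * (B u u + B v v)
      = contr (fun u v => g u v) (fun u v => B u v) (planeBasis 0) (planeBasis 1) := by
  have h1 := gram_planeDet g hg u v
  have h2 := contr_planeDet g B hg hB u v
  rw [huu, hvv, huv] at h1
  have h3 : contr (fun u v => g u v) (fun u v => B u v) u v = B u u + B v v := by
    simp only [contr, huu, hvv, huv]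
    ring
  rw [h3] at h2
  rw [h2, ← mul_assoc]
  linear_combination -contr (fun u v => g u v) (fun u v => B u v) (planeBasis 0) (planeBasis 1) * h1

lemma exists_orthonormal (g : Plane →L[ℝ] Plane →L[ℝ] ℝ) (hg : ∀ u v, g u v = g v u)
    (hp : ∀ u, u ≠ 0 → 0 < g u u) {ε : ℝ} (hε : ε ^ 2 = 1) :
    ∃ P : Plane →L[ℝ] Plane, (∀ u v, g (P u) (P v) = u 0 * v 0 + u 1 * v 1) ∧
      0 < ε * planeDet (P (planeBasis 0)) (P (planeBasis 1)) := by
  set e := planeBasis 0 with he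
  set f := planeBasis 1 with hf
  set A := g e e with hA
  set B := g e f with hB
  set C := g f f with hC
  have hA0 : 0 < A := hp e (planeBasis.ne_zero 0)
  have hm : 0 < A * C - B ^ 2 := gram_det_pos hg hp fun a b => planeBasis_linearIndependent
  set m := A * C - B ^ 2 with hmdef
  have hAm : 0 < A * m := mul_pos hA0 hm
  have s1 : √A * √A = A := Real.mul_self_sqrt hA0.le
  have s2 : √(A * m) * √(A * m) = A * m := Real.mul_self_sqrt hAm.le
  have p1 := Real.sqrt_pos.2 hA0
  have p2 := Real.sqrt_pos.2 hAm
  set b₀ : Plane := (√A)⁻¹ • e with hb₀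
  -- The second Gram-Schmidt vector: `A • f - B • e` is orthogonal to `e` and has squared length `A
  -- * m`. The sign `ε` chooses the orientation.
  set b₁ : Plane := (ε * (√(A * m))⁻¹) • (A • f - B • e) with hb₁
  let P : Plane →L[ℝ] Plane :=
    (EuclideanSpace.proj (𝕜 := ℝ) (0 : Fin 2) : Plane →L[ℝ] ℝ).smulRight b₀
      + (EuclideanSpace.proj (𝕜 := ℝ) (1 : Fin 2) : Plane →L[ℝ] ℝ).smulRight b₁
  have hP : ∀ u : Plane, P u = u 0 • b₀ + u 1 • b₁ := fun u => by simp [P]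
  have g00 : g b₀ b₀ = 1 := by
    simp only [hb₀, map_smul, smul_apply, smul_eq_mul, ← hA]
    field_simp
    rw [pow_two, s1]
  have g01 : g b₀ b₁ = 0 := by
    simp only [hb₀, hb₁, map_smul, map_sub, smul_apply, smul_eq_mul, ← hA, ← hB]
    ring
  have g10 : g b₁ b₀ = 0 := by rw [hg, g01]
  have g11 : g b₁ b₁ = 1 := by
    simp only [hb₁, map_smul, map_sub, smul_apply, sub_apply, smul_eq_mul, ← hA, ← hB, ← hC,
      hg f e]
    field_simp
    rw [pow_two (√(A * m)), s2, hε, hmdef]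
    ring
  refine ⟨P, ?_, ?_⟩
  · intro u v
    simp only [hP, map_add, map_smul, add_apply, smul_apply, smul_eq_mul, g00, g01, g10, g11]
    ring
  · have q0 : P e = b₀ := by rw [hP]; simp [he, planeBasis]
    have q1 : P f = b₁ := by rw [hP]; simp [hf, planeBasis]
    rw [q0, q1]
    have : planeDet b₀ b₁ = ε * ((√A)⁻¹ * (√(A * m))⁻¹ * A) := by
      have hd := planeDet_basis
      rw [← he, ← hf] at hd
      simp only [planeDet, hb₀, hb₁, PiLp.smul_apply, PiLp.sub_apply, smul_eq_mul] at hd ⊢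
      linear_combination (ε * ((√A)⁻¹ * (√(A * m))⁻¹ * A)) * hd
    rw [this, ← mul_assoc, ← pow_two, hε, one_mul]
    positivity

end PlaneForms

/-! ### Time-independent changes of the space parameters. -/

section ChangeOfParameters

variable {E F : Type*} [NormedAddCommGroup E] [NormedSpace ℝ E] [NormedAddCommGroup F]
  [NormedSpace ℝ F]

/-- A time-independent change of the space parameters. -/
def spaceMap (σ : Plane → Plane) (z : ℝ × Plane) : ℝ × Plane := (z.1, σ z.2)

variable {σ : Plane → Plane} (hσ : ContDiff ℝ ∞ σ)

include hσ

lemma contDiff_spaceMap : ContDiff ℝ ∞ (spaceMap σ) :=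
  contDiff_fst.prodMk (hσ.comp contDiff_snd)

lemma fderiv_spaceMap (z ξ : ℝ × Plane) :
    fderiv ℝ (spaceMap σ) z ξ = (ξ.1, fderiv ℝ σ z.2 ξ.2) := by
  have h1 : HasFDerivAt σ (fderiv ℝ σ z.2) z.2 := ((hσ.differentiable (by simp)) z.2).hasFDerivAt
  have h2 := (hasFDerivAt_fst (𝕜 := ℝ) (p := z)).prodMk (h1.comp z (hasFDerivAt_snd (𝕜 := ℝ) (p := z)))
  have h3 : fderiv ℝ (spaceMap σ) z = _ := h2.fderiv
  rw [h3]
  simp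

lemma fderiv_fderiv_spaceMap (z ξ ζ : ℝ × Plane) :
    fderiv ℝ (fderiv ℝ (spaceMap σ)) z ξ ζ = (0, fderiv ℝ (fderiv ℝ σ) z.2 ξ.2 ζ.2) := by
  rw [← fderiv_fderiv_apply isOpen_univ (contDiff_spaceMap hσ).contDiffOn (Set.mem_univ z)]
  have e : (fun x => fderiv ℝ (spaceMap σ) x ζ) = fun x => (ζ.1, fderiv ℝ σ x.2 ζ.2) := by
    funext x
    exact fderiv_spaceMap hσ x ζ
  have hd : DifferentiableAt ℝ (fderiv ℝ σ) z.2 :=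
    ((hσ.fderiv_right (m := ∞) infty_add_one_le).differentiable (by simp)) z.2
  have h1 := (hd.hasFDerivAt.clm_apply (hasFDerivAt_const ζ.2 z.2)).comp z
    (hasFDerivAt_snd (𝕜 := ℝ) (p := z))
  have h2 := (hasFDerivAt_const (𝕜 := ℝ) ζ.1 z).prodMk h1
  have h3 : fderiv ℝ (fun x : ℝ × Plane => (ζ.1, fderiv ℝ σ x.2 ζ.2)) z = _ := h2.fderiv
  rw [e, h3]
  simp

lemma partialD_spaceMap {φ : ℝ × Plane → F} {z : ℝ × Plane}
    (hφ : DifferentiableAt ℝ φ (spaceMap σ z)) (s : ℝ) (u : Plane) :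
    partialD (fun x => φ (spaceMap σ x)) (s, u) z
      = partialD φ (s, fderiv ℝ σ z.2 u) (spaceMap σ z) := by
  have h := (HasFDerivAt.comp (g := φ) (f := spaceMap σ) z hφ.hasFDerivAt
    ((contDiff_spaceMap hσ).differentiable (by simp) z).hasFDerivAt).fderiv
  have h' : fderiv ℝ (fun x => φ (spaceMap σ x)) z = _ := h
  rw [partialD, h', ContinuousLinearMap.comp_apply, fderiv_spaceMap hσ]
  rfl

lemma covX_spaceMap {Γ : F → F →L[ℝ] F →L[ℝ] F} {φ : ℝ × Plane → F} {z : ℝ × Plane}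
    (hφ : ContDiffAt ℝ ∞ φ (spaceMap σ z)) (u v : Plane) :
    covX Γ (fun x => φ (spaceMap σ x)) (0, u) (0, v) z
      = covX Γ φ (0, fderiv ℝ σ z.2 u) (0, fderiv ℝ σ z.2 v) (spaceMap σ z)
        + partialD φ (0, fderiv ℝ (fderiv ℝ σ) z.2 u v) (spaceMap σ z) := by
  have := covX_comp (Γ := Γ) (Γ' := Γ) (τ := fun x : F => x) (φ := φ)
    (σ := spaceMap σ) (z := z) contDiffAt_id (isConnMapAt_id Γ _) hφ
    (contDiff_spaceMap hσ).contDiffAt (0, u) (0, v)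
  rw [this, fderiv_fderiv_spaceMap hσ, fderiv_spaceMap hσ, fderiv_spaceMap hσ]
  simp [fderiv_fun_id, partialD]

lemma secondD_spaceMap {f : ℝ × Plane → ℝ} {z : ℝ × Plane}
    (hf : ContDiffAt ℝ ∞ f (spaceMap σ z)) (u : Plane) :
    secondD (0, u) (fun x => f (spaceMap σ x)) z
      = secondD (0, fderiv ℝ σ z.2 u) f (spaceMap σ z)
        + partialD f (0, fderiv ℝ (fderiv ℝ σ) z.2 u u) (spaceMap σ z) := by
  -- A scalar function is a map to the line with zero connection, so `covX_spaceMap` applies to it.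
  have e : ∀ (f : ℝ × Plane → ℝ) (ξ z : ℝ × Plane), secondD ξ f z = covX 0 f ξ ξ z := by
    intro f ξ z
    simp [secondD, covX, covDeriv]
    rfl
  rw [e, e, covX_spaceMap hσ hf]

/-- A fixed change of parameters does not alter the velocity, and it changes the trace of the
Hessian only by tangential vectors. -/
lemma IsFlowInChart.comp_spaceMap {G : E → E →L[ℝ] E →L[ℝ] ℝ} {Γ : E → E →L[ℝ] E →L[ℝ] E}
    {V : Set E} {φ : ℝ × Plane → E} {O : Set (ℝ × Plane)} (h : IsFlowInChart G Γ V φ O)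
    {U : Set Plane} (hU : IsOpen U)
    (hdet : ∀ y ∈ U, planeDet (fderiv ℝ σ y (planeBasis 0)) (fderiv ℝ σ y (planeBasis 1)) ≠ 0) :
    IsFlowInChart G Γ V (fun z => φ (spaceMap σ z)) {z | spaceMap σ z ∈ O ∧ z.2 ∈ U} := by
  have hc := contDiff_spaceMap hσ
  have hat : ∀ z, spaceMap σ z ∈ O → ContDiffAt ℝ ∞ φ (spaceMap σ z) := fun z hz =>
    h.smooth.contDiffAt (h.isOpen.mem_nhds hz)
  have hX : ∀ z, spaceMap σ z ∈ O → ∀ s u, partialD (fun x => φ (spaceMap σ x)) (s, u) z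
      = partialD φ (s, fderiv ℝ σ z.2 u) (spaceMap σ z) := fun z hz s u =>
    partialD_spaceMap hσ ((hat z hz).differentiableAt (by simp)) s u
  have hg : ∀ z, spaceMap σ z ∈ O → ∀ s u s' v, indMetric G (fun x => φ (spaceMap σ x)) (s, u) (s', v) z
      = indMetric G φ (s, fderiv ℝ σ z.2 u) (s', fderiv ℝ σ z.2 v) (spaceMap σ z) := by
    intro z hz s u s' v
    rw [indMetric, hX z hz, hX z hz, indMetric]
  refine ⟨h.lc, ?_, ?_, fun z hz => h.mapsTo hz.1, ?_, ?_, ?_⟩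
  · exact (h.isOpen.preimage hc.continuous).inter (hU.preimage continuous_snd)
  · exact h.smooth.comp hc.contDiffOn fun z hz => hz.1
  · intro z hz u hu
    rw [hX z hz.1] at hu
    exact eq_zero_of_planeDet (hdet z.2 hz.2) (h.immersion _ hz.1 _ hu)
  · intro z hz u
    rw [hg z hz.1, map_zero]
    exact h.normal _ hz.1 _
  · intro z hz u v
    set A := fderiv ℝ σ z.2 with hA
    obtain ⟨a, ha⟩ := h.flow _ hz.1 (A u) (A v)
    set s := fun u v => fderiv ℝ (fderiv ℝ σ) z.2 u v with hs
    have hAs : Function.Surjective A := by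
      refine LinearMap.surjective_of_injective (f := (A : Plane →ₗ[ℝ] Plane)) ?_
      rw [injective_iff_map_eq_zero]
      exact fun u hu => eq_zero_of_planeDet (hdet z.2 hz.2) hu
    set g := fun u v => indMetric G φ (0, u) (0, v) (spaceMap σ z) with hgd
    -- The old tangential term minus the trace of the second derivatives of `σ`, pulled back by the
    -- invertible differential of `σ`.
    obtain ⟨a', ha'⟩ := hAs (a - g (A v) (A v) • s u u - (-2 * g (A u) (A v)) • s u v
      - g (A u) (A u) • s v v)
    refine ⟨a', ?_⟩
    have hlin : ∀ a b : Plane, partialD φ (0, a + b) (spaceMap σ z)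
        = partialD φ (0, a) (spaceMap σ z) + partialD φ (0, b) (spaceMap σ z) := by
      intro a b
      rw [partialD, partialD, partialD, ← map_add]
      simp
    have hsub : ∀ a b : Plane, partialD φ (0, a - b) (spaceMap σ z)
        = partialD φ (0, a) (spaceMap σ z) - partialD φ (0, b) (spaceMap σ z) := by
      intro a b
      rw [partialD, partialD, partialD, ← map_sub]
      simp
    have hsmul : ∀ (r : ℝ) (a : Plane), partialD φ (0, r • a) (spaceMap σ z)
        = r • partialD φ (0, a) (spaceMap σ z) := by
      intro r a
      rw [partialD, partialD, ← map_smul]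
      simp
    have hcov := fun u v => covX_spaceMap (Γ := Γ) hσ (hat z hz.1) u v
    rw [hX z hz.1, hX z hz.1, map_zero, ← hA, ha']
    simp only [indDet, traceHess, hg z hz.1, hcov, ← hA, hsub, hsmul] at ha ⊢
    rw [ha]
    simp only [hgd, hs]
    module

end ChangeOfParameters

/-! ### Coordinates that are normal at one point. -/

section NormalCoordinates

variable {E : Type*} [NormedAddCommGroup E] [NormedSpace ℝ E]
  {G : E → E →L[ℝ] E →L[ℝ] ℝ} {Γ : E → E →L[ℝ] E →L[ℝ] E} {V : Set E}
  {φ : ℝ × Plane → E} {O : Set (ℝ × Plane)} {z : ℝ × Plane}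

/-- The second order expansion `P`, `Q` of normal coordinates at `z`. -/
structure IsNormalChange (G : E → E →L[ℝ] E →L[ℝ] ℝ) (Γ : E → E →L[ℝ] E →L[ℝ] E)
    (φ : ℝ × Plane → E) (z : ℝ × Plane) (ε : ℝ) (P : Plane →L[ℝ] Plane)
    (Q : Plane →L[ℝ] Plane →L[ℝ] Plane) : Prop where
  orthonormal : ∀ u v, indMetric G φ (0, P u) (0, P v) z = u 0 * v 0 + u 1 * v 1
  orient : 0 < ε * planeDet (P (planeBasis 0)) (P (planeBasis 1))
  symm : ∀ u v, Q u v = Q v u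
  tangential : ∀ u v w, G (φ z) (covX Γ φ (0, P u) (0, P v) z + partialD φ (0, Q u v) z)
    (partialD φ (0, w) z) = 0

/-- The restriction of the differential of `φ` to the space directions. -/
def spaceDiff (φ : ℝ × Plane → E) (z : ℝ × Plane) : Plane →L[ℝ] E :=
  fderiv ℝ φ z ∘L ContinuousLinearMap.inr ℝ ℝ Plane

lemma spaceDiff_apply (φ : ℝ × Plane → E) (z : ℝ × Plane) (u : Plane) :
    spaceDiff φ z u = partialD φ (0, u) z := by simp [spaceDiff, partialD]

/-- The induced metric, as a bilinear form. -/
def spaceMetric (G : E → E →L[ℝ] E →L[ℝ] ℝ) (φ : ℝ × Plane → E) (z : ℝ × Plane) :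
    Plane →L[ℝ] Plane →L[ℝ] ℝ :=
  (G (φ z)).bilinearComp (spaceDiff φ z) (spaceDiff φ z)

lemma spaceMetric_apply (G : E → E →L[ℝ] E →L[ℝ] ℝ) (φ : ℝ × Plane → E) (z : ℝ × Plane)
    (u v : Plane) : spaceMetric G φ z u v = indMetric G φ (0, u) (0, v) z := by
  rw [indMetric, ← spaceDiff_apply, ← spaceDiff_apply]
  rfl

/-- The covariant Hessian in the space directions, as a bilinear map. -/
def spaceHess (Γ : E → E →L[ℝ] E →L[ℝ] E) (φ : ℝ × Plane → E) (z : ℝ × Plane) :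
    Plane →L[ℝ] Plane →L[ℝ] E :=
  (fderiv ℝ (fderiv ℝ φ) z).bilinearComp (ContinuousLinearMap.inr ℝ ℝ Plane)
      (ContinuousLinearMap.inr ℝ ℝ Plane)
    + (Γ (φ z)).bilinearComp (spaceDiff φ z) (spaceDiff φ z)

namespace IsFlowInChart

variable (h : IsFlowInChart G Γ V φ O) (hz : z ∈ O)

include h hz

lemma spaceHess_apply (u v : Plane) : spaceHess Γ φ z u v = covX Γ φ (0, u) (0, v) z := by
  have e : fderiv ℝ (partialD φ (0, v)) z (0, u) = fderiv ℝ (fderiv ℝ φ) z (0, u) (0, v) :=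
    fderiv_fderiv_apply h.isOpen h.smooth hz _ _
  rw [covX, covDeriv, e, spaceHess]
  simp [ContinuousLinearMap.bilinearComp_apply, spaceDiff_apply, partialD]

lemma spaceHess_symm (u v : Plane) : spaceHess Γ φ z u v = spaceHess Γ φ z v u := by
  rw [h.spaceHess_apply hz, h.spaceHess_apply hz]
  exact h.isLocalFlow.covX_comm hz _ _

lemma spaceMetric_symm (u v : Plane) : spaceMetric G φ z u v = spaceMetric G φ z v u :=
  h.lc.symm _ (h.mapsTo hz) _ _

lemma spaceMetric_pos (u : Plane) (hu : u ≠ 0) : 0 < spaceMetric G φ z u u := by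
  refine h.lc.pos _ (h.mapsTo hz) _ fun h0 => hu (h.immersion z hz u ?_)
  rw [← spaceDiff_apply]
  exact h0

lemma indDet_pos : 0 < indDet G φ (0, planeBasis 0) (0, planeBasis 1) z := by
  simp only [indDet, ← spaceMetric_apply]
  exact gram_det_pos (h.spaceMetric_symm hz) (h.spaceMetric_pos hz)
    fun a b => planeBasis_linearIndependent

lemma exists_isNormalChange {ε : ℝ} (hε : ε ^ 2 = 1) : ∃ P Q, IsNormalChange G Γ φ z ε P Q := by
  obtain ⟨P, hP, hor⟩ := exists_orthonormal (spaceMetric G φ z) (h.spaceMetric_symm hz)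
    (h.spaceMetric_pos hz) hε
  obtain ⟨e, he⟩ := isInvertible_of_pos (h.spaceMetric_pos hz)
  -- `N` takes minus the tangential part of a vector and pulls it back to the parameter plane. As
  -- the second order coefficient `Q`, it makes the new Hessian normal to the surface.
  let N : E →L[ℝ] Plane := -((e.symm : (Plane →L[ℝ] ℝ) →L[ℝ] Plane) ∘L
    ((ContinuousLinearMap.compL ℝ Plane E ℝ).flip (spaceDiff φ z) ∘L G (φ z)))
  have hN : ∀ U w, spaceMetric G φ z (N U) w = -G (φ z) U (spaceDiff φ z w) := by
    intro U w
    rw [← he]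
    simp [N]
  let Q : Plane →L[ℝ] Plane →L[ℝ] Plane :=
    ContinuousLinearMap.compL ℝ Plane E Plane N ∘L (spaceHess Γ φ z).bilinearComp P P
  have hQ : ∀ u v, Q u v = N (spaceHess Γ φ z (P u) (P v)) := fun u v => by
    simp [Q, ContinuousLinearMap.bilinearComp_apply]
  refine ⟨P, Q, fun u v => ?_, hor, fun u v => ?_, fun u v w => ?_⟩
  · rw [← hP, spaceMetric_apply]
  · rw [hQ, hQ, h.spaceHess_symm hz]
  · have := hN (spaceHess Γ φ z (P u) (P v)) w
    rw [map_add, add_apply, ← spaceDiff_apply, ← spaceDiff_apply, hQ, ← h.spaceHess_apply hz]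
    have e2 : G (φ z) (spaceDiff φ z (N (spaceHess Γ φ z (P u) (P v)))) (spaceDiff φ z w)
      = spaceMetric G φ z (N (spaceHess Γ φ z (P u) (P v))) w := rfl
    rw [e2, this]
    ring

end IsFlowInChart

/-- The map with Taylor coefficients `y₀`, `P`, `Q`. -/
def quadMap (y₀ : Plane) (P : Plane →L[ℝ] Plane) (Q : Plane →L[ℝ] Plane →L[ℝ] Plane) (y : Plane) :
    Plane := y₀ + P y + (1 / 2 : ℝ) • Q y y

section QuadMap

variable {y₀ : Plane} {P : Plane →L[ℝ] Plane} {Q : Plane →L[ℝ] Plane →L[ℝ] Plane}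

lemma contDiff_quadMap : ContDiff ℝ ∞ (quadMap y₀ P Q) := by
  unfold quadMap
  fun_prop

lemma quadMap_zero : quadMap y₀ P Q 0 = y₀ := by simp [quadMap]

lemma fderiv_quadMap (hQ : ∀ u v, Q u v = Q v u) :
    fderiv ℝ (quadMap y₀ P Q) = fun y => P + Q y := by
  funext y
  have h1 : HasFDerivAt (fun y => Q y y) _ y := Q.hasFDerivAt.clm_apply (hasFDerivAt_id y)
  have h2 := ((hasFDerivAt_const y₀ y).add P.hasFDerivAt).add (h1.const_smul (1 / 2 : ℝ))
  have h3 : fderiv ℝ (quadMap y₀ P Q) y = _ := h2.fderiv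
  rw [h3]
  ext u : 1
  simp only [add_apply, smul_apply, ContinuousLinearMap.comp_apply, ContinuousLinearMap.flip_apply,
    zero_apply, ContinuousLinearMap.id_apply, hQ u y]
  module

lemma fderiv_fderiv_quadMap (hQ : ∀ u v, Q u v = Q v u) (y : Plane) :
    fderiv ℝ (fderiv ℝ (quadMap y₀ P Q)) y = Q := by
  rw [fderiv_quadMap hQ, fderiv_const_add]
  exact Q.fderiv

end QuadMap

/-- The flow in normal coordinates. -/
def normalMap (z : ℝ × Plane) (P : Plane →L[ℝ] Plane) (Q : Plane →L[ℝ] Plane →L[ℝ] Plane) :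
    ℝ × Plane → ℝ × Plane := spaceMap (quadMap z.2 P Q)

/-- The domain of normal coordinates. -/
def normalDom (O : Set (ℝ × Plane)) (z : ℝ × Plane) (ε : ℝ) (P : Plane →L[ℝ] Plane)
    (Q : Plane →L[ℝ] Plane →L[ℝ] Plane) : Set (ℝ × Plane) :=
  {x | normalMap z P Q x ∈ O ∧ x.2 ∈ {y : Plane | 0 < ε * planeDet
    (fderiv ℝ (quadMap z.2 P Q) y (planeBasis 0)) (fderiv ℝ (quadMap z.2 P Q) y (planeBasis 1))}}

namespace IsNormalChange

variable {ε : ℝ} {P : Plane →L[ℝ] Plane} {Q : Plane →L[ℝ] Plane →L[ℝ] Plane}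
  (hn : IsNormalChange G Γ φ z ε P Q)

lemma normalMap_self : normalMap z P Q (z.1, 0) = z := by
  simp [normalMap, spaceMap, quadMap_zero]

include hn

lemma fderiv_zero : fderiv ℝ (quadMap z.2 P Q) 0 = P := by
  rw [fderiv_quadMap hn.symm]
  simp

lemma mem (hz : z ∈ O) : (z.1, 0) ∈ normalDom O z ε P Q := by
  refine ⟨by rwa [normalMap_self], ?_⟩
  simp only [Set.mem_ofPred_eq, hn.fderiv_zero]
  exact hn.orient

omit hn in
lemma isFlowInChart (h : IsFlowInChart G Γ V φ O) :
    IsFlowInChart G Γ V (fun x => φ (normalMap z P Q x)) (normalDom O z ε P Q) := by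
  refine h.comp_spaceMap contDiff_quadMap ?_ ?_
  · refine isOpen_lt continuous_const ?_
    have hc : Continuous (fderiv ℝ (quadMap z.2 P Q)) :=
      contDiff_quadMap.continuous_fderiv (n := ∞) (by simp)
    have hc' : ∀ i j, Continuous fun y => (fderiv ℝ (quadMap z.2 P Q) y (planeBasis i)) j := by
      intro i j
      have := hc.clm_apply (continuous_const (y := planeBasis i))
      exact (EuclideanSpace.proj (𝕜 := ℝ) j : Plane →L[ℝ] ℝ).continuous.comp this
    unfold planeDet
    exact continuous_const.mul (((hc' 0 0).mul (hc' 1 1)).sub ((hc' 0 1).mul (hc' 1 0)))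
  · intro y hy h0
    simp only [Set.mem_ofPred_eq, h0, mul_zero, lt_self_iff_false] at hy

variable (h : IsFlowInChart G Γ V φ O) (hz : z ∈ O)

include h

omit hn in
lemma partialD_eq {x : ℝ × Plane} (hx : x ∈ normalDom O z ε P Q) (s : ℝ) (u : Plane) :
    partialD (fun x => φ (normalMap z P Q x)) (s, u) x
      = partialD φ (s, fderiv ℝ (quadMap z.2 P Q) x.2 u) (normalMap z P Q x) :=
  partialD_spaceMap contDiff_quadMap (differentiableAt_of_contDiffOn h.isOpen h.smooth hx.1) s u

omit hn in
lemma indMetric_eq {x : ℝ × Plane} (hx : x ∈ normalDom O z ε P Q) (s s' : ℝ) (u v : Plane) :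
    indMetric G (fun x => φ (normalMap z P Q x)) (s, u) (s', v) x
      = indMetric G φ (s, fderiv ℝ (quadMap z.2 P Q) x.2 u)
        (s', fderiv ℝ (quadMap z.2 P Q) x.2 v) (normalMap z P Q x) := by
  rw [indMetric, partialD_eq h hx, partialD_eq h hx, indMetric]

include hz

lemma covX_eq (u v : Plane) :
    covX Γ (fun x => φ (normalMap z P Q x)) (0, u) (0, v) (z.1, 0)
      = covX Γ φ (0, P u) (0, P v) z + partialD φ (0, Q u v) z := by
  have e := covX_spaceMap (Γ := Γ) (φ := φ) (z := (z.1, (0 : Plane))) (contDiff_quadMap (y₀ := z.2) (P := P) (Q := Q))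
    (by
      have : spaceMap (quadMap z.2 P Q) (z.1, 0) = z := normalMap_self
      rw [this]
      exact h.smooth.contDiffAt (h.isOpen.mem_nhds hz)) u v
  have e0 : spaceMap (quadMap z.2 P Q) (z.1, 0) = z := normalMap_self
  simp only [e0, hn.fderiv_zero, fderiv_fderiv_quadMap hn.symm] at e
  exact e

lemma isNormalAt : IsNormalAt G Γ (fun x => φ (normalMap z P Q x)) (0, planeBasis 0)
    (0, planeBasis 1) (z.1, 0) := by
  have hx := hn.mem hz
  have e0 : normalMap z P Q (z.1, 0) = z := normalMap_self
  have k : ∀ u v w, G (φ (normalMap z P Q (z.1, 0)))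
      (covX Γ (fun x => φ (normalMap z P Q x)) (0, u) (0, v) (z.1, 0))
      (partialD (fun x => φ (normalMap z P Q x)) (0, w) (z.1, 0)) = 0 := by
    intro u v w
    rw [hn.covX_eq h hz, partialD_eq h hx, e0]
    exact hn.tangential u v _
  refine ⟨?_, ?_, ?_, k _ _ _, k _ _ _, k _ _ _, k _ _ _, k _ _ _, k _ _ _⟩
  all_goals
    rw [IsNormalChange.indMetric_eq h hx, hn.fderiv_zero, e0, hn.orthonormal]
    simp [planeBasis]

omit hz hn in
lemma form_eq {W : E → E →L[ℝ] E →L[ℝ] ℝ} (hW : ∀ y ∈ V, ∀ v, W y v v = 0) {x : ℝ × Plane}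
    (hx : x ∈ normalDom O z ε P Q) :
    W (φ (normalMap z P Q x)) (partialD (fun x => φ (normalMap z P Q x)) (0, planeBasis 0) x)
        (partialD (fun x => φ (normalMap z P Q x)) (0, planeBasis 1) x)
      = planeDet (fderiv ℝ (quadMap z.2 P Q) x.2 (planeBasis 0))
          (fderiv ℝ (quadMap z.2 P Q) x.2 (planeBasis 1))
        * W (φ (normalMap z P Q x)) (partialD φ (0, planeBasis 0) (normalMap z P Q x))
          (partialD φ (0, planeBasis 1) (normalMap z P Q x)) := by
  rw [partialD_eq h hx, partialD_eq h hx]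
  have := alternating_plane' ((W (φ (normalMap z P Q x))).bilinearComp
    (spaceDiff φ (normalMap z P Q x)) (spaceDiff φ (normalMap z P Q x)))
    (fun v => hW _ (h.mapsTo hx.1) _) (fderiv ℝ (quadMap z.2 P Q) x.2 (planeBasis 0))
          (fderiv ℝ (quadMap z.2 P Q) x.2 (planeBasis 1))
  simpa only [ContinuousLinearMap.bilinearComp_apply, spaceDiff_apply] using this

omit hz hn in
lemma indDet_eq {x : ℝ × Plane} (hx : x ∈ normalDom O z ε P Q) :
    indDet G (fun x => φ (normalMap z P Q x)) (0, planeBasis 0) (0, planeBasis 1) x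
      = planeDet (fderiv ℝ (quadMap z.2 P Q) x.2 (planeBasis 0))
          (fderiv ℝ (quadMap z.2 P Q) x.2 (planeBasis 1)) ^ 2
        * indDet G φ (0, planeBasis 0) (0, planeBasis 1) (normalMap z P Q x) := by
  simp only [indDet, IsNormalChange.indMetric_eq h hx, ← spaceMetric_apply]
  exact gram_planeDet _ (h.spaceMetric_symm hx.1) _ _

omit hz hn in
-- The form changes by the Jacobian determinant and the area density by its absolute value. On the
-- domain the Jacobian has the sign `ε`, so the quotient is `ε`.
lemma angle_eq {W₁ W₂ : E → E →L[ℝ] E →L[ℝ] ℝ} (hW : ∀ y ∈ V, ∀ v, (W₁ + W₂) y v v = 0)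
    (hε : ε ^ 2 = 1) {x : ℝ × Plane} (hx : x ∈ normalDom O z ε P Q) :
    IsLocalFlow.angle G W₁ W₂ (fun x => φ (normalMap z P Q x)) (0, planeBasis 0) (0, planeBasis 1) x
      = ε * IsLocalFlow.angle G W₁ W₂ φ (0, planeBasis 0) (0, planeBasis 1) (normalMap z P Q x) := by
  unfold IsLocalFlow.angle
  have e := IsNormalChange.form_eq h hW hx
  rw [e, IsNormalChange.indDet_eq h hx]
  have hx2 : 0 < ε * planeDet (fderiv ℝ (quadMap z.2 P Q) x.2 (planeBasis 0))
          (fderiv ℝ (quadMap z.2 P Q) x.2 (planeBasis 1)) := hx.2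
  set d := planeDet (fderiv ℝ (quadMap z.2 P Q) x.2 (planeBasis 0))
          (fderiv ℝ (quadMap z.2 P Q) x.2 (planeBasis 1)) with hd
  have hm := h.indDet_pos hx.1
  set m := indDet G φ (0, planeBasis 0) (0, planeBasis 1) (normalMap z P Q x) with hmdef
  have hs : √(d ^ 2 * m) = ε * d * √m := by
    have : d ^ 2 * m = (ε * d) ^ 2 * m := by rw [mul_pow, hε, one_mul]
    rw [this, Real.sqrt_mul (sq_nonneg _), Real.sqrt_sq hx2.le]
  rw [hs]
  have hd0 : d ≠ 0 := fun h0 => by simp [h0] at hx2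
  have hε0 : ε ≠ 0 := fun h0 => by simp [h0] at hx2
  have hm0 := (Real.sqrt_pos.2 hm).ne'
  field_simp
  rw [hε, mul_one]

/-- The Hessian in normal coordinates is the normal part of the original one, so it is not longer.
Only this inequality is needed, as the maximum principle just requires an upper bound. -/
lemma sqNormA_le : IsLocalFlow.sqNormA G Γ (fun x => φ (normalMap z P Q x)) (0, planeBasis 0)
    (0, planeBasis 1) (z.1, 0) ≤
    G (φ z) (covX Γ φ (0, P (planeBasis 0)) (0, P (planeBasis 0)) z)
        (covX Γ φ (0, P (planeBasis 0)) (0, P (planeBasis 0)) z)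
      + 2 * G (φ z) (covX Γ φ (0, P (planeBasis 0)) (0, P (planeBasis 1)) z)
        (covX Γ φ (0, P (planeBasis 0)) (0, P (planeBasis 1)) z)
      + G (φ z) (covX Γ φ (0, P (planeBasis 1)) (0, P (planeBasis 1)) z)
        (covX Γ φ (0, P (planeBasis 1)) (0, P (planeBasis 1)) z) := by
  have key : ∀ u v, G (φ (normalMap z P Q (z.1, 0)))
      (covX Γ (fun x => φ (normalMap z P Q x)) (0, u) (0, v) (z.1, 0))
      (covX Γ (fun x => φ (normalMap z P Q x)) (0, u) (0, v) (z.1, 0))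
      ≤ G (φ z) (covX Γ φ (0, P u) (0, P v) z) (covX Γ φ (0, P u) (0, P v) z) := by
    intro u v
    rw [normalMap_self, hn.covX_eq h hz]
    have t := hn.tangential u v (Q u v)
    set Y := covX Γ φ (0, P u) (0, P v) z
    set D := partialD φ (0, Q u v) z
    have hs := h.lc.symm _ (h.mapsTo hz)
    have hD : 0 ≤ G (φ z) D D := by
      by_cases h0 : D = 0
      · simp [h0]
      · exact (h.lc.pos _ (h.mapsTo hz) D h0).le
    simp only [map_add, add_apply] at t ⊢
    rw [hs D Y]
    linarith
  have k1 := key (planeBasis 0) (planeBasis 0)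
  have k2 := key (planeBasis 0) (planeBasis 1)
  have k3 := key (planeBasis 1) (planeBasis 1)
  unfold IsLocalFlow.sqNormA
  linarith

lemma secondD_eq {f : ℝ × Plane → ℝ} (hf : ContDiffOn ℝ ∞ f O) (u : Plane) :
    secondD (0, u) (fun x => f (normalMap z P Q x)) (z.1, 0)
      = secondD (0, P u) f z + partialD f (0, Q u u) z := by
  have e0 : spaceMap (quadMap z.2 P Q) (z.1, 0) = z := normalMap_self
  have e := secondD_spaceMap (f := f) (z := (z.1, (0 : Plane)))
    (contDiff_quadMap (y₀ := z.2) (P := P) (Q := Q))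
    (by
      rw [e0]
      exact hf.contDiffAt (h.isOpen.mem_nhds hz)) u
  simp only [e0, hn.fderiv_zero, fderiv_fderiv_quadMap hn.symm] at e
  exact e

end IsNormalChange

end NormalCoordinates

/-! ### The Laplacian in divergence form and the variation of area. -/

section Divergence

variable {E : Type*} [NormedAddCommGroup E] [NormedSpace ℝ E]
  {G : E → E →L[ℝ] E →L[ℝ] ℝ} {Γ : E → E →L[ℝ] E →L[ℝ] E} {V : Set E}
  {φ : ℝ × Plane → E} {O : Set (ℝ × Plane)} {z : ℝ × Plane}

/-- The first component of the gradient density `√m g^{ij} ∂_j f`. -/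
def flux₀ (G : E → E →L[ℝ] E →L[ℝ] ℝ) (φ : ℝ × Plane → E) (f : ℝ × Plane → ℝ) (x : ℝ × Plane) : ℝ :=
  (indMetric G φ (0, planeBasis 1) (0, planeBasis 1) x * partialD f (0, planeBasis 0) x
    - indMetric G φ (0, planeBasis 0) (0, planeBasis 1) x * partialD f (0, planeBasis 1) x)
  / √(indDet G φ (0, planeBasis 0) (0, planeBasis 1) x)

/-- The second component of the gradient density `√m g^{ij} ∂_j f`. -/
def flux₁ (G : E → E →L[ℝ] E →L[ℝ] ℝ) (φ : ℝ × Plane → E) (f : ℝ × Plane → ℝ) (x : ℝ × Plane) : ℝ :=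
  (indMetric G φ (0, planeBasis 0) (0, planeBasis 0) x * partialD f (0, planeBasis 1) x
    - indMetric G φ (0, planeBasis 0) (0, planeBasis 1) x * partialD f (0, planeBasis 0) x)
  / √(indDet G φ (0, planeBasis 0) (0, planeBasis 1) x)

/-- The Laplacian, multiplied by the area density, in divergence form. -/
def fluxDiv (G : E → E →L[ℝ] E →L[ℝ] ℝ) (φ : ℝ × Plane → E) (f : ℝ × Plane → ℝ) (x : ℝ × Plane) : ℝ :=
  partialD (flux₀ G φ f) (0, planeBasis 0) x + partialD (flux₁ G φ f) (0, planeBasis 1) x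

lemma fderiv_div_sqrt {N m : ℝ × Plane → ℝ} (hN : DifferentiableAt ℝ N z)
    (hm : DifferentiableAt ℝ m z) (h0 : 0 < m z) (ξ : ℝ × Plane) :
    2 * m z * √(m z) * fderiv ℝ (fun x => N x / √(m x)) z ξ
      = 2 * m z * fderiv ℝ N z ξ - N z * fderiv ℝ m z ξ := by
  have h1 := hm.hasFDerivAt.sqrt h0.ne'
  have hs := (Real.sqrt_pos.2 h0).ne'
  have hss := Real.mul_self_sqrt h0.le
  have h2 : DifferentiableAt ℝ (fun x => N x / √(m x)) z := by
    simp only [div_eq_mul_inv]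
    exact hN.fun_mul (h1.differentiableAt.fun_inv hs)
  have h3 : (fun x => N x / √(m x) * √(m x)) =ᶠ[𝓝 z] N := by
    filter_upwards [hm.continuousAt.eventually (lt_mem_nhds h0)] with x hx
    exact div_mul_cancel₀ _ (Real.sqrt_pos.2 hx).ne'
  rw [← h3.fderiv_eq, fderiv_mul_apply' h2 h1.differentiableAt, h1.fderiv]
  simp only [smul_apply, smul_eq_mul]
  set s := √(m z)
  rw [← hss]
  field_simp
  ring

namespace IsFlowInChart

variable (h : IsFlowInChart G Γ V φ O) (hz : z ∈ O)

include h hz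

omit hz in
lemma contDiffOn_flux {f : ℝ × Plane → ℝ} (hf : ContDiffOn ℝ ∞ f O) :
    ContDiffOn ℝ ∞ (flux₀ G φ f) O ∧ ContDiffOn ℝ ∞ (flux₁ G φ f) O := by
  have hg := h.isLocalFlow.contDiffOn_indMetric
  have hp := contDiffOn_partialD h.isOpen hf
  have hs := (h.isLocalFlow.contDiffOn_indDet (0, planeBasis 0) (0, planeBasis 1)).sqrt
    fun x hx => (h.indDet_pos hx).ne'
  exact ⟨(((hg _ _).mul (hp _)).sub ((hg _ _).mul (hp _))).div hs
      fun x hx => (Real.sqrt_pos.2 (h.indDet_pos hx)).ne',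
    (((hg _ _).mul (hp _)).sub ((hg _ _).mul (hp _))).div hs
      fun x hx => (Real.sqrt_pos.2 (h.indDet_pos hx)).ne'⟩

lemma fderiv_indDet (ξ : ℝ × Plane) :
    fderiv ℝ (indDet G φ (0, planeBasis 0) (0, planeBasis 1)) z ξ
      = fderiv ℝ (indMetric G φ (0, planeBasis 0) (0, planeBasis 0)) z ξ
          * indMetric G φ (0, planeBasis 1) (0, planeBasis 1) z
        + indMetric G φ (0, planeBasis 0) (0, planeBasis 0) z
          * fderiv ℝ (indMetric G φ (0, planeBasis 1) (0, planeBasis 1)) z ξ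
        - 2 * indMetric G φ (0, planeBasis 0) (0, planeBasis 1) z
          * fderiv ℝ (indMetric G φ (0, planeBasis 0) (0, planeBasis 1)) z ξ := by
  have hd := fun ξ ζ => (h.isLocalFlow.diff (h.isLocalFlow.contDiffOn_indMetric ξ ζ) hz).hasFDerivAt
  have h1 := ((hd (0, planeBasis 0) (0, planeBasis 0)).mul (hd (0, planeBasis 1) (0, planeBasis 1))).sub
    ((hd (0, planeBasis 0) (0, planeBasis 1)).pow 2)
  have h2 : fderiv ℝ (indDet G φ (0, planeBasis 0) (0, planeBasis 1)) z = _ := h1.fderiv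
  rw [h2]
  simp
  ring

/-- `∂_t √m = -|H|² √m`. -/
lemma fderiv_indDet_time :
    fderiv ℝ (indDet G φ (0, planeBasis 0) (0, planeBasis 1)) z (1, 0)
      = -2 * indDet G φ (0, planeBasis 0) (0, planeBasis 1) z * indMetric G φ (1, 0) (1, 0) z := by
  have hl := h.isLocalFlow
  have hs := hl.G_symm hz
  rw [h.fderiv_indDet hz, hl.fderiv_indMetric hz, hl.fderiv_indMetric hz, hl.fderiv_indMetric hz,
    hl.covX_comm hz (1, 0) (0, planeBasis 0), hl.covX_comm hz (1, 0) (0, planeBasis 1)]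
  obtain ⟨a1, a2⟩ := hl.G_covX_velocity hz (0, planeBasis 0)
  obtain ⟨b1, b2⟩ := hl.G_covX_velocity hz (0, planeBasis 1)
  rw [hs (partialD φ (0, planeBasis 0) z), hs (partialD φ (0, planeBasis 1) z),
    hs (partialD φ (0, planeBasis 0) z), a1, a2, b1, b2,
    hl.covX_comm hz (0, planeBasis 1) (0, planeBasis 0)]
  obtain ⟨a, b, hab⟩ := hl.flow z hz
  have e := congrArg (fun v => G (φ z) (partialD φ (1, 0) z) v) hab
  have n1 : G (φ z) (partialD φ (1, 0) z) (partialD φ (0, planeBasis 0) z) = 0 := hl.normal₁ z hz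
  have n2 : G (φ z) (partialD φ (1, 0) z) (partialD φ (0, planeBasis 1) z) = 0 := hl.normal₂ z hz
  simp only [map_add, map_smul, smul_eq_mul, n1, n2, traceHess] at e
  have u : indMetric G φ (1, 0) (1, 0) z = G (φ z) (partialD φ (1, 0) z) (partialD φ (1, 0) z) := rfl
  rw [u]
  linear_combination 2 * e

/-- The sum in parentheses on the right is the flat Laplacian of `f` in normal coordinates. Thus the
pointwise heat operator is translated into a divergence in the chart. -/
lemma fluxDiv_eq {ε : ℝ} {P : Plane →L[ℝ] Plane} {Q : Plane →L[ℝ] Plane →L[ℝ] Plane}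
    (hn : IsNormalChange G Γ φ z ε P Q) {f : ℝ × Plane → ℝ} (hf : ContDiffOn ℝ ∞ f O) :
    fluxDiv G φ f z = √(indDet G φ (0, planeBasis 0) (0, planeBasis 1) z)
      * (secondD (0, P (planeBasis 0)) f z + partialD f (0, Q (planeBasis 0) (planeBasis 0)) z
        + (secondD (0, P (planeBasis 1)) f z + partialD f (0, Q (planeBasis 1) (planeBasis 1)) z)) := by
  have hl := h.isLocalFlow
  have hm := h.indDet_pos hz
  have dg := fun ξ ζ => hl.diff (hl.contDiffOn_indMetric ξ ζ) hz
  have df := fun ξ => hl.diff (contDiffOn_partialD h.isOpen hf ξ) hz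
  have dm := hl.diff (hl.contDiffOn_indDet (0, planeBasis 0) (0, planeBasis 1)) hz
  have hff : ∀ u v : Plane, fderiv ℝ (partialD f (0, v)) z (0, u)
      = (fderiv ℝ (fderiv ℝ f) z).bilinearComp (ContinuousLinearMap.inr ℝ ℝ Plane)
      (ContinuousLinearMap.inr ℝ ℝ Plane) u v := by
    intro u v
    have := fderiv_fderiv_apply h.isOpen hf hz (0, u) (0, v)
    exact this.trans (by simp [ContinuousLinearMap.bilinearComp_apply])
  set D2 := (fderiv ℝ (fderiv ℝ f) z).bilinearComp (ContinuousLinearMap.inr ℝ ℝ Plane)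
      (ContinuousLinearMap.inr ℝ ℝ Plane) with hD2
  have hD2s : ∀ u v, D2 u v = D2 v u := by
    intro u v
    simp only [hD2, ContinuousLinearMap.bilinearComp_apply]
    exact fderiv_fderiv_comm h.isOpen hf hz _ _
  have hsec : ∀ u, secondD (0, u) f z = D2 u u := fun u => hff u u
  -- the trace of the Hessian
  have o11 := hn.orthonormal (planeBasis 0) (planeBasis 0)
  have o12 := hn.orthonormal (planeBasis 0) (planeBasis 1)
  have o22 := hn.orthonormal (planeBasis 1) (planeBasis 1)
  rw [← spaceMetric_apply] at o11 o12 o22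
  have p11 : spaceMetric G φ z (P (planeBasis 0)) (P (planeBasis 0)) = 1 := by
    rw [o11]; simp [planeBasis]
  have p22 : spaceMetric G φ z (P (planeBasis 1)) (P (planeBasis 1)) = 1 := by
    rw [o22]; simp [planeBasis]
  have p12 : spaceMetric G φ z (P (planeBasis 0)) (P (planeBasis 1)) = 0 := by
    rw [o12]; simp [planeBasis]
  have t1 := contr_orthonormal _ D2 (h.spaceMetric_symm hz) hD2s p11 p22 p12
  have t2 : ∀ w, _ := fun w => contr_orthonormal _ (ContinuousLinearMap.compL ℝ Plane E ℝ
    ((G (φ z)).flip (spaceDiff φ z w)) ∘L spaceHess Γ φ z) (h.spaceMetric_symm hz)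
    (fun u v => by simp [h.spaceHess_symm hz u v]) p11 p22 p12
  simp only [contr, spaceMetric_apply, ContinuousLinearMap.comp_apply,
    ContinuousLinearMap.compL_apply, ContinuousLinearMap.flip_apply, h.spaceHess_apply hz,
    spaceDiff_apply] at t1 t2
  -- `S` is the trace of the second order Taylor coefficient, the source of the first order terms in
  -- the Laplacian.
  set S : Plane := Q (planeBasis 0) (planeBasis 0) + Q (planeBasis 1) (planeBasis 1) with hS
  have hfS : partialD f (0, Q (planeBasis 0) (planeBasis 0)) z
      + partialD f (0, Q (planeBasis 1) (planeBasis 1)) z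
      = S 0 * partialD f (0, planeBasis 0) z + S 1 * partialD f (0, planeBasis 1) z := by
    have : ((0 : ℝ), Q (planeBasis 0) (planeBasis 0)) + (0, Q (planeBasis 1) (planeBasis 1))
      = S 0 • ((0 : ℝ), planeBasis 0) + S 1 • ((0 : ℝ), planeBasis 1) := by
      rw [Prod.smul_mk, Prod.smul_mk, Prod.mk_add_mk, Prod.mk_add_mk, ← hS, ← plane_eq]
      simp
    rw [partialD, partialD, ← map_add, this]
    simp only [map_add, map_smul, smul_eq_mul, partialD]
  have hgS : ∀ w, G (φ z) (partialD φ (0, Q (planeBasis 0) (planeBasis 0)) z)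
        (partialD φ (0, w) z)
      + G (φ z) (partialD φ (0, Q (planeBasis 1) (planeBasis 1)) z) (partialD φ (0, w) z)
      = S 0 * indMetric G φ (0, planeBasis 0) (0, w) z
        + S 1 * indMetric G φ (0, planeBasis 1) (0, w) z := by
    intro w
    rw [indMetric, indMetric, ← add_apply, ← map_add]
    have : partialD φ (0, Q (planeBasis 0) (planeBasis 0)) z
        + partialD φ (0, Q (planeBasis 1) (planeBasis 1)) z
        = S 0 • partialD φ (0, planeBasis 0) z + S 1 • partialD φ (0, planeBasis 1) z := by
      simp only [← spaceDiff_apply]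
      rw [← map_add, ← hS]
      conv_lhs => rw [plane_eq S, map_add, map_smul, map_smul]
    rw [this]
    simp only [map_add, map_smul, add_apply, smul_apply, smul_eq_mul]
  -- The condition `tangential`, traced over the orthonormal basis. It says that `S` is minus the
  -- trace of the Christoffel symbols of the induced metric.
  have hT : ∀ w, indDet G φ (0, planeBasis 0) (0, planeBasis 1) z
      * (S 0 * indMetric G φ (0, planeBasis 0) (0, w) z
        + S 1 * indMetric G φ (0, planeBasis 1) (0, w) z)
      = -(indMetric G φ (0, planeBasis 1) (0, planeBasis 1) z
          * G (φ z) (covX Γ φ (0, planeBasis 0) (0, planeBasis 0) z) (partialD φ (0, w) z)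
        - 2 * indMetric G φ (0, planeBasis 0) (0, planeBasis 1) z
          * G (φ z) (covX Γ φ (0, planeBasis 0) (0, planeBasis 1) z) (partialD φ (0, w) z)
        + indMetric G φ (0, planeBasis 0) (0, planeBasis 0) z
          * G (φ z) (covX Γ φ (0, planeBasis 1) (0, planeBasis 1) z) (partialD φ (0, w) z)) := by
    intro w
    have q0 := hn.tangential (planeBasis 0) (planeBasis 0) w
    have q1 := hn.tangential (planeBasis 1) (planeBasis 1) w
    simp only [map_add, add_apply] at q0 q1
    rw [← hgS, ← t2 w, indDet]
    linear_combination (indMetric G φ (0, planeBasis 0) (0, planeBasis 0) z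
      * indMetric G φ (0, planeBasis 1) (0, planeBasis 1) z
      - indMetric G φ (0, planeBasis 0) (0, planeBasis 1) z ^ 2) * (q0 + q1)
  have T0 := hT (planeBasis 0)
  have T1 := hT (planeBasis 1)
  have gs : indMetric G φ (0, planeBasis 1) (0, planeBasis 0) z
    = indMetric G φ (0, planeBasis 0) (0, planeBasis 1) z := hl.G_symm hz _ _
  rw [gs] at T0
  -- the derivatives of the flux
  have k0 := fderiv_div_sqrt (((dg (0, planeBasis 1) (0, planeBasis 1)).fun_mul
    (df (0, planeBasis 0))).fun_sub ((dg (0, planeBasis 0) (0, planeBasis 1)).fun_mul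
    (df (0, planeBasis 1)))) dm hm (0, planeBasis 0)
  have k1 := fderiv_div_sqrt (((dg (0, planeBasis 0) (0, planeBasis 0)).fun_mul
    (df (0, planeBasis 1))).fun_sub ((dg (0, planeBasis 0) (0, planeBasis 1)).fun_mul
    (df (0, planeBasis 0)))) dm hm (0, planeBasis 1)
  rw [fderiv_fun_sub ((dg _ _).fun_mul (df _)) ((dg _ _).fun_mul (df _)), sub_apply,
    fderiv_mul_apply' (dg _ _) (df _), fderiv_mul_apply' (dg _ _) (df _), h.fderiv_indDet hz]
    at k0 k1
  simp only [hff, hl.fderiv_indMetric hz, hl.covX_comm hz (0, planeBasis 1) (0, planeBasis 0),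
    hl.G_symm hz (partialD φ _ z)] at k0 k1
  rw [hD2s (planeBasis 1) (planeBasis 0)] at k1
  have hflux : fluxDiv G φ f z = fderiv ℝ (flux₀ G φ f) z (0, planeBasis 0)
    + fderiv ℝ (flux₁ G φ f) z (0, planeBasis 1) := rfl
  change 2 * _ * _ * fderiv ℝ (flux₀ G φ f) z _ = _ at k0
  change 2 * _ * _ * fderiv ℝ (flux₁ G φ f) z _ = _ at k1
  rw [hsec, hsec, hflux]
  have e1 : D2 (P (planeBasis 0)) (P (planeBasis 0))
      + partialD f (0, Q (planeBasis 0) (planeBasis 0)) z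
        + (D2 (P (planeBasis 1)) (P (planeBasis 1))
          + partialD f (0, Q (planeBasis 1) (planeBasis 1)) z)
      = D2 (P (planeBasis 0)) (P (planeBasis 0)) + D2 (P (planeBasis 1)) (P (planeBasis 1))
        + (S 0 * partialD f (0, planeBasis 0) z + S 1 * partialD f (0, planeBasis 1) z) := by
    rw [← hfS]; ring
  rw [e1]
  have hmd : indDet G φ (0, planeBasis 0) (0, planeBasis 1) z
    = indMetric G φ (0, planeBasis 0) (0, planeBasis 0) z
      * indMetric G φ (0, planeBasis 1) (0, planeBasis 1) z
      - indMetric G φ (0, planeBasis 0) (0, planeBasis 1) z ^ 2 := rfl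
  rw [← hmd] at t1
  have hss := Real.mul_self_sqrt hm.le
  set s := √(indDet G φ (0, planeBasis 0) (0, planeBasis 1) z) with hs
  have hs0 : s ≠ 0 := (Real.sqrt_pos.2 hm).ne'
  set m := indDet G φ (0, planeBasis 0) (0, planeBasis 1) z
  set a := indMetric G φ (0, planeBasis 0) (0, planeBasis 0) z
  set b := indMetric G φ (0, planeBasis 0) (0, planeBasis 1) z
  set d := indMetric G φ (0, planeBasis 1) (0, planeBasis 1) z
  set f0 := partialD f (0, planeBasis 0) z
  set f1 := partialD f (0, planeBasis 1) z
  refine mul_left_cancel₀ (mul_ne_zero (mul_ne_zero two_ne_zero hm.ne') hs0) ?_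
  rw [mul_add, k0, k1]
  set T000 := G (φ z) (covX Γ φ (0, planeBasis 0) (0, planeBasis 0) z) (partialD φ (0, planeBasis 0) z)
  set T001 := G (φ z) (covX Γ φ (0, planeBasis 0) (0, planeBasis 0) z) (partialD φ (0, planeBasis 1) z)
  set T010 := G (φ z) (covX Γ φ (0, planeBasis 0) (0, planeBasis 1) z) (partialD φ (0, planeBasis 0) z)
  set T011 := G (φ z) (covX Γ φ (0, planeBasis 0) (0, planeBasis 1) z) (partialD φ (0, planeBasis 1) z)
  set T110 := G (φ z) (covX Γ φ (0, planeBasis 1) (0, planeBasis 1) z) (partialD φ (0, planeBasis 0) z)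
  set T111 := G (φ z) (covX Γ φ (0, planeBasis 1) (0, planeBasis 1) z) (partialD φ (0, planeBasis 1) z)
  -- Cramer's rule for the components of `S` in the system `T0`, `T1`.
  have S0 : m * (m * S 0) = -(d * (d * T000 - 2 * b * T010 + a * T110)
      - b * (d * T001 - 2 * b * T011 + a * T111)) := by
    linear_combination d * T0 - b * T1 + m * S 0 * hmd
  have S1 : m * (m * S 1) = -(a * (d * T001 - 2 * b * T011 + a * T111)
      - b * (d * T000 - 2 * b * T010 + a * T110)) := by
    linear_combination a * T1 - b * T0 + m * S 1 * hmd
  clear_value m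
  subst hmd
  linear_combination (-2) * f0 * S0 - 2 * f1 * S1 - 2 * (a * d - b ^ 2) * t1
    - 2 * (a * d - b ^ 2) * (D2 (P (planeBasis 0)) (P (planeBasis 0))
      + D2 (P (planeBasis 1)) (P (planeBasis 1)) + (S.ofLp 0 * f0 + S.ofLp 1 * f1)) * hss

end IsFlowInChart
end Divergence

/-! ### The heat operator in a fixed chart, and its sign at spatial maxima. -/

section CoordinateEvolution

variable {E : Type*} [NormedAddCommGroup E] [NormedSpace ℝ E]
  {G : E → E →L[ℝ] E →L[ℝ] ℝ} {Γ : E → E →L[ℝ] E →L[ℝ] E} {V : Set E}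
  {φ : ℝ × Plane → E} {O : Set (ℝ × Plane)} {z : ℝ × Plane}

/-- The contraction of `⟨X(u, ·), X(v, ·)⟩`, for the covariant Hessian `X` of `ψ`. -/
def hessContr (G : E → E →L[ℝ] E →L[ℝ] ℝ) (Γ : E → E →L[ℝ] E →L[ℝ] E) (ψ : Plane → E)
    (y u v : Plane) : ℝ :=
  indMetric G ψ (planeBasis 1) (planeBasis 1) y
      * G (ψ y) (covX Γ ψ u (planeBasis 0) y) (covX Γ ψ v (planeBasis 0) y)
    - indMetric G ψ (planeBasis 0) (planeBasis 1) y
      * (G (ψ y) (covX Γ ψ u (planeBasis 0) y) (covX Γ ψ v (planeBasis 1) y)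
        + G (ψ y) (covX Γ ψ u (planeBasis 1) y) (covX Γ ψ v (planeBasis 0) y))
    + indMetric G ψ (planeBasis 0) (planeBasis 0) y
      * G (ψ y) (covX Γ ψ u (planeBasis 1) y) (covX Γ ψ v (planeBasis 1) y)

/-- The squared norm of the covariant Hessian of `ψ`, in the induced metric. -/
def sqNormHess (G : E → E →L[ℝ] E →L[ℝ] ℝ) (Γ : E → E →L[ℝ] E →L[ℝ] E) (ψ : Plane → E)
    (y : Plane) : ℝ :=
  (indMetric G ψ (planeBasis 1) (planeBasis 1) y * hessContr G Γ ψ y (planeBasis 0) (planeBasis 0)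
    - 2 * indMetric G ψ (planeBasis 0) (planeBasis 1) y
      * hessContr G Γ ψ y (planeBasis 0) (planeBasis 1)
    + indMetric G ψ (planeBasis 0) (planeBasis 0) y
      * hessContr G Γ ψ y (planeBasis 1) (planeBasis 1))
  / indDet G ψ (planeBasis 0) (planeBasis 1) y ^ 2

lemma secondD_nonpos_of_isLocalMax (hO : IsOpen O) {f : ℝ × Plane → ℝ} (hf : ContDiffOn ℝ ∞ f O)
    (hz : z ∈ O) (hmax : IsLocalMax (fun y => f (z.1, y)) z.2) (u : Plane) :
    partialD f (0, u) z = 0 ∧ secondD (0, u) f z ≤ 0 := by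
  set ℓ : ℝ → ℝ × Plane := fun s => (z.1, z.2 + s • u) with hℓ
  have hℓd : ∀ s, HasDerivAt ℓ (0, u) s := by
    intro s
    have h1 : HasDerivAt (fun s : ℝ => z.2 + s • u) u s := by
      simpa using ((hasDerivAt_id s).smul_const u).const_add z.2
    exact (hasDerivAt_const s z.1).prodMk h1
  have hℓc : Continuous ℓ := by fun_prop
  have hℓ0 : ℓ 0 = z := by simp [hℓ]
  have hnear : ∀ᶠ s in 𝓝 (0 : ℝ), ℓ s ∈ O :=
    hℓc.continuousAt.eventually (hO.mem_nhds (by rwa [hℓ0]))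
  have hd : ∀ s, ℓ s ∈ O → HasDerivAt (fun s => f (ℓ s)) (partialD f (0, u) (ℓ s)) s := fun s hs =>
    (differentiableAt_of_contDiffOn hO hf hs).hasFDerivAt.comp_hasDerivAt s (hℓd s)
  have hd2 : HasDerivAt (fun s => partialD f (0, u) (ℓ s)) (secondD (0, u) f z) 0 := by
    have h1 := (differentiableAt_of_contDiffOn hO (contDiffOn_partialD hO hf (0, u))
      (show ℓ 0 ∈ O by rwa [hℓ0])).hasFDerivAt.comp_hasDerivAt 0 (hℓd 0)
    rw [hℓ0] at h1
    exact h1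
  have hmax' : IsLocalMax (fun s => f (ℓ s)) 0 := by
    have h1 : ContinuousAt (fun s : ℝ => z.2 + s • u) 0 := by fun_prop
    have h2 := h1.eventually (p := fun y => f (z.1, y) ≤ f (z.1, z.2)) (by
      simp only [zero_smul, add_zero]
      exact hmax)
    filter_upwards [h2] with s hs
    simpa [hℓ] using hs
  have h0 : partialD f (0, u) z = 0 := by
    have := hmax'.hasDerivAt_eq_zero (hd 0 (by rwa [hℓ0]))
    rwa [hℓ0] at this
  refine ⟨h0, ?_⟩
  by_contra hpos
  push Not at hpos
  have e1 : deriv (fun s => f (ℓ s)) =ᶠ[𝓝 0] fun s => partialD f (0, u) (ℓ s) := by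
    filter_upwards [hnear] with s hs using (hd s hs).deriv
  -- A positive second derivative would make the maximum also a local minimum. The function would be
  -- locally constant on the line, with vanishing second derivative.
  have hmin := isLocalMin_of_deriv_deriv_pos (f := fun s => f (ℓ s)) (x₀ := 0)
    (by rw [e1.deriv_eq, hd2.deriv]; exact hpos)
    (by rw [(hd 0 (by rwa [hℓ0])).deriv, hℓ0, h0])
    (hd 0 (by rwa [hℓ0])).continuousAt
  have e2 : (fun s => f (ℓ s)) =ᶠ[𝓝 0] fun _ => f (ℓ 0) := by
    filter_upwards [hmin, hmax'] with s h1 h2 using le_antisymm h2 h1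
  have e3 : (fun s => partialD f (0, u) (ℓ s)) =ᶠ[𝓝 0] fun _ => 0 := by
    refine e1.symm.trans (e2.deriv.trans ?_)
    simp
  have e4 := hd2.deriv
  rw [e3.deriv_eq] at e4
  simp at e4
  linarith

namespace IsFlowInChart

variable (h : IsFlowInChart G Γ V φ O) (hz : z ∈ O)

include h hz

/-- The normal coordinates depend on the point, while `fluxDiv` belongs to the chart; this makes the
pointwise computation usable in neighbourhoods and under the integral. -/
lemma heatOp_normalMap {ε : ℝ} {P : Plane →L[ℝ] Plane} {Q : Plane →L[ℝ] Plane →L[ℝ] Plane}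
    (hn : IsNormalChange G Γ φ z ε P Q) {f : ℝ × Plane → ℝ} (hf : ContDiffOn ℝ ∞ f O) :
    heatOp (1, 0) (0, planeBasis 0) (0, planeBasis 1) (fun x => f (normalMap z P Q x)) (z.1, 0)
      = partialD f (1, 0) z
        - fluxDiv G φ f z / √(indDet G φ (0, planeBasis 0) (0, planeBasis 1) z) := by
  have e0 : spaceMap (quadMap z.2 P Q) (z.1, 0) = z := IsNormalChange.normalMap_self
  have e := partialD_spaceMap (φ := f) (z := (z.1, (0 : Plane)))
    (contDiff_quadMap (y₀ := z.2) (P := P) (Q := Q))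
    (by rw [e0]; exact differentiableAt_of_contDiffOn h.isOpen hf hz) 1 0
  rw [e0, map_zero] at e
  have e' : fderiv ℝ (fun x => f (normalMap z P Q x)) (z.1, 0) (1, 0) = partialD f (1, 0) z := e
  rw [heatOp, e', hn.secondD_eq h hz hf, hn.secondD_eq h hz hf, h.fluxDiv_eq hz hn hf,
    mul_div_cancel_left₀ _ (Real.sqrt_pos.2 (h.indDet_pos hz)).ne']
  ring

lemma fluxDiv_nonpos_of_isLocalMax {f : ℝ × Plane → ℝ} (hf : ContDiffOn ℝ ∞ f O)
    (hmax : IsLocalMax (fun y => f (z.1, y)) z.2) : fluxDiv G φ f z ≤ 0 := by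
  obtain ⟨P, Q, hn⟩ := h.exists_isNormalChange hz (ε := 1) (by norm_num)
  rw [h.fluxDiv_eq hz hn hf]
  have k := secondD_nonpos_of_isLocalMax h.isOpen hf hz hmax
  rw [(k _).1, (k _).1]
  refine mul_nonpos_of_nonneg_of_nonpos (Real.sqrt_nonneg _) ?_
  linarith [(k (P (planeBasis 0))).2, (k (P (planeBasis 1))).2]

lemma fluxDiv_neg {f : ℝ × Plane → ℝ} (hf : ContDiffOn ℝ ∞ f O) :
    fluxDiv G φ (fun x => -f x) z = -fluxDiv G φ f z := by
  obtain ⟨P, Q, hn⟩ := h.exists_isNormalChange hz (ε := 1) (by norm_num)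
  have e1 : ∀ ξ, partialD (fun x => -f x) ξ = fun x => -partialD f ξ x := fun ξ => by
    funext x
    simp [partialD]
  have e2 : ∀ ξ, secondD ξ (fun x => -f x) z = -secondD ξ f z := by
    intro ξ
    have : secondD ξ (fun x => -f x) z = fderiv ℝ (partialD (fun x => -f x) ξ) z ξ := rfl
    rw [this, e1]
    simp [secondD, partialD]
  rw [h.fluxDiv_eq hz hn hf, h.fluxDiv_eq hz hn hf.neg]
  simp only [e1, e2]
  ring

lemma slice_eq : (∀ u v, indMetric G (fun y => φ (z.1, y)) u v z.2 = indMetric G φ (0, u) (0, v) z) ∧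
    ∀ u v, covX Γ (fun y => φ (z.1, y)) u v z.2 = covX Γ φ (0, u) (0, v) z := by
  refine ⟨fun u v => ?_, fun u v => covX_slice (h.smooth.contDiffAt (h.isOpen.mem_nhds hz)) u v⟩
  have hd := sliceD_eq_partialD (h.isLocalFlow.diff h.smooth hz)
  rw [indMetric, indMetric, ← hd u, ← hd v]
  rfl

/-- The bound is an expression in the fixed chart that is continuous up to the initial time, unlike
quantities tied to a choice of normal coordinates at each point. -/
lemma sqNormA_normalMap_le {ε : ℝ} {P : Plane →L[ℝ] Plane} {Q : Plane →L[ℝ] Plane →L[ℝ] Plane}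
    (hn : IsNormalChange G Γ φ z ε P Q) :
    IsLocalFlow.sqNormA G Γ (fun x => φ (normalMap z P Q x)) (0, planeBasis 0)
      (0, planeBasis 1) (z.1, 0) ≤ sqNormHess G Γ (fun y => φ (z.1, y)) z.2 := by
  refine (hn.sqNormA_le h hz).trans (le_of_eq ?_)
  obtain ⟨hg, hX⟩ := h.slice_eq hz
  have o11 := hn.orthonormal (planeBasis 0) (planeBasis 0)
  have o12 := hn.orthonormal (planeBasis 0) (planeBasis 1)
  have o22 := hn.orthonormal (planeBasis 1) (planeBasis 1)
  rw [← spaceMetric_apply] at o11 o12 o22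
  have p11 : spaceMetric G φ z (P (planeBasis 0)) (P (planeBasis 0)) = 1 := by
    rw [o11]; simp [planeBasis]
  have p22 : spaceMetric G φ z (P (planeBasis 1)) (P (planeBasis 1)) = 1 := by
    rw [o22]; simp [planeBasis]
  have p12 : spaceMetric G φ z (P (planeBasis 0)) (P (planeBasis 1)) = 0 := by
    rw [o12]; simp [planeBasis]
  have hs := h.lc.symm _ (h.mapsTo hz)
  set H := spaceHess Γ φ z with hH
  have hHs : ∀ u v, H u v = H v u := h.spaceHess_symm hz
  -- The squared norm contracts two pairs of indices, and `contr_orthonormal` is used for one pair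
  -- at a time.
  have t1 : ∀ u, _ := fun u => contr_orthonormal _ ((G (φ z)).bilinearComp (H u) (H u))
    (h.spaceMetric_symm hz) (fun a b => by simp [ContinuousLinearMap.bilinearComp_apply, hs])
    p11 p22 p12
  have t2 := contr_orthonormal _
    (spaceMetric G φ z (planeBasis 1) (planeBasis 1) •
        (G (φ z)).bilinearComp (H (planeBasis 0)) (H (planeBasis 0))
      - spaceMetric G φ z (planeBasis 0) (planeBasis 1) •
        ((G (φ z)).bilinearComp (H (planeBasis 0)) (H (planeBasis 1))
          + (G (φ z)).bilinearComp (H (planeBasis 1)) (H (planeBasis 0)))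
      + spaceMetric G φ z (planeBasis 0) (planeBasis 0) •
        (G (φ z)).bilinearComp (H (planeBasis 1)) (H (planeBasis 1)))
    (h.spaceMetric_symm hz)
    (fun a b => by
      simp only [add_apply, sub_apply, smul_apply, ContinuousLinearMap.bilinearComp_apply,
        smul_eq_mul]
      rw [hs (H (planeBasis 0) b) (H (planeBasis 0) a), hs (H (planeBasis 1) b) (H (planeBasis 1) a),
        hs (H (planeBasis 0) b) (H (planeBasis 1) a), hs (H (planeBasis 1) b) (H (planeBasis 0) a)]
      ring) p11 p22 p12
  have t10 := t1 (P (planeBasis 0))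
  have t11 := t1 (P (planeBasis 1))
  simp only [contr, add_apply, sub_apply, smul_apply, ContinuousLinearMap.bilinearComp_apply,
        smul_eq_mul] at t10 t11 t2
  have hm := h.indDet_pos hz
  rw [sqNormHess, eq_div_iff (by
    simp only [indDet, hg]
    exact (pow_pos hm 2).ne')]
  simp only [hessContr, indDet, hg, hX, ← h.spaceHess_apply hz, ← hH, ← spaceMetric_apply] at hm ⊢
  rw [hHs (P (planeBasis 0)) (planeBasis 0), hHs (P (planeBasis 0)) (planeBasis 1)] at t10
  rw [hHs (P (planeBasis 1)) (planeBasis 0), hHs (P (planeBasis 1)) (planeBasis 1),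
    hHs (P (planeBasis 1)) (P (planeBasis 0))] at t11
  rw [hHs (planeBasis 1) (planeBasis 0)] at t2 ⊢
  have f0 := hs (H (planeBasis 0) (P (planeBasis 0))) (H (planeBasis 1) (P (planeBasis 0)))
  have f1 := hs (H (planeBasis 0) (P (planeBasis 1))) (H (planeBasis 1) (P (planeBasis 1)))
  have f2 := hs (H (planeBasis 0) (planeBasis 1)) (H (planeBasis 0) (planeBasis 0))
  have f3 := hs (H (planeBasis 1) (planeBasis 1)) (H (planeBasis 0) (planeBasis 1))
  rw [← f0, ← f1] at t2
  simp only [f2, f3] at t2 ⊢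
  set m := spaceMetric G φ z (planeBasis 0) (planeBasis 0)
    * spaceMetric G φ z (planeBasis 1) (planeBasis 1)
    - spaceMetric G φ z (planeBasis 0) (planeBasis 1) ^ 2
  linear_combination m * t10 + m * t11 + t2

end IsFlowInChart

end CoordinateEvolution

/-! ### Evolution of the angle and of the quotient in a fixed chart. -/

section ProductEvolution

variable {E : Type*} [NormedAddCommGroup E] [NormedSpace ℝ E]
  {G : E → E →L[ℝ] E →L[ℝ] ℝ} {Γ : E → E →L[ℝ] E →L[ℝ] E} {V : Set E}
  {φ : ℝ × Plane → E} {O : Set (ℝ × Plane)} {z : ℝ × Plane}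
  {W₁ W₂ : E → E →L[ℝ] E →L[ℝ] ℝ} {c ε : ℝ}

lemma IsProductChart.alternating {y : E} (hp : IsProductChart G Γ V W₁ W₂ c y) (v : E) :
    W₁ y v v = 0 ∧ W₂ y v v = 0 := by
  obtain ⟨L, hL⟩ := hp.point
  rw [hL.form₁, hL.form₂, FourSpace.a₁, FourSpace.a₂]
  constructor <;> ring

namespace IsFlowInChart

variable (h : IsFlowInChart G Γ V φ O) (hz : z ∈ O)
  (hp : ∀ y ∈ V, IsProductChart G Γ V W₁ W₂ c y)

include h hp in
lemma contDiffOn_angle (ε : ℝ) : ContDiffOn ℝ ∞ (fun x => ε * IsLocalFlow.angle G W₁ W₂ φ (0, planeBasis 0)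
    (0, planeBasis 1) x) O := by
  rcases O.eq_empty_or_nonempty with rfl | ⟨x, hx⟩
  · exact fun x hx => hx.elim
  have hq := hp _ (h.mapsTo hx)
  have hl := h.isLocalFlow
  exact contDiffOn_const.mul ((contDiffOn_bilin (hq.contDiffOn₁.add hq.contDiffOn₂) h.smooth h.mapsTo
    (hl.contDiffOn_X _) (hl.contDiffOn_X _)).div
      ((hl.contDiffOn_indDet _ _).sqrt fun x hx => (h.indDet_pos hx).ne')
      fun x hx => (Real.sqrt_pos.2 (h.indDet_pos hx)).ne')

include h hz hp

/-- The pointwise equation in normal coordinates of orientation `ε` is rewritten in the chart. The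
constant sign `ε` turns the coordinate angle into the oriented one. -/
lemma exists_fderiv_angle (hε : ε ^ 2 = 1) : ∃ B, -|c| ≤ B ∧
    B ≤ 2 * sqNormHess G Γ (fun y => φ (z.1, y)) z.2 + |c| ∧
    partialD (fun x => ε * IsLocalFlow.angle G W₁ W₂ φ (0, planeBasis 0) (0, planeBasis 1) x) (1, 0) z
      = fluxDiv G φ (fun x => ε * IsLocalFlow.angle G W₁ W₂ φ (0, planeBasis 0) (0, planeBasis 1) x) z
          / √(indDet G φ (0, planeBasis 0) (0, planeBasis 1) z)
        + B * (ε * IsLocalFlow.angle G W₁ W₂ φ (0, planeBasis 0) (0, planeBasis 1) z) := by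
  obtain ⟨P, Q, hn⟩ := h.exists_isNormalChange hz hε
  have hq := hp _ (h.mapsTo hz)
  have h' := IsNormalChange.isFlowInChart (z := z) (ε := ε) (P := P) (Q := Q) h
  have hz' := hn.mem hz
  obtain ⟨L, hL⟩ := hq.point
  have e0 : normalMap z P Q (z.1, 0) = z := IsNormalChange.normalMap_self
  obtain ⟨B, hB1, hB2, hB⟩ := IsLocalFlow.exists_heatOp_angle (c := c) (L := L) h'.isLocalFlow hz'
    (hn.isNormalAt h hz) (fun x hx => h'.indDet_pos hx) hq.contDiffOn₁ hq.contDiffOn₂ hq.parallel₁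
    hq.parallel₂ (by rw [e0]; exact hL)
  have halt : ∀ y ∈ V, ∀ v, (W₁ + W₂) y v v = 0 := by
    intro y hy v
    obtain ⟨a1, a2⟩ := (hp y hy).alternating v
    simp [a1, a2]
  refine ⟨B, hB1, hB2.trans (by linarith [h.sqNormA_normalMap_le hz hn]), ?_⟩
  have ec : IsLocalFlow.angle G W₁ W₂ (fun x => φ (normalMap z P Q x)) (0, planeBasis 0) (0, planeBasis 1)
      =ᶠ[𝓝 (z.1, 0)] fun x => ε * IsLocalFlow.angle G W₁ W₂ φ (0, planeBasis 0) (0, planeBasis 1)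
        (normalMap z P Q x) := by
    filter_upwards [h'.isOpen.mem_nhds hz'] with x hx using IsNormalChange.angle_eq h halt hε hx
  have e := h.heatOp_normalMap hz hn (h.contDiffOn_angle hp ε)
  rw [← heatOp_congr ec, hB, ec.eq_of_nhds, e0] at e
  linarith

/-- The evolution of `|H|² / η`, multiplied by the area density. -/
lemma fderiv_quotient_le (hε : ε ^ 2 = 1)
    (hlag : ∀ x ∈ O, W₁ (φ x) (partialD φ (0, planeBasis 0) x) (partialD φ (0, planeBasis 1) x)
      = W₂ (φ x) (partialD φ (0, planeBasis 0) x) (partialD φ (0, planeBasis 1) x))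
    (hpos : ∀ x ∈ O, 0 < ε * IsLocalFlow.angle G W₁ W₂ φ (0, planeBasis 0) (0, planeBasis 1) x)
    {w : ℝ × Plane → ℝ} (hw : ∀ x ∈ O, w x = indMetric G φ (1, 0) (1, 0) x
      / (ε * IsLocalFlow.angle G W₁ W₂ φ (0, planeBasis 0) (0, planeBasis 1) x)) :
    ContDiffOn ℝ ∞ w O ∧
    partialD (fun x => w x * √(indDet G φ (0, planeBasis 0) (0, planeBasis 1) x)) (1, 0) z
      ≤ fluxDiv G φ w z + c * (w z * √(indDet G φ (0, planeBasis 0) (0, planeBasis 1) z)) := by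
  obtain ⟨P, Q, hn⟩ := h.exists_isNormalChange hz hε
  have hq := hp _ (h.mapsTo hz)
  have h' := IsNormalChange.isFlowInChart (z := z) (ε := ε) (P := P) (Q := Q) h
  have hz' := hn.mem hz
  obtain ⟨L, hL⟩ := hq.point
  have e0 : normalMap z P Q (z.1, 0) = z := IsNormalChange.normalMap_self
  have cw : ContDiffOn ℝ ∞ w O := by
    refine ((h.isLocalFlow.contDiffOn_indMetric (1, 0) (1, 0)).div (h.contDiffOn_angle hp ε)
      fun x hx => (hpos x hx).ne').congr fun x hx => hw x hx
  refine ⟨cw, ?_⟩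
  have halt : ∀ y ∈ V, ∀ v, (W₁ + W₂) y v v = 0 := by
    intro y hy v
    obtain ⟨a1, a2⟩ := (hp y hy).alternating v
    simp [a1, a2]
  have hle := IsLocalFlow.heatOp_quotient_le (c := c) (L := L) h'.isLocalFlow hz'
    (hn.isNormalAt h hz) (fun x hx => h'.indDet_pos hx) hq.contDiffOn₁ hq.contDiffOn₂ hq.parallel₁
    hq.parallel₂ (by rw [e0]; exact hL)
    (fun x hx => by
      rw [IsNormalChange.form_eq h (fun y hy v => ((hp y hy).alternating v).1) hx,
        IsNormalChange.form_eq h (fun y hy v => ((hp y hy).alternating v).2) hx, hlag _ hx.1])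
    (fun x hx => by
      rw [IsNormalChange.angle_eq h halt hε hx]
      exact hpos _ hx.1)
  have hH : ∀ x ∈ normalDom O z ε P Q, indMetric G (fun x => φ (normalMap z P Q x)) (1, 0) (1, 0) x
      = indMetric G φ (1, 0) (1, 0) (normalMap z P Q x) := by
    intro x hx
    rw [IsNormalChange.indMetric_eq h hx, map_zero]
  have ew : ∀ x ∈ normalDom O z ε P Q, indMetric G (fun x => φ (normalMap z P Q x)) (1, 0) (1, 0) x
      / IsLocalFlow.angle G W₁ W₂ (fun x => φ (normalMap z P Q x)) (0, planeBasis 0) (0, planeBasis 1) x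
      = w (normalMap z P Q x) := by
    intro x hx
    rw [hH x hx, IsNormalChange.angle_eq h halt hε hx, hw _ hx.1]
  have ec : (fun x => indMetric G (fun x => φ (normalMap z P Q x)) (1, 0) (1, 0) x
      / IsLocalFlow.angle G W₁ W₂ (fun x => φ (normalMap z P Q x)) (0, planeBasis 0) (0, planeBasis 1) x)
      =ᶠ[𝓝 (z.1, 0)] fun x => w (normalMap z P Q x) := by
    filter_upwards [h'.isOpen.mem_nhds hz'] with x hx using ew x hx
  rw [heatOp_congr ec, ew _ hz', hH _ hz', h.heatOp_normalMap hz hn cw, e0] at hle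
  have hm := h.indDet_pos hz
  have hs := Real.sqrt_pos.2 hm
  have hss := Real.mul_self_sqrt hm.le
  have dm := (h.isLocalFlow.diff (h.isLocalFlow.contDiffOn_indDet (0, planeBasis 0) (0, planeBasis 1)) hz)
  have dw := h.isLocalFlow.diff cw hz
  have h1 := dm.hasFDerivAt.sqrt hm.ne'
  rw [partialD, fderiv_mul_apply' dw h1.differentiableAt, h1.fderiv]
  have et := h.fderiv_indDet_time hz
  simp only [smul_apply, smul_eq_mul, et]
  set m := indDet G φ (0, planeBasis 0) (0, planeBasis 1) z
  set s := √m
  set u := indMetric G φ (1, 0) (1, 0) z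
  -- The area density shrinks at the rate `|H|²`, which is exactly the extra reaction coefficient in
  -- `heatOp_quotient_le`.
  have e1 : 1 / (2 * s) * (-2 * m * u) = -(s * u) := by
    rw [← hss]
    field_simp
  rw [e1]
  have e2 := mul_le_mul_of_nonneg_right hle hs.le
  rw [sub_mul, div_mul_cancel₀ _ hs.ne'] at e2
  simp only [partialD] at e2
  linarith

end IsFlowInChart
end ProductEvolution

/-! ### The Hodge star in an arbitrary chart. -/

section HodgeStarInCharts

variable {S : Type*} [TopologicalSpace S] [ChartedSpace Plane S] [IsManifold (𝓡 2) ∞ S]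

lemma det_gram (B : Plane → Plane → ℝ) : (gram planeBasis B).det
    = B (planeBasis 0) (planeBasis 0) * B (planeBasis 1) (planeBasis 1)
      - B (planeBasis 0) (planeBasis 1) * B (planeBasis 1) (planeBasis 0) := by
  rw [Matrix.det_fin_two]
  rfl

/-- The Hodge star in an arbitrary chart. -/
lemma hodgeStar_eq_inChart {σ h α : TwoTensor (𝓡 2) S} {p : S} {y : Plane}
    (hy : y ∈ (extChartAt (𝓡 2) p).target) (σ' h' α' : Plane →L[ℝ] Plane →L[ℝ] ℝ)
    (hσ : σ ((extChartAt (𝓡 2) p).symm y) = fun u v => σ' u v) (hσa : ∀ v, σ' v v = 0)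
    (hh : h ((extChartAt (𝓡 2) p).symm y) = fun u v => h' u v) (hhs : ∀ u v, h' u v = h' v u)
    (hα : α ((extChartAt (𝓡 2) p).symm y) = fun u v => α' u v) (hαa : ∀ v, α' v v = 0) :
    hodgeStar σ h α ((extChartAt (𝓡 2) p).symm y)
      = Real.sign (inChart σ p y (planeBasis 0) (planeBasis 1))
        * (inChart α p y (planeBasis 0) (planeBasis 1) / √(gram planeBasis (inChart h p y)).det) := by
  let A : Plane →L[ℝ] Plane := mfderiv 𝓘(ℝ, Plane) (𝓡 2) (extChartAt (𝓡 2) p).symm y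
  have hA : Function.Injective A := injective_mfderiv_extChartAt_symm p hy
  have i : ∀ (β : TwoTensor (𝓡 2) S) (β' : Plane →L[ℝ] Plane →L[ℝ] ℝ),
      (β ((extChartAt (𝓡 2) p).symm y) = fun u v => β' u v) → ∀ u v,
      inChart β p y u v = β' (A u) (A v) := fun β β' hβ u v => by
    rw [inChart, hβ]
    rfl
  set d := planeDet (A (planeBasis 0)) (A (planeBasis 1)) with hd
  have hd0 : d ≠ 0 := by
    intro h0
    have hs := alternating_plane' σ' hσa (A (planeBasis 0)) (A (planeBasis 1))
    have h1 : A ((A (planeBasis 0)) 1 • planeBasis 1 - (A (planeBasis 1)) 1 • planeBasis 0) = 0 := by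
      rw [map_sub, map_smul, map_smul]
      unfold planeDet at hd
      ext j
      fin_cases j
      · simp only [PiLp.sub_apply, PiLp.smul_apply, smul_eq_mul, PiLp.zero_apply, Fin.zero_eta]
        linear_combination hd - h0
      · simp only [PiLp.sub_apply, PiLp.smul_apply, smul_eq_mul, PiLp.zero_apply, Fin.mk_one]
        ring
    have h2 : A ((A (planeBasis 0)) 0 • planeBasis 1 - (A (planeBasis 1)) 0 • planeBasis 0) = 0 := by
      rw [map_sub, map_smul, map_smul]
      unfold planeDet at hd
      ext j
      fin_cases j
      · simp only [PiLp.sub_apply, PiLp.smul_apply, smul_eq_mul, PiLp.zero_apply, Fin.zero_eta]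
        ring
      · simp only [PiLp.sub_apply, PiLp.smul_apply, smul_eq_mul, PiLp.zero_apply, Fin.mk_one]
        linear_combination h0 - hd
    have h1' := hA (h1.trans (map_zero A).symm)
    have h2' := hA (h2.trans (map_zero A).symm)
    have k1 := (planeBasis_linearIndependent (a := -(A (planeBasis 1)) 1) (b := (A (planeBasis 0)) 1)
      (by rw [← h1']; module)).2
    have k2 := (planeBasis_linearIndependent (a := -(A (planeBasis 1)) 0) (b := (A (planeBasis 0)) 0)
      (by rw [← h2']; module)).2
    have k3 : A (planeBasis 0) = 0 := by
      rw [plane_eq (A (planeBasis 0)), k1, k2]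
      simp
    exact planeBasis.ne_zero 0 (hA (k3.trans (map_zero A).symm))
  have e1 : inChart σ p y (planeBasis 0) (planeBasis 1)
      = d * σ' (planeBasis 0) (planeBasis 1) := by
    rw [i σ σ' hσ]
    exact alternating_plane' σ' hσa _ _
  have e2 : inChart α p y (planeBasis 0) (planeBasis 1)
      = d * α' (planeBasis 0) (planeBasis 1) := by
    rw [i α α' hα]
    exact alternating_plane' α' hαa _ _
  have e3 : (gram planeBasis (inChart h p y)).det
      = d ^ 2 * (gram planeBasis fun u v => h' u v).det := by
    rw [det_gram, det_gram]
    simp only [i h h' hh]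
    have k := gram_planeDet h' hhs (A (planeBasis 0)) (A (planeBasis 1))
    rw [hhs (planeBasis 1) (planeBasis 0), hhs (A (planeBasis 1)) (A (planeBasis 0))]
    linear_combination k
  rw [hodgeStar, hσ, hh, hα, e1, e2, e3, Real.sqrt_mul (sq_nonneg d), Real.sqrt_sq_eq_abs]
  set s := σ' (planeBasis 0) (planeBasis 1)
  -- A change of basis of determinant `d` multiplies the quotient by `d / |d|` and the orientation
  -- by the sign of `d`. The two factors cancel.
  rcases lt_or_gt_of_ne hd0 with hneg | hpos
  · rw [abs_of_neg hneg, neg_mul, div_neg, mul_div_mul_left _ _ hd0]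
    have : Real.sign (d * s) = -Real.sign s := by
      rcases lt_trichotomy s 0 with h1 | h1 | h1
      · rw [Real.sign_of_neg h1, Real.sign_of_pos (mul_pos_of_neg_of_neg hneg h1)]; norm_num
      · simp [h1]
      · rw [Real.sign_of_pos h1, Real.sign_of_neg (mul_neg_of_neg_of_pos hneg h1)]
    rw [this]
    ring
  · rw [abs_of_pos hpos, mul_div_mul_left _ _ hd0]
    have : Real.sign (d * s) = Real.sign s := by
      rcases lt_trichotomy s 0 with h1 | h1 | h1
      · rw [Real.sign_of_neg h1, Real.sign_of_neg (mul_neg_of_pos_of_neg hpos h1)]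
      · simp [h1]
      · rw [Real.sign_of_pos h1, Real.sign_of_pos (mul_pos hpos h1)]
    rw [this]

/-- The opposite orientation. -/
def VolumeForm.neg {g : SurfaceMetric S} (σ : VolumeForm g) : VolumeForm g where
  form p := -σ.form p
  alternating p v := by
    have := σ.alternating p v
    simp [this]
  sq_eq p u v := by
    have := σ.sq_eq p u v
    simpa using this
  contMDiff := σ.contMDiff.neg_section

end HodgeStarInCharts

/-! ### The oriented angle of the flow in charts. -/

section FlowInCharts

variable {S₁ S₂ : Type*}
    [TopologicalSpace S₁] [ChartedSpace Plane S₁] [IsManifold (𝓡 2) ∞ S₁]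
    [TopologicalSpace S₂] [ChartedSpace Plane S₂] [IsManifold (𝓡 2) ∞ S₂]
    {g₁ : SurfaceMetric S₁} {g₂ : SurfaceMetric S₂} {T : EReal} {F : ℝ → S₁ → S₁ × S₂}

/-- The function `*_{Σ_t} F_t^* (ω₁ + ω₂)`. -/
def flowAngle (ω₁ : VolumeForm g₁) (ω₂ : VolumeForm g₂) (F : ℝ → S₁ → S₁ × S₂) (t : ℝ) : S₁ → ℝ :=
  hodgeStar ω₁.tensor (pullback (𝓡 2) (productTensor (metricTensor g₁) (metricTensor g₂)) (F t))
      (pullback (𝓡 2) (productTensor ω₁.tensor ω₂.tensor) (F t))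

/-- The orientation of a chart. -/
def chartSign (ω₁ : VolumeForm g₁) (p : S₁) (y : Plane) : ℝ :=
  Real.sign (chartForm ω₁.form p y (planeBasis 0) (planeBasis 1))

variable (hF : IsMeanCurvatureFlow (𝓡 2) planeBasis productBasis
  (productTensor (metricTensor g₁) (metricTensor g₂)) (timeInterval T) F)

include hF

lemma det_gram_flow {p : S₁} {q : S₁ × S₂} {z : ℝ × Plane}
    (hz : z ∈ flowDom (timeInterval T) F p q) :
    (gram planeBasis (inChart (pullback (𝓡 2) (productTensor (metricTensor g₁) (metricTensor g₂))
      (F z.1)) p z.2)).det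
      = indDet (chartMetric g₁ g₂ q) (fun y => flowMap F p q (z.1, y)) (planeBasis 0) (planeBasis 1)
        z.2 := by
  have h1 : ∀ u v, inChart (pullback (𝓡 2) (productTensor (metricTensor g₁) (metricTensor g₂))
      (F z.1)) p z.2 u v = indMetric (chartMetric g₁ g₂ q) (fun y => flowMap F p q (z.1, y)) u v z.2 :=
    fun u v => (inChart_pullback _ (contMDiff_flow hF hz.1) hz.2 u v).trans
      (inChart_metric g₁ g₂ q (mapInChart_mem hz.2) _ _)
  have h2 : ∀ u v, indMetric (chartMetric g₁ g₂ q) (fun y => flowMap F p q (z.1, y)) u v z.2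
      = indMetric (chartMetric g₁ g₂ q) (fun y => flowMap F p q (z.1, y)) v u z.2 := fun u v =>
    (isLeviCivitaOn_chartMetric g₁ g₂ q).symm _ (mapInChart_mem hz.2) _ _
  rw [det_gram]
  simp only [h1]
  rw [h2 (planeBasis 1) (planeBasis 0), indDet]
  ring

lemma flowAngle_eq (ω₁ : VolumeForm g₁) (ω₂ : VolumeForm g₂) {p : S₁} {q : S₁ × S₂} {z : ℝ × Plane}
    (hz : z ∈ flowDom (timeInterval T) F p q) :
    flowAngle ω₁ ω₂ F z.1 ((extChartAt (𝓡 2) p).symm z.2)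
      = chartSign ω₁ p z.2 * IsLocalFlow.angle (chartMetric g₁ g₂ q)
        (prodForm (chartForm ω₁.form q.1) 0) (prodForm 0 (chartForm ω₂.form q.2))
        (fun y => flowMap F p q (z.1, y)) (planeBasis 0) (planeBasis 1) z.2 := by
  set x := (extChartAt (𝓡 2) p).symm z.2 with hx
  let D : Plane →L[ℝ] Plane × Plane := mfderiv (𝓡 2) ((𝓡 2).prod (𝓡 2)) (F z.1) x
  let mk : ((p : S₁) → TangentSpace (𝓡 2) p →L[ℝ] TangentSpace (𝓡 2) p →L[ℝ] ℝ) →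
      ((p : S₂) → TangentSpace (𝓡 2) p →L[ℝ] TangentSpace (𝓡 2) p →L[ℝ] ℝ) →
      Plane →L[ℝ] Plane →L[ℝ] ℝ := fun α₁ α₂ =>
    (prodForm (E := Plane) (fun _ => α₁ (F z.1 x).1) (fun _ => α₂ (F z.1 x).2) 0).bilinearComp D D
  have e := hodgeStar_eq_inChart (σ := ω₁.tensor)
    (h := pullback (𝓡 2) (productTensor (metricTensor g₁) (metricTensor g₂)) (F z.1))
    (α := pullback (𝓡 2) (productTensor ω₁.tensor ω₂.tensor) (F z.1)) hz.2.1 (ω₁.form x)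
    (mk g₁.inner g₂.inner) (mk ω₁.form ω₂.form) rfl (fun v => ω₁.alternating x v)
    rfl
    (fun u v => congrArg₂ (· + ·) (g₁.symm _ _ _) (g₂.symm _ _ _))
    rfl
    (fun v => (congrArg₂ (· + ·) (ω₁.alternating _ _) (ω₂.alternating _ _)).trans (add_zero 0))
  rw [flowAngle, e, det_gram_flow hF hz, IsLocalFlow.angle]
  congr 2
  exact (inChart_pullback _ (contMDiff_flow hF hz.1) hz.2 _ _).trans
      ((inChart_productTensor ω₁.form ω₂.form q (mapInChart_mem hz.2) _ _).trans (by
        simp [prodForm_apply]; rfl))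

end FlowInCharts

/-! ### Smoothness in space-time up to the initial time. -/

section SmoothnessInCharts

lemma IsFlowInChart.mono {E : Type*} [NormedAddCommGroup E] [NormedSpace ℝ E]
    {G : E → E →L[ℝ] E →L[ℝ] ℝ} {Γ : E → E →L[ℝ] E →L[ℝ] E} {V : Set E}
    {φ : ℝ × Plane → E} {O O' : Set (ℝ × Plane)} (h : IsFlowInChart G Γ V φ O) (hO' : IsOpen O')
    (hsub : O' ⊆ O) : IsFlowInChart G Γ V φ O' :=
  ⟨h.lc, hO', h.smooth.mono hsub, h.mapsTo.mono_left hsub, fun z hz => h.immersion z (hsub hz),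
    fun z hz => h.normal z (hsub hz), fun z hz => h.flow z (hsub hz)⟩

variable {S₁ S₂ : Type*}
    [TopologicalSpace S₁] [ChartedSpace Plane S₁] [IsManifold (𝓡 2) ∞ S₁]
    [TopologicalSpace S₂] [ChartedSpace Plane S₂] [IsManifold (𝓡 2) ∞ S₂]
    {g₁ : SurfaceMetric S₁} {g₂ : SurfaceMetric S₂} {T : EReal} {F : ℝ → S₁ → S₁ × S₂}

lemma contDiffOn_chartForm_apply (ω₁ : VolumeForm g₁) (p : S₁) (u v : Plane) :
    ContDiffOn ℝ ∞ (fun y => chartForm ω₁.form p y u v) (extChartAt (𝓡 2) p).target :=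
  ((contDiffOn_chartForm ω₁.contMDiff p).clm_apply contDiffOn_const).clm_apply contDiffOn_const

lemma chartForm_basis_ne (ω₁ : VolumeForm g₁) {p : S₁} {y : Plane}
    (hy : y ∈ (extChartAt (𝓡 2) p).target) :
    chartForm ω₁.form p y (planeBasis 0) (planeBasis 1) ≠ 0 := by
  intro h0
  have h1 : chartForm ω₁.form p y (planeBasis 0) (planeBasis 1) ^ 2 = _ := ω₁.sq_eq _ _ _
  have h2 : 0 < chartForm g₁.inner p y (planeBasis 0) (planeBasis 0)
      * chartForm g₁.inner p y (planeBasis 1) (planeBasis 1)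
      - chartForm g₁.inner p y (planeBasis 0) (planeBasis 1) ^ 2 :=
    gram_det_pos ((isLeviCivitaOn_chart g₁ p).symm y hy) ((isLeviCivitaOn_chart g₁ p).pos y hy)
      fun a b => planeBasis_linearIndependent
  rw [h0] at h1
  exact absurd (h2.trans_eq h1.symm) (by norm_num)

lemma chartSign_eq_div (ω₁ : VolumeForm g₁) {p : S₁} {y : Plane}
    (hy : y ∈ (extChartAt (𝓡 2) p).target) : chartSign ω₁ p y
      = chartForm ω₁.form p y (planeBasis 0) (planeBasis 1)
        / |chartForm ω₁.form p y (planeBasis 0) (planeBasis 1)| := by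
  rw [chartSign]
  rcases lt_or_gt_of_ne (chartForm_basis_ne ω₁ hy) with h | h
  · rw [Real.sign_of_neg h, abs_of_neg h, div_neg, div_self h.ne]
  · rw [Real.sign_of_pos h, abs_of_pos h, div_self h.ne']

lemma chartSign_sq (ω₁ : VolumeForm g₁) {p : S₁} {y : Plane}
    (hy : y ∈ (extChartAt (𝓡 2) p).target) : chartSign ω₁ p y ^ 2 = 1 := by
  rw [chartSign_eq_div ω₁ hy, div_pow, sq_abs, div_self (pow_ne_zero 2 (chartForm_basis_ne ω₁ hy))]

lemma chartSign_mul_pos (ω₁ : VolumeForm g₁) {p : S₁} {y : Plane}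
    (hy : y ∈ (extChartAt (𝓡 2) p).target) :
    0 < chartSign ω₁ p y * chartForm ω₁.form p y (planeBasis 0) (planeBasis 1) := by
  rw [chartSign]
  rcases lt_or_gt_of_ne (chartForm_basis_ne ω₁ hy) with h | h
  · rw [Real.sign_of_neg h]; linarith
  · rw [Real.sign_of_pos h]; linarith

lemma chartSign_eq_of_mul_pos (ω₁ : VolumeForm g₁) {p : S₁} {y : Plane} {ε : ℝ} (hε : ε ^ 2 = 1)
    (h : 0 < ε * chartForm ω₁.form p y (planeBasis 0) (planeBasis 1)) : chartSign ω₁ p y = ε := by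
  rw [chartSign]
  rcases (sq_eq_one_iff.1 hε) with rfl | rfl
  · rw [Real.sign_of_pos (by linarith)]
  · rw [Real.sign_of_neg (by linarith)]

/-- The orientation sign is the nowhere vanishing component of the area form divided by its absolute
value. -/
lemma contDiffOn_chartSign (ω₁ : VolumeForm g₁) (p : S₁) :
    ContDiffOn ℝ ∞ (chartSign ω₁ p) (extChartAt (𝓡 2) p).target := by
  have h := contDiffOn_chartForm_apply ω₁ p (planeBasis 0) (planeBasis 1)
  exact (h.div (h.abs fun y hy => chartForm_basis_ne ω₁ hy)
    fun y hy => abs_ne_zero.2 (chartForm_basis_ne ω₁ hy)).congr fun y hy => chartSign_eq_div ω₁ hy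

/-- The part of the domain of a flow in charts where the chart has orientation `ε`. -/
def signDom (ω₁ : VolumeForm g₁) (T : EReal) (F : ℝ → S₁ → S₁ × S₂) (p : S₁) (q : S₁ × S₂) (ε : ℝ) :
    Set (ℝ × Plane) :=
  flowDom {t : ℝ | 0 < t ∧ (t : EReal) < T} F p q
    ∩ {z | 0 < ε * chartForm ω₁.form p z.2 (planeBasis 0) (planeBasis 1)}

variable (hF : IsMeanCurvatureFlow (𝓡 2) planeBasis productBasis
  (productTensor (metricTensor g₁) (metricTensor g₂)) (timeInterval T) F)

include hF

lemma isOpen_signDom (ω₁ : VolumeForm g₁) (p : S₁) (q : S₁ × S₂) (ε : ℝ) :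
    IsOpen (signDom ω₁ T F p q ε) := by
  have h : ContinuousOn (fun z : ℝ × Plane => ε * chartForm ω₁.form p z.2 (planeBasis 0) (planeBasis 1))
      (flowDom {t : ℝ | 0 < t ∧ (t : EReal) < T} F p q) :=
    continuousOn_const.mul ((contDiffOn_chartForm_apply ω₁ p _ _).continuousOn.comp
      continuousOn_snd fun z hz => hz.2.1)
  exact h.isOpen_inter_preimage (isOpen_flowDom_pos hF p q) isOpen_Ioi

lemma isFlowInChart_signDom (ω₁ : VolumeForm g₁) (p : S₁) (q : S₁ × S₂) (ε : ℝ) :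
    IsFlowInChart (chartMetric g₁ g₂ q) (chartConn g₁ g₂ q)
      (extChartAt ((𝓡 2).prod (𝓡 2)) q).target (flowMap F p q) (signDom ω₁ T F p q ε) :=
  (isFlowInChart hF p q).mono (isOpen_signDom hF ω₁ p q ε) Set.inter_subset_left

lemma contDiffOn_sliceD_flowMap (p : S₁) (q : S₁ × S₂) (u : Plane) :
    ContDiffOn ℝ ∞ (sliceD (flowMap F p q) u) (flowDom (timeInterval T) F p q) := by
  have h := contDiffOn_flowMap hF p q
  obtain ⟨W, hW, e⟩ := exists_flowDom_eq hF p q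
  rw [e] at h ⊢
  exact contDiffOn_sliceD (uniqueDiffOn_timeInterval T) hW h u

lemma contDiffOn_sliceD_sliceD_flowMap (p : S₁) (q : S₁ × S₂) (u v : Plane) :
    ContDiffOn ℝ ∞ (sliceD (sliceD (flowMap F p q) u) v) (flowDom (timeInterval T) F p q) := by
  have h := contDiffOn_sliceD_flowMap hF p q u
  obtain ⟨W, hW, e⟩ := exists_flowDom_eq hF p q
  rw [e] at h ⊢
  exact contDiffOn_sliceD (uniqueDiffOn_timeInterval T) hW h v

lemma contDiffOn_flowMap_bilin (p : S₁) (q : S₁ × S₂)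
    {B : Plane × Plane → Plane × Plane →L[ℝ] Plane × Plane →L[ℝ] ℝ}
    (hB : ContDiffOn ℝ ∞ B (extChartAt ((𝓡 2).prod (𝓡 2)) q).target)
    {Y W : ℝ × Plane → Plane × Plane} (hY : ContDiffOn ℝ ∞ Y (flowDom (timeInterval T) F p q))
    (hW : ContDiffOn ℝ ∞ W (flowDom (timeInterval T) F p q)) :
    ContDiffOn ℝ ∞ (fun z => B (flowMap F p q z) (Y z) (W z)) (flowDom (timeInterval T) F p q) :=
  contDiffOn_bilin hB (contDiffOn_flowMap hF p q) (fun _ hz => mapInChart_mem hz.2) hY hW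

lemma contDiffOn_slice_indMetric (p : S₁) (q : S₁ × S₂) (u v : Plane) :
    ContDiffOn ℝ ∞ (fun z : ℝ × Plane => indMetric (chartMetric g₁ g₂ q)
      (fun y => flowMap F p q (z.1, y)) u v z.2) (flowDom (timeInterval T) F p q) :=
  contDiffOn_flowMap_bilin hF p q (isLeviCivitaOn_chartMetric g₁ g₂ q).contDiffOn
    (contDiffOn_sliceD_flowMap hF p q u) (contDiffOn_sliceD_flowMap hF p q v)

lemma slice_indDet_pos {p : S₁} {q : S₁ × S₂} {z : ℝ × Plane}
    (hz : z ∈ flowDom (timeInterval T) F p q) :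
    0 < indDet (chartMetric g₁ g₂ q) (fun y => flowMap F p q (z.1, y)) (planeBasis 0) (planeBasis 1)
      z.2 := by
  have hlc := isLeviCivitaOn_chartMetric g₁ g₂ q
  have hm : flowMap F p q z ∈ (extChartAt ((𝓡 2).prod (𝓡 2)) q).target := mapInChart_mem hz.2
  let D : Plane →L[ℝ] Plane × Plane := fderiv ℝ (fun y => flowMap F p q (z.1, y)) z.2
  have hD : ∀ u, D u = 0 → u = 0 := by
    intro u hu
    have h1 := mfderiv_mapInChart (contMDiff_flow hF hz.1) hz.2 u
    have h3 := h1.symm.trans ((congrArg _ hu).trans (map_zero _))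
    have h4 := hF.immersion z.1 hz.1 _ (h3.trans (map_zero _).symm)
    exact injective_mfderiv_extChartAt_symm p hz.2.1 (h4.trans (map_zero _).symm)
  exact gram_det_pos (B := (chartMetric g₁ g₂ q (flowMap F p q z)).bilinearComp D D)
    (fun u v => hlc.symm _ hm _ _) (fun u hu => hlc.pos _ hm _ fun h0 => hu (hD u h0))
    fun a b => planeBasis_linearIndependent

lemma contDiffOn_slice_indDet (p : S₁) (q : S₁ × S₂) :
    ContDiffOn ℝ ∞ (fun z : ℝ × Plane => indDet (chartMetric g₁ g₂ q)
      (fun y => flowMap F p q (z.1, y)) (planeBasis 0) (planeBasis 1) z.2)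
      (flowDom (timeInterval T) F p q) :=
  ((contDiffOn_slice_indMetric hF p q _ _).mul (contDiffOn_slice_indMetric hF p q _ _)).sub
    ((contDiffOn_slice_indMetric hF p q _ _).pow 2)

lemma contDiffOn_slice_covX (p : S₁) (q : S₁ × S₂) (u v : Plane) :
    ContDiffOn ℝ ∞ (fun z : ℝ × Plane => covX (chartConn g₁ g₂ q)
      (fun y => flowMap F p q (z.1, y)) u v z.2) (flowDom (timeInterval T) F p q) := by
  refine (contDiffOn_sliceD_sliceD_flowMap hF p q v u).add ?_
  have h1 := (isLeviCivitaOn_chartMetric g₁ g₂ q).contDiffOn_conn.comp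
    (contDiffOn_flowMap hF p q) fun _ hz => mapInChart_mem hz.2
  exact (h1.clm_apply (contDiffOn_sliceD_flowMap hF p q u)).clm_apply
    (contDiffOn_sliceD_flowMap hF p q v)

/-- Continuity including time `0` yields the uniform bound on the reaction coefficient over compact
time intervals. -/
lemma continuousOn_slice_sqNormHess (p : S₁) (q : S₁ × S₂) :
    ContinuousOn (fun z : ℝ × Plane => sqNormHess (chartMetric g₁ g₂ q) (chartConn g₁ g₂ q)
      (fun y => flowMap F p q (z.1, y)) z.2) (flowDom (timeInterval T) F p q) := by
  have g := fun u v => (contDiffOn_slice_indMetric hF p q u v).continuousOn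
  have X : ∀ u v u' v', ContinuousOn (fun z : ℝ × Plane => chartMetric g₁ g₂ q (flowMap F p q z)
      (covX (chartConn g₁ g₂ q) (fun y => flowMap F p q (z.1, y)) u v z.2)
      (covX (chartConn g₁ g₂ q) (fun y => flowMap F p q (z.1, y)) u' v' z.2))
      (flowDom (timeInterval T) F p q) := fun u v u' v' =>
    (contDiffOn_flowMap_bilin hF p q (isLeviCivitaOn_chartMetric g₁ g₂ q).contDiffOn
    (contDiffOn_slice_covX hF p q u v) (contDiffOn_slice_covX hF p q u' v')).continuousOn
  have K : ∀ u v, ContinuousOn (fun z : ℝ × Plane => hessContr (chartMetric g₁ g₂ q)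
      (chartConn g₁ g₂ q) (fun y => flowMap F p q (z.1, y)) z.2 u v)
      (flowDom (timeInterval T) F p q) := fun u v =>
    (((g _ _).mul (X _ _ _ _)).sub ((g _ _).mul ((X _ _ _ _).add (X _ _ _ _)))).add
      ((g _ _).mul (X _ _ _ _))
  exact ((((g _ _).mul (K _ _)).sub ((continuousOn_const.mul (g _ _)).mul (K _ _))).add
      ((g _ _).mul (K _ _))).div ((contDiffOn_slice_indDet hF p q).continuousOn.pow 2)
      fun z hz => (pow_pos (slice_indDet_pos hF hz) 2).ne'

lemma contDiffOn_flowAngle_chart (ω₁ : VolumeForm g₁) (ω₂ : VolumeForm g₂) (p : S₁) (q : S₁ × S₂) :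
    ContDiffOn ℝ ∞ (fun z : ℝ × Plane => flowAngle ω₁ ω₂ F z.1 ((extChartAt (𝓡 2) p).symm z.2))
      (flowDom (timeInterval T) F p q) := by
  have h1 : ContDiffOn ℝ ∞ (prodForm (chartForm ω₁.form q.1) 0 + prodForm 0 (chartForm ω₂.form q.2))
      (extChartAt ((𝓡 2).prod (𝓡 2)) q).target := by
    rw [target_prod]
    have z₁ : ContDiffOn ℝ ∞ (0 : Plane → Plane →L[ℝ] Plane →L[ℝ] ℝ) (extChartAt (𝓡 2) q.1).target :=
      contDiffOn_const
    have z₂ : ContDiffOn ℝ ∞ (0 : Plane → Plane →L[ℝ] Plane →L[ℝ] ℝ) (extChartAt (𝓡 2) q.2).target :=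
      contDiffOn_const
    exact (contDiffOn_prodForm (contDiffOn_chartForm ω₁.contMDiff q.1) z₂).add
      (contDiffOn_prodForm z₁ (contDiffOn_chartForm ω₂.contMDiff q.2))
  have h2 := (contDiffOn_flowMap_bilin hF p q h1 (contDiffOn_sliceD_flowMap hF p q (planeBasis 0))
    (contDiffOn_sliceD_flowMap hF p q (planeBasis 1))).div
    ((contDiffOn_slice_indDet hF p q).sqrt fun z hz => (slice_indDet_pos hF hz).ne')
    fun z hz => (Real.sqrt_pos.2 (slice_indDet_pos hF hz)).ne'
  have h3 : ContDiffOn ℝ ∞ (fun z : ℝ × Plane => chartSign ω₁ p z.2) (flowDom (timeInterval T) F p q) :=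
    (contDiffOn_chartSign ω₁ p).comp contDiffOn_snd fun z hz => hz.2.1
  exact (h3.mul h2).congr fun z hz => flowAngle_eq hF ω₁ ω₂ hz

/-- Along the flow `|H|²` is the squared length of the time derivative, and the derivative within
the slab is smooth up to the initial time. -/
lemma contDiffOn_normSqMeanCurvature_chart (p : S₁) (q : S₁ × S₂) :
    ContDiffOn ℝ ∞ (fun z : ℝ × Plane => normSqMeanCurvature
      (productTensor (metricTensor g₁) (metricTensor g₂)) (F z.1) ((extChartAt (𝓡 2) p).symm z.2))
      (flowDom (timeInterval T) F p q) := by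
  have h := contDiffOn_flowMap hF p q
  obtain ⟨W, hW, e⟩ := exists_flowDom_eq hF p q
  have hu := uniqueDiffOn_slab (P := Plane) (uniqueDiffOn_timeInterval T) hW
  rw [← e] at hu
  have h1 : ContDiffOn ℝ ∞ (fun z => fderivWithin ℝ (flowMap F p q) (flowDom (timeInterval T) F p q) z
      (1, 0)) (flowDom (timeInterval T) F p q) :=
    (h.fderivWithin hu infty_add_one_le).clm_apply contDiffOn_const
  refine (contDiffOn_flowMap_bilin hF p q (isLeviCivitaOn_chartMetric g₁ g₂ q).contDiffOn h1 h1).congr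
    fun z hz => ?_
  obtain ⟨v, hv, -, -, hn⟩ := exists_velocity hF hz
  have h2 : HasFDerivWithinAt (flowMap F p q) (fderivWithin ℝ (flowMap F p q)
      (flowDom (timeInterval T) F p q) z) (flowDom (timeInterval T) F p q) (z.1, z.2) :=
    ((h z hz).differentiableWithinAt (by simp)).hasFDerivWithinAt
  have hpre : (fun s : ℝ => (s, z.2)) ⁻¹' (flowDom (timeInterval T) F p q) ∈ 𝓝[timeInterval T] z.1 := by
    have hc : Continuous fun s : ℝ => (s, z.2) := by fun_prop
    rw [e]
    have hzW : z ∈ W := (e ▸ hz : z ∈ _ ∩ W).2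
    filter_upwards [mem_nhdsWithin_of_mem_nhds ((hW.preimage hc).mem_nhds (show z.1 ∈ _ from hzW)),
      self_mem_nhdsWithin] with s hs hsJ
    exact ⟨⟨hsJ, trivial⟩, hs⟩
  have h3 := (HasFDerivWithinAt.comp (g := flowMap F p q) (f := fun s : ℝ => (s, z.2)) z.1 h2
    ((hasFDerivAt_prodMk_left z.1 z.2).hasFDerivWithinAt
      (s := (fun s : ℝ => (s, z.2)) ⁻¹' (flowDom (timeInterval T) F p q)))
    fun s hs => hs).hasDerivWithinAt.mono_of_mem_nhdsWithin hpre
  have h4 := (uniqueDiffOn_timeInterval T z.1 hz.1).eq_deriv _ hv h3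
  rw [hn, h4]
  simp

end SmoothnessInCharts

/-! ### The parabolic maximum principle. -/

section MaximumPrinciple

/-- The parabolic maximum principle, on a compact space. -/
lemma nonpos_of_evolution {X : Type*} [TopologicalSpace X] [CompactSpace X] {f : ℝ → X → ℝ}
    {τ K : ℝ} (hf : ContinuousOn (fun q : ℝ × X => f q.1 q.2) (Set.Icc 0 τ ×ˢ Set.univ))
    (h0 : ∀ x, f 0 x ≤ 0)
    (h : ∀ t ∈ Set.Ioc 0 τ, ∀ x, (∀ y, f t y ≤ f t x) → 0 < f t x →
      ∃ d ≤ K * f t x, HasDerivAt (fun s => f s x) d t) :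
    ∀ t ∈ Set.Icc 0 τ, ∀ x, f t x ≤ 0 := by
  by_contra! hcon
  obtain ⟨t₁, ht₁, x₁, h₁⟩ := hcon
  -- The weight with exponent `K + 1` instead of `K` makes the time derivative strictly negative at
  -- a positive maximum.
  have hg : ContinuousOn (fun q : ℝ × X => Real.exp (-(K + 1) * q.1) * f q.1 q.2)
      (Set.Icc 0 τ ×ˢ Set.univ) := by
    refine ContinuousOn.mul ?_ hf
    exact (Real.continuous_exp.comp (continuous_const.mul continuous_fst)).continuousOn
  obtain ⟨⟨t, x⟩, hmem, hmax⟩ := (isCompact_Icc.prod isCompact_univ).exists_isMaxOn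
    ⟨(t₁, x₁), ht₁, trivial⟩ hg
  have ht : t ∈ Set.Icc 0 τ := hmem.1
  have hm : ∀ s ∈ Set.Icc 0 τ, ∀ y, Real.exp (-(K + 1) * s) * f s y
      ≤ Real.exp (-(K + 1) * t) * f t x := fun s hs y => hmax (show (s, y) ∈ _ from ⟨hs, trivial⟩)
  have hpos : 0 < f t x := by
    have h2 := (mul_pos (Real.exp_pos (-(K + 1) * t₁)) h₁).trans_le (hm t₁ ht₁ x₁)
    exact pos_of_mul_pos_right h2 (Real.exp_pos _).le
  have ht0 : 0 < t := by
    rcases ht.1.eq_or_lt with h2 | h2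
    · rw [← h2] at hpos
      exact absurd (h0 x) (not_le.2 hpos)
    · exact h2
  obtain ⟨d, hd, hder⟩ := h t ⟨ht0, ht.2⟩ x
    (fun y => le_of_mul_le_mul_left (hm t ht y) (Real.exp_pos _)) hpos
  have he : HasDerivAt (fun s => Real.exp (-(K + 1) * s)) (Real.exp (-(K + 1) * t) * (-(K + 1))) t := by
    simpa using ((hasDerivAt_id t).const_mul (-(K + 1))).exp
  have hgd := (he.mul hder).hasDerivWithinAt (s := Set.Icc 0 t)
  have hloc : IsLocalMaxOn (fun s => Real.exp (-(K + 1) * s) * f s x) (Set.Icc 0 t) t := by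
    refine IsMaxOn.localize fun s hs => ?_
    exact hm s ⟨hs.1, hs.2.trans ht.2⟩ x
  -- The maximum over `[0, t]` is at the right end point, so the derivative in the backward
  -- direction is nonpositive. This contradicts the strict decay.
  have hcone : (0 - t : ℝ) ∈ posTangentConeAt (Set.Icc 0 t) t :=
    sub_mem_posTangentConeAt_of_segment_subset (by rw [segment_symm, segment_eq_Icc ht0.le])
  have := hloc.hasFDerivWithinAt_nonpos hgd.hasFDerivWithinAt hcone
  simp only [ContinuousLinearMap.toSpanSingleton_apply, smul_eq_mul, zero_sub] at this
  have e : -t * (Real.exp (-(K + 1) * t) * -(K + 1) * f t x + Real.exp (-(K + 1) * t) * d)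
      = (t * Real.exp (-(K + 1) * t)) * ((K + 1) * f t x - d) := by ring
  rw [e] at this
  have h3 : 0 < (t * Real.exp (-(K + 1) * t)) * ((K + 1) * f t x - d) :=
    mul_pos (mul_pos ht0 (Real.exp_pos _)) (by linarith)
  linarith

end MaximumPrinciple

/-! ### The flow stays Lagrangian with positive Kähler angle. -/

section AngleEvolution

variable {S₁ S₂ : Type*}
    [TopologicalSpace S₁] [ChartedSpace Plane S₁] [IsManifold (𝓡 2) ∞ S₁]
    [TopologicalSpace S₂] [ChartedSpace Plane S₂] [IsManifold (𝓡 2) ∞ S₂]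
    {g₁ : SurfaceMetric S₁} {g₂ : SurfaceMetric S₂} {T : EReal} {F : ℝ → S₁ → S₁ × S₂} {c : ℝ}

variable (hF : IsMeanCurvatureFlow (𝓡 2) planeBasis productBasis
  (productTensor (metricTensor g₁) (metricTensor g₂)) (timeInterval T) F)

include hF

lemma flowAngle_eq_signDom (ω₁ : VolumeForm g₁) (ω₂ : VolumeForm g₂) {p : S₁} {q : S₁ × S₂} {ε : ℝ}
    (hε : ε ^ 2 = 1) {z : ℝ × Plane} (hz : z ∈ signDom ω₁ T F p q ε) :
    flowAngle ω₁ ω₂ F z.1 ((extChartAt (𝓡 2) p).symm z.2)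
      = ε * IsLocalFlow.angle (chartMetric g₁ g₂ q)
        (prodForm (chartForm ω₁.form q.1) 0) (prodForm 0 (chartForm ω₂.form q.2))
        (flowMap F p q) (0, planeBasis 0) (0, planeBasis 1) z := by
  have h := isFlowInChart_signDom hF ω₁ p q ε
  obtain ⟨hg, -⟩ := h.slice_eq hz
  have hd := sliceD_eq_partialD (h.isLocalFlow.diff h.smooth hz)
  rw [flowAngle_eq hF ω₁ ω₂ (flowDom_pos_subset p q hz.1), chartSign_eq_of_mul_pos ω₁ hε hz.2]
  simp only [IsLocalFlow.angle, indDet, hg, ← hd]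
  rfl

/-- The evolution of the Kähler angle, at its spatial extrema. -/
lemma exists_hasDerivAt_flowAngle (hg₁ : HasConstantCurvature planeBasis (metricTensor g₁) c)
    (hg₂ : HasConstantCurvature planeBasis (metricTensor g₂) c)
    (ω₁ : VolumeForm g₁) (ω₂ : VolumeForm g₂) {p : S₁} {q : S₁ × S₂}
    {z : ℝ × Plane} (hz : z ∈ flowDom {t : ℝ | 0 < t ∧ (t : EReal) < T} F p q) :
    ∃ B d, -|c| ≤ B ∧ B ≤ 2 * sqNormHess (chartMetric g₁ g₂ q) (chartConn g₁ g₂ q)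
        (fun y => flowMap F p q (z.1, y)) z.2 + |c| ∧
      HasDerivAt (fun s => flowAngle ω₁ ω₂ F s ((extChartAt (𝓡 2) p).symm z.2)) d z.1 ∧
      ((∀ y, flowAngle ω₁ ω₂ F z.1 y ≤ flowAngle ω₁ ω₂ F z.1 ((extChartAt (𝓡 2) p).symm z.2)) →
        d ≤ B * flowAngle ω₁ ω₂ F z.1 ((extChartAt (𝓡 2) p).symm z.2)) ∧
      ((∀ y, flowAngle ω₁ ω₂ F z.1 ((extChartAt (𝓡 2) p).symm z.2) ≤ flowAngle ω₁ ω₂ F z.1 y) →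
        B * flowAngle ω₁ ω₂ F z.1 ((extChartAt (𝓡 2) p).symm z.2) ≤ d) := by
  set ε := chartSign ω₁ p z.2 with hεd
  have hε : ε ^ 2 = 1 := chartSign_sq ω₁ hz.2.1
  have hzs : z ∈ signDom ω₁ T F p q ε := ⟨hz, chartSign_mul_pos ω₁ hz.2.1⟩
  have h := isFlowInChart_signDom hF ω₁ p q ε
  have hp : ∀ y ∈ (extChartAt ((𝓡 2).prod (𝓡 2)) q).target, _ := fun y hy =>
    (isProductChart_chart hg₁ hg₂ ω₁ ω₂ q hy).1
  obtain ⟨B, hB1, hB2, hB⟩ := h.exists_fderiv_angle hzs hp hε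
  have cf := h.contDiffOn_angle hp ε
  set f : ℝ × Plane → ℝ := fun x => ε * IsLocalFlow.angle (chartMetric g₁ g₂ q)
        (prodForm (chartForm ω₁.form q.1) 0) (prodForm 0 (chartForm ω₂.form q.2))
        (flowMap F p q) (0, planeBasis 0) (0, planeBasis 1) x with hf
  have hΘ : ∀ x ∈ signDom ω₁ T F p q ε, flowAngle ω₁ ω₂ F x.1 ((extChartAt (𝓡 2) p).symm x.2) = f x :=
    fun x hx => flowAngle_eq_signDom hF ω₁ ω₂ hε hx
  have hfd : HasFDerivAt f (fderiv ℝ f z) (z.1, z.2) := (h.isLocalFlow.diff cf hzs).hasFDerivAt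
  have hder := (hfd.comp z.1 (hasFDerivAt_prodMk_left z.1 z.2)).hasDerivAt
  have hs := Real.sqrt_pos.2 (h.indDet_pos hzs)
  refine ⟨B, partialD f (1, 0) z, hB1, hB2, ?_, ?_, ?_⟩
  · have hc : Continuous fun s : ℝ => (s, z.2) := by fun_prop
    have he : (fun s => flowAngle ω₁ ω₂ F s ((extChartAt (𝓡 2) p).symm z.2)) =ᶠ[𝓝 z.1]
        f ∘ fun s => (s, z.2) := by
      filter_upwards [(h.isOpen.preimage hc).mem_nhds (show z.1 ∈ _ from hzs)] with s hs
      exact hΘ _ hs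
    refine (hder.congr_of_eventuallyEq he).congr_deriv ?_
    simp [partialD]
  · intro hmax
    have hc : Continuous fun y : Plane => (z.1, y) := by fun_prop
    have hlm : IsLocalMax (fun y => f (z.1, y)) z.2 := by
      filter_upwards [(h.isOpen.preimage hc).mem_nhds (show z.2 ∈ _ from hzs)] with y hy
      rw [← hΘ _ hy, ← hΘ _ hzs]
      exact hmax _
    rw [hΘ z hzs, hB]
    have := div_nonpos_of_nonpos_of_nonneg (h.fluxDiv_nonpos_of_isLocalMax hzs cf hlm) hs.le
    linarith
  · intro hmin
    have hc : Continuous fun y : Plane => (z.1, y) := by fun_prop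
    have hlm : IsLocalMax (fun y => -f (z.1, y)) z.2 := by
      filter_upwards [(h.isOpen.preimage hc).mem_nhds (show z.2 ∈ _ from hzs)] with y hy
      rw [← hΘ _ hy, ← hΘ _ hzs]
      exact neg_le_neg (hmin _)
    rw [hΘ z hzs, hB]
    have h1 := h.fluxDiv_nonpos_of_isLocalMax hzs cf.neg hlm
    rw [h.fluxDiv_neg hzs cf] at h1
    have := div_nonneg (neg_nonpos.1 h1) hs.le
    linarith

omit [IsManifold (𝓡 2) ∞ S₁] [IsManifold (𝓡 2) ∞ S₂] hF in
lemma flowDom_self_mem {t : ℝ} (ht : t ∈ timeInterval T) (x : S₁) :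
    (t, extChartAt (𝓡 2) x x) ∈ flowDom (timeInterval T) F x (F t x) :=
  ⟨ht, mem_mapDom_self (F t) x⟩

/-- Points near `(t, x)` lie in the domain of the charts at `(t, x)`. -/
lemma eventually_mem_flowDom {t : ℝ} (ht : t ∈ timeInterval T) (x : S₁) :
    ∀ᶠ s : ℝ × S₁ in 𝓝[timeInterval T ×ˢ Set.univ] (t, x),
      (s.1, extChartAt (𝓡 2) x s.2) ∈ flowDom (timeInterval T) F x (F t x) ∧
        s.2 ∈ (extChartAt (𝓡 2) x).source := by
  have h1 := (continuousOn_flow hF) (t, x) ⟨ht, trivial⟩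
  have h2 := h1.eventually (extChartAt_source_mem_nhds (I := (𝓡 2).prod (𝓡 2)) (F t x))
  have h3 : ∀ᶠ s : ℝ × S₁ in 𝓝[timeInterval T ×ˢ Set.univ] (t, x), s.2 ∈ (extChartAt (𝓡 2) x).source :=
    mem_nhdsWithin_of_mem_nhds (continuous_snd.continuousAt.eventually
      (extChartAt_source_mem_nhds (I := 𝓡 2) x))
  filter_upwards [h2, h3, self_mem_nhdsWithin] with s hs2 hs3 hs
  refine ⟨⟨hs.1, (extChartAt (𝓡 2) x).map_source hs3, ?_⟩, hs3⟩
  simp only [Set.mem_preimage]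
  rwa [(extChartAt (𝓡 2) x).left_inv hs3]

/-- A function on space-time is continuous if its coordinate expressions are. -/
lemma continuousWithinAt_of_chart {f : ℝ → S₁ → ℝ} {t : ℝ} (ht : t ∈ timeInterval T) (x : S₁)
    (h : ContinuousOn (fun z : ℝ × Plane => f z.1 ((extChartAt (𝓡 2) x).symm z.2))
      (flowDom (timeInterval T) F x (F t x))) :
    ContinuousWithinAt (fun s : ℝ × S₁ => f s.1 s.2) (timeInterval T ×ˢ Set.univ) (t, x) := by
  have h1 : ContinuousWithinAt (fun s : ℝ × S₁ => (s.1, extChartAt (𝓡 2) x s.2))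
      (timeInterval T ×ˢ Set.univ) (t, x) :=
    (continuousAt_fst.prodMk ((continuousAt_extChartAt x).comp_of_eq continuousAt_snd rfl)).continuousWithinAt
  have he := eventually_mem_flowDom hF ht x
  have h2 : Filter.Tendsto (fun s : ℝ × S₁ => (s.1, extChartAt (𝓡 2) x s.2))
      (𝓝[timeInterval T ×ˢ Set.univ] (t, x))
      (𝓝[flowDom (timeInterval T) F x (F t x)] (t, extChartAt (𝓡 2) x x)) :=
    tendsto_nhdsWithin_iff.2 ⟨h1, he.mono fun s hs => hs.1⟩
  have h3 := (h _ (flowDom_self_mem ht x)).tendsto.comp h2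
  rw [extChartAt_to_inv] at h3
  refine Filter.Tendsto.congr' ?_ h3
  filter_upwards [he] with s hs
  simp only [Function.comp]
  rw [(extChartAt (𝓡 2) x).left_inv hs.2]

lemma continuousOn_flowAngle (ω₁ : VolumeForm g₁) (ω₂ : VolumeForm g₂) :
    ContinuousOn (fun s : ℝ × S₁ => flowAngle ω₁ ω₂ F s.1 s.2) (timeInterval T ×ˢ Set.univ) :=
  fun s hs => continuousWithinAt_of_chart hF hs.1 s.2
    (contDiffOn_flowAngle_chart hF ω₁ ω₂ s.2 (F s.1 s.2)).continuousOn

omit hF in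
lemma Icc_subset_timeInterval {τ : ℝ} (hτ : τ ∈ timeInterval T) : Set.Icc 0 τ ⊆ timeInterval T :=
  fun _ hs => ⟨hs.1, lt_of_le_of_lt (EReal.coe_le_coe_iff.2 hs.2) hτ.2⟩

/-- The evolution of the Kähler angle at its spatial extrema, uniformly in compact time intervals. -/
lemma exists_flowAngle_bound [CompactSpace S₁]
    (hg₁ : HasConstantCurvature planeBasis (metricTensor g₁) c)
    (hg₂ : HasConstantCurvature planeBasis (metricTensor g₂) c)
    (ω₁ : VolumeForm g₁) (ω₂ : VolumeForm g₂) {τ : ℝ} (hτ : τ ∈ timeInterval T) :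
    ∃ K, ∀ t ∈ Set.Ioc 0 τ, ∀ x, ∃ B d, -|c| ≤ B ∧ B ≤ K ∧
      HasDerivAt (fun s => flowAngle ω₁ ω₂ F s x) d t ∧
      ((∀ y, flowAngle ω₁ ω₂ F t y ≤ flowAngle ω₁ ω₂ F t x) → d ≤ B * flowAngle ω₁ ω₂ F t x) ∧
      ((∀ y, flowAngle ω₁ ω₂ F t x ≤ flowAngle ω₁ ω₂ F t y) → B * flowAngle ω₁ ω₂ F t x ≤ d) := by
  set P : ℝ → ℝ × S₁ → Prop := fun K s => 0 < s.1 → ∃ B d, -|c| ≤ B ∧ B ≤ K ∧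
      HasDerivAt (fun r => flowAngle ω₁ ω₂ F r s.2) d s.1 ∧
      ((∀ y, flowAngle ω₁ ω₂ F s.1 y ≤ flowAngle ω₁ ω₂ F s.1 s.2) → d ≤ B * flowAngle ω₁ ω₂ F s.1 s.2) ∧
      ((∀ y, flowAngle ω₁ ω₂ F s.1 s.2 ≤ flowAngle ω₁ ω₂ F s.1 y) → B * flowAngle ω₁ ω₂ F s.1 s.2 ≤ d)
    with hP
  have hmono : ∀ K K' s, K ≤ K' → P K s → P K' s := by
    intro K K' s hK h hs
    obtain ⟨B, d, h1, h2, h3⟩ := h hs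
    exact ⟨B, d, h1, h2.trans hK, h3⟩
  have hloc : ∀ s ∈ Set.Icc 0 τ ×ˢ (Set.univ : Set S₁),
      ∃ N ∈ 𝓝[Set.Icc 0 τ ×ˢ (Set.univ : Set S₁)] s, ∃ K, ∀ r ∈ N, P K r := by
    rintro ⟨t, x⟩ hs
    have ht := Icc_subset_timeInterval hτ hs.1
    have h1 : ContinuousWithinAt (fun s : ℝ × S₁ => (s.1, extChartAt (𝓡 2) x s.2))
        (timeInterval T ×ˢ Set.univ) (t, x) :=
      (continuousAt_fst.prodMk ((continuousAt_extChartAt x).comp_of_eq continuousAt_snd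
        rfl)).continuousWithinAt
    have he := eventually_mem_flowDom hF ht x
    have h2 : Filter.Tendsto (fun s : ℝ × S₁ => (s.1, extChartAt (𝓡 2) x s.2))
        (𝓝[timeInterval T ×ˢ Set.univ] (t, x))
        (𝓝[flowDom (timeInterval T) F x (F t x)] (t, extChartAt (𝓡 2) x x)) :=
      tendsto_nhdsWithin_iff.2 ⟨h1, he.mono fun s hs => hs.1⟩
    have h3 := ((continuousOn_slice_sqNormHess hF x (F t x)) _ (flowDom_self_mem ht x)).tendsto.comp h2
    -- Near `(t, x)` the squared norm of the Hessian, in the fixed charts at `(t, x)`, is at most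
    -- one more than its value there.
    have h4 := h3.eventually (gt_mem_nhds (lt_add_one _))
    have h5 : ∀ᶠ r in 𝓝[Set.Icc 0 τ ×ˢ (Set.univ : Set S₁)] (t, x), P (2 * (sqNormHess
        (chartMetric g₁ g₂ (F t x)) (chartConn g₁ g₂ (F t x)) (fun y => flowMap F x (F t x) (t, y))
        (extChartAt (𝓡 2) x x) + 1) + |c|) r := by
      have hle : 𝓝[Set.Icc 0 τ ×ˢ (Set.univ : Set S₁)] (t, x) ≤ 𝓝[timeInterval T ×ˢ Set.univ] (t, x) :=
        nhdsWithin_mono _ (Set.prod_mono (Icc_subset_timeInterval hτ) le_rfl)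
      filter_upwards [hle h4, hle he] with r hr4 hre hr0
      have hz : (r.1, extChartAt (𝓡 2) x r.2)
          ∈ flowDom {t : ℝ | 0 < t ∧ (t : EReal) < T} F x (F t x) :=
        ⟨⟨hr0, hre.1.1.2⟩, hre.1.2⟩
      obtain ⟨B, d, k1, k2, k3⟩ := exists_hasDerivAt_flowAngle hF hg₁ hg₂ ω₁ ω₂ hz
      simp only [(extChartAt (𝓡 2) x).left_inv hre.2] at k3
      simp only [Function.comp] at hr4
      exact ⟨B, d, k1, by linarith, k3⟩
    exact ⟨_, h5, _, fun r hr => hr⟩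
  have hK : ∃ K, ∀ r ∈ Set.Icc 0 τ ×ˢ (Set.univ : Set S₁), P K r := by
    -- The charts vary with the point, so the uniform bound is obtained by covering space-time with
    -- finitely many neighbourhoods. The property is monotone in the bound.
    refine (isCompact_Icc.prod isCompact_univ).induction_on (p := fun s => ∃ K, ∀ r ∈ s, P K r) ?_ ?_ ?_ ?_
    · exact ⟨0, fun r hr => hr.elim⟩
    · rintro s s' hss ⟨K, hK⟩
      exact ⟨K, fun r hr => hK r (hss hr)⟩
    · rintro s s' ⟨K, hK⟩ ⟨K', hK'⟩
      refine ⟨max K K', fun r hr => hr.elim (fun h => hmono _ _ _ (le_max_left _ _) (hK r h))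
        fun h => hmono _ _ _ (le_max_right _ _) (hK' r h)⟩
    · intro s hs
      exact hloc s hs
  obtain ⟨K, hK⟩ := hK
  exact ⟨K, fun t ht x => hK (t, x) ⟨⟨ht.1.le, ht.2⟩, trivial⟩ ht.1⟩

/-- The angle stays zero, if it is zero initially. -/
lemma flowAngle_eq_zero [CompactSpace S₁]
    (hg₁ : HasConstantCurvature planeBasis (metricTensor g₁) c)
    (hg₂ : HasConstantCurvature planeBasis (metricTensor g₂) c)
    (ω₁ : VolumeForm g₁) (ω₂ : VolumeForm g₂) (h0 : ∀ x, flowAngle ω₁ ω₂ F 0 x = 0) {t : ℝ}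
    (ht : t ∈ timeInterval T) (x : S₁) : flowAngle ω₁ ω₂ F t x = 0 := by
  obtain ⟨K, hK⟩ := exists_flowAngle_bound hF hg₁ hg₂ ω₁ ω₂ ht
  have hc := (continuousOn_flowAngle hF ω₁ ω₂).mono
    (Set.prod_mono (Icc_subset_timeInterval ht) le_rfl)
  refine le_antisymm ?_ ?_
  · refine nonpos_of_evolution (K := K) hc (fun x => (h0 x).le) (fun s hs y hy hpos => ?_) t
      ⟨ht.1, le_rfl⟩ x
    obtain ⟨B, d, -, h2, h3, h4, -⟩ := hK s hs y
    exact ⟨d, (h4 hy).trans (mul_le_mul_of_nonneg_right h2 hpos.le), h3⟩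
  · have := nonpos_of_evolution (f := fun t x => -flowAngle ω₁ ω₂ F t x) (K := K) hc.neg
      (fun x => by simp [h0 x]) (fun s hs y hy hpos => ?_) t ⟨ht.1, le_rfl⟩ x
    · linarith
    · obtain ⟨B, d, -, h2, h3, -, h4⟩ := hK s hs y
      refine ⟨-d, ?_, h3.neg⟩
      have k1 := h4 fun y' => neg_le_neg_iff.1 (hy y')
      have k2 := mul_le_mul_of_nonneg_right h2 hpos.le
      linarith

/-- The angle stays positive, if it is positive initially. -/
lemma flowAngle_pos [CompactSpace S₁]
    (hg₁ : HasConstantCurvature planeBasis (metricTensor g₁) c)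
    (hg₂ : HasConstantCurvature planeBasis (metricTensor g₂) c)
    (ω₁ : VolumeForm g₁) (ω₂ : VolumeForm g₂) (h0 : ∀ x, 0 < flowAngle ω₁ ω₂ F 0 x) {t : ℝ}
    (ht : t ∈ timeInterval T) (x : S₁) : 0 < flowAngle ω₁ ω₂ F t x := by
  obtain ⟨K, hK⟩ := exists_flowAngle_bound hF hg₁ hg₂ ω₁ ω₂ ht
  have hc := (continuousOn_flowAngle hF ω₁ ω₂).mono
    (Set.prod_mono (Icc_subset_timeInterval ht) le_rfl)
  -- Nonnegativity uses the upper bound on the coefficient. It is needed below, where the lower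
  -- bound `-|c|` is multiplied by the angle.
  have hnonneg : ∀ s ∈ Set.Icc 0 t, ∀ y, 0 ≤ flowAngle ω₁ ω₂ F s y := by
    intro s hs y
    have := nonpos_of_evolution (f := fun t x => -flowAngle ω₁ ω₂ F t x) (K := K) hc.neg
      (fun x => by linarith [h0 x]) (fun s hs y hy hpos => ?_) s hs y
    · linarith
    · obtain ⟨B, d, -, h2, h3, -, h4⟩ := hK s hs y
      refine ⟨-d, ?_, h3.neg⟩
      have k1 := h4 fun y' => neg_le_neg_iff.1 (hy y')
      have k2 := mul_le_mul_of_nonneg_right h2 hpos.le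
      linarith
  have hc0 : Continuous fun y => flowAngle ω₁ ω₂ F 0 y := by
    rw [← continuousOn_univ]
    exact ContinuousOn.comp (g := fun s : ℝ × S₁ => flowAngle ω₁ ω₂ F s.1 s.2)
      (f := fun y : S₁ => ((0 : ℝ), y)) hc (by fun_prop) fun y _ => ⟨⟨le_rfl, ht.1⟩, trivial⟩
  obtain ⟨x₀, -, hx₀⟩ := isCompact_univ.exists_isMinOn ⟨x, trivial⟩ hc0.continuousOn
  set δ := flowAngle ω₁ ω₂ F 0 x₀ with hδ
  have hδ0 : 0 < δ := h0 x₀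
  have hexp : ∀ s, HasDerivAt (fun s => δ * Real.exp (-|c| * s)) (δ * (Real.exp (-|c| * s) * (-|c|))) s := by
    intro s
    simpa using (((hasDerivAt_id s).const_mul (-|c|)).exp).const_mul δ
  -- Comparison with the spatially constant solution of `d' = -|c| d` that starts at the initial
  -- minimum `δ > 0`.
  have := nonpos_of_evolution (f := fun s y => δ * Real.exp (-|c| * s) - flowAngle ω₁ ω₂ F s y)
    (K := 0) ((by fun_prop : Continuous fun q : ℝ × S₁ => δ * Real.exp (-|c| * q.1)).continuousOn.sub hc)
    (fun y => by
      have : δ ≤ flowAngle ω₁ ω₂ F 0 y := hx₀ (Set.mem_univ y)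
      simpa using this)
    (fun s hs y hy hpos => ?_) t ⟨ht.1, le_rfl⟩ x
  · have h2 := mul_pos hδ0 (Real.exp_pos (-|c| * t))
    linarith
  · obtain ⟨B, d, h1, -, h3, -, h4⟩ := hK s hs y
    refine ⟨_, ?_, (hexp s).sub h3⟩
    have k1 := h4 fun y' => by linarith [hy y']
    have k2 := mul_le_mul_of_nonneg_right h1 (hnonneg s ⟨hs.1.le, hs.2⟩ y)
    have k3 := mul_nonneg (abs_nonneg c) hpos.le
    linarith

end AngleEvolution

/-! ### Integrals of functions with compact support in an open set. -/

section CompactSupport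

variable {E : Type*} [NormedAddCommGroup E] [NormedSpace ℝ E] [FiniteDimensional ℝ E]
  [MeasurableSpace E] [BorelSpace E] {μ : Measure E} [μ.IsAddHaarMeasure]
  {U K : Set E} {f : E → ℝ}

omit [NormedSpace ℝ E] [FiniteDimensional ℝ E] [MeasurableSpace E] [BorelSpace E] in
lemma exists_extension (hK : IsCompact K) (h0 : ∀ y ∈ U \ K, f y = 0) :
    HasCompactSupport (U.indicator f) ∧ ∀ y ∉ K, U.indicator f =ᶠ[𝓝 y] 0 := by
  have h1 : ∀ y ∉ K, U.indicator f y = 0 := fun y hy => by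
    by_cases hU : y ∈ U
    · rw [Set.indicator_of_mem hU, h0 y ⟨hU, hy⟩]
    · exact Set.indicator_of_notMem hU f
  exact ⟨HasCompactSupport.intro hK h1, fun y hy =>
    Filter.eventually_of_mem (hK.isClosed.isOpen_compl.mem_nhds hy) h1⟩

omit [NormedSpace ℝ E] [FiniteDimensional ℝ E] [MeasurableSpace E] [BorelSpace E] in
lemma indicator_eventuallyEq (hU : IsOpen U) {y : E} (hy : y ∈ U) : U.indicator f =ᶠ[𝓝 y] f :=
  Filter.eventually_of_mem (hU.mem_nhds hy) fun _ hz => Set.indicator_of_mem hz f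

omit [NormedSpace ℝ E] [FiniteDimensional ℝ E] [MeasurableSpace E] [BorelSpace E] in
lemma continuous_indicator_of_support (hU : IsOpen U) (hK : IsCompact K) (hKU : K ⊆ U)
    (hf : ContinuousOn f U) (h0 : ∀ y ∈ U \ K, f y = 0) : Continuous (U.indicator f) := by
  rw [continuous_iff_continuousAt]
  intro y
  by_cases hy : y ∈ K
  · exact (hf.continuousAt (hU.mem_nhds (hKU hy))).congr (indicator_eventuallyEq hU (hKU hy)).symm
  · exact continuousAt_const.congr ((exists_extension hK h0).2 y hy).symm

omit [NormedSpace ℝ E] [FiniteDimensional ℝ E] [μ.IsAddHaarMeasure] in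
lemma integrableOn_of_support [IsFiniteMeasureOnCompacts μ] (hU : IsOpen U) (hK : IsCompact K)
    (hKU : K ⊆ U) (hf : ContinuousOn f U) (h0 : ∀ y ∈ U \ K, f y = 0) : IntegrableOn f U μ :=
  (integrable_indicator_iff hU.measurableSet).1
    ((continuous_indicator_of_support hU hK hKU hf h0).integrable_of_hasCompactSupport
      (exists_extension hK h0).1)

/-- A compactly supported derivative has integral zero. -/
lemma setIntegral_fderiv_eq_zero (hU : IsOpen U) (hK : IsCompact K) (hKU : K ⊆ U)
    (hf : ContDiffOn ℝ ∞ f U) (h0 : ∀ y ∈ U \ K, f y = 0) (v : E) :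
    ∫ y in U, fderiv ℝ f y v ∂μ = 0 := by
  obtain ⟨hc, hz⟩ := exists_extension hK h0
  have hg : ContDiff ℝ ∞ (U.indicator f) := by
    rw [contDiff_iff_contDiffAt]
    intro y
    by_cases hy : y ∈ K
    · exact (hf.contDiffAt (hU.mem_nhds (hKU hy))).congr_of_eventuallyEq
        (indicator_eventuallyEq hU (hKU hy))
    · exact contDiffAt_const.congr_of_eventuallyEq (hz y hy)
  have hd : Continuous fun y => fderiv ℝ (U.indicator f) y v :=
    (hg.continuous_fderiv (by simp)).clm_apply continuous_const
  have hdc : HasCompactSupport fun y => fderiv ℝ (U.indicator f) y v := hc.fderiv_apply ℝ v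
  -- Integration by parts against the constant function `1`.
  have key := integral_mul_fderiv_eq_neg_fderiv_mul_of_integrable (μ := μ)
    (f := fun _ : E => (1 : ℝ)) (g := U.indicator f) (v := v) (by simp)
    (by simpa using hd.integrable_of_hasCompactSupport hdc)
    (by simpa using hg.continuous.integrable_of_hasCompactSupport hc)
    (fun x _ => differentiableAt_const _) (fun x _ => (hg.differentiable (by simp)) x)
  simp only [one_mul, fderiv_fun_const, Pi.zero_apply, zero_apply, zero_mul, integral_zero,
    neg_zero] at key
  rw [← key, ← integral_indicator hU.measurableSet]
  congr 1
  ext y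
  by_cases hy : y ∈ U
  · rw [Set.indicator_of_mem hy, (indicator_eventuallyEq hU hy).fderiv_eq]
  · rw [Set.indicator_of_notMem hy, (hz y fun h => hy (hKU h)).fderiv_eq]
    simp

end CompactSupport

/-! ### Gradient densities of a metric in the plane. -/

section GradientFlux

variable {B : Plane → Plane → Plane → ℝ} {U : Set Plane} {f w : Plane → ℝ} {y : Plane}

/-- The first component of the gradient density `√(det B) B^{ij} ∂_j f` of a metric `B`. -/
def gradFlux₀ (B : Plane → Plane → Plane → ℝ) (f : Plane → ℝ) (y : Plane) : ℝ :=
  (B y (planeBasis 1) (planeBasis 1) * fderiv ℝ f y (planeBasis 0)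
    - B y (planeBasis 0) (planeBasis 1) * fderiv ℝ f y (planeBasis 1))
  / √(gram planeBasis (B y)).det

/-- The second component of the gradient density `√(det B) B^{ij} ∂_j f` of a metric `B`. -/
def gradFlux₁ (B : Plane → Plane → Plane → ℝ) (f : Plane → ℝ) (y : Plane) : ℝ :=
  (B y (planeBasis 0) (planeBasis 0) * fderiv ℝ f y (planeBasis 1)
    - B y (planeBasis 0) (planeBasis 1) * fderiv ℝ f y (planeBasis 0))
  / √(gram planeBasis (B y)).det

/-- The Laplacian of `f`, multiplied by the area density. -/
def gradDiv (B : Plane → Plane → Plane → ℝ) (f : Plane → ℝ) (y : Plane) : ℝ :=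
  fderiv ℝ (gradFlux₀ B f) y (planeBasis 0) + fderiv ℝ (gradFlux₁ B f) y (planeBasis 1)

/-- The inner product of the gradients of `f` and `w`, multiplied by the area density. -/
def gradInner (B : Plane → Plane → Plane → ℝ) (f w : Plane → ℝ) (y : Plane) : ℝ :=
  fderiv ℝ f y (planeBasis 0) * gradFlux₀ B w y + fderiv ℝ f y (planeBasis 1) * gradFlux₁ B w y

lemma det_clm_plane (A : Plane →L[ℝ] Plane) :
    A.det = planeDet (A (planeBasis 0)) (A (planeBasis 1)) := by
  rw [ContinuousLinearMap.det, ← LinearMap.det_toMatrix planeBasis, Matrix.det_fin_two]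
  simp only [LinearMap.toMatrix_apply, planeDet, planeBasis]
  simp
  ring

/-- Cofactors and derivatives together scale by the squared determinant, and the area density in the
denominator by its absolute value. So the expression is a density, which can be integrated in any
chart. -/
lemma gradInner_comp {B' : Plane → Plane → Plane → ℝ} {g : Plane →L[ℝ] Plane →L[ℝ] ℝ}
    {A : Plane →L[ℝ] Plane} {x : Plane} {f' w' : Plane → ℝ}
    (hg : ∀ u v, B' x u v = g u v) (hs : ∀ u v, g u v = g v u)
    (hB : ∀ u v, B y u v = B' x (A u) (A v)) (hf : ∀ u, fderiv ℝ f y u = fderiv ℝ f' x (A u))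
    (hw : ∀ u, fderiv ℝ w y u = fderiv ℝ w' x (A u)) (hA : A.det ≠ 0) :
    gradInner B f w y = |A.det| * gradInner B' f' w' x := by
  have hd : (gram planeBasis (B y)).det = A.det ^ 2 * (gram planeBasis (B' x)).det := by
    rw [det_clm_plane, det_gram, det_gram, hB, hB, hB, hB, hg, hg, hg, hg, hg, hg, hg, hg]
    have := gram_planeDet g hs (A (planeBasis 0)) (A (planeBasis 1))
    rw [hs (A (planeBasis 1)) (A (planeBasis 0)), hs (planeBasis 1) (planeBasis 0)]
    linear_combination this
  have key : ∀ α β : Plane →L[ℝ] ℝ, ∀ a b : Plane,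
      α a * (g b b * β a - g a b * β b) + α b * (g a a * β b - g a b * β a)
      = planeDet a b ^ 2 * (α (planeBasis 0) * (g (planeBasis 1) (planeBasis 1) * β (planeBasis 0)
        - g (planeBasis 0) (planeBasis 1) * β (planeBasis 1))
        + α (planeBasis 1) * (g (planeBasis 0) (planeBasis 0) * β (planeBasis 1)
        - g (planeBasis 0) (planeBasis 1) * β (planeBasis 0))) := by
    intro α β a b
    conv_lhs => rw [plane_eq a, plane_eq b]
    simp only [map_add, map_smul, add_apply, smul_apply, smul_eq_mul, planeDet,
      hs (planeBasis 1) (planeBasis 0)]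
    ring
  have k := key (fderiv ℝ f' x) (fderiv ℝ w' x) (A (planeBasis 0)) (A (planeBasis 1))
  rw [← det_clm_plane] at k
  simp only [gradInner, gradFlux₀, gradFlux₁, hd, Real.sqrt_mul (sq_nonneg _), Real.sqrt_sq_eq_abs,
    hB, hf, hw, hg]
  have h2 : A.det ^ 2 = |A.det| * |A.det| := by rw [← sq, sq_abs]
  rw [h2] at k
  have h3 : |A.det| ≠ 0 := abs_ne_zero.2 hA
  rw [← mul_div_assoc, ← mul_div_assoc, ← add_div, k, mul_assoc |A.det|, mul_div_mul_left _ _ h3,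
    ← mul_div_assoc, ← mul_div_assoc, ← add_div, mul_div_assoc]

end GradientFlux

/-! ### Functions and densities under transition maps. -/

section Charts

variable {S : Type*} [TopologicalSpace S] [ChartedSpace Plane S] [IsManifold (𝓡 2) ∞ S]

/-- A smooth Riemannian metric, given by its coordinate expressions. -/
structure IsSmoothMetric (h : TwoTensor (𝓡 2) S) : Prop where
  bilin (p : S) : ∀ y ∈ (extChartAt (𝓡 2) p).target, ∃ B : Plane →L[ℝ] Plane →L[ℝ] ℝ,
    (∀ u v, inChart h p y u v = B u v) ∧ ∀ u v, B u v = B v u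
  smooth (p : S) (u v : Plane) :
    ContDiffOn ℝ ∞ (fun y => inChart h p y u v) (extChartAt (𝓡 2) p).target
  det_pos (p : S) : ∀ y ∈ (extChartAt (𝓡 2) p).target, 0 < (gram planeBasis (inChart h p y)).det

/-- A function in the chart at `p`. -/
def readChart (f : S → ℝ) (p : S) (y : Plane) : ℝ := f ((extChartAt (𝓡 2) p).symm y)

variable {h : TwoTensor (𝓡 2) S} {f w : S → ℝ} {p p' : S} {y : Plane}

lemma fderiv_readChart (hf : ContDiffOn ℝ ∞ (readChart f p') (extChartAt (𝓡 2) p').target)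
    (hy : y ∈ transDom (𝓡 2) p p') (u : Plane) :
    fderiv ℝ (readChart f p) y u
      = fderiv ℝ (readChart f p') (transMap (𝓡 2) p p' y) (fderiv ℝ (transMap (𝓡 2) p p') y u) := by
  have h1 : readChart f p =ᶠ[𝓝 y] readChart f p' ∘ transMap (𝓡 2) p p' :=
    Filter.eventually_of_mem ((isOpen_transDom p p').mem_nhds hy)
      fun z hz => congrArg f (symm_transMap hz).symm
  rw [h1.fderiv_eq, fderiv_comp _ (differentiableAt_of_contDiffOn (isOpen_extChartAt_target p') hf
    (transMap_mem hy)) (differentiableAt_of_contDiffOn (isOpen_transDom p p')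
    (contDiffOn_transMap p p') hy)]
  rfl

lemma det_fderiv_transMap_ne (hy : y ∈ transDom (𝓡 2) p p') :
    (fderiv ℝ (transMap (𝓡 2) p p') y).det ≠ 0 :=
  ((LinearMap.isUnit_iff_isUnit_det _).1 (LinearMap.isUnit_iff_ker_eq_bot _ |>.2
    (LinearMap.ker_eq_bot.2 (fderiv_transMap_injective hy)))).ne_zero

lemma gradInner_transMap (hh : IsSmoothMetric h)
    (hf : ContDiffOn ℝ ∞ (readChart f p') (extChartAt (𝓡 2) p').target)
    (hw : ContDiffOn ℝ ∞ (readChart w p') (extChartAt (𝓡 2) p').target)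
    (hy : y ∈ transDom (𝓡 2) p p') :
    gradInner (inChart h p) (readChart f p) (readChart w p) y
      = |(fderiv ℝ (transMap (𝓡 2) p p') y).det|
        * gradInner (inChart h p') (readChart f p') (readChart w p') (transMap (𝓡 2) p p' y) := by
  obtain ⟨g, hg, hs⟩ := hh.bilin p' _ (transMap_mem hy)
  exact gradInner_comp hg hs (inChart_transMap h hy) (fderiv_readChart hf hy)
    (fderiv_readChart hw hy) (det_fderiv_transMap_ne hy)

omit [IsManifold (𝓡 2) ∞ S] in
lemma image_transMap (p p' : S) :
    transMap (𝓡 2) p p' '' transDom (𝓡 2) p p' = transDom (𝓡 2) p' p := by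
  have key : ∀ p p' : S, ∀ y ∈ transDom (𝓡 2) p p', transMap (𝓡 2) p p' y ∈ transDom (𝓡 2) p' p ∧
      transMap (𝓡 2) p' p (transMap (𝓡 2) p p' y) = y := by
    intro p p' y hy
    refine ⟨⟨transMap_mem hy, ?_⟩, ?_⟩
    · rw [Set.mem_preimage, symm_transMap hy]
      exact (extChartAt (𝓡 2) p).map_target hy.1
    · rw [transMap, symm_transMap hy]
      exact (extChartAt (𝓡 2) p).right_inv hy.1
  ext z
  constructor
  · rintro ⟨y, hy, rfl⟩
    exact (key p p' y hy).1
  · exact fun hz => ⟨_, key p' p z hz⟩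

omit [IsManifold (𝓡 2) ∞ S] in
lemma injOn_transMap (p p' : S) : Set.InjOn (transMap (𝓡 2) p p') (transDom (𝓡 2) p p') := by
  intro y hy z hz e
  have := congrArg (fun x => extChartAt (𝓡 2) p ((extChartAt (𝓡 2) p').symm x)) e
  simp only [symm_transMap hy, symm_transMap hz] at this
  rwa [(extChartAt (𝓡 2) p).right_inv hy.1, (extChartAt (𝓡 2) p).right_inv hz.1] at this

/-- Change of variables for densities. -/
lemma setIntegral_transMap {D D' : Plane → ℝ} (p p' : S)
    (hD : ∀ y ∈ transDom (𝓡 2) p p', D y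
      = |(fderiv ℝ (transMap (𝓡 2) p p') y).det| * D' (transMap (𝓡 2) p p' y)) :
    ∫ y in transDom (𝓡 2) p p', D y = ∫ y in transDom (𝓡 2) p' p, D' y := by
  rw [← image_transMap p p', integral_image_eq_integral_abs_det_fderiv_smul volume
    (isOpen_transDom p p').measurableSet (fun y hy => (differentiableAt_of_contDiffOn
      (isOpen_transDom p p') (contDiffOn_transMap p p') hy).hasFDerivAt.hasFDerivWithinAt)
    (injOn_transMap p p')]
  exact setIntegral_congr_fun (isOpen_transDom p p').measurableSet hD

omit [IsManifold (𝓡 2) ∞ S] in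
lemma IsSmoothMetric.contDiffOn_gradFlux (hh : IsSmoothMetric h)
    (hw : ContDiffOn ℝ ∞ (readChart w p) (extChartAt (𝓡 2) p).target) :
    ContDiffOn ℝ ∞ (gradFlux₀ (inChart h p) (readChart w p)) (extChartAt (𝓡 2) p).target ∧
    ContDiffOn ℝ ∞ (gradFlux₁ (inChart h p) (readChart w p)) (extChartAt (𝓡 2) p).target := by
  have hO := isOpen_extChartAt_target (I := 𝓡 2) p
  have hd := fun u => contDiffOn_partialD hO hw u
  have hm : ContDiffOn ℝ ∞ (fun y => (gram planeBasis (inChart h p y)).det)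
      (extChartAt (𝓡 2) p).target := by
    simp only [det_gram]
    exact ((hh.smooth p _ _).mul (hh.smooth p _ _)).sub ((hh.smooth p _ _).mul (hh.smooth p _ _))
  have hs := hm.sqrt fun y hy => (hh.det_pos p y hy).ne'
  exact ⟨(((hh.smooth p _ _).mul (hd _)).sub ((hh.smooth p _ _).mul (hd _))).div hs
      fun y hy => (Real.sqrt_pos.2 (hh.det_pos p y hy)).ne',
    (((hh.smooth p _ _).mul (hd _)).sub ((hh.smooth p _ _).mul (hd _))).div hs
      fun y hy => (Real.sqrt_pos.2 (hh.det_pos p y hy)).ne'⟩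

end Charts

/-! ### The divergence theorem with a partition of unity. -/

section DivergenceTheorem

variable {S : Type*} [TopologicalSpace S] [ChartedSpace Plane S] [IsManifold (𝓡 2) ∞ S]
  [T2Space S] [CompactSpace S] {h : TwoTensor (𝓡 2) S} {w : S → ℝ} {p q : S} {y : Plane}

lemma tsupport_chartPartition (p : S) :
    tsupport (chartPartition S p) ⊆ (extChartAt (𝓡 2) p).source := by
  rw [extChartAt_source]
  exact Classical.choose_spec (SmoothPartitionOfUnity.exists_isSubordinate_chartAt_source (𝓡 2) S) p

variable (S) in
lemma finite_chartPartition : {p | (Function.support (chartPartition S p)).Nonempty}.Finite :=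
  (chartPartition S).locallyFinite.finite_nonempty_of_compact

variable (S) in
/-- The charts which occur in the partition of unity. -/
def chartIndices : Finset S := (finite_chartPartition S).toFinset

lemma chartPartition_eq_zero (hp : p ∉ chartIndices S) (x : S) : chartPartition S p x = 0 := by
  by_contra hx
  exact hp ((finite_chartPartition S).mem_toFinset.2 ⟨x, hx⟩)

lemma sum_chartPartition (x : S) : ∑ p ∈ chartIndices S, chartPartition S p x = 1 := by
  rw [← (chartPartition S).sum_eq_one (Set.mem_univ x)]
  refine (finsum_eq_sum_of_support_subset _ fun p hp => ?_).symm
  by_contra hn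
  exact hp (chartPartition_eq_zero hn x)

/-- The support of the partition function at `p`, in the chart at `p`. -/
def chartSupport (p : S) : Set Plane := extChartAt (𝓡 2) p '' tsupport (chartPartition S p)

lemma isCompact_chartSupport (p : S) : IsCompact (chartSupport p) :=
  (isClosed_tsupport _).isCompact.image_of_continuousOn
    ((continuousOn_extChartAt p).mono (tsupport_chartPartition p))

lemma chartSupport_subset (p : S) : chartSupport p ⊆ (extChartAt (𝓡 2) p).target := by
  rintro _ ⟨x, hx, rfl⟩
  exact (extChartAt (𝓡 2) p).map_source (tsupport_chartPartition p hx)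

lemma notMem_tsupport (hy : y ∈ (extChartAt (𝓡 2) p).target \ chartSupport p) :
    (extChartAt (𝓡 2) p).symm y ∉ tsupport (chartPartition S p) := fun hx =>
  hy.2 ⟨_, hx, (extChartAt (𝓡 2) p).right_inv hy.1⟩

lemma readChart_eventuallyEq_zero (hq : y ∈ (extChartAt (𝓡 2) q).target)
    (hy : (extChartAt (𝓡 2) q).symm y ∉ tsupport (chartPartition S p)) :
    readChart (chartPartition S p) q =ᶠ[𝓝 y] 0 :=
  ((continuousOn_extChartAt_symm (I := 𝓡 2) q).continuousAt
    ((isOpen_extChartAt_target q).mem_nhds hq)).eventually (notMem_tsupport_iff_eventuallyEq.1 hy)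

lemma readChart_chartPartition_eq_zero
    (hy : y ∈ (extChartAt (𝓡 2) p).target \ chartSupport p) :
    readChart (chartPartition S p) p y = 0 :=
  (readChart_eventuallyEq_zero hy.1 (notMem_tsupport hy)).self_of_nhds

lemma gradInner_chartPartition_eq_zero {B : Plane → Plane → Plane → ℝ} {v : Plane → ℝ}
    (hq : y ∈ (extChartAt (𝓡 2) q).target)
    (hy : (extChartAt (𝓡 2) q).symm y ∉ tsupport (chartPartition S p)) :
    gradInner B (readChart (chartPartition S p) q) v y = 0 := by
  have := (readChart_eventuallyEq_zero hq hy).fderiv_eq (𝕜 := ℝ)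
  have e : ∀ u, fderiv ℝ (readChart (chartPartition S p) q) y u = 0 := fun u => by
    rw [this]; simp
  rw [gradInner, e, e, zero_mul, zero_mul, add_zero]

lemma contDiffOn_readChart_chartPartition (p q : S) :
    ContDiffOn ℝ ∞ (readChart (chartPartition S p) q) (extChartAt (𝓡 2) q).target := by
  rw [← contMDiffOn_iff_contDiffOn]
  exact (chartPartition S p).contMDiff.comp_contMDiffOn (contMDiffOn_extChartAt_symm q)

lemma contDiffOn_gradInner (hh : IsSmoothMetric h)
    (hw : ∀ p, ContDiffOn ℝ ∞ (readChart w p) (extChartAt (𝓡 2) p).target) (p q : S) :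
    ContDiffOn ℝ ∞ (gradInner (inChart h q) (readChart (chartPartition S p) q) (readChart w q))
      (extChartAt (𝓡 2) q).target := by
  have hO := isOpen_extChartAt_target (I := 𝓡 2) q
  have hd := fun u => contDiffOn_partialD hO (contDiffOn_readChart_chartPartition p q) u
  obtain ⟨h0, h1⟩ := hh.contDiffOn_gradFlux (hw q)
  exact ((hd _).mul h0).add ((hd _).mul h1)

/-- The partition functions add up to one, so their derivatives add up to zero. -/
lemma sum_gradInner_chartPartition {B : Plane → Plane → Plane → ℝ} {v : Plane → ℝ}
    (hq : y ∈ (extChartAt (𝓡 2) q).target) :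
    ∑ p ∈ chartIndices S, gradInner B (readChart (chartPartition S p) q) v y = 0 := by
  have h1 : ∑ p ∈ chartIndices S, fderiv ℝ (readChart (chartPartition S p) q) y = 0 := by
    rw [← fderiv_fun_sum fun p _ => differentiableAt_of_contDiffOn (isOpen_extChartAt_target q)
      (contDiffOn_readChart_chartPartition p q) hq]
    simp only [readChart, sum_chartPartition]
    simp
  have h2 := fun u => congrArg (fun A : Plane →L[ℝ] ℝ => A u) h1
  simp only [FunLike.coe_sum, Finset.sum_apply, zero_apply] at h2
  simp only [gradInner, Finset.sum_add_distrib, ← Finset.sum_mul, h2]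
  ring

/-- Integration by parts in one chart. The cut-off by the partition function gives compact support,
at the price of a gradient term which does not vanish for a single chart. -/
lemma setIntegral_gradDiv (hh : IsSmoothMetric h)
    (hw : ∀ p, ContDiffOn ℝ ∞ (readChart w p) (extChartAt (𝓡 2) p).target) (p : S) :
    IntegrableOn (fun y => readChart (chartPartition S p) p y
      * gradDiv (inChart h p) (readChart w p) y) (extChartAt (𝓡 2) p).target ∧
    ∫ y in (extChartAt (𝓡 2) p).target, readChart (chartPartition S p) p y
      * gradDiv (inChart h p) (readChart w p) y
    = -∫ y in (extChartAt (𝓡 2) p).target,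
      gradInner (inChart h p) (readChart (chartPartition S p) p) (readChart w p) y := by
  have hO := isOpen_extChartAt_target (I := 𝓡 2) p
  have hK := isCompact_chartSupport p
  have hKU := chartSupport_subset p
  have hr := contDiffOn_readChart_chartPartition p p
  obtain ⟨h0, h1⟩ := hh.contDiffOn_gradFlux (hw p)
  set r := readChart (chartPartition S p) p with hr_def
  set a := gradFlux₀ (inChart h p) (readChart w p)
  set b := gradFlux₁ (inChart h p) (readChart w p)
  have hr0 : ∀ y ∈ (extChartAt (𝓡 2) p).target \ chartSupport p, r y = 0 :=
    fun y hy => readChart_chartPartition_eq_zero hy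
  have i0 := setIntegral_fderiv_eq_zero (μ := volume) hO hK hKU (hr.mul h0)
    (fun y hy => by simp [hr0 y hy]) (planeBasis 0)
  have i1 := setIntegral_fderiv_eq_zero (μ := volume) hO hK hKU (hr.mul h1)
    (fun y hy => by simp [hr0 y hy]) (planeBasis 1)
  have hE := integrableOn_of_support (μ := volume) hO hK hKU (contDiffOn_gradInner hh hw p p).continuousOn
    fun y hy => gradInner_chartPartition_eq_zero hy.1 (notMem_tsupport hy)
  have hD := integrableOn_of_support (μ := volume) hO hK hKU
    (f := fun y => r y * gradDiv (inChart h p) (readChart w p) y)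
    (hr.mul ((contDiffOn_partialD hO h0 (planeBasis 0)).add
      (contDiffOn_partialD hO h1 (planeBasis 1)))).continuousOn
    fun y hy => by simp [hr0 y hy]
  have hI : ∀ c : Plane → ℝ, ContDiffOn ℝ ∞ c (extChartAt (𝓡 2) p).target → ∀ v,
      IntegrableOn (fun y => fderiv ℝ (fun y => r y * c y) y v) (extChartAt (𝓡 2) p).target := by
    intro c hc v
    refine integrableOn_of_support hO hK hKU
      (contDiffOn_partialD hO (hr.mul hc) v).continuousOn fun y hy => ?_
    have e : (fun y => r y * c y) =ᶠ[𝓝 y] 0 := by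
      filter_upwards [readChart_eventuallyEq_zero hy.1 (notMem_tsupport hy)] with z hz
      simp only [← hr_def] at hz
      simp [hz]
    show fderiv ℝ (fun y => r y * c y) y v = 0
    rw [e.fderiv_eq]
    simp
  refine ⟨hD, ?_⟩
  rw [← add_eq_zero_iff_eq_neg, ← integral_add hD hE]
  refine Eq.trans ?_ ((integral_add (hI a h0 _) (hI b h1 _)).trans (by rw [i0, i1, add_zero]))
  refine setIntegral_congr_fun hO.measurableSet fun y hy => ?_
  have dr := differentiableAt_of_contDiffOn hO hr hy
  have da := differentiableAt_of_contDiffOn hO h0 hy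
  have db := differentiableAt_of_contDiffOn hO h1 hy
  simp only [fderiv_mul_apply' dr da, fderiv_mul_apply' dr db, gradDiv, gradInner]
  ring

/-- The divergence theorem on a closed surface. -/
theorem sum_integral_gradDiv (hh : IsSmoothMetric h)
    (hw : ∀ p, ContDiffOn ℝ ∞ (readChart w p) (extChartAt (𝓡 2) p).target) :
    ∑ p ∈ chartIndices S, ∫ y in (extChartAt (𝓡 2) p).target,
      readChart (chartPartition S p) p y * gradDiv (inChart h p) (readChart w p) y = 0 := by
  have hO := fun p : S => isOpen_extChartAt_target (I := 𝓡 2) p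
  -- `D p q s` is the density `ρ_q ⟨∇ρ_p, ∇w⟩` in the chart at `s`. The second partition function
  -- confines it to the chart at `q` as well, so its integral can be moved from the chart at `p` to
  -- the chart at `q`.
  set D : S → S → S → Plane → ℝ := fun p q s y => readChart (chartPartition S q) s y
    * gradInner (inChart h s) (readChart (chartPartition S p) s) (readChart w s) y with hD
  have hDc : ∀ p q s, ContinuousOn (D p q s) (extChartAt (𝓡 2) s).target := fun p q s =>
    ((contDiffOn_readChart_chartPartition q s).mul (contDiffOn_gradInner hh hw p s)).continuousOn
  have z1 : ∀ p q s, ∀ y ∈ (extChartAt (𝓡 2) s).target,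
      (extChartAt (𝓡 2) s).symm y ∉ tsupport (chartPartition S p) → D p q s y = 0 := by
    intro p q s y hy hn
    simp only [hD, gradInner_chartPartition_eq_zero hy hn, mul_zero]
  have z2 : ∀ p q s, ∀ y ∈ (extChartAt (𝓡 2) s).target,
      (extChartAt (𝓡 2) s).symm y ∉ tsupport (chartPartition S q) → D p q s y = 0 := by
    intro p q s y hy hn
    simp only [hD]
    rw [(readChart_eventuallyEq_zero hy hn).self_of_nhds, Pi.zero_apply, zero_mul]
  have hi1 : ∀ p q, IntegrableOn (D p q p) (extChartAt (𝓡 2) p).target := fun p q =>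
    integrableOn_of_support (hO p) (isCompact_chartSupport p) (chartSupport_subset p) (hDc p q p)
      fun y hy => z1 p q p y hy.1 (notMem_tsupport hy)
  have hi2 : ∀ p q, IntegrableOn (D p q q) (extChartAt (𝓡 2) q).target := fun p q =>
    integrableOn_of_support (hO q) (isCompact_chartSupport q) (chartSupport_subset q) (hDc p q q)
      fun y hy => z2 p q q y hy.1 (notMem_tsupport hy)
  have hsub : ∀ s s' : S, transDom (𝓡 2) s s' ⊆ (extChartAt (𝓡 2) s).target := fun s s' y hy => hy.1
  have swap : ∀ p q, ∫ y in (extChartAt (𝓡 2) p).target, D p q p y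
      = ∫ y in (extChartAt (𝓡 2) q).target, D p q q y := by
    intro p q
    rw [setIntegral_eq_of_subset_of_forall_sdiff_eq_zero (hO p).measurableSet (hsub p q)
        fun y hy => z2 p q p y hy.1 fun hn => hy.2 ⟨hy.1, tsupport_chartPartition q hn⟩,
      setIntegral_eq_of_subset_of_forall_sdiff_eq_zero (hO q).measurableSet (hsub q p)
        fun y hy => z1 p q q y hy.1 fun hn => hy.2 ⟨hy.1, tsupport_chartPartition p hn⟩]
    refine setIntegral_transMap p q fun y hy => ?_
    simp only [hD]
    rw [gradInner_transMap hh (contDiffOn_readChart_chartPartition p q) (hw q) hy]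
    have : readChart (chartPartition S q) q (transMap (𝓡 2) p q y)
        = readChart (chartPartition S q) p y := congrArg _ (symm_transMap hy)
    rw [this]
    ring
  have h1 : ∀ p, ∫ y in (extChartAt (𝓡 2) p).target,
      readChart (chartPartition S p) p y * gradDiv (inChart h p) (readChart w p) y
      = -∑ q ∈ chartIndices S, ∫ y in (extChartAt (𝓡 2) q).target, D p q q y := by
    intro p
    rw [(setIntegral_gradDiv hh hw p).2, ← Finset.sum_congr rfl fun q _ => swap p q,
      ← integral_finsetSum _ fun q _ => hi1 p q]
    congr 2
    ext y
    simp only [hD, ← Finset.sum_mul]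
    rw [show ∑ q ∈ chartIndices S, readChart (chartPartition S q) p y = 1 from
      sum_chartPartition _, one_mul]
  -- Exchanging the sums leaves, for fixed `q`, the sum over `p` inside a single chart, where the
  -- gradients of the partition functions add up to zero.
  rw [Finset.sum_congr rfl fun p _ => h1 p, Finset.sum_neg_distrib, Finset.sum_comm, neg_eq_zero]
  refine Finset.sum_eq_zero fun q _ => ?_
  rw [← integral_finsetSum _ fun p _ => hi2 p q]
  refine (setIntegral_congr_fun (hO q).measurableSet fun y hy => ?_).trans (integral_zero _ _)
  simp only [hD, ← Finset.mul_sum]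
  rw [sum_gradInner_chartPartition hy, mul_zero]

end DivergenceTheorem

/-! ### The density of the quotient and its evolution in charts. -/

section FlowDensities

variable {S₁ S₂ : Type*}
    [TopologicalSpace S₁] [ChartedSpace Plane S₁] [IsManifold (𝓡 2) ∞ S₁]
    [TopologicalSpace S₂] [ChartedSpace Plane S₂] [IsManifold (𝓡 2) ∞ S₂]
    {g₁ : SurfaceMetric S₁} {g₂ : SurfaceMetric S₂} {T : EReal} {F : ℝ → S₁ → S₁ × S₂} {c : ℝ}

/-- The metric of `Σ_t`. -/
def flowMetric (g₁ : SurfaceMetric S₁) (g₂ : SurfaceMetric S₂) (F : ℝ → S₁ → S₁ × S₂) (t : ℝ) :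
    TwoTensor (𝓡 2) S₁ :=
  pullback (𝓡 2) (productTensor (metricTensor g₁) (metricTensor g₂)) (F t)

/-- The area density of `Σ_t` in the chart at `p`. -/
def flowArea (g₁ : SurfaceMetric S₁) (g₂ : SurfaceMetric S₂) (F : ℝ → S₁ → S₁ × S₂) (p : S₁)
    (z : ℝ × Plane) : ℝ :=
  √(gram planeBasis (inChart (flowMetric g₁ g₂ F z.1) p z.2)).det

/-- The function `|H|² / η` on `Σ_t`. -/
def flowQuot (ω₁ : VolumeForm g₁) (ω₂ : VolumeForm g₂) (F : ℝ → S₁ → S₁ × S₂) (t : ℝ) (x : S₁) : ℝ :=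
  normSqMeanCurvature (productTensor (metricTensor g₁) (metricTensor g₂)) (F t) x
    / flowAngle ω₁ ω₂ F t x

variable (hF : IsMeanCurvatureFlow (𝓡 2) planeBasis productBasis
  (productTensor (metricTensor g₁) (metricTensor g₂)) (timeInterval T) F)

include hF

omit [IsManifold (𝓡 2) ∞ S₁] [IsManifold (𝓡 2) ∞ S₂] hF in
lemma mem_flowDom_self {p : S₁} {z : ℝ × Plane} (hz : z ∈ timeInterval T ×ˢ (extChartAt (𝓡 2) p).target) :
    z ∈ flowDom (timeInterval T) F p (F z.1 ((extChartAt (𝓡 2) p).symm z.2)) :=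
  ⟨hz.1, hz.2, mem_extChartAt_source _⟩

/-- Smoothness is local in space-time, and near each point the image of the flow lies in a single
chart of the target. The target chart thus disappears from the statement. -/
lemma contDiffOn_slab {p : S₁} {f : ℝ × Plane → ℝ}
    (h : ∀ q, ContDiffOn ℝ ∞ f (flowDom (timeInterval T) F p q)) :
    ContDiffOn ℝ ∞ f (timeInterval T ×ˢ (extChartAt (𝓡 2) p).target) := by
  intro z hz
  have hm := mem_flowDom_self (F := F) hz
  have h1 := h _ z hm
  obtain ⟨W, hW, e⟩ := exists_flowDom_eq hF p (F z.1 ((extChartAt (𝓡 2) p).symm z.2))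
  rw [e] at h1 hm
  have h2 := (contDiffWithinAt_inter (hW.mem_nhds hm.2)).1 h1
  exact h2.mono fun x hx => ⟨hx.1, trivial⟩

lemma inChart_flowMetric {p : S₁} {q : S₁ × S₂} {z : ℝ × Plane}
    (hz : z ∈ flowDom (timeInterval T) F p q) (u v : Plane) :
    inChart (flowMetric g₁ g₂ F z.1) p z.2 u v
      = indMetric (chartMetric g₁ g₂ q) (fun y => flowMap F p q (z.1, y)) u v z.2 :=
  (inChart_pullback _ (contMDiff_flow hF hz.1) hz.2 u v).trans
      (inChart_metric g₁ g₂ q (mapInChart_mem hz.2) _ _)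

lemma flowArea_eq {p : S₁} {q : S₁ × S₂} {z : ℝ × Plane} (hz : z ∈ flowDom (timeInterval T) F p q) :
    flowArea g₁ g₂ F p z = √(indDet (chartMetric g₁ g₂ q) (fun y => flowMap F p q (z.1, y))
      (planeBasis 0) (planeBasis 1) z.2) := congrArg Real.sqrt (det_gram_flow hF hz)

lemma contDiffOn_flowArea (p : S₁) :
    ContDiffOn ℝ ∞ (flowArea g₁ g₂ F p) (timeInterval T ×ˢ (extChartAt (𝓡 2) p).target) :=
  contDiffOn_slab hF fun q => ((contDiffOn_slice_indDet hF p q).sqrt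
    fun _ hz => (slice_indDet_pos hF hz).ne').congr fun _ hz => flowArea_eq hF hz

lemma contDiffOn_flowQuot {ω₁ : VolumeForm g₁} {ω₂ : VolumeForm g₂}
    (hpos : ∀ t ∈ timeInterval T, ∀ x, 0 < flowAngle ω₁ ω₂ F t x) (p : S₁) :
    ContDiffOn ℝ ∞ (fun z : ℝ × Plane => readChart (flowQuot ω₁ ω₂ F z.1) p z.2)
      (timeInterval T ×ˢ (extChartAt (𝓡 2) p).target) :=
  contDiffOn_slab hF fun q => (contDiffOn_normSqMeanCurvature_chart hF p q).div
    (contDiffOn_flowAngle_chart hF ω₁ ω₂ p q) fun z hz => (hpos z.1 hz.1 _).ne'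

omit [IsManifold (𝓡 2) ∞ S₁] [TopologicalSpace S₂] [ChartedSpace Plane S₂]
  [IsManifold (𝓡 2) ∞ S₂] hF in
lemma contDiffOn_slice_slab {p : S₁} {f : ℝ × Plane → ℝ}
    (h : ContDiffOn ℝ ∞ f (timeInterval T ×ˢ (extChartAt (𝓡 2) p).target)) {t : ℝ}
    (ht : t ∈ timeInterval T) : ContDiffOn ℝ ∞ (fun y => f (t, y)) (extChartAt (𝓡 2) p).target :=
  ContDiffOn.comp (g := f) (f := fun y : Plane => (t, y)) h
    (contDiff_const.prodMk contDiff_id).contDiffOn fun _ hy => ⟨ht, hy⟩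

lemma isSmoothMetric_flowMetric {t : ℝ} (ht : t ∈ timeInterval T) :
    IsSmoothMetric (flowMetric g₁ g₂ F t) where
  bilin p y hy := by
    have hz := mem_flowDom_self (F := F) (p := p) (z := (t, y)) ⟨ht, hy⟩
    set q := F t ((extChartAt (𝓡 2) p).symm y)
    let D : Plane →L[ℝ] Plane × Plane := fderiv ℝ (fun y => flowMap F p q (t, y)) y
    exact ⟨(chartMetric g₁ g₂ q (flowMap F p q (t, y))).bilinearComp D D,
      fun u v => inChart_flowMetric hF hz u v,
      fun u v => (isLeviCivitaOn_chartMetric g₁ g₂ q).symm _ (mapInChart_mem hz.2) _ _⟩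
  smooth p u v := contDiffOn_slice_slab
    (f := fun z => inChart (flowMetric g₁ g₂ F z.1) p z.2 u v)
    (contDiffOn_slab hF fun q => (contDiffOn_slice_indMetric hF p q u v).congr
      fun z hz => inChart_flowMetric hF hz u v) ht
  det_pos p y hy := by
    have hz := mem_flowDom_self (F := F) (p := p) (z := (t, y)) ⟨ht, hy⟩
    have := slice_indDet_pos hF hz
    rwa [← det_gram_flow hF hz] at this

/-- The flux of the space-time expression of the flow is the gradient flux of the induced metric in
each time slice. The divergence theorem is available for the latter. -/
lemma fluxDiv_eq_gradDiv {p : S₁} {q : S₁ × S₂} {O : Set (ℝ × Plane)}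
    (h : IsFlowInChart (chartMetric g₁ g₂ q) (chartConn g₁ g₂ q)
      (extChartAt ((𝓡 2).prod (𝓡 2)) q).target (flowMap F p q) O)
    (hO : O ⊆ flowDom (timeInterval T) F p q) {w : ℝ → S₁ → ℝ}
    (hw : ContDiffOn ℝ ∞ (fun z : ℝ × Plane => readChart (w z.1) p z.2) O) {z : ℝ × Plane} (hz : z ∈ O) :
    fluxDiv (chartMetric g₁ g₂ q) (flowMap F p q) (fun z => readChart (w z.1) p z.2) z
      = gradDiv (inChart (flowMetric g₁ g₂ F z.1) p) (readChart (w z.1) p) z.2 := by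
  have hc : Continuous fun y : Plane => (z.1, y) := by fun_prop
  have hnear : ∀ᶠ y in 𝓝 z.2, (z.1, y) ∈ O := (h.isOpen.preimage hc).mem_nhds hz
  have key : ∀ y, (z.1, y) ∈ O →
      (∀ u v, inChart (flowMetric g₁ g₂ F z.1) p y u v
        = indMetric (chartMetric g₁ g₂ q) (flowMap F p q) (0, u) (0, v) (z.1, y)) ∧
      ∀ u, fderiv ℝ (readChart (w z.1) p) y u
        = partialD (fun z => readChart (w z.1) p z.2) (0, u) (z.1, y) := fun y hy =>
    ⟨fun u v => (inChart_flowMetric hF (hO hy) u v).trans ((h.slice_eq hy).1 u v),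
      fun u => sliceD_eq_partialD (h.isLocalFlow.diff hw hy) u⟩
  have hdet : ∀ y, (z.1, y) ∈ O → (gram planeBasis (inChart (flowMetric g₁ g₂ F z.1) p y)).det
      = indDet (chartMetric g₁ g₂ q) (flowMap F p q) (0, planeBasis 0) (0, planeBasis 1) (z.1, y) := by
    intro y hy
    rw [flowMetric, det_gram_flow hF (hO hy), indDet, indDet]
    simp only [(h.slice_eq hy).1]
  have e0 : gradFlux₀ (inChart (flowMetric g₁ g₂ F z.1) p) (readChart (w z.1) p) =ᶠ[𝓝 z.2]
      fun y => flux₀ (chartMetric g₁ g₂ q) (flowMap F p q) (fun z => readChart (w z.1) p z.2) (z.1, y) := by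
    filter_upwards [hnear] with y hy
    obtain ⟨k1, k2⟩ := key y hy
    simp only [gradFlux₀, flux₀, k1, k2, hdet y hy]
  have e1 : gradFlux₁ (inChart (flowMetric g₁ g₂ F z.1) p) (readChart (w z.1) p) =ᶠ[𝓝 z.2]
      fun y => flux₁ (chartMetric g₁ g₂ q) (flowMap F p q) (fun z => readChart (w z.1) p z.2) (z.1, y) := by
    filter_upwards [hnear] with y hy
    obtain ⟨k1, k2⟩ := key y hy
    simp only [gradFlux₁, flux₁, k1, k2, hdet y hy]
  obtain ⟨s0, s1⟩ := h.contDiffOn_flux hw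
  rw [gradDiv, e0.fderiv_eq, e1.fderiv_eq, fluxDiv,
    ← sliceD_eq_partialD (h.isLocalFlow.diff s0 hz), ← sliceD_eq_partialD (h.isLocalFlow.diff s1 hz)]
  rfl

/-- The evolution inequality for the density `|H|² / η dμ` in charts. -/
lemma partialD_flowQuot_le (hg₁ : HasConstantCurvature planeBasis (metricTensor g₁) c)
    (hg₂ : HasConstantCurvature planeBasis (metricTensor g₂) c)
    {ω₁ : VolumeForm g₁} {ω₂ : VolumeForm g₂}
    (hlag : ∀ t ∈ timeInterval T, ∀ x, flowAngle ω₁ ω₂.neg F t x = 0)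
    (hpos : ∀ t ∈ timeInterval T, ∀ x, 0 < flowAngle ω₁ ω₂ F t x) {p : S₁} {z : ℝ × Plane}
    (hz : z ∈ timeInterval T ×ˢ (extChartAt (𝓡 2) p).target) (h0 : 0 < z.1) :
    partialD (fun z => readChart (flowQuot ω₁ ω₂ F z.1) p z.2 * flowArea g₁ g₂ F p z) (1, 0) z
      ≤ gradDiv (inChart (flowMetric g₁ g₂ F z.1) p) (readChart (flowQuot ω₁ ω₂ F z.1) p) z.2
        + c * (readChart (flowQuot ω₁ ω₂ F z.1) p z.2 * flowArea g₁ g₂ F p z) := by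
  set q := F z.1 ((extChartAt (𝓡 2) p).symm z.2)
  have hzd := mem_flowDom_self (F := F) hz
  set ε := chartSign ω₁ p z.2 with hεd
  have hε : ε ^ 2 = 1 := chartSign_sq ω₁ hz.2
  have hzs : z ∈ signDom ω₁ T F p q ε := ⟨⟨⟨h0, hz.1.2⟩, hzd.2⟩, chartSign_mul_pos ω₁ hz.2⟩
  have h := isFlowInChart_signDom hF ω₁ p q ε
  have hsub : signDom ω₁ T F p q ε ⊆ flowDom (timeInterval T) F p q := fun x hx =>
    flowDom_pos_subset p q hx.1
  have hp : ∀ y ∈ (extChartAt ((𝓡 2).prod (𝓡 2)) q).target, _ := fun y hy =>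
    (isProductChart_chart hg₁ hg₂ ω₁ ω₂ q hy).1
  have hm : ∀ x ∈ signDom ω₁ T F p q ε, flowArea g₁ g₂ F p x
      = √(indDet (chartMetric g₁ g₂ q) (flowMap F p q) (0, planeBasis 0) (0, planeBasis 1) x) := by
    intro x hx
    rw [flowArea_eq hF (hsub hx), indDet, indDet]
    simp only [(h.slice_eq hx).1]
  have key := h.fderiv_quotient_le hzs hp hε (fun x hx => ?_) (fun x hx => ?_)
    (w := fun z => readChart (flowQuot ω₁ ω₂ F z.1) p z.2) fun x hx => ?_
  · have e : (fun z => readChart (flowQuot ω₁ ω₂ F z.1) p z.2 * flowArea g₁ g₂ F p z) =ᶠ[𝓝 z]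
        fun x => readChart (flowQuot ω₁ ω₂ F x.1) p x.2
          * √(indDet (chartMetric g₁ g₂ q) (flowMap F p q) (0, planeBasis 0) (0, planeBasis 1) x) := by
      filter_upwards [h.isOpen.mem_nhds hzs] with x hx
      rw [hm x hx]
    rw [partialD, e.fderiv_eq, hm z hzs, ← fluxDiv_eq_gradDiv hF h hsub key.1 hzs]
    exact key.2
  -- The angle for the reversed orientation of the second factor is that of `ω₁ - ω₂`. Its vanishing
  -- is the Lagrangian condition.
  · have h1 := flowAngle_eq_signDom hF ω₁ ω₂.neg hε hx
    rw [hlag _ (hsub hx).1] at h1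
    have hε0 : ε ≠ 0 := fun h0 => by simp [h0] at hε
    have h2 := (mul_eq_zero.1 h1.symm).resolve_left hε0
    rw [IsLocalFlow.angle, div_eq_zero_iff] at h2
    have h3 := h2.resolve_right (Real.sqrt_pos.2 (h.indDet_pos hx)).ne'
    have h4 : ∀ u v : Plane × Plane, prodForm 0 (chartForm ω₂.neg.form q.2) (flowMap F p q x) u v
        = -prodForm 0 (chartForm ω₂.form q.2) (flowMap F p q x) u v := fun u v => by
      simp only [prodForm_apply, chartForm_apply, VolumeForm.neg]
      simp only [neg_apply, Pi.zero_apply, zero_apply, zero_add]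
      rfl
    rw [Pi.add_apply, add_apply, add_apply, h4] at h3
    linarith
  · rw [← flowAngle_eq_signDom hF ω₁ ω₂ hε hx]
    exact hpos _ (hsub hx).1 _
  · rw [← flowAngle_eq_signDom hF ω₁ ω₂ hε hx, ← normSqMeanCurvature_eq hF hx.1]
    rfl

/-- For the graph of an area preserving map, the two volume forms agree on the surface. -/
lemma flowAngle_graph {f : S₁ → S₂} (hf : ContMDiff (𝓡 2) (𝓡 2) ∞ f) {ω₁ : VolumeForm g₁}
    {ω₂ : VolumeForm g₂} (hfω : pullback (𝓡 2) ω₂.tensor f = ω₁.tensor)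
    (hF₀ : ∀ x, F 0 x = (x, f x)) (hT : 0 ∈ timeInterval T) (x : S₁) :
    flowAngle ω₁ ω₂.neg F 0 x = 0 ∧ 0 < flowAngle ω₁ ω₂ F 0 x := by
  have hF0 : F 0 = fun x => (x, f x) := funext hF₀
  have hd : ∀ u : Plane, (mfderiv (𝓡 2) ((𝓡 2).prod (𝓡 2)) (F 0) x u : Plane × Plane)
      = (u, mfderiv (𝓡 2) (𝓡 2) f x u) := by
    intro u
    have h1 := mfderiv_prodMk (I := 𝓡 2) (I' := 𝓡 2) (f := fun x : S₁ => x) (g := f) (x := x)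
      mdifferentiableAt_id (hf.mdifferentiableAt (by simp))
    rw [← hF0] at h1
    refine (DFunLike.congr_fun h1 u).trans ?_
    exact congrArg (fun v : Plane => (v, (mfderiv (𝓡 2) (𝓡 2) f x u : Plane)))
      (DFunLike.congr_fun (mfderiv_id (I := 𝓡 2) (x := x)) u)
  set a := ω₁.tensor x (planeBasis 0) (planeBasis 1) with ha
  have hb : ω₂.tensor (f x) (mfderiv (𝓡 2) (𝓡 2) f x (planeBasis 0))
      (mfderiv (𝓡 2) (𝓡 2) f x (planeBasis 1)) = a :=
    congrFun (congrFun (congrFun hfω x) (planeBasis 0)) (planeBasis 1)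
  have key : ∀ τ : TwoTensor (𝓡 2) S₂,
      pullback (𝓡 2) (productTensor ω₁.tensor τ) (F 0) x (planeBasis 0) (planeBasis 1)
      = a + τ (f x) (mfderiv (𝓡 2) (𝓡 2) f x (planeBasis 0))
      (mfderiv (𝓡 2) (𝓡 2) f x (planeBasis 1)) := by
    intro τ
    have h1 : ∀ q : S₁ × S₂, q = (x, f x) → ∀ u v u' v' : Plane,
        productTensor ω₁.tensor τ q (u, u') (v, v') = ω₁.tensor x u v + τ (f x) u' v' := by
      rintro q rfl u v u' v'
      rfl
    exact (congrArg₂ (fun u v : Plane × Plane => productTensor ω₁.tensor τ (F 0 x) u v)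
      (hd _) (hd _)).trans (h1 _ (hF₀ x) _ _ _ _)
  have hm : 0 < (gram planeBasis (flowMetric g₁ g₂ F 0 x)).det := by
    have := (isSmoothMetric_flowMetric hF hT).det_pos x _ (mem_extChartAt_target x)
    rw [det_gram, inChart_self, inChart_self, inChart_self, inChart_self] at this
    exact this.trans_eq (det_gram (flowMetric g₁ g₂ F 0 x)).symm
  have ha0 : a ≠ 0 := by
    have := chartForm_basis_ne ω₁ (mem_extChartAt_target (I := 𝓡 2) x)
    rw [chartForm_apply, inChart_self] at this
    exact this
  constructor
  · rw [flowAngle, hodgeStar, key]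
    have : ω₂.neg.tensor (f x) (mfderiv (𝓡 2) (𝓡 2) f x (planeBasis 0))
      (mfderiv (𝓡 2) (𝓡 2) f x (planeBasis 1)) = -a := by
      rw [← hb]
      rfl
    rw [this, add_neg_cancel, zero_div, mul_zero]
  · rw [flowAngle, hodgeStar, key, hb, ← ha, ← mul_div_assoc]
    refine div_pos ?_ (Real.sqrt_pos.2 hm)
    rcases lt_or_gt_of_ne ha0 with h | h
    · rw [Real.sign_of_neg h]; linarith
    · rw [Real.sign_of_pos h]; linarith

end FlowDensities

/-! ### Differentiation under the integral on an interval with end points. -/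

section DerivativeOfIntegral

variable {E : Type*} [NormedAddCommGroup E] [NormedSpace ℝ E] [FiniteDimensional ℝ E]
  [MeasurableSpace E] [BorelSpace E] {μ : Measure E} [IsFiniteMeasureOnCompacts μ]

omit [NormedSpace ℝ E] [FiniteDimensional ℝ E] [MeasurableSpace E] [BorelSpace E] in
lemma continuousOn_slice {J : Set ℝ} {U : Set E} {f : ℝ × E → ℝ} (hf : ContinuousOn f (J ×ˢ U))
    {t : ℝ} (ht : t ∈ J) : ContinuousOn (fun y => f (t, y)) U :=
  ContinuousOn.comp (g := f) (f := fun y : E => (t, y)) hf (by fun_prop) fun _ hy => ⟨ht, hy⟩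

omit [NormedSpace ℝ E] [FiniteDimensional ℝ E] in
lemma exists_integrable_bound {J I : Set ℝ} {U K : Set E} (hK : IsCompact K) (hKU : K ⊆ U)
    (hI : IsCompact I) (hIJ : I ⊆ J) {r : E → ℝ} {f : ℝ × E → ℝ} (hr : ContinuousOn r U)
    (hr0 : ∀ y ∈ U \ K, r y = 0) (hf : ContinuousOn f (J ×ˢ U)) :
    ∃ b : E → ℝ, Integrable b μ ∧ ∀ y ∈ U, ∀ s ∈ I, ‖r y * f (s, y)‖ ≤ b y := by
  have hc : ContinuousOn (fun z : ℝ × E => r z.2 * f z) (I ×ˢ K) :=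
    (hr.comp continuousOn_snd fun z hz => hKU hz.2).mul (hf.mono (Set.prod_mono hIJ hKU))
  obtain ⟨C, hC⟩ := (hI.prod hK).exists_bound_of_continuousOn hc
  refine ⟨K.indicator fun _ => C, (integrable_indicator_iff hK.measurableSet).2
    (integrableOn_const hK.measure_lt_top.ne), fun y hy s hs => ?_⟩
  by_cases hyK : y ∈ K
  · rw [Set.indicator_of_mem hyK]
    exact hC (s, y) ⟨hs, hyK⟩
  · rw [Set.indicator_of_notMem hyK, hr0 y ⟨hy, hyK⟩, zero_mul, norm_zero]

omit [NormedSpace ℝ E] [FiniteDimensional ℝ E] in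
/-- Differentiation under the integral sign, for a compactly supported integrand on an interval
which may have end points. -/
lemma hasDerivWithinAt_setIntegral {J I : Set ℝ} {U K : Set E} (hU : IsOpen U) (hK : IsCompact K)
    (hKU : K ⊆ U) (hI : IsCompact I) (hIJ : I ⊆ J) (hIc : Convex ℝ I) {t : ℝ} (ht : t ∈ I)
    (hIt : I ∈ 𝓝[J] t) {r : E → ℝ} {f f' : ℝ × E → ℝ} (hr : ContinuousOn r U)
    (hr0 : ∀ y ∈ U \ K, r y = 0) (hf : ContinuousOn f (J ×ˢ U)) (hf' : ContinuousOn f' (J ×ˢ U))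
    (hd : ∀ z ∈ J ×ˢ U, HasDerivWithinAt (fun s => f (s, z.2)) (f' z) J z.1) :
    HasDerivWithinAt (fun s => ∫ y in U, r y * f (s, y) ∂μ) (∫ y in U, r y * f' (t, y) ∂μ) J t ∧
    ContinuousWithinAt (fun s => ∫ y in U, r y * f' (s, y) ∂μ) J t := by
  obtain ⟨b, hb, hbd⟩ := exists_integrable_bound (μ := μ) hK hKU hI hIJ hr hr0 hf'
  have hm : ∀ g : ℝ × E → ℝ, ContinuousOn g (J ×ˢ U) → ∀ s ∈ J,
      ContinuousOn (fun y => r y * g (s, y)) U := fun g hg s hs => hr.mul (continuousOn_slice hg hs)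
  have hint : ∀ s ∈ J, IntegrableOn (fun y => r y * f (s, y)) U μ := fun s hs =>
    integrableOn_of_support hU hK hKU (hm f hf s hs) fun y hy => by simp [hr0 y hy]
  constructor
  · rw [hasDerivWithinAt_iff_tendsto_slope]
    have hI' : I \ {t} ∈ 𝓝[J \ {t}] t := by
      have h1 : I ∈ 𝓝[J \ {t}] t := nhdsWithin_mono t Set.sdiff_subset hIt
      filter_upwards [h1, self_mem_nhdsWithin] with s hs hs'
      exact ⟨hs, hs'.2⟩
    have e : ∀ᶠ s in 𝓝[J \ {t}] t, ∫ y in U, (s - t)⁻¹ * (r y * f (s, y) - r y * f (t, y)) ∂μ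
        = slope (fun s => ∫ y in U, r y * f (s, y) ∂μ) t s := by
      filter_upwards [hI'] with s hs
      rw [integral_const_mul, integral_sub (hint s (hIJ hs.1)) (hint t (hIJ ht)), slope_def_module,
        smul_eq_mul]
    refine Filter.Tendsto.congr' e ?_
    refine tendsto_integral_filter_of_dominated_convergence b ?_ ?_ hb.integrableOn ?_
    · filter_upwards [hI'] with s hs
      exact (((hm f hf s (hIJ hs.1)).sub (hm f hf t (hIJ ht))).const_mul _).aestronglyMeasurable
        hU.measurableSet
    · filter_upwards [hI'] with s hs
      filter_upwards [ae_restrict_mem hU.measurableSet] with y hy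
      -- The mean value inequality on the convex set `I` bounds the difference quotients by the
      -- integrable bound of the derivative.
      have h1 := hIc.norm_image_sub_le_of_norm_hasDerivWithin_le (f := fun s => r y * f (s, y))
        (fun x hx => ((hd (x, y) ⟨hIJ hx, hy⟩).const_mul (r y)).mono hIJ) (fun x hx => hbd y hy x hx)
        ht hs.1
      have h2 : 0 < ‖s - t‖ := norm_pos_iff.2 (sub_ne_zero.2 hs.2)
      rw [norm_mul, norm_inv, inv_mul_le_iff₀ h2, mul_comm ‖s - t‖]
      exact h1
    · filter_upwards [ae_restrict_mem hU.measurableSet] with y hy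
      have h1 := hasDerivWithinAt_iff_tendsto_slope.1 ((hd (t, y) ⟨hIJ ht, hy⟩).const_mul (r y))
      refine h1.congr fun s => ?_
      rw [slope_def_module, smul_eq_mul]
  · refine continuousWithinAt_of_dominated (bound := b) ?_ ?_ hb.integrableOn ?_
    · filter_upwards [hIt] with s hs
      exact (hm f' hf' s (hIJ hs)).aestronglyMeasurable hU.measurableSet
    · filter_upwards [hIt] with s hs
      filter_upwards [ae_restrict_mem hU.measurableSet] with y hy using hbd y hy s hs
    · filter_upwards [ae_restrict_mem hU.measurableSet] with y hy
      refine continuousWithinAt_const.mul ?_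
      exact ContinuousWithinAt.comp (g := f') (f := fun s : ℝ => (s, y)) (hf' (t, y) ⟨hIJ ht, hy⟩)
        (by fun_prop) fun s hs => ⟨hs, hy⟩

end DerivativeOfIntegral

/-! ### Integrals for the area measure as finite sums over charts. -/

section AreaMeasure

variable {S : Type*} [TopologicalSpace S] [ChartedSpace Plane S] [IsManifold (𝓡 2) ∞ S]
  [T2Space S] [CompactSpace S] [MeasurableSpace S] [BorelSpace S] {h : TwoTensor (𝓡 2) S}
  {f : S → ℝ}

omit [BorelSpace S] in
lemma areaMeasure_eq_sum (h : TwoTensor (𝓡 2) S) : areaMeasure h = ∑ p ∈ chartIndices S,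
    Measure.map (extChartAt (𝓡 2) p).symm
      (((volume : Measure Plane).restrict (extChartAt (𝓡 2) p).target).withDensity fun y =>
        ENNReal.ofReal (chartPartition S p ((extChartAt (𝓡 2) p).symm y) *
          √(gram planeBasis (inChart h p y)).det)) := by
  ext s hs
  rw [areaMeasure, Measure.sum_apply _ hs, Measure.finsetSum_apply]
  refine tsum_eq_sum fun p hp => ?_
  have : (fun y => ENNReal.ofReal (chartPartition S p ((extChartAt (𝓡 2) p).symm y) *
      √(gram planeBasis (inChart h p y)).det)) = 0 := by
    ext y
    simp [chartPartition_eq_zero hp]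
  rw [this, withDensity_zero, Measure.map_zero]
  rfl

/-- The integral with respect to the area measure, in charts. -/
lemma integral_areaMeasure (hh : IsSmoothMetric h) (hf : Continuous f) :
    Integrable f (areaMeasure h) ∧ ∫ x, f x ∂areaMeasure h = ∑ p ∈ chartIndices S,
      ∫ y in (extChartAt (𝓡 2) p).target, readChart (chartPartition S p) p y *
        (readChart f p y * √(gram planeBasis (inChart h p y)).det) := by
  rw [areaMeasure_eq_sum]
  have key : ∀ p : S, Integrable f (Measure.map (extChartAt (𝓡 2) p).symm
      (((volume : Measure Plane).restrict (extChartAt (𝓡 2) p).target).withDensity fun y =>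
        ENNReal.ofReal (chartPartition S p ((extChartAt (𝓡 2) p).symm y) *
          √(gram planeBasis (inChart h p y)).det))) ∧
      ∫ x, f x ∂(Measure.map (extChartAt (𝓡 2) p).symm
      (((volume : Measure Plane).restrict (extChartAt (𝓡 2) p).target).withDensity fun y =>
        ENNReal.ofReal (chartPartition S p ((extChartAt (𝓡 2) p).symm y) *
          √(gram planeBasis (inChart h p y)).det)))
      = ∫ y in (extChartAt (𝓡 2) p).target, readChart (chartPartition S p) p y *
        (readChart f p y * √(gram planeBasis (inChart h p y)).det) := by
    intro p
    have hO := isOpen_extChartAt_target (I := 𝓡 2) p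
    have hs := continuousOn_extChartAt_symm (I := 𝓡 2) p
    have hm : ContinuousOn (fun y => √(gram planeBasis (inChart h p y)).det)
        (extChartAt (𝓡 2) p).target := by
      simp only [det_gram]
      exact (((hh.smooth p _ _).mul (hh.smooth p _ _)).sub
        ((hh.smooth p _ _).mul (hh.smooth p _ _))).continuousOn.sqrt
    have hr := (contDiffOn_readChart_chartPartition p p).continuousOn
    have hd := (hr.mul hm).aemeasurable (μ := volume) hO.measurableSet
    have hfc : ContinuousOn (readChart f p) (extChartAt (𝓡 2) p).target := hf.comp_continuousOn hs
    have ha : AEMeasurable (extChartAt (𝓡 2) p).symm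
        (((volume : Measure Plane).restrict (extChartAt (𝓡 2) p).target).withDensity fun y =>
        ENNReal.ofReal (chartPartition S p ((extChartAt (𝓡 2) p).symm y) *
          √(gram planeBasis (inChart h p y)).det)) :=
      (hs.aemeasurable hO.measurableSet).mono_ac (withDensity_absolutelyContinuous _ _)
    have e : ∀ y, Real.toNNReal (chartPartition S p ((extChartAt (𝓡 2) p).symm y) *
          √(gram planeBasis (inChart h p y)).det) • readChart f p y
        = readChart (chartPartition S p) p y *
        (readChart f p y * √(gram planeBasis (inChart h p y)).det) := by
      intro y
      rw [NNReal.smul_def, Real.coe_toNNReal _ (mul_nonneg ((chartPartition S).nonneg p _)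
        (Real.sqrt_nonneg _)), smul_eq_mul, readChart, readChart]
      ring
    have hi := integrableOn_of_support (μ := volume) hO (isCompact_chartSupport p)
      (chartSupport_subset p) (hr.mul (hfc.mul hm)) fun y hy => by
        rw [Pi.mul_apply, readChart_chartPartition_eq_zero hy, zero_mul]
    constructor
    · rw [integrable_map_measure hf.aestronglyMeasurable ha]
      refine (integrable_withDensity_iff_integrable_smul₀ hd.real_toNNReal).2 ?_
      exact hi.congr (Filter.Eventually.of_forall fun y => (e y).symm)
    · rw [integral_map ha hf.aestronglyMeasurable]
      refine (integral_withDensity_eq_integral_smul₀ hd.real_toNNReal _).trans ?_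
      exact integral_congr_ae (Filter.Eventually.of_forall e)
  refine ⟨integrable_finsetSum_measure.2 fun p _ => (key p).1, ?_⟩
  rw [integral_finsetSum_measure fun p _ => (key p).1]
  exact Finset.sum_congr rfl fun p _ => (key p).2

end AreaMeasure

/-! ### The derivative of the integral of the quotient. -/

section FlowIntegral

lemma exists_Icc_mem_nhdsWithin {T : EReal} {t : ℝ} (ht : t ∈ timeInterval T) :
    ∃ b, t ∈ Set.Icc 0 b ∧ Set.Icc 0 b ⊆ timeInterval T ∧ Set.Icc 0 b ∈ 𝓝[timeInterval T] t := by
  obtain ⟨b, hb, hbT⟩ := EReal.lt_iff_exists_real_btwn.1 ht.2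
  have htb : t < b := by exact_mod_cast hb
  refine ⟨b, ⟨ht.1, htb.le⟩, Icc_subset_timeInterval ⟨ht.1.trans htb.le, hbT⟩, ?_⟩
  filter_upwards [self_mem_nhdsWithin, mem_nhdsWithin_of_mem_nhds (Iio_mem_nhds htb)] with s hs hs'
  exact ⟨hs.1, le_of_lt hs'⟩

lemma continuous_of_readChart {S : Type*} [TopologicalSpace S] [ChartedSpace Plane S]
    {f : S → ℝ} (hf : ∀ p, ContinuousOn (readChart f p) (extChartAt (𝓡 2) p).target) :
    Continuous f := by
  rw [continuous_iff_continuousAt]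
  intro x
  have h1 := ((hf x).continuousAt ((isOpen_extChartAt_target x).mem_nhds
    (mem_extChartAt_target x))).comp (continuousAt_extChartAt (I := 𝓡 2) x)
  refine h1.congr ?_
  filter_upwards [extChartAt_source_mem_nhds (I := 𝓡 2) x] with y hy
  exact congrArg f ((extChartAt (𝓡 2) x).left_inv hy)

variable {S₁ S₂ : Type*}
    [TopologicalSpace S₁] [ChartedSpace Plane S₁] [IsManifold (𝓡 2) ∞ S₁]
    [T2Space S₁] [CompactSpace S₁] [MeasurableSpace S₁] [BorelSpace S₁]
    [TopologicalSpace S₂] [ChartedSpace Plane S₂] [IsManifold (𝓡 2) ∞ S₂]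
    {g₁ : SurfaceMetric S₁} {g₂ : SurfaceMetric S₂} {T : EReal} {F : ℝ → S₁ → S₁ × S₂} {c : ℝ}

/-- The density `|H|² / η dμ` in the chart at `p`. -/
def flowDensity (ω₁ : VolumeForm g₁) (ω₂ : VolumeForm g₂) (F : ℝ → S₁ → S₁ × S₂) (p : S₁)
    (z : ℝ × Plane) : ℝ :=
  readChart (flowQuot ω₁ ω₂ F z.1) p z.2 * flowArea g₁ g₂ F p z

/-- The time derivative of the density `|H|² / η dμ` in the chart at `p`. -/
def flowDensityDeriv (T : EReal) (ω₁ : VolumeForm g₁) (ω₂ : VolumeForm g₂)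
    (F : ℝ → S₁ → S₁ × S₂) (p : S₁) (z : ℝ × Plane) : ℝ :=
  fderivWithin ℝ (flowDensity ω₁ ω₂ F p) (timeInterval T ×ˢ (extChartAt (𝓡 2) p).target) z (1, 0)

/-- The time derivative of the integral of `|H|² / η`. -/
def flowIntegralDeriv (T : EReal) (ω₁ : VolumeForm g₁) (ω₂ : VolumeForm g₂)
    (F : ℝ → S₁ → S₁ × S₂) (t : ℝ) : ℝ :=
  ∑ p ∈ chartIndices S₁, ∫ y in (extChartAt (𝓡 2) p).target,
    readChart (chartPartition S₁ p) p y * flowDensityDeriv T ω₁ ω₂ F p (t, y)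

variable (hF : IsMeanCurvatureFlow (𝓡 2) planeBasis productBasis
  (productTensor (metricTensor g₁) (metricTensor g₂)) (timeInterval T) F)
  {ω₁ : VolumeForm g₁} {ω₂ : VolumeForm g₂}
  (hpos : ∀ t ∈ timeInterval T, ∀ x, 0 < flowAngle ω₁ ω₂ F t x)

include hF hpos

omit [T2Space S₁] [CompactSpace S₁] [MeasurableSpace S₁] [BorelSpace S₁] in
lemma contDiffOn_readChart_flowQuot {t : ℝ} (ht : t ∈ timeInterval T) (p : S₁) :
    ContDiffOn ℝ ∞ (readChart (flowQuot ω₁ ω₂ F t) p) (extChartAt (𝓡 2) p).target :=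
  contDiffOn_slice_slab (contDiffOn_flowQuot hF hpos p) ht

lemma integral_flowQuot {t : ℝ} (ht : t ∈ timeInterval T) :
    Integrable (flowQuot ω₁ ω₂ F t) (areaMeasure (flowMetric g₁ g₂ F t)) ∧
    ∫ x, flowQuot ω₁ ω₂ F t x ∂areaMeasure (flowMetric g₁ g₂ F t)
      = ∑ p ∈ chartIndices S₁, ∫ y in (extChartAt (𝓡 2) p).target,
        readChart (chartPartition S₁ p) p y * flowDensity ω₁ ω₂ F p (t, y) :=
  integral_areaMeasure (isSmoothMetric_flowMetric hF ht)
    (continuous_of_readChart fun p => (contDiffOn_readChart_flowQuot hF hpos ht p).continuousOn)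

omit [T2Space S₁] [CompactSpace S₁] [MeasurableSpace S₁] [BorelSpace S₁] in
lemma contDiffOn_flowDensity (p : S₁) : ContDiffOn ℝ ∞ (flowDensity ω₁ ω₂ F p)
    (timeInterval T ×ˢ (extChartAt (𝓡 2) p).target) :=
  (contDiffOn_flowQuot hF hpos p).mul (contDiffOn_flowArea hF p)

omit [T2Space S₁] [CompactSpace S₁] [MeasurableSpace S₁] [BorelSpace S₁] in
lemma continuousOn_flowDensityDeriv (p : S₁) : ContinuousOn (flowDensityDeriv T ω₁ ω₂ F p)
    (timeInterval T ×ˢ (extChartAt (𝓡 2) p).target) :=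
  ((contDiffOn_flowDensity hF hpos p).continuousOn_fderivWithin
    ((uniqueDiffOn_timeInterval T).prod (isOpen_extChartAt_target p).uniqueDiffOn)
    (by simp)).clm_apply continuousOn_const

/-- Continuity of the derivative is recorded together with differentiability, since the inequality
at the initial time is obtained as a limit. -/
lemma hasDerivWithinAt_flowIntegral {t : ℝ} (ht : t ∈ timeInterval T) :
    HasDerivWithinAt (fun s => ∫ x, flowQuot ω₁ ω₂ F s x ∂areaMeasure (flowMetric g₁ g₂ F s))
      (flowIntegralDeriv T ω₁ ω₂ F t) (timeInterval T) t ∧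
    ContinuousWithinAt (flowIntegralDeriv T ω₁ ω₂ F) (timeInterval T) t := by
  obtain ⟨b, htb, hbT, hbn⟩ := exists_Icc_mem_nhdsWithin ht
  have key := fun p : S₁ => hasDerivWithinAt_setIntegral (μ := volume)
    (isOpen_extChartAt_target (I := 𝓡 2) p) (isCompact_chartSupport p) (chartSupport_subset p)
    isCompact_Icc hbT (convex_Icc 0 b) htb hbn
    (contDiffOn_readChart_chartPartition p p).continuousOn
    (fun y hy => readChart_chartPartition_eq_zero hy) (contDiffOn_flowDensity hF hpos p).continuousOn
    (continuousOn_flowDensityDeriv hF hpos p) fun z hz => by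
      have h1 := ((contDiffOn_flowDensity hF hpos p z hz).differentiableWithinAt
        (by simp)).hasFDerivWithinAt
      have h2 : HasDerivWithinAt (fun s : ℝ => (s, z.2)) (1, 0) (timeInterval T) z.1 :=
        (hasDerivWithinAt_id _ _).prodMk (hasDerivWithinAt_const _ _ _)
      have h3 : Set.MapsTo (fun s : ℝ => (s, z.2)) (timeInterval T)
          (timeInterval T ×ˢ (extChartAt (𝓡 2) p).target) := fun s hs => ⟨hs, hz.2⟩
      exact h1.comp_hasDerivWithinAt z.1 h2 h3
  constructor
  · refine (HasDerivWithinAt.fun_sum fun p _ => (key p).1).congr (fun s hs => ?_) ?_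
    · exact (integral_flowQuot hF hpos hs).2
    · exact (integral_flowQuot hF hpos ht).2
  · exact tendsto_finsetSum _ fun p _ => (key p).2

lemma flowIntegralDeriv_le_of_pos (hg₁ : HasConstantCurvature planeBasis (metricTensor g₁) c)
    (hg₂ : HasConstantCurvature planeBasis (metricTensor g₂) c)
    (hlag : ∀ t ∈ timeInterval T, ∀ x, flowAngle ω₁ ω₂.neg F t x = 0)
    {t : ℝ} (ht : t ∈ timeInterval T) (h0 : 0 < t) :
    flowIntegralDeriv T ω₁ ω₂ F t
      ≤ c * ∫ x, flowQuot ω₁ ω₂ F t x ∂areaMeasure (flowMetric g₁ g₂ F t) := by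
  have hh := isSmoothMetric_flowMetric hF ht
  have hw := contDiffOn_readChart_flowQuot hF hpos ht
  -- The divergence terms vanish only after summation over the charts. Zero is therefore inserted as
  -- this sum, and the integrands are compared chart by chart.
  rw [(integral_flowQuot hF hpos ht).2, ← zero_add (c * _), ← sum_integral_gradDiv hh hw,
    Finset.mul_sum, ← Finset.sum_add_distrib]
  refine Finset.sum_le_sum fun p _ => ?_
  have hO := isOpen_extChartAt_target (I := 𝓡 2) p
  have hr := (contDiffOn_readChart_chartPartition p p).continuousOn
  have hi : ∀ f : ℝ × Plane → ℝ, ContinuousOn f (timeInterval T ×ˢ (extChartAt (𝓡 2) p).target) →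
      IntegrableOn (fun y => readChart (chartPartition S₁ p) p y * f (t, y))
        (extChartAt (𝓡 2) p).target := fun f hf =>
    integrableOn_of_support hO (isCompact_chartSupport p) (chartSupport_subset p)
      (hr.mul (continuousOn_slice hf ht)) fun y hy => by
        rw [readChart_chartPartition_eq_zero hy, zero_mul]
  have i1 := (setIntegral_gradDiv hh hw p).1
  have i2 := hi _ (contDiffOn_flowDensity hF hpos p).continuousOn
  rw [← integral_const_mul, ← integral_add i1 (i2.const_mul c)]
  refine setIntegral_mono_on (hi _ (continuousOn_flowDensityDeriv hF hpos p))
    (i1.add (i2.const_mul c)) hO.measurableSet fun y hy => ?_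
  have hz : (t, y) ∈ timeInterval T ×ˢ (extChartAt (𝓡 2) p).target := ⟨ht, hy⟩
  have hn : timeInterval T ×ˢ (extChartAt (𝓡 2) p).target ∈ 𝓝 (t, y) :=
    prod_mem_nhds (timeInterval_mem_nhds ht h0) (hO.mem_nhds hy)
  have hle := partialD_flowQuot_le hF hg₁ hg₂ hlag hpos hz h0
  have e : flowDensityDeriv T ω₁ ω₂ F p (t, y) = partialD (flowDensity ω₁ ω₂ F p) (1, 0) (t, y) := by
    rw [flowDensityDeriv, fderivWithin_of_mem_nhds hn, partialD]
  have hρ : 0 ≤ readChart (chartPartition S₁ p) p y := (chartPartition S₁).nonneg p _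
  rw [e]
  refine (mul_le_mul_of_nonneg_left hle hρ).trans (le_of_eq ?_)
  simp only [flowDensity]
  ring

lemma flowIntegralDeriv_le (hg₁ : HasConstantCurvature planeBasis (metricTensor g₁) c)
    (hg₂ : HasConstantCurvature planeBasis (metricTensor g₂) c)
    (hlag : ∀ t ∈ timeInterval T, ∀ x, flowAngle ω₁ ω₂.neg F t x = 0)
    {t : ℝ} (ht : t ∈ timeInterval T) :
    flowIntegralDeriv T ω₁ ω₂ F t
      ≤ c * ∫ x, flowQuot ω₁ ω₂ F t x ∂areaMeasure (flowMetric g₁ g₂ F t) := by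
  rcases ht.1.eq_or_lt with rfl | h0
  · obtain ⟨hd, hc⟩ := hasDerivWithinAt_flowIntegral hF hpos ht
    obtain ⟨b, hb, hbT⟩ := EReal.lt_iff_exists_real_btwn.1 ht.2
    have hb0 : (0 : ℝ) < b := by exact_mod_cast hb
    have hsub : Set.Ioo 0 b ⊆ timeInterval T := fun s hs =>
      ⟨hs.1.le, (EReal.coe_lt_coe_iff.2 hs.2).trans hbT⟩
    have hne : (𝓝[Set.Ioo 0 b] (0 : ℝ)).NeBot := by
      rw [nhdsWithin_Ioo_eq_nhdsGT hb0]
      infer_instance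
    -- At the initial time both sides are limits of their values at positive times.
    refine le_of_tendsto_of_tendsto (hc.mono hsub) ((hd.continuousWithinAt.const_mul c).mono hsub) ?_
    filter_upwards [self_mem_nhdsWithin] with s hs
    exact flowIntegralDeriv_le_of_pos hF hpos hg₁ hg₂ hlag (hsub hs) hs.1
  · exact flowIntegralDeriv_le_of_pos hF hpos hg₁ hg₂ hlag ht h0

end FlowIntegral

end SurfaceFlow

end

open SurfaceFlow in
theorem lemma4p3
    {S₁ S₂ : Type*}
    [TopologicalSpace S₁] [ChartedSpace Plane S₁] [IsManifold (𝓡 2) ∞ S₁]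
    [T2Space S₁] [CompactSpace S₁] [MeasurableSpace S₁] [BorelSpace S₁]
    [TopologicalSpace S₂] [ChartedSpace Plane S₂] [IsManifold (𝓡 2) ∞ S₂]
    [T2Space S₂] [CompactSpace S₂]
    (c : ℝ) (g₁ : SurfaceMetric S₁) (g₂ : SurfaceMetric S₂)
    (hg₁ : HasConstantCurvature planeBasis (metricTensor g₁) c)
    (hg₂ : HasConstantCurvature planeBasis (metricTensor g₂) c)
    (ω₁ : VolumeForm g₁) (ω₂ : VolumeForm g₂)
    (f : S₁ → S₂) (hf : ContMDiff (𝓡 2) (𝓡 2) ∞ f)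
    (hfω : pullback (𝓡 2) ω₂.tensor f = ω₁.tensor)
    (g : TwoTensor ((𝓡 2).prod (𝓡 2)) (S₁ × S₂))
    (hg : g = productTensor (metricTensor g₁) (metricTensor g₂))
    (T : EReal) (F : ℝ → S₁ → S₁ × S₂)
    (hF : IsMeanCurvatureFlow (𝓡 2) planeBasis productBasis g (timeInterval T) F)
    (hF₀ : ∀ x, F 0 x = (x, f x))
    (η : ℝ → S₁ → ℝ)
    (hη : ∀ t, η t = hodgeStar ω₁.tensor (pullback (𝓡 2) g (F t))
      (pullback (𝓡 2) (productTensor ω₁.tensor ω₂.tensor) (F t)))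
    (μ : ℝ → MeasureTheory.Measure S₁)
    (hμ : ∀ t, μ t = areaMeasure (pullback (𝓡 2) g (F t))) :
    ∀ t ∈ timeInterval T,
      (∀ x, 0 < η t x) ∧
      MeasureTheory.Integrable (fun x => normSqMeanCurvature g (F t) x / η t x) (μ t) ∧
      ∃ D : ℝ,
        HasDerivWithinAt (fun s => ∫ x, normSqMeanCurvature g (F s) x / η s x ∂(μ s)) D
          (timeInterval T) t ∧
        D ≤ c * ∫ x, normSqMeanCurvature g (F t) x / η t x ∂(μ t) := by
  subst hg
  have hη' : η = flowAngle ω₁ ω₂ F := funext hη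
  have hμ' : μ = fun t => areaMeasure (flowMetric g₁ g₂ F t) := funext hμ
  subst hη' hμ'
  intro t ht
  have h0 : (0 : ℝ) ∈ timeInterval T :=
    ⟨le_rfl, lt_of_le_of_lt (EReal.coe_le_coe_iff.2 ht.1) ht.2⟩
  have hpos : ∀ t ∈ timeInterval T, ∀ x, 0 < flowAngle ω₁ ω₂ F t x := fun t ht x =>
    flowAngle_pos hF hg₁ hg₂ ω₁ ω₂ (fun x => (flowAngle_graph hF hf hfω hF₀ h0 x).2) ht x
  -- The reversed orientation `ω₂.neg` is again a volume form of `g₂`, so the same evolution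
  -- equation applies to `ω₁ - ω₂`.
  have hlag : ∀ t ∈ timeInterval T, ∀ x, flowAngle ω₁ ω₂.neg F t x = 0 := fun t ht x =>
    flowAngle_eq_zero hF hg₁ hg₂ ω₁ ω₂.neg (fun x => (flowAngle_graph hF hf hfω hF₀ h0 x).1) ht x
  exact ⟨hpos t ht, (integral_flowQuot hF hpos ht).1, flowIntegralDeriv T ω₁ ω₂ F t,
    (hasDerivWithinAt_flowIntegral hF hpos ht).1, flowIntegralDeriv_le hF hpos hg₁ hg₂ hlag ht⟩
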